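/- Let $d\ge 2$. Let $\hbar,m,m_0,\epsilon_0>0$ and $q\in\mathbb R\setminus\{0\}$. Let $\omega:\mathbb R^d\to[0,\infty)$ and $\hat\rho:\mathbb R^d\to\mathbb R$ be Borel functions that depend only on $|\boldsymbol k|$, with $\omega>0$ almost everywhere and $\hat\rho/\omega^{1/2},\ \hat\rho/\omega^{3/2}\in L^2(\mathbb R^d)\setminus\{0\}$. Let $\boldsymbol e^{(1)},\dots,\boldsymbol e^{(d-1)}:\mathbb R^d\to\mathbb R^d$ be Borel functions such that $\boldsymbol k/|\boldsymbol k|,\boldsymbol e^{(1)}(\boldsymbol k),\dots,\boldsymbol e^{(d-1)}(\boldsymbol k)$ is an orthonormal basis of $\mathbb R^d$ for almost every $\boldsymbol k$. Assume the mass relation $$\frac1{m_0}=\frac1m+\frac{d-1}{d}\,\frac{q^2}{\epsilon_0m^2}\int_{\mathbb R^d}\frac{|\hat\rho(\boldsymbol k)|^2}{\omega(\boldsymbol k)^2}\,d\boldsymbol k .$$ Let $V:\mathbb R^d\to\mathbb R$ be a Borel function such that * either $|V|$ is infinitesimally form-bounded with respect to $-\Delta$, or $V$ is bounded from below; and * $\int_{\mathbb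 R^d}|V(\boldsymbol x)|e^{-t|\boldsymbol x|^2}\,d\boldsymbol x<\infty$ for all $t>0$. Let $\mathscr F$ be the Boson Fock space over $L^2(\mathbb R^d\times\{1,\dots,d-1\})$, with vacuum $\Omega=(1,0,0,\dots)$, Segal field operators $\Phi_{\mathrm S}(f)=\overline{(a(f)+a^*(f))/\sqrt2}$ (closure from the finite-particle vectors) and second quantization $d\Gamma$. Put $g_j(\boldsymbol k,\lambda)=\sqrt{\hbar/(\epsilon_0\omega(\boldsymbol k))}\,\hat\rho(\boldsymbol k)\,e^{(\lambda)}_j(\boldsymbol k)$ and $p_j=-i\hbar\partial_{x_j}$. On $L^2(\mathbb R^d)\otimes\mathscr F$ define $$H_0=-\frac{\hbar^2}{2m_0}\Delta\otimes1+1\otimes d\Gamma(\hbar\omega)-\frac qm\sum_{j=1}^dp_j\otimes\Phi_{\mathrm S}(g_j),\qquad H_{\mathrm{tot}}=H_0\,\dot+\,(V\otimes1),$$ where $\dot+$ is the quadratic form sum, and let $s_{\mathrm{tot}}$ be the quadratic form associated with $H_{\mathrm{tot}}$. Let $\mathcal F\psi(\boldsymbol P)=(2\pi\hbar)^{-d/2}\int\psi(\boldsymbol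 x)e^{-i\boldsymbol x\cdot\boldsymbol P/\hbar}\,d\boldsymbol x$ be the Fourier transform on $L^2(\mathbb R^d)$, and set $$U(\boldsymbol P)=\exp\Big(\tfrac{iq}{m\hbar}\,\Phi_{\mathrm S}\big(i\textstyle\sum_jP_jg_j/\omega\big)\Big),\qquad U=(\mathcal F\otimes1)^*\Big[\int^{\oplus}_{\mathbb R^d}U(\boldsymbol P)\,d\boldsymbol P\Big](\mathcal F\otimes1).$$ For $\psi\in L^2(\mathbb R^d)$ let $\psi_{\mathrm{dr}}=U^*(\psi\otimes\Omega)$. With $$a=\frac{d-1}{4d}\,\frac{\hbar q^2}{\epsilon_0m^2}\int_{\mathbb R^d}\frac{|\hat\rho(\boldsymbol k)|^2}{\omega(\boldsymbol k)^3}\,d\boldsymbol k$$ define, for $W=V$ and for $W=|V|$, $$W_{\mathrm{eff}}(\boldsymbol x)=\frac1{(4\pi a)^{d/2}}\int_{\mathbb R^d}W(\boldsymbol y)\,e^{-|\boldsymbol x-\boldsymbol y|^2/(4a)}\,d\boldsymbol y,$$ and let $H_{\mathrm{eff}}=-\frac{\hbar^2}{2m}\Delta\,\dot+\,V_{\mathrm{eff}}$.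 Then both quadratic form sums exist, that is, the sums of forms are densely defined, closed, hermitian and bounded from below, and $H_{\mathrm{tot}}$ and $H_{\mathrm{eff}}$ are self-adjoint. For every $\psi\in\mathrm{dom}(|\Delta|^{1/2})\cap\mathrm{dom}((|V|_{\mathrm{eff}})^{1/2})$ the vector $\psi_{\mathrm{dr}}$ lies in the domain of $s_{\mathrm{tot}}$. Moreover the quadratic form $$s_{\mathrm{eff}}(\psi):=s_{\mathrm{tot}}(\psi_{\mathrm{dr}}),\qquad\psi\in\mathrm{dom}(|\Delta|^{1/2})\cap\mathrm{dom}((|V|_{\mathrm{eff}})^{1/2}),$$ is densely defined, closed and bounded from below, and the self-adjoint operator associated with it is $H_{\mathrm{eff}}$. -/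

import Mathlib

open MeasureTheory Filter Topology
open scoped SchwartzMap FourierTransform ENNReal

noncomputable section

/-! ## Quadratic forms and unbounded operators on a complex Hilbert space

Unbounded operators are `LinearPMap`s. Inner products are linear in the second argument. -/

section Abstract

variable {H : Type*} [NormedAddCommGroup H] [InnerProductSpace ℂ H]

/-- A form on `H`: a domain and the values `s(φ, ψ)`, which are meaningful for `φ, ψ` in the
domain only. That the values are sesquilinear and hermitian is `QForm.IsHermitian`. -/
structure QForm (H : Type*) [NormedAddCommGroup H] [InnerProductSpace ℂ H] where
  domain : Submodule ℂ H
  val : H → H → ℂ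

namespace QForm

/-- `s` is a hermitian sesquilinear form on its domain. -/
structure IsHermitian (s : QForm H) : Prop where
  add_right : ∀ φ ∈ s.domain, ∀ ψ ∈ s.domain, ∀ χ ∈ s.domain,
    s.val φ (ψ + χ) = s.val φ ψ + s.val φ χ
  smul_right : ∀ (c : ℂ), ∀ φ ∈ s.domain, ∀ ψ ∈ s.domain, s.val φ (c • ψ) = c * s.val φ ψ
  conj_symm : ∀ φ ∈ s.domain, ∀ ψ ∈ s.domain, s.val ψ φ = starRingEnd ℂ (s.val φ ψ)

/-- `s(ψ, ψ) ≥ c ‖ψ‖²` on the domain, for some real `c`. -/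
def BoundedBelow (s : QForm H) : Prop :=
  ∃ c : ℝ, ∀ ψ ∈ s.domain, c * ‖ψ‖ ^ 2 ≤ (s.val ψ ψ).re

/-- Closedness of a (semibounded) form: if `uₙ ∈ dom s`, `uₙ → ψ` in `H` and
`s(uₙ - uₘ, uₙ - uₘ) → 0`, then `ψ ∈ dom s` and `s(uₙ - ψ, uₙ - ψ) → 0`. -/
def IsClosed (s : QForm H) : Prop :=
  ∀ (u : ℕ → H) (ψ : H), (∀ n, u n ∈ s.domain) → Tendsto u atTop (𝓝 ψ) →
    Tendsto (fun p : ℕ × ℕ => (s.val (u p.1 - u p.2) (u p.1 - u p.2)).re) atTop (𝓝 0) →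
    ψ ∈ s.domain ∧ Tendsto (fun n => (s.val (u n - ψ) (u n - ψ)).re) atTop (𝓝 0)

/-- `s` is a densely defined, closed, hermitian form which is bounded from below. -/
structure IsClosedSemibounded (s : QForm H) : Prop where
  isHermitian : s.IsHermitian
  dense : Dense (s.domain : Set H)
  boundedBelow : s.BoundedBelow
  isClosed : s.IsClosed

/-- The sum of two forms, on the intersection of the domains. -/
def add (s t : QForm H) : QForm H where
  domain := s.domain ⊓ t.domain
  val φ ψ := s.val φ ψ + t.val φ ψ

/-- The operator associated with a form `s`: `ψ` is in its domain and is mapped to `χ` if and only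
if `ψ ∈ dom s` and `s(φ, ψ) = ⟨φ, χ⟩` for all `φ ∈ dom s`.
(For a sesquilinear form the set below is already a subspace, so that taking the span does not
change it; for a densely defined form it is the graph of an operator.) -/
def op (s : QForm H) : H →ₗ.[ℂ] H :=
  (Submodule.span ℂ {p : H × H | p.1 ∈ s.domain ∧
    ∀ φ ∈ s.domain, s.val φ p.1 = inner ℂ φ p.2}).toLinearPMap

end QForm

/-- `⟨ψ, A ψ⟩ ≥ c ‖ψ‖²` on `dom A`, for some real `c`. -/
def IsSemibounded (A : H →ₗ.[ℂ] H) : Prop :=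
  ∃ c : ℝ, ∀ ψ : A.domain, c * ‖(ψ : H)‖ ^ 2 ≤ (inner ℂ (ψ : H) (A ψ)).re

/-- `uₙ ∈ dom A` converges to `ψ` in `H` and is a Cauchy sequence for the form
`⟨φ, A φ⟩`. -/
def FormApprox (A : H →ₗ.[ℂ] H) (u : ℕ → A.domain) (ψ : H) : Prop :=
  Tendsto (fun n => (u n : H)) atTop (𝓝 ψ) ∧
  Tendsto (fun p : ℕ × ℕ =>
    (inner ℂ ((u p.1 - u p.2 : A.domain) : H) (A (u p.1 - u p.2))).re) atTop (𝓝 0)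

theorem FormApprox.add {A : H →ₗ.[ℂ] H} (hA : IsSemibounded A) {u v : ℕ → A.domain} {φ ψ : H}
    (hu : FormApprox A u φ) (hv : FormApprox A v ψ) :
    FormApprox A (fun n => u n + v n) (φ + ψ) := by
  obtain ⟨c, hc⟩ := hA
  refine ⟨by simpa using hu.1.add hv.1, ?_⟩
  have cauchy : ∀ {w : ℕ → A.domain} {χ : H}, FormApprox A w χ →
      Tendsto (fun p : ℕ × ℕ => ‖((w p.1 - w p.2 : A.domain) : H)‖ ^ 2) atTop (𝓝 0) := by
    intro w χ hw
    have h1 : Tendsto (fun p : ℕ × ℕ => ((w p.1 : A.domain) : H)) atTop (𝓝 χ) :=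
      hw.1.comp (by rw [← prod_atTop_atTop_eq]; exact tendsto_fst)
    have h2 : Tendsto (fun p : ℕ × ℕ => ((w p.2 : A.domain) : H)) atTop (𝓝 χ) :=
      hw.1.comp (by rw [← prod_atTop_atTop_eq]; exact tendsto_snd)
    simpa using ((h1.sub h2).norm).pow 2
  have huv : Tendsto (fun n => ((u n + v n : A.domain) : H)) atTop (𝓝 (φ + ψ)) := by
    simpa using hu.1.add hv.1
  have cuv : Tendsto (fun p : ℕ × ℕ =>
      ‖(((u p.1 + v p.1) - (u p.2 + v p.2) : A.domain) : H)‖ ^ 2) atTop (𝓝 0) := by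
    have h1 : Tendsto (fun p : ℕ × ℕ => ((u p.1 + v p.1 : A.domain) : H)) atTop (𝓝 (φ + ψ)) :=
      huv.comp (by rw [← prod_atTop_atTop_eq]; exact tendsto_fst)
    have h2 : Tendsto (fun p : ℕ × ℕ => ((u p.2 + v p.2 : A.domain) : H)) atTop (𝓝 (φ + ψ)) :=
      huv.comp (by rw [← prod_atTop_atTop_eq]; exact tendsto_snd)
    simpa using ((h1.sub h2).norm).pow 2
  have lower : Tendsto (fun p : ℕ × ℕ =>
      c * ‖(((u p.1 + v p.1) - (u p.2 + v p.2) : A.domain) : H)‖ ^ 2) atTop (𝓝 0) := by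
    simpa using cuv.const_mul c
  have upper := (((hu.2.const_mul 2).add (hv.2.const_mul 2)).sub
    (((cauchy hu).const_mul (2 * c)).add ((cauchy hv).const_mul (2 * c)))).add lower
  simp only [mul_zero, add_zero, sub_zero] at upper
  refine tendsto_of_tendsto_of_tendsto_of_le_of_le lower upper
    (fun p => hc _) (fun p => ?_)
  have key : ∀ x y : A.domain,
      (inner ℂ ((x + y : A.domain) : H) (A (x + y))).re ≤
        2 * (inner ℂ (x : H) (A x)).re + 2 * (inner ℂ (y : H) (A y)).re
          - (2 * c * ‖(x : H)‖ ^ 2 + 2 * c * ‖(y : H)‖ ^ 2)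
          + c * ‖((x + y : A.domain) : H)‖ ^ 2 := by
    intro x y
    have h := hc (x - y)
    have par := parallelogram_law_with_norm ℂ (x : H) (y : H)
    simp only [LinearPMap.map_sub, LinearPMap.map_add, Submodule.coe_sub, Submodule.coe_add, inner_sub_left,
      inner_sub_right, inner_add_left, inner_add_right, Complex.add_re, Complex.sub_re] at h ⊢
    have par' : c * (‖(x : H) + y‖ ^ 2 + ‖(x : H) - y‖ ^ 2) =
        c * (2 * (‖(x : H)‖ ^ 2 + ‖(y : H)‖ ^ 2)) := by rw [par]
    linarith
  have e : (u p.1 + v p.1) - (u p.2 + v p.2) = (u p.1 - u p.2) + (v p.1 - v p.2) := by abel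
  simp only
  rw [e]
  exact key _ _

theorem FormApprox.smul {A : H →ₗ.[ℂ] H} {u : ℕ → A.domain} {ψ : H}
    (hu : FormApprox A u ψ) (c : ℂ) : FormApprox A (fun n => c • u n) (c • ψ) := by
  refine ⟨by simpa using hu.1.const_smul c, ?_⟩
  have h := hu.2.const_mul (‖c‖ ^ 2)
  rw [mul_zero] at h
  refine h.congr fun p => ?_
  rw [← smul_sub, LinearPMap.map_smul, Submodule.coe_smul, inner_smul_left, inner_smul_right,
    ← mul_assoc, ← Complex.normSq_eq_conj_mul_self, Complex.normSq_eq_norm_sq,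
    Complex.re_ofReal_mul]

open Classical in
/-- The domain of the form associated with a self-adjoint operator `A` bounded from below, i.e.
`dom (|A|^{1/2})`: all limits of sequences in `dom A` that are Cauchy for the form norm. -/
def formDomain (A : H →ₗ.[ℂ] H) : Submodule ℂ H :=
  if hA : IsSemibounded A then
    { carrier := {ψ | ∃ u, FormApprox A u ψ}
      add_mem' := by
        rintro _ _ ⟨u, hu⟩ ⟨v, hv⟩
        exact ⟨_, hu.add hA hv⟩
      zero_mem' := ⟨fun _ => 0, by simp [FormApprox]⟩
      smul_mem' := by
        rintro c _ ⟨u, hu⟩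
        exact ⟨_, hu.smul c⟩ }
  else ⊥

/-- The closed quadratic form associated with a self-adjoint operator `A` bounded from below:
the closure of the form `⟨φ, A ψ⟩`, `φ, ψ ∈ dom A`. Its value at `φ, ψ` is the common limit of
`⟨uₙ, A vₙ⟩` over all approximating sequences `uₙ` of `φ` and `vₙ` of `ψ`. -/
def formOf (A : H →ₗ.[ℂ] H) : QForm H where
  domain := formDomain A
  val φ ψ := Classical.epsilon fun L : ℂ => ∀ u v, FormApprox A u φ → FormApprox A v ψ →
    Tendsto (fun n => inner ℂ (u n : H) (A (v n))) atTop (𝓝 L)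

/-- `W` is the strongly continuous one-parameter unitary group `t ↦ e^{itA}` generated by
the self-adjoint operator `A`. -/
structure IsUnitaryGroup (A : H →ₗ.[ℂ] H) (W : ℝ → H →L[ℂ] H) : Prop where
  zero : W 0 = 1
  add : ∀ s t, W (s + t) = W s * W t
  norm_map : ∀ t ψ, ‖W t ψ‖ = ‖ψ‖
  continuous : ∀ ψ, Continuous fun t => W t ψ
  hasDerivAt : ∀ ψ : A.domain, HasDerivAt (fun t => W t ψ) (Complex.I • A ψ) 0

open Classical in
/-- The unitary operator `e^{iA}` of a self-adjoint operator `A`: the value at time `1` of the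
unitary group generated by `A`, which exists and is unique for self-adjoint `A`. -/
def expI (A : H →ₗ.[ℂ] H) : H →L[ℂ] H :=
  if h : ∃ W, IsUnitaryGroup A W then h.choose 1 else 0

end Abstract

/-! ## Operators on `L²(ℝᵈ; F)` -/

/-- Euclidean space `ℝᵈ`. -/
abbrev Space (d : ℕ) := EuclideanSpace ℝ (Fin d)

/-- `L²(ℝᵈ; F)`. For a Hilbert space `F` this is the Hilbert space tensor product
`L²(ℝᵈ) ⊗ F`; see `tensor` for the elementary tensors. -/
abbrev L2 (d : ℕ) (F : Type*) [NormedAddCommGroup F] := Lp (α := Space d) F 2 volume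

section VectorValued

variable {d : ℕ} {F : Type*} [NormedAddCommGroup F] [InnerProductSpace ℂ F]

/-- The elementary tensor `ψ ⊗ Φ`, i.e. `x ↦ ψ(x) Φ`. -/
def tensor (ψ : L2 d ℂ) (Φ : F) : L2 d F :=
  (ContinuousLinearMap.toSpanSingleton ℂ Φ).compLp ψ

/-- The tensor product `A ⊗ B` of (closable) operators: the closure of the operator
`ψ ⊗ Φ ↦ Aψ ⊗ BΦ` on the algebraic tensor product of `dom A` and `dom B`. -/
def tensorOp (A : L2 d ℂ →ₗ.[ℂ] L2 d ℂ) (B : F →ₗ.[ℂ] F) : L2 d F →ₗ.[ℂ] L2 d F :=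
  (Submodule.span ℂ {p : L2 d F × L2 d F | ∃ (ψ : A.domain) (Φ : B.domain),
    p = (tensor (ψ : L2 d ℂ) (Φ : F), tensor (A ψ) (B Φ))}).topologicalClosure.toLinearPMap

/-- The identity operator. -/
def idOp (H : Type*) [NormedAddCommGroup H] [InnerProductSpace ℂ H] : H →ₗ.[ℂ] H :=
  LinearMap.id.toPMap ⊤

/-- The domain of the multiplication operator `|V|^{1/2} ⊗ 1`:
all `Ψ` with `|V|^{1/2} Ψ ∈ L²`. -/
def mulFormDomain (F : Type*) [NormedAddCommGroup F] [InnerProductSpace ℂ F]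
    (V : Space d → ℝ) : Submodule ℂ (L2 d F) where
  carrier := {Ψ | MemLp (fun x => ((√|V x| : ℝ) : ℂ) • Ψ x) 2 volume}
  add_mem' := by
    intro Φ Ψ hΦ hΨ
    refine (MemLp.add hΦ hΨ).ae_eq ?_
    filter_upwards [Lp.coeFn_add Φ Ψ] with x hx
    rw [hx, Pi.add_apply, Pi.add_apply, smul_add]
  zero_mem' := by
    refine (MemLp.zero (ε := F)).ae_eq ?_
    filter_upwards [Lp.coeFn_zero F 2 (volume : Measure (Space d))] with x hx
    rw [hx]
    simp
  smul_mem' := by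
    intro c Ψ hΨ
    refine (MemLp.const_smul hΨ c).ae_eq ?_
    filter_upwards [Lp.coeFn_smul c Ψ] with x hx
    rw [hx, Pi.smul_apply, Pi.smul_apply, smul_comm]

/-- The quadratic form of the multiplication operator `V ⊗ 1` on `L²(ℝᵈ; F)`, namely
`∫ V(x) ⟨Φ(x), Ψ(x)⟩ dx` on `dom (|V|^{1/2} ⊗ 1)`. -/
def mulForm (F : Type*) [NormedAddCommGroup F] [InnerProductSpace ℂ F]
    (V : Space d → ℝ) : QForm (L2 d F) where
  domain := mulFormDomain F V
  val Φ Ψ := ∫ x, (V x : ℂ) * inner ℂ (Φ x) (Ψ x)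

open Classical in
/-- The decomposable operator `∫^⊕ T(ξ) dξ`, that is `(TΨ)(ξ) = T(ξ) Ψ(ξ)`, for a bounded
measurable field of operators `T(ξ)`. -/
def directIntegral (T : Space d → F →L[ℂ] F) : L2 d F →L[ℂ] L2 d F :=
  if h : (∃ C : ℝ, ∀ ξ, ‖T ξ‖ ≤ C) ∧
      ∀ Ψ : L2 d F, AEStronglyMeasurable (fun ξ => T ξ (Ψ ξ)) volume then
    have hmem : ∀ Ψ : L2 d F, MemLp (fun ξ => T ξ (Ψ ξ)) 2 volume := fun Ψ =>
      MemLp.of_le_mul (c := h.1.choose) (Lp.memLp Ψ) (h.2 Ψ) (Eventually.of_forall fun ξ =>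
        (T ξ).le_of_opNorm_le (h.1.choose_spec ξ) (Ψ ξ))
    LinearMap.mkContinuousOfExistsBound
      { toFun := fun Ψ => (hmem Ψ).toLp _
        map_add' := by
          intro Φ Ψ
          apply Lp.ext
          filter_upwards [(hmem (Φ + Ψ)).coeFn_toLp, (hmem Φ).coeFn_toLp, (hmem Ψ).coeFn_toLp,
            Lp.coeFn_add Φ Ψ, Lp.coeFn_add ((hmem Φ).toLp _) ((hmem Ψ).toLp _)]
            with x h1 h2 h3 h4 h5
          rw [h1, h5, Pi.add_apply, h2, h3, h4, Pi.add_apply, map_add]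
        map_smul' := by
          intro c Ψ
          apply Lp.ext
          filter_upwards [(hmem (c • Ψ)).coeFn_toLp, (hmem Ψ).coeFn_toLp,
            Lp.coeFn_smul c Ψ, Lp.coeFn_smul c ((hmem Ψ).toLp _)] with x h1 h2 h3 h4
          rw [h1, RingHom.id_apply, h4, Pi.smul_apply, h2, h3, Pi.smul_apply, map_smul] }
      ⟨h.1.choose, fun Ψ => by
        refine Lp.norm_le_mul_norm_of_ae_le_mul ?_
        filter_upwards [(hmem Ψ).coeFn_toLp] with x hx
        simp only [LinearMap.coe_mk, AddHom.coe_mk]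
        rw [hx]
        exact (T x).le_of_opNorm_le (h.1.choose_spec x) (Ψ x)⟩
  else 0

end VectorValued

/-! ## Schrödinger operators on `L²(ℝᵈ)` -/

section Scalar

variable {d : ℕ}

/-- The momentum operator `p_j = -iħ ∂_j` on `L²(ℝᵈ)`, with the derivative in the sense of
distributions: its graph consists of all `(ψ, χ)` in `L² × L²` with `χ = -iħ ∂_j ψ`. -/
def momentum (hbar : ℝ) (j : Fin d) : L2 d ℂ →ₗ.[ℂ] L2 d ℂ :=
  (LinearMap.eqLocus
    ((Lp.toTemperedDistributionCLM ℂ (volume : Measure (Space d)) 2).toLinearMap ∘ₗ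
      LinearMap.snd ℂ (L2 d ℂ) (L2 d ℂ))
    ((-(Complex.I * hbar)) •
      ((LineDeriv.lineDerivOpCLM ℂ 𝓢'(Space d, ℂ)
          (EuclideanSpace.single j (1 : ℝ) : Space d)).toLinearMap ∘ₗ
        (Lp.toTemperedDistributionCLM ℂ (volume : Measure (Space d)) 2).toLinearMap ∘ₗ
        LinearMap.fst ℂ (L2 d ℂ) (L2 d ℂ)))).toLinearPMap

/-- The Laplacian `Δ = ∑_j ∂_j²` on `L²(ℝᵈ)` in the sense of distributions: its graph consists
of all `(ψ, χ)` in `L² × L²` with `χ = Δψ`. -/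
def laplacianOp (d : ℕ) : L2 d ℂ →ₗ.[ℂ] L2 d ℂ :=
  (LinearMap.eqLocus
    ((Lp.toTemperedDistributionCLM ℂ (volume : Measure (Space d)) 2).toLinearMap ∘ₗ
      LinearMap.snd ℂ (L2 d ℂ) (L2 d ℂ))
    ((∑ j : Fin d,
        LineDeriv.lineDerivOpCLM ℂ 𝓢'(Space d, ℂ) (EuclideanSpace.single j (1 : ℝ) : Space d) ∘L
        LineDeriv.lineDerivOpCLM ℂ 𝓢'(Space d, ℂ)
          (EuclideanSpace.single j (1 : ℝ) : Space d)).toLinearMap ∘ₗ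
      (Lp.toTemperedDistributionCLM ℂ (volume : Measure (Space d)) 2).toLinearMap ∘ₗ
      LinearMap.fst ℂ (L2 d ℂ) (L2 d ℂ))).toLinearPMap

/-- The form of `-Δ`; its domain is `dom (|Δ|^{1/2})` and its diagonal is `‖|Δ|^{1/2} ψ‖²`. -/
def kineticForm (d : ℕ) : QForm (L2 d ℂ) := formOf (-laplacianOp d)

/-- `|V|` is infinitesimally form-bounded with respect to `-Δ`. -/
def InfinitesimallyFormBounded (V : Space d → ℝ) : Prop :=
  (kineticForm d).domain ≤ mulFormDomain ℂ V ∧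
  ∀ α > 0, ∃ β : ℝ, 0 ≤ β ∧ ∀ ψ ∈ (kineticForm d).domain,
    ∫ x, |V x| * ‖ψ x‖ ^ 2 ≤ α * ((kineticForm d).val ψ ψ).re + β * ‖ψ‖ ^ 2

end Scalar

/-! ## The Boson Fock space over `L²(ℝᵈ × {1, …, d-1})` -/

section Fock

/-- The one-photon configuration space `ℝᵈ × {1, …, d-1}`. -/
abbrev PhotonSpace (d : ℕ) := Space d × Fin (d - 1)

/-- Lebesgue measure times counting measure. -/
def photonMeasure (d : ℕ) : Measure (PhotonSpace d) :=
  (volume : Measure (Space d)).prod Measure.count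

instance (d : ℕ) : SigmaFinite (photonMeasure d) := by
  unfold photonMeasure
  infer_instance

/-- The product measure on `n`-photon configurations. -/
abbrev photonMeasureN (d n : ℕ) : Measure (Fin n → PhotonSpace d) :=
  Measure.pi fun _ => photonMeasure d

theorem measurePreserving_perm (d n : ℕ) (σ : Equiv.Perm (Fin n)) :
    MeasurePreserving (fun k : Fin n → PhotonSpace d => k ∘ σ)
      (photonMeasureN d n) (photonMeasureN d n) := by
  have h := measurePreserving_arrowCongr' (fun _ : Fin n => photonMeasure d)
    (fun _ : Fin n => photonMeasure d) σ.symm (MeasurableEquiv.refl _)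
    (fun _ => MeasurePreserving.id _)
  exact h

/-- The space of symmetric `L²` functions of `n` photon variables, i.e. the `n`-fold symmetric
tensor product of the one-photon space. -/
def symSector (d n : ℕ) : Submodule ℂ (Lp ℂ 2 (photonMeasureN d n)) :=
  ⨅ σ : Equiv.Perm (Fin n), LinearMap.eqLocus
    (Lp.compMeasurePreservingₗᵢ ℂ (fun k : Fin n → PhotonSpace d => k ∘ σ)
      (measurePreserving_perm d n σ)).toLinearMap LinearMap.id

instance (d n : ℕ) : CompleteSpace (symSector d n) := by
  have h : IsClosed ((symSector d n : Submodule ℂ (Lp ℂ 2 (photonMeasureN d n))) :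
      Set (Lp ℂ 2 (photonMeasureN d n))) := by
    simp only [symSector, Submodule.coe_iInf]
    refine isClosed_iInter fun σ => ?_
    exact isClosed_eq (Lp.compMeasurePreservingₗᵢ ℂ (fun k : Fin n → PhotonSpace d => k ∘ σ)
      (measurePreserving_perm d n σ)).continuous continuous_id
  exact h.completeSpace_coe

/-- The Boson Fock space: square summable sequences `(Ψ_n)` of symmetric `n`-photon functions. -/
abbrev Fock (d : ℕ) := lp (fun n : ℕ => symSector d n) 2

/-- The `n`-photon component of a Fock vector, as a function. -/
def photonFn {d : ℕ} (Ψ : Fock d) (n : ℕ) : (Fin n → PhotonSpace d) → ℂ :=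
  ((Ψ n : symSector d n) : Lp ℂ 2 (photonMeasureN d n))

theorem memLp_one_zero (d : ℕ) : MemLp (fun _ => (1 : ℂ)) 2 (photonMeasureN d 0) := by
  have : IsFiniteMeasure (photonMeasureN d 0) := by
    unfold photonMeasureN
    rw [Measure.pi_of_empty]
    infer_instance
  exact memLp_const 1

/-- The Fock vacuum `(1, 0, 0, …)`. -/
def vacuum (d : ℕ) : Fock d :=
  lp.single 2 0 ⟨(memLp_one_zero d).toLp _, by
    rw [symSector, Submodule.mem_iInf]
    intro σ
    change Lp.compMeasurePreserving _ (measurePreserving_perm d 0 σ) _ = _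
    apply Lp.ext
    refine (Lp.coeFn_compMeasurePreserving _ (measurePreserving_perm d 0 σ)).trans ?_
    refine Eventually.of_forall fun k => ?_
    change ((memLp_one_zero d).toLp _ : (Fin 0 → PhotonSpace d) → ℂ) (k ∘ σ) =
      ((memLp_one_zero d).toLp _ : (Fin 0 → PhotonSpace d) → ℂ) k
    rw [Subsingleton.elim (k ∘ σ) k]⟩

/-- The second quantization `dΓ(f)` of the multiplication operator by a function `f` on
`ℝᵈ × {1, …, d-1}`: `(dΓ(f)Ψ)_n(k_1, …, k_n) = (f(k_1) + … + f(k_n)) Ψ_n(k_1, …, k_n)` on its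
maximal domain. -/
def secondQuantization {d : ℕ} (f : PhotonSpace d → ℝ) : Fock d →ₗ.[ℂ] Fock d :=
  Submodule.toLinearPMap
    { carrier := {p : Fock d × Fock d | ∀ n, photonFn p.2 n =ᵐ[photonMeasureN d n]
        fun k => ((∑ i, f (k i) : ℝ) : ℂ) * photonFn p.1 n k}
      add_mem' := by
        intro p q hp hq n
        filter_upwards [hp n, hq n,
          Lp.coeFn_add ((p.1 n : symSector d n) : Lp ℂ 2 (photonMeasureN d n)) (q.1 n),
          Lp.coeFn_add ((p.2 n : symSector d n) : Lp ℂ 2 (photonMeasureN d n)) (q.2 n)]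
          with k h1 h2 h3 h4
        have h3' : photonFn (p + q).1 n k = photonFn p.1 n k + photonFn q.1 n k := h3
        have h4' : photonFn (p + q).2 n k = photonFn p.2 n k + photonFn q.2 n k := h4
        rw [h3', h4', h1, h2, mul_add]
      zero_mem' := by
        intro n
        filter_upwards [Lp.coeFn_zero ℂ 2 (photonMeasureN d n)] with k hk
        have h : photonFn (0 : Fock d × Fock d).2 n k = 0 := hk
        have h' : photonFn (0 : Fock d × Fock d).1 n k = 0 := hk
        rw [h, h', mul_zero]
      smul_mem' := by
        intro c p hp n
        filter_upwards [hp n,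
          Lp.coeFn_smul c ((p.1 n : symSector d n) : Lp ℂ 2 (photonMeasureN d n)),
          Lp.coeFn_smul c ((p.2 n : symSector d n) : Lp ℂ 2 (photonMeasureN d n))]
          with k h1 h2 h3
        have h2' : photonFn (c • p).1 n k = c * photonFn p.1 n k := h2
        have h3' : photonFn (c • p).2 n k = c * photonFn p.2 n k := h3
        rw [h2', h3', h1]
        ring }

/-- The `n`-photon component of `a(f)Ψ`:
`√(n+1) ∫ conj (f(y)) Ψ_{n+1}(y, k_1, …, k_n) dy`. -/
def annihilation {d : ℕ} (f : PhotonSpace d → ℂ) (Ψ : Fock d) (n : ℕ)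
    (k : Fin n → PhotonSpace d) : ℂ :=
  (√(n + 1 : ℝ) : ℂ) *
    ∫ y, starRingEnd ℂ (f y) * photonFn Ψ (n + 1) (Fin.cons y k) ∂(photonMeasure d)

/-- The `n`-photon component of `a*(f)Ψ`: it is `0` for `n = 0` and
`n^{-1/2} ∑_i f(k_i) Ψ_{n-1}(k_1, …, k_n without k_i)` for `n ≥ 1`. -/
def creation {d : ℕ} (f : PhotonSpace d → ℂ) (Ψ : Fock d) :
    (n : ℕ) → (Fin n → PhotonSpace d) → ℂ
  | 0, _ => 0
  | n + 1, k => (√(n + 1 : ℝ) : ℂ)⁻¹ * ∑ i, f (k i) * photonFn Ψ n (fun j => k (i.succAbove j))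

/-- The Segal field operator `Φ_S(f)`, for `f` in `L²(ℝᵈ × {1, …, d-1})`: the closure of
`(a(f) + a*(f)) / √2` on the finite particle vectors. (The pairs below form a subspace already.) -/
def segalField {d : ℕ} (f : PhotonSpace d → ℂ) : Fock d →ₗ.[ℂ] Fock d :=
  (Submodule.span ℂ {p : Fock d × Fock d |
    (∃ N, ∀ n ≥ N, p.1 n = 0) ∧
    ∀ n, photonFn p.2 n =ᵐ[photonMeasureN d n] fun k =>
      (√2 : ℂ)⁻¹ * (annihilation f p.1 n k + creation f p.1 n k)}).topologicalClosure.toLinearPMap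

end Fock

/-! ## The Pauli–Fierz model in the dipole approximation, without the `A²` term -/

/-- The data of the model in dimension `d`: constants, dispersion relation `ω`, form factor `ρ̂`
and polarization vectors `e`, together with the standing assumptions on them. -/
structure PauliFierzModel (d : ℕ) where
  /-- reduced Planck constant -/
  hbar : ℝ
  /-- observed electron mass -/
  m : ℝ
  /-- bare electron mass -/
  m0 : ℝ
  /-- coupling constant -/
  q : ℝ
  /-- vacuum permittivity -/
  eps0 : ℝ
  ω : Space d → ℝ
  ρ : Space d → ℝ
  e : Fin (d - 1) → Space d → Space d
  hbar_pos : 0 < hbar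
  m_pos : 0 < m
  m0_pos : 0 < m0
  q_ne_zero : q ≠ 0
  eps0_pos : 0 < eps0
  ω_measurable : Measurable ω
  ω_nonneg : ∀ k, 0 ≤ ω k
  ω_pos : ∀ᵐ k, 0 < ω k
  ω_radial : ∀ k k', ‖k‖ = ‖k'‖ → ω k = ω k'
  ρ_measurable : Measurable ρ
  ρ_radial : ∀ k k', ‖k‖ = ‖k'‖ → ρ k = ρ k'
  ρ_div_memLp : MemLp (fun k => ρ k / ω k ^ (1 / 2 : ℝ)) 2 volume
  ρ_div_memLp' : MemLp (fun k => ρ k / ω k ^ (3 / 2 : ℝ)) 2 volume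
  ρ_div_ne_zero : ¬ (fun k => ρ k / ω k ^ (1 / 2 : ℝ)) =ᵐ[volume] 0
  ρ_div_ne_zero' : ¬ (fun k => ρ k / ω k ^ (3 / 2 : ℝ)) =ᵐ[volume] 0
  e_measurable : ∀ l, Measurable (e l)
  /-- For almost every `k` the `d` vectors `k/|k|, e⁽¹⁾(k), …, e⁽ᵈ⁻¹⁾(k)` form an orthonormal
  basis of `ℝᵈ`. -/
  e_orthonormal : ∀ᵐ k, Orthonormal ℝ
    (fun o : Option (Fin (d - 1)) => o.elim (‖k‖⁻¹ • k) (fun l => e l k))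
  /-- Mass renormalization. -/
  mass_relation : 1 / m0 = 1 / m +
    ((d : ℝ) - 1) / d * (q ^ 2 / (eps0 * m ^ 2)) * ∫ k, |ρ k| ^ 2 / ω k ^ 2

namespace PauliFierzModel

variable {d : ℕ} (M : PauliFierzModel d)

/-- `g_j(k, λ) = (ħ / (ε₀ ω(k)))^{1/2} ρ̂(k) e_j^{(λ)}(k)`. -/
def g (j : Fin d) (κ : PhotonSpace d) : ℝ :=
  √(M.hbar / (M.eps0 * M.ω κ.1)) * M.ρ κ.1 * M.e κ.2 κ.1 j

/-- The quantized vector potential `A_j(0) = Φ_S(g_j)`. -/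
def vectorPotential (j : Fin d) : Fock d →ₗ.[ℂ] Fock d :=
  segalField fun κ => (M.g j κ : ℂ)

/-- The photon energy `dΓ(ħω)`. -/
def photonEnergy : Fock d →ₗ.[ℂ] Fock d :=
  secondQuantization fun κ => M.hbar * M.ω κ.1

/-- `H_0 = -ħ²/(2m_0) Δ ⊗ 1 + 1 ⊗ dΓ(ħω) - (q/m) ∑_j p_j ⊗ A_j(0)`, an operator sum on the
intersection of the domains. -/
def freeHamiltonian : L2 d (Fock d) →ₗ.[ℂ] L2 d (Fock d) :=
  (-(M.hbar ^ 2 / (2 * M.m0) : ℂ)) • tensorOp (laplacianOp d) (idOp (Fock d))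
    + tensorOp (idOp (L2 d ℂ)) M.photonEnergy
    - (M.q / M.m : ℂ) • ∑ j : Fin d, tensorOp (momentum M.hbar j) (M.vectorPotential j)

/-- The sum of the forms of `H_0` and of `V ⊗ 1`. -/
def totalFormSum (V : Space d → ℝ) : QForm (L2 d (Fock d)) :=
  (formOf M.freeHamiltonian).add (mulForm (Fock d) V)

/-- The total Hamiltonian, the quadratic form sum of `H_0` and `V ⊗ 1`. -/
def totalHamiltonian (V : Space d → ℝ) : L2 d (Fock d) →ₗ.[ℂ] L2 d (Fock d) :=
  (M.totalFormSum V).op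

/-- The quadratic form `s_tot` associated with the total Hamiltonian. -/
def totalForm (V : Space d → ℝ) : QForm (L2 d (Fock d)) :=
  formOf (M.totalHamiltonian V)

/-- `U(P) = exp(i q/(mħ) Φ_S(i P·g/ω))`, where `P·g = ∑_j P_j g_j`. -/
def dressingFiber (P : Space d) : Fock d →L[ℂ] Fock d :=
  expI ((M.q / (M.m * M.hbar) : ℂ) • segalField fun κ =>
    Complex.I * ((∑ j, P j * M.g j κ : ℝ) : ℂ) / (M.ω κ.1 : ℂ))

/-- The unitary `U = (𝓕 ⊗ 1)* [∫^⊕ U(P) dP] (𝓕 ⊗ 1)`. The Fourier transform in use is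
`∫ ψ(x) e^{-2πi x·ξ} dx`, so that the momentum is `P = 2πħξ`. -/
def dressing : L2 d (Fock d) →L[ℂ] L2 d (Fock d) :=
  (Lp.fourierTransformₗᵢ (Space d) (Fock d)).symm.toContinuousLinearEquiv.toContinuousLinearMap ∘L
    directIntegral (fun ξ => M.dressingFiber ((2 * Real.pi * M.hbar) • ξ)) ∘L
    (Lp.fourierTransformₗᵢ (Space d) (Fock d)).toContinuousLinearEquiv.toContinuousLinearMap

/-- The dressed electron state `ψ_dr = U* (ψ ⊗ Ω)`. -/
def dressed (ψ : L2 d ℂ) : L2 d (Fock d) :=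
  ContinuousLinearMap.adjoint M.dressing (tensor ψ (vacuum d))

/-- The variance parameter `a`. -/
def a : ℝ :=
  ((d : ℝ) - 1) / (4 * d) * (M.hbar * M.q ^ 2 / (M.eps0 * M.m ^ 2)) * ∫ k, |M.ρ k| ^ 2 / M.ω k ^ 3

/-- The effective potential
`V_eff(x) = (4πa)^{-d/2} ∫ V(y) exp(-|x - y|²/(4a)) dy`. -/
def effectivePotential (V : Space d → ℝ) (x : Space d) : ℝ :=
  1 / (4 * Real.pi * M.a) ^ ((d : ℝ) / 2) * ∫ y, V y * Real.exp (-‖x - y‖ ^ 2 / (4 * M.a))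

/-- The sum of the forms of `-ħ²/(2m) Δ` and of `V_eff`. -/
def effectiveFormSum (V : Space d → ℝ) : QForm (L2 d ℂ) :=
  (formOf ((-(M.hbar ^ 2 / (2 * M.m) : ℂ)) • laplacianOp d)).add
    (mulForm ℂ (M.effectivePotential V))

/-- The effective Hamiltonian, the quadratic form sum of `-ħ²/(2m) Δ` and `V_eff`. -/
def effectiveHamiltonian (V : Space d → ℝ) : L2 d ℂ →ₗ.[ℂ] L2 d ℂ :=
  (M.effectiveFormSum V).op

/-- The form `s_eff(ψ) = s_tot(ψ_dr)` on `dom (|Δ|^{1/2}) ∩ dom ((|V|_eff)^{1/2})`. -/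
def effectiveForm (V : Space d → ℝ) : QForm (L2 d ℂ) where
  domain := (kineticForm d).domain ⊓ mulFormDomain ℂ (M.effectivePotential fun x => |V x|)
  val φ ψ := (M.totalForm V).val (M.dressed φ) (M.dressed ψ)

end PauliFierzModel

end

open MeasureTheory Filter Topology
open scoped SchwartzMap FourierTransform ENNReal

noncomputable section

universe u

section AbstractForms

variable {H : Type*} [NormedAddCommGroup H] [InnerProductSpace ℂ H]

theorem cauchySeq_iff_tendsto_norm_sub_sq {E : Type*} [NormedAddCommGroup E] {u : ℕ → E} :
    CauchySeq u ↔ Tendsto (fun p : ℕ × ℕ => ‖u p.1 - u p.2‖ ^ 2) atTop (𝓝 0) := by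
  rw [cauchySeq_iff_tendsto_dist_atTop_0]
  simp only [dist_eq_norm]
  constructor
  · intro h
    simpa using h.pow 2
  · intro h
    simpa [Function.comp_def, Real.sqrt_sq (norm_nonneg _)] using
      (Real.continuous_sqrt.tendsto 0).comp h

theorem inner_self_re (x : H) : (inner ℂ x x).re = ‖x‖ ^ 2 := inner_self_eq_norm_sq (𝕜 := ℂ) x

theorem tendsto_iff_norm_sub_sq_tendsto_zero {ι E : Type*} [NormedAddCommGroup E] {l : Filter ι}
    {u : ι → E} {x : E} :
    Tendsto u l (𝓝 x) ↔ Tendsto (fun n => ‖u n - x‖ ^ 2) l (𝓝 0) := by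
  rw [tendsto_iff_norm_sub_tendsto_zero]
  constructor
  · intro h
    simpa using h.pow 2
  · intro h
    simpa [Function.comp_def, Real.sqrt_sq (norm_nonneg _)] using
      (Real.continuous_sqrt.tendsto 0).comp h

theorem dense_of_forall_inner_eq_zero [CompleteSpace H] {S : Submodule ℂ H}
    (h : ∀ x, (∀ y ∈ S, inner ℂ y x = 0) → x = 0) : Dense (S : Set H) := by
  rw [Submodule.dense_iff_topologicalClosure_eq_top, Submodule.topologicalClosure_eq_top_iff,
    Submodule.eq_bot_iff]
  intro x hx
  exact h x ((Submodule.mem_orthogonal _ _).1 hx)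

namespace QForm

/-- A realization of a form by the inner product of a Hilbert space `K` that is continuously
embedded in `H`. -/
structure Model (s : QForm H) (K : Type*) [NormedAddCommGroup K] [InnerProductSpace ℂ K] where
  j : K →L[ℂ] H
  injective : Function.Injective j
  shift : ℝ
  mem_domain : ∀ ψ, ψ ∈ s.domain ↔ ∃ x, j x = ψ
  val_eq : ∀ x y, s.val (j x) (j y) = inner ℂ x y - shift * inner ℂ (j x) (j y)

theorem IsHermitian.add_left {s : QForm H} (hs : s.IsHermitian) {φ ψ χ : H} (hφ : φ ∈ s.domain)
    (hψ : ψ ∈ s.domain) (hχ : χ ∈ s.domain) : s.val (φ + ψ) χ = s.val φ χ + s.val ψ χ := by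
  rw [hs.conj_symm _ hχ _ (add_mem hφ hψ), hs.add_right _ hχ _ hφ _ hψ, map_add,
    ← hs.conj_symm _ hχ _ hφ, ← hs.conj_symm _ hχ _ hψ]

theorem IsHermitian.smul_left {s : QForm H} (hs : s.IsHermitian) (c : ℂ) {φ χ : H}
    (hφ : φ ∈ s.domain) (hχ : χ ∈ s.domain) :
    s.val (c • φ) χ = starRingEnd ℂ c * s.val φ χ := by
  rw [hs.conj_symm _ hχ _ (Submodule.smul_mem _ c hφ), hs.smul_right c _ hχ _ hφ, map_mul,
    ← hs.conj_symm _ hχ _ hφ]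

/-- A hermitian form is determined by its diagonal. -/
theorem IsHermitian.ext_of_diag {H' : Type*} [NormedAddCommGroup H'] [InnerProductSpace ℂ H']
    {s : QForm H} {t : QForm H'} (hs : s.IsHermitian) (ht : t.IsHermitian) (D : Submodule ℂ H)
    (J : H →ₗ[ℂ] H') (hD : D ≤ s.domain) (hJ : ∀ ψ ∈ D, J ψ ∈ t.domain)
    (h : ∀ ψ ∈ D, (s.val ψ ψ).re = (t.val (J ψ) (J ψ)).re) {φ ψ : H} (hφ : φ ∈ D) (hψ : ψ ∈ D) :
    s.val φ ψ = t.val (J φ) (J ψ) := by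
  have key : ∀ φ ∈ D, ∀ ψ ∈ D, (s.val φ ψ).re = (t.val (J φ) (J ψ)).re := by
    intro φ hφ ψ hψ
    have h1 := h _ (add_mem hφ hψ)
    have e1 : (s.val ψ φ).re = (s.val φ ψ).re := by
      rw [hs.conj_symm φ (hD hφ) ψ (hD hψ), Complex.conj_re]
    have e2 : (t.val (J ψ) (J φ)).re = (t.val (J φ) (J ψ)).re := by
      rw [ht.conj_symm _ (hJ _ hφ) _ (hJ _ hψ), Complex.conj_re]
    rw [hs.add_right _ (hD (add_mem hφ hψ)) _ (hD hφ) _ (hD hψ),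
      hs.add_left (hD hφ) (hD hψ) (hD hφ), hs.add_left (hD hφ) (hD hψ) (hD hψ), map_add,
      ht.add_right _ (add_mem (hJ _ hφ) (hJ _ hψ)) _ (hJ _ hφ) _ (hJ _ hψ),
      ht.add_left (hJ _ hφ) (hJ _ hψ) (hJ _ hφ), ht.add_left (hJ _ hφ) (hJ _ hψ) (hJ _ hψ)] at h1
    simp only [Complex.add_re] at h1
    have h2 := h _ hφ
    have h3 := h _ hψ
    linarith
  apply Complex.ext (key φ hφ ψ hψ)
  have h1 := key _ (D.smul_mem Complex.I hφ) ψ hψ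
  rw [hs.smul_left _ (hD hφ) (hD hψ), map_smul, ht.smul_left _ (hJ _ hφ) (hJ _ hψ)] at h1
  simpa using h1

theorem IsClosedSemibounded.congr {s t : QForm H} (hs : s.IsClosedSemibounded)
    (hd : t.domain = s.domain) (hv : ∀ φ ∈ s.domain, ∀ ψ ∈ s.domain, t.val φ ψ = s.val φ ψ) :
    t.IsClosedSemibounded := by
  obtain ⟨⟨h1, h2, h3⟩, h4, ⟨c, h5⟩, h6⟩ := hs
  refine ⟨⟨?_, ?_, ?_⟩, hd ▸ h4, ⟨c, ?_⟩, ?_⟩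
  · rw [hd]
    intro φ hφ ψ hψ χ hχ
    rw [hv _ hφ _ (add_mem hψ hχ), hv _ hφ _ hψ, hv _ hφ _ hχ, h1 _ hφ _ hψ _ hχ]
  · rw [hd]
    intro c φ hφ ψ hψ
    rw [hv _ hφ _ (Submodule.smul_mem _ c hψ), hv _ hφ _ hψ, h2 _ _ hφ _ hψ]
  · rw [hd]
    intro φ hφ ψ hψ
    rw [hv _ hφ _ hψ, hv _ hψ _ hφ, h3 _ hφ _ hψ]
  · rw [hd]
    intro ψ hψ
    rw [hv _ hψ _ hψ]
    exact h5 _ hψ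
  · intro u ψ hu hψ hc
    rw [hd] at hu ⊢
    have := h6 u ψ hu hψ (by
      refine hc.congr fun p => ?_
      rw [hv _ (sub_mem (hu _) (hu _)) _ (sub_mem (hu _) (hu _))])
    refine ⟨this.1, this.2.congr fun n => ?_⟩
    rw [hv _ (sub_mem (hu _) this.1) _ (sub_mem (hu _) this.1)]

theorem op_congr {s t : QForm H} (hd : t.domain = s.domain)
    (hv : ∀ φ ∈ s.domain, ∀ ψ ∈ s.domain, t.val φ ψ = s.val φ ψ) : t.op = s.op := by
  unfold op
  congr 2
  ext p
  simp only [Set.mem_ofPred_eq, hd]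
  refine and_congr_right fun hp => forall₂_congr fun φ hφ => ?_
  rw [hv φ hφ _ hp]

section Model

variable {s : QForm H} {K : Type*} [NormedAddCommGroup K] [InnerProductSpace ℂ K]

namespace Model

theorem re_val (m : Model s K) (x : K) :
    (s.val (m.j x) (m.j x)).re = ‖x‖ ^ 2 - m.shift * ‖m.j x‖ ^ 2 := by
  rw [m.val_eq, Complex.sub_re, Complex.re_ofReal_mul, inner_self_re, inner_self_re]

theorem denseRange (m : Model s K) (hd : Dense (s.domain : Set H)) : DenseRange m.j :=
  hd.mono fun ψ hψ => (m.mem_domain ψ).1 hψ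

theorem isClosedSemibounded [CompleteSpace K] (m : Model s K) (hd : DenseRange m.j) :
    s.IsClosedSemibounded := by
  have hdom : (s.domain : Set H) = Set.range m.j := by
    ext ψ
    exact m.mem_domain ψ
  refine ⟨⟨?_, ?_, ?_⟩, by rw [hdom]; exact hd, ⟨-m.shift, ?_⟩, ?_⟩
  · intro φ hφ ψ hψ χ hχ
    obtain ⟨x, rfl⟩ := (m.mem_domain _).1 hφ
    obtain ⟨y, rfl⟩ := (m.mem_domain _).1 hψ
    obtain ⟨z, rfl⟩ := (m.mem_domain _).1 hχ
    rw [← map_add, m.val_eq, m.val_eq, m.val_eq, map_add, inner_add_right, inner_add_right]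
    ring
  · intro c φ hφ ψ hψ
    obtain ⟨x, rfl⟩ := (m.mem_domain _).1 hφ
    obtain ⟨y, rfl⟩ := (m.mem_domain _).1 hψ
    rw [← map_smul, m.val_eq, m.val_eq, map_smul, inner_smul_right, inner_smul_right]
    ring
  · intro φ hφ ψ hψ
    obtain ⟨x, rfl⟩ := (m.mem_domain _).1 hφ
    obtain ⟨y, rfl⟩ := (m.mem_domain _).1 hψ
    rw [m.val_eq, m.val_eq, map_sub, map_mul, inner_conj_symm, inner_conj_symm,
      Complex.conj_ofReal]
  · intro ψ hψ
    obtain ⟨x, rfl⟩ := (m.mem_domain _).1 hψ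
    rw [m.re_val]
    nlinarith [sq_nonneg ‖x‖]
  · intro u ψ hu hψ hc
    choose x hx using fun n => (m.mem_domain _).1 (hu n)
    obtain rfl : (fun n => m.j (x n)) = u := funext hx
    have h1 : CauchySeq x := by
      rw [cauchySeq_iff_tendsto_norm_sub_sq]
      have h2 := cauchySeq_iff_tendsto_norm_sub_sq.1 hψ.cauchySeq
      have h3 := hc.add (h2.const_mul m.shift)
      simp only [mul_zero, add_zero] at h3
      refine h3.congr fun p => ?_
      rw [← map_sub, m.re_val]
      ring
    obtain ⟨y, hy⟩ := cauchySeq_tendsto_of_complete h1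
    have hjy : m.j y = ψ := tendsto_nhds_unique ((m.j.continuous.tendsto y).comp hy) hψ
    refine ⟨(m.mem_domain _).2 ⟨y, hjy⟩, ?_⟩
    have h3 := (tendsto_iff_norm_sub_sq_tendsto_zero.1 hy).sub
      ((tendsto_iff_norm_sub_sq_tendsto_zero.1 hψ).const_mul m.shift)
    simp only [mul_zero, sub_zero] at h3
    refine h3.congr fun n => ?_
    rw [← hjy, ← map_sub, m.re_val]

end Model

end Model

/-- The domain of a form as a type, to be equipped with the form norm. -/
def FormSpace (s : QForm H) : Type _ := s.domain

instance (s : QForm H) : AddCommGroup (FormSpace s) := inferInstanceAs (AddCommGroup s.domain)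

instance (s : QForm H) : Module ℂ (FormSpace s) := inferInstanceAs (Module ℂ s.domain)

/-- The form inner product `s(φ, ψ) + (1 - c)⟨φ, ψ⟩`, for a form bounded from below by `c`. -/
@[reducible]
def formCore (s : QForm H) (hs : s.IsHermitian) (c : ℝ)
    (hc : ∀ ψ ∈ s.domain, c * ‖ψ‖ ^ 2 ≤ (s.val ψ ψ).re) :
    InnerProductSpace.Core ℂ (FormSpace s) where
  inner φ ψ := s.val (Subtype.val φ) (Subtype.val ψ)
    + ((1 - c : ℝ) : ℂ) * inner ℂ (Subtype.val φ) (Subtype.val ψ)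
  conj_inner_symm := by
    rintro ⟨x, hx⟩ ⟨y, hy⟩
    simp only [map_add, map_mul, Complex.conj_ofReal, inner_conj_symm]
    rw [hs.conj_symm _ hx _ hy, Complex.conj_conj]
  re_inner_nonneg := by
    rintro ⟨x, hx⟩
    have h := hc x hx
    have h' : (inner ℂ x x).re = ‖x‖ ^ 2 := inner_self_eq_norm_sq (𝕜 := ℂ) x
    simp only [RCLike.re_to_complex, Complex.add_re, Complex.re_ofReal_mul, h']
    nlinarith [sq_nonneg ‖x‖]
  add_left := by
    rintro ⟨x, hx⟩ ⟨y, hy⟩ ⟨z, hz⟩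
    change s.val (x + y) z + _ * inner ℂ (x + y) z = _
    rw [hs.add_left hx hy hz, inner_add_left]
    ring
  smul_left := by
    rintro ⟨x, hx⟩ ⟨y, hy⟩ r
    change s.val (r • x) y + _ * inner ℂ (r • x) y = _
    rw [hs.smul_left r hx hy, inner_smul_left]
    ring
  definite := by
    rintro ⟨x, hx⟩ h0
    have h := hc x hx
    have h' : (inner ℂ x x).re = ‖x‖ ^ 2 := inner_self_eq_norm_sq (𝕜 := ℂ) x
    have h0' := congrArg Complex.re h0
    simp only [Complex.add_re, Complex.re_ofReal_mul, h', Complex.zero_re] at h0'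
    have : ‖x‖ ^ 2 ≤ 0 := by nlinarith
    have : ‖x‖ = 0 := by nlinarith [norm_nonneg x]
    exact Subtype.ext (norm_eq_zero.1 this)

/-- A closed semibounded form is realized by the inner product of a Hilbert space. -/
theorem IsClosedSemibounded.exists_model {H : Type u} [NormedAddCommGroup H]
    [InnerProductSpace ℂ H] [CompleteSpace H] {s : QForm H} (hs : s.IsClosedSemibounded) :
    ∃ (K : Type u) (_ : NormedAddCommGroup K) (_ : InnerProductSpace ℂ K) (_ : CompleteSpace K),
      Nonempty (Model s K) := by
  obtain ⟨hh, hd, ⟨c, hc⟩, hcl⟩ := hs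
  let i0 : InnerProductSpace.Core ℂ (FormSpace s) := formCore s hh c hc
  let i1 : NormedAddCommGroup (FormSpace s) := i0.toNormedAddCommGroup
  let i2 : InnerProductSpace ℂ (FormSpace s) := InnerProductSpace.ofCore i0.toCore
  have hin : ∀ φ ψ : FormSpace s, inner ℂ φ ψ = s.val (Subtype.val φ) (Subtype.val ψ)
    + ((1 - c : ℝ) : ℂ) * inner ℂ (Subtype.val φ) (Subtype.val ψ) := fun _ _ => rfl
  have hnorm : ∀ φ : FormSpace s, ‖φ‖ ^ 2 =
      (s.val (Subtype.val φ) (Subtype.val φ)).re + (1 - c) * ‖(Subtype.val φ : H)‖ ^ 2 := by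
    intro φ
    rw [← inner_self_eq_norm_sq (𝕜 := ℂ) φ, ← inner_self_eq_norm_sq (𝕜 := ℂ) (Subtype.val φ), hin]
    simp only [RCLike.re_to_complex, Complex.add_re, Complex.re_ofReal_mul]
  let j0 : FormSpace s →ₗ[ℂ] H := s.domain.subtype
  have hj0 : ∀ φ : FormSpace s, j0 φ = Subtype.val φ := fun _ => rfl
  have hb : ∀ φ : FormSpace s, ‖j0 φ‖ ≤ 1 * ‖φ‖ := by
    intro φ
    have h1 := hnorm φ
    have h2 := hc _ φ.2
    rw [hj0, one_mul]
    refine abs_le_of_sq_le_sq' ?_ (norm_nonneg _) |>.2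
    linarith
  let j : FormSpace s →L[ℂ] H := j0.mkContinuous 1 hb
  have hj : ∀ φ : FormSpace s, j φ = Subtype.val φ := fun _ => rfl
  refine ⟨FormSpace s, i1, i2, ?_, ⟨⟨j, Subtype.val_injective, 1 - c, ?_, ?_⟩⟩⟩
  · refine Metric.complete_of_cauchySeq_tendsto fun u hu => ?_
    have hju : CauchySeq fun n => j (u n) := j.uniformContinuous.comp_cauchySeq hu
    obtain ⟨ψ, h1⟩ := cauchySeq_tendsto_of_complete hju
    obtain ⟨hψ, h2⟩ := hcl (fun n => j (u n)) ψ (fun n => (u n).2) h1 (by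
      have h3 := (cauchySeq_iff_tendsto_norm_sub_sq.1 hu).sub
        ((cauchySeq_iff_tendsto_norm_sub_sq.1 hju).const_mul (1 - c))
      simp only [mul_zero, sub_zero] at h3
      refine h3.congr fun p => ?_
      rw [← map_sub, hnorm, ← hj]
      ring)
    let x : FormSpace s := (⟨ψ, hψ⟩ : s.domain)
    refine ⟨x, ?_⟩
    rw [tendsto_iff_norm_sub_sq_tendsto_zero]
    have h3 := h2.add ((tendsto_iff_norm_sub_sq_tendsto_zero.1 h1).const_mul (1 - c))
    simp only [mul_zero, add_zero] at h3
    refine h3.congr fun n => ?_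
    rw [hnorm]
    rfl
  · intro ψ
    exact ⟨fun h => ⟨(⟨ψ, h⟩ : s.domain), rfl⟩, by rintro ⟨x, rfl⟩; exact x.2⟩
  · intro x y
    rw [hin, hj, hj]
    ring


section Representation

variable [CompleteSpace H] {s : QForm H} {K : Type*} [NormedAddCommGroup K]
  [InnerProductSpace ℂ K] [CompleteSpace K]

namespace Model

/-- The bounded operator `j j*`. -/
def resolvent (m : Model s K) : H →L[ℂ] H := m.j ∘L ContinuousLinearMap.adjoint m.j

theorem inner_resolvent (m : Model s K) (x y : H) :
    inner ℂ x (m.resolvent y) =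
      inner ℂ (ContinuousLinearMap.adjoint m.j x) (ContinuousLinearMap.adjoint m.j y) := by
  rw [resolvent, ContinuousLinearMap.comp_apply, ContinuousLinearMap.adjoint_inner_left]

theorem resolvent_symm (m : Model s K) (x y : H) :
    inner ℂ (m.resolvent x) y = inner ℂ x (m.resolvent y) := by
  rw [← inner_conj_symm, inner_resolvent, inner_resolvent, inner_conj_symm]

theorem adjoint_injective (m : Model s K) (hd : DenseRange m.j) {x : H}
    (hx : ContinuousLinearMap.adjoint m.j x = 0) : x = 0 := by
  refine hd.eq_zero_of_inner_left ℂ fun y => ?_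
  rw [← ContinuousLinearMap.adjoint_inner_left, hx, inner_zero_left]

theorem resolvent_injective (m : Model s K) (hd : DenseRange m.j) {x : H}
    (hx : m.resolvent x = 0) : x = 0 :=
  m.adjoint_injective hd (m.injective (by rw [map_zero]; exact hx))

theorem mem_op_iff (m : Model s K) (p : H × H) :
    (p.1 ∈ s.domain ∧ ∀ φ ∈ s.domain, s.val φ p.1 = inner ℂ φ p.2) ↔
      p.1 = m.resolvent (p.2 + (m.shift : ℂ) • p.1) := by
  obtain ⟨ψ, χ⟩ := p
  constructor
  · rintro ⟨h1, h2⟩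
    obtain ⟨x, rfl⟩ := (m.mem_domain _).1 h1
    refine congrArg m.j (ext_inner_left ℂ fun y => ?_)
    have h3 := h2 (m.j y) ((m.mem_domain _).2 ⟨y, rfl⟩)
    rw [m.val_eq] at h3
    refine Eq.trans ?_ (ContinuousLinearMap.adjoint_inner_right _ _ _).symm
    rw [inner_add_right, inner_smul_right, ← h3]
    ring
  · intro h
    refine ⟨(m.mem_domain _).2 ⟨_, h.symm⟩, fun φ hφ => ?_⟩
    obtain ⟨y, rfl⟩ := (m.mem_domain _).1 hφ
    have h' : ψ = m.j (ContinuousLinearMap.adjoint m.j (χ + (m.shift : ℂ) • ψ)) := h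
    change s.val (m.j y) ψ = inner ℂ (m.j y) χ
    conv_lhs => rw [h']
    rw [m.val_eq, ContinuousLinearMap.adjoint_inner_right, ← h', inner_add_right,
      inner_smul_right]
    ring

theorem mem_graph_op (m : Model s K) (hd : DenseRange m.j) (p : H × H) :
    p ∈ s.op.graph ↔ p.1 = m.resolvent (p.2 + (m.shift : ℂ) • p.1) := by
  let G : Submodule ℂ (H × H) := LinearMap.eqLocus (LinearMap.fst ℂ H H)
    (m.resolvent.toLinearMap ∘ₗ
      (LinearMap.snd ℂ H H + (m.shift : ℂ) • LinearMap.fst ℂ H H))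
  have hG : Submodule.span ℂ {p : H × H | p.1 ∈ s.domain ∧
      ∀ φ ∈ s.domain, s.val φ p.1 = inner ℂ φ p.2} = G := by
    have : {p : H × H | p.1 ∈ s.domain ∧ ∀ φ ∈ s.domain, s.val φ p.1 = inner ℂ φ p.2} =
        (G : Set (H × H)) := by
      ext p
      exact m.mem_op_iff p
    rw [this, Submodule.span_eq]
  rw [op, hG, Submodule.toLinearPMap_graph_eq]
  · rfl
  · rintro ⟨ψ, χ⟩ hp h0
    have hp' : ψ = m.resolvent (χ + (m.shift : ℂ) • ψ) := hp
    have h0' : ψ = 0 := h0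
    rw [h0', smul_zero, add_zero] at hp'
    exact m.resolvent_injective hd hp'.symm

theorem mem_graph_op_resolvent (m : Model s K) (hd : DenseRange m.j) (x : H) :
    (m.resolvent x, x - (m.shift : ℂ) • m.resolvent x) ∈ s.op.graph := by
  rw [m.mem_graph_op hd]
  simp

theorem dense_op_domain (m : Model s K) (hd : DenseRange m.j) :
    Dense (s.op.domain : Set H) := by
  refine dense_of_forall_inner_eq_zero fun x hx => m.resolvent_injective hd ?_
  refine ext_inner_left ℂ fun y => ?_
  rw [inner_zero_right, ← m.resolvent_symm]
  exact hx _ (LinearPMap.mem_domain_of_mem_graph (m.mem_graph_op_resolvent hd y))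

theorem isSelfAdjoint_op (m : Model s K) (hd : DenseRange m.j) : IsSelfAdjoint s.op := by
  have hdd := m.dense_op_domain hd
  rw [LinearPMap.isSelfAdjoint_def]
  apply LinearPMap.eq_of_eq_graph
  rw [LinearPMap.adjoint_graph_eq_graph_adjoint hdd]
  ext ⟨y, η⟩
  rw [Submodule.mem_adjoint_iff, m.mem_graph_op hd]
  constructor
  · intro h
    refine ext_inner_left ℂ fun ζ => ?_
    have h1 := h _ _ (m.mem_graph_op_resolvent hd ζ)
    rw [← m.resolvent_symm, inner_add_right, inner_smul_right]
    rw [inner_sub_left, inner_smul_left, Complex.conj_ofReal] at h1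
    linear_combination h1
  · intro h a b hab
    rw [m.mem_graph_op hd] at hab
    simp only at h hab ⊢
    have h1 : inner ℂ a (η + (m.shift : ℂ) • y) = inner ℂ (b + (m.shift : ℂ) • a) y := by
      conv_lhs => rw [hab]
      conv_rhs => rw [h]
      rw [m.resolvent_symm]
    rw [inner_add_right, inner_add_left, inner_smul_left, inner_smul_right,
      Complex.conj_ofReal] at h1
    linear_combination -h1

end Model

end Representation

section FormOf

variable {A : H →ₗ.[ℂ] H} {s : QForm H} {K : Type*} [NormedAddCommGroup K]
  [InnerProductSpace ℂ K] [CompleteSpace K]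

theorem Model.formApprox_iff (m : Model s K) (hA : ∀ u : A.domain, (u : H) ∈ s.domain)
    (hval : ∀ u v : A.domain, inner ℂ (u : H) (A v) = s.val u v) (u : ℕ → A.domain) (ψ : H) :
    FormApprox A u ψ ↔ ∃ (x : ℕ → K) (y : K), (∀ n, m.j (x n) = u n) ∧
      Tendsto x atTop (𝓝 y) ∧ m.j y = ψ := by
  choose x hx using fun n => (m.mem_domain _).1 (hA (u n))
  have hu : ∀ p : ℕ × ℕ, (inner ℂ ((u p.1 - u p.2 : A.domain) : H) (A (u p.1 - u p.2))).re =
      ‖x p.1 - x p.2‖ ^ 2 - m.shift * ‖(u p.1 : H) - u p.2‖ ^ 2 := by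
    intro p
    rw [hval, Submodule.coe_sub, ← hx, ← hx, ← map_sub, m.re_val]
  constructor
  · rintro ⟨h1, h2⟩
    have h3 : CauchySeq x := by
      rw [cauchySeq_iff_tendsto_norm_sub_sq]
      have h4 := h2.add ((cauchySeq_iff_tendsto_norm_sub_sq.1 h1.cauchySeq).const_mul m.shift)
      simp only [mul_zero, add_zero] at h4
      refine h4.congr fun p => ?_
      rw [hu]
      ring
    obtain ⟨y, hy⟩ := cauchySeq_tendsto_of_complete h3
    refine ⟨x, y, hx, hy, tendsto_nhds_unique ?_ h1⟩
    simpa only [Function.comp_def, hx] using (m.j.continuous.tendsto y).comp hy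
  · rintro ⟨x', y, hx', hy, rfl⟩
    obtain rfl : x' = x := funext fun n => m.injective (by rw [hx, hx'])
    have h1 : Tendsto (fun n => (u n : H)) atTop (𝓝 (m.j y)) := by
      simpa only [Function.comp_def, hx] using (m.j.continuous.tendsto y).comp hy
    refine ⟨h1, ?_⟩
    have h4 := (cauchySeq_iff_tendsto_norm_sub_sq.1 hy.cauchySeq).sub
      ((cauchySeq_iff_tendsto_norm_sub_sq.1 h1.cauchySeq).const_mul m.shift)
    simp only [mul_zero, sub_zero] at h4
    exact h4.congr fun p => (hu p).symm

theorem mem_formDomain (hA : IsSemibounded A) (ψ : H) :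
    ψ ∈ formDomain A ↔ ∃ u, FormApprox A u ψ := by
  rw [formDomain, dif_pos hA]
  rfl

/-- If the domain of an operator is a form core of `s`, then `formOf` recovers `s`. -/
theorem Model.formOf_eq (m : Model s K) (hA : ∀ u : A.domain, (u : H) ∈ s.domain)
    (hval : ∀ u v : A.domain, inner ℂ (u : H) (A v) = s.val u v)
    (hcore : Dense (m.j ⁻¹' A.domain)) :
    (formOf A).domain = s.domain ∧
      (∀ φ ∈ s.domain, ∀ ψ ∈ s.domain, (formOf A).val φ ψ = s.val φ ψ) ∧
      ∀ φ ψ u v, FormApprox A u φ → FormApprox A v ψ →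
        Tendsto (fun n => inner ℂ (u n : H) (A (v n))) atTop (𝓝 ((formOf A).val φ ψ)) := by
  have hsb : IsSemibounded A := by
    refine ⟨-m.shift, fun ψ => ?_⟩
    obtain ⟨x, hx⟩ := (m.mem_domain _).1 (hA ψ)
    rw [hval, ← hx, m.re_val]
    nlinarith [sq_nonneg ‖x‖]
  have hlim : ∀ φ ψ u v, FormApprox A u φ → FormApprox A v ψ →
      Tendsto (fun n => inner ℂ (u n : H) (A (v n))) atTop (𝓝 (s.val φ ψ)) := by
    intro φ ψ u v hu hv
    obtain ⟨x, y, hx, hy, rfl⟩ := (m.formApprox_iff hA hval _ _).1 hu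
    obtain ⟨x', y', hx', hy', rfl⟩ := (m.formApprox_iff hA hval _ _).1 hv
    have e : ∀ n, inner ℂ (u n : H) (A (v n)) =
        inner ℂ (x n) (x' n) - m.shift * inner ℂ (m.j (x n)) (m.j (x' n)) := by
      intro n
      rw [hval, ← hx, ← hx', m.val_eq]
    simp only [e]
    rw [m.val_eq]
    exact (Filter.Tendsto.inner (𝕜 := ℂ) hy hy').sub ((Filter.Tendsto.inner (𝕜 := ℂ)
      ((m.j.continuous.tendsto y).comp hy) ((m.j.continuous.tendsto y').comp hy')).const_mul _)
  have hex : ∀ ψ ∈ s.domain, ∃ u, FormApprox A u ψ := by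
    intro ψ hψ
    obtain ⟨y, rfl⟩ := (m.mem_domain _).1 hψ
    obtain ⟨x, hx, hy⟩ := mem_closure_iff_seq_limit.1 (hcore y)
    exact ⟨fun n => ⟨m.j (x n), hx n⟩, (m.formApprox_iff hA hval _ _).2
      ⟨x, y, fun _ => rfl, hy, rfl⟩⟩
  have hv : ∀ φ ∈ s.domain, ∀ ψ ∈ s.domain, (formOf A).val φ ψ = s.val φ ψ := by
    intro φ hφ ψ hψ
    obtain ⟨u, hu⟩ := hex φ hφ
    obtain ⟨v, hv⟩ := hex ψ hψ
    exact tendsto_nhds_unique (Classical.epsilon_spec (p := fun L : ℂ => ∀ u v, FormApprox A u φ →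
      FormApprox A v ψ → Tendsto (fun n => inner ℂ (u n : H) (A (v n))) atTop (𝓝 L))
      ⟨_, hlim φ ψ⟩ u v hu hv) (hlim φ ψ u v hu hv)
  have hdom : ∀ ψ u, FormApprox A u ψ → ψ ∈ s.domain := by
    intro ψ u hu
    obtain ⟨x, y, -, -, h⟩ := (m.formApprox_iff hA hval _ _).1 hu
    exact (m.mem_domain _).2 ⟨y, h⟩
  refine ⟨?_, hv, ?_⟩
  · ext ψ
    refine (mem_formDomain hsb ψ).trans ⟨?_, hex ψ⟩
    rintro ⟨u, hu⟩
    exact hdom ψ u hu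
  · intro φ ψ u v hu hv'
    rw [hv φ (hdom _ _ hu) ψ (hdom _ _ hv')]
    exact hlim φ ψ u v hu hv'

theorem IsClosedSemibounded.isSelfAdjoint_op [CompleteSpace H] (hs : s.IsClosedSemibounded) :
    IsSelfAdjoint s.op := by
  obtain ⟨K, _, _, _, ⟨m⟩⟩ := hs.exists_model
  exact m.isSelfAdjoint_op (m.denseRange hs.dense)

theorem IsClosedSemibounded.formOf_op [CompleteSpace H] (hs : s.IsClosedSemibounded) :
    (formOf s.op).domain = s.domain ∧
      ∀ φ ∈ s.domain, ∀ ψ ∈ s.domain, (formOf s.op).val φ ψ = s.val φ ψ := by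
  obtain ⟨K, _, _, _, ⟨m⟩⟩ := hs.exists_model
  have hd := m.denseRange hs.dense
  have key : ∀ u : s.op.domain, (u : H) ∈ s.domain ∧
      ∀ φ ∈ s.domain, s.val φ u = inner ℂ φ (s.op u) := fun u =>
    (m.mem_op_iff (u, s.op u)).2 ((m.mem_graph_op hd _).1 (s.op.mem_graph u))
  have h := m.formOf_eq (fun u => (key u).1)
    (fun u v => ((key v).2 u (key u).1).symm) (by
      refine dense_of_forall_inner_eq_zero (S := s.op.domain.comap m.j.toLinearMap)
        fun x hx => m.injective ?_
      rw [map_zero]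
      refine ext_inner_left ℂ fun y => ?_
      rw [inner_zero_right, ← ContinuousLinearMap.adjoint_inner_left]
      exact hx _ (LinearPMap.mem_domain_of_mem_graph (m.mem_graph_op_resolvent hd y)))
  exact ⟨h.1, h.2.1⟩

theorem IsClosedSemibounded.formOf_eq [CompleteSpace H] (hs : s.IsClosedSemibounded)
    (hA : ∀ u : A.domain, (u : H) ∈ s.domain)
    (hval : ∀ u v : A.domain, inner ℂ (u : H) (A v) = s.val u v)
    (hcore : ∀ ψ ∈ s.domain, ∃ u : ℕ → A.domain, Tendsto (fun n => (u n : H)) atTop (𝓝 ψ) ∧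
      Tendsto (fun n => (s.val (u n - ψ) (u n - ψ)).re) atTop (𝓝 0)) :
    (formOf A).domain = s.domain ∧
      ∀ φ ∈ s.domain, ∀ ψ ∈ s.domain, (formOf A).val φ ψ = s.val φ ψ := by
  obtain ⟨K, _, _, _, ⟨m⟩⟩ := hs.exists_model
  have h := m.formOf_eq hA hval (by
    intro x
    obtain ⟨u, h1, h2⟩ := hcore (m.j x) ((m.mem_domain _).2 ⟨x, rfl⟩)
    choose y hy using fun n => (m.mem_domain _).1 (hA (u n))
    refine mem_closure_of_tendsto (f := y) (b := atTop) ?_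
      (Eventually.of_forall fun n => by
        rw [Set.mem_preimage, hy]
        exact (u n).2)
    rw [tendsto_iff_norm_sub_sq_tendsto_zero]
    have h3 := h2.add ((tendsto_iff_norm_sub_sq_tendsto_zero.1 h1).const_mul m.shift)
    simp only [mul_zero, add_zero] at h3
    refine h3.congr fun n => ?_
    rw [← hy, ← map_sub, m.re_val]
    ring)
  exact ⟨h.1, h.2.1⟩

open Classical in
/-- The form `⟨φ, A ψ⟩` on the domain of an operator. -/
def ofOp (A : H →ₗ.[ℂ] H) : QForm H where
  domain := A.domain
  val φ ψ := if h : ψ ∈ A.domain then inner ℂ φ (A ⟨ψ, h⟩) else 0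

theorem ofOp_val (φ : H) (ψ : A.domain) : (ofOp A).val φ ψ = inner ℂ φ (A ψ) := by
  simp [ofOp]

theorem ofOp_isHermitian (hsymm : ∀ u v : A.domain, inner ℂ (A u) (v : H) = inner ℂ (u : H) (A v)) :
    (ofOp A).IsHermitian := by
  refine ⟨?_, ?_, ?_⟩
  · intro φ hφ ψ hψ χ hχ
    lift ψ to A.domain using hψ
    lift χ to A.domain using hχ
    rw [← Submodule.coe_add, ofOp_val, ofOp_val, ofOp_val, LinearPMap.map_add, inner_add_right]
  · intro c φ hφ ψ hψ
    lift ψ to A.domain using hψ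
    rw [← Submodule.coe_smul, ofOp_val, ofOp_val, LinearPMap.map_smul, inner_smul_right]
  · intro φ hφ ψ hψ
    lift ψ to A.domain using hψ
    lift φ to A.domain using hφ
    rw [ofOp_val, ofOp_val, ← hsymm, inner_conj_symm]

/-- The form of a densely defined, symmetric, semibounded operator is closable, and `formOf` is its
closure. -/
theorem formOf_isClosedSemibounded [CompleteSpace H]
    (hsymm : ∀ u v : A.domain, inner ℂ (A u) (v : H) = inner ℂ (u : H) (A v))
    (hsb : IsSemibounded A) (hd : Dense (A.domain : Set H)) :
    (formOf A).IsClosedSemibounded ∧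
      ∀ φ ψ u v, FormApprox A u φ → FormApprox A v ψ →
        Tendsto (fun n => inner ℂ (u n : H) (A (v n))) atTop (𝓝 ((formOf A).val φ ψ)) := by
  obtain ⟨c, hc⟩ := hsb
  have hh := ofOp_isHermitian hsymm
  have hc' : ∀ ψ ∈ (ofOp A).domain, c * ‖ψ‖ ^ 2 ≤ ((ofOp A).val ψ ψ).re := by
    intro ψ hψ
    rw [ofOp_val ψ ⟨ψ, hψ⟩]
    exact hc ⟨ψ, hψ⟩
  let i0 : InnerProductSpace.Core ℂ (FormSpace (ofOp A)) := formCore (ofOp A) hh c hc'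
  let i1 : NormedAddCommGroup (FormSpace (ofOp A)) := i0.toNormedAddCommGroup
  let i2 : InnerProductSpace ℂ (FormSpace (ofOp A)) := InnerProductSpace.ofCore i0.toCore
  have hin : ∀ φ ψ : FormSpace (ofOp A), inner ℂ φ ψ =
      (ofOp A).val (Subtype.val φ) (Subtype.val ψ)
        + ((1 - c : ℝ) : ℂ) * inner ℂ (Subtype.val φ) (Subtype.val ψ) := fun _ _ => rfl
  let j0 : FormSpace (ofOp A) →ₗ[ℂ] H := A.domain.subtype
  have hb : ∀ φ : FormSpace (ofOp A), ‖j0 φ‖ ≤ 1 * ‖φ‖ := by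
    intro φ
    have h1 := inner_self_re φ
    rw [hin, Complex.add_re, Complex.re_ofReal_mul, inner_self_re] at h1
    have h2 := hc' _ φ.2
    rw [one_mul]
    refine abs_le_of_sq_le_sq' ?_ (norm_nonneg _) |>.2
    change ‖Subtype.val φ‖ ^ 2 ≤ _
    linarith
  let j1 : FormSpace (ofOp A) →L[ℂ] H := j0.mkContinuous 1 hb
  let e : FormSpace (ofOp A) →L[ℂ] UniformSpace.Completion (FormSpace (ofOp A)) :=
    UniformSpace.Completion.toComplL
  have he : DenseRange e := UniformSpace.Completion.denseRange_coe
  let j : UniformSpace.Completion (FormSpace (ofOp A)) →L[ℂ] H := j1.extend e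
  have hj : ∀ u : FormSpace (ofOp A), j (e u) = Subtype.val u := fun u =>
    ContinuousLinearMap.extend_eq j1 he (UniformSpace.Completion.isUniformInducing_coe _) u
  have hinner : ∀ (u : A.domain) (x : UniformSpace.Completion (FormSpace (ofOp A))),
      inner ℂ (e u) x = inner ℂ (A u) (j x) + ((1 - c : ℝ) : ℂ) * inner ℂ (u : H) (j x) := by
    intro u x
    refine he.induction_on (p := fun x => inner ℂ (e u) x =
      inner ℂ (A u) (j x) + ((1 - c : ℝ) : ℂ) * inner ℂ (u : H) (j x)) x ?_ ?_
    · exact isClosed_eq (by fun_prop) (by fun_prop)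
    · intro v
      rw [hj]
      refine (UniformSpace.Completion.inner_coe _ _).trans ?_
      refine (hin _ _).trans ?_
      congr 1
      exact (ofOp_val _ _).trans (hsymm u v).symm
  have hjinj : Function.Injective j := by
    rw [injective_iff_map_eq_zero]
    intro x hx
    refine he.eq_zero_of_inner_right ℂ fun u => ?_
    rw [hinner u x, hx, inner_zero_right, inner_zero_right, mul_zero, add_zero]
  let s : QForm H :=
    { domain := LinearMap.range j.toLinearMap
      val := fun φ ψ => inner ℂ (Function.invFun j φ) (Function.invFun j ψ)
        - ((1 - c : ℝ) : ℂ) * inner ℂ φ ψ }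
  have hinv : ∀ x, Function.invFun j (j x) = x := Function.leftInverse_invFun hjinj
  let m : Model s (UniformSpace.Completion (FormSpace (ofOp A))) :=
    { j := j
      injective := hjinj
      shift := 1 - c
      mem_domain := fun ψ => Iff.rfl
      val_eq := fun x y => by
        change inner ℂ (Function.invFun j (j x)) (Function.invFun j (j y)) - _ = _
        rw [hinv, hinv] }
  have hmd : DenseRange m.j := by
    refine hd.mono fun ψ hψ => ?_
    exact ⟨e (⟨ψ, hψ⟩ : A.domain), hj _⟩
  have h := m.formOf_eq (A := A) (fun u => ⟨e u, hj u⟩) (fun u v => by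
      have h1 := m.val_eq (e u) (e v)
      have h2 := hinner u (e v)
      have e1 : m.j (e u) = u := hj u
      have e2 : m.j (e v) = v := hj v
      have e3 : j (e v) = v := hj v
      rw [e1, e2] at h1
      rw [e3] at h2
      rw [h1, h2, ← hsymm]
      change _ = _ - ((1 - c : ℝ) : ℂ) * _
      ring) (by
      refine he.mono ?_
      rintro _ ⟨u, rfl⟩
      rw [Set.mem_preimage]
      have e1 : m.j (e u) = Subtype.val u := hj u
      rw [e1]
      exact u.2)
  exact ⟨(m.isClosedSemibounded hmd).congr h.1 h.2.1, h.2.2⟩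

end FormOf

section Add

variable {s t : QForm H}

theorem IsHermitian.add (hs : s.IsHermitian) (ht : t.IsHermitian) : (s.add t).IsHermitian := by
  refine ⟨?_, ?_, ?_⟩
  · intro φ hφ ψ hψ χ hχ
    simp only [QForm.add]
    rw [hs.add_right _ hφ.1 _ hψ.1 _ hχ.1, ht.add_right _ hφ.2 _ hψ.2 _ hχ.2]
    ring
  · intro c φ hφ ψ hψ
    simp only [QForm.add]
    rw [hs.smul_right _ _ hφ.1 _ hψ.1, ht.smul_right _ _ hφ.2 _ hψ.2]
    ring
  · intro φ hφ ψ hψ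
    simp only [QForm.add]
    rw [hs.conj_symm _ hφ.1 _ hψ.1, ht.conj_symm _ hφ.2 _ hψ.2, map_add]

theorem IsClosedSemibounded.add (hs : s.IsClosedSemibounded) (ht : t.IsHermitian)
    (htb : t.BoundedBelow) (htc : t.IsClosed) (hd : Dense ((s.add t).domain : Set H)) :
    (s.add t).IsClosedSemibounded := by
  obtain ⟨hh, -, ⟨c, hc⟩, hcl⟩ := hs
  obtain ⟨c', hc'⟩ := htb
  refine ⟨hh.add ht, hd, ⟨c + c', fun ψ hψ => ?_⟩, ?_⟩
  · have h1 := hc ψ hψ.1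
    have h2 := hc' ψ hψ.2
    simp only [QForm.add, Complex.add_re]
    linarith
  · intro u ψ hu hψ hlim
    have h0 := cauchySeq_iff_tendsto_norm_sub_sq.1 hψ.cauchySeq
    have e : ∀ p : ℕ × ℕ, ((s.add t).val (u p.1 - u p.2) (u p.1 - u p.2)).re =
      (s.val (u p.1 - u p.2) (u p.1 - u p.2)).re + (t.val (u p.1 - u p.2) (u p.1 - u p.2)).re :=
      fun p => rfl
    simp only [e] at hlim
    have l1 := h0.const_mul c
    have l2 := h0.const_mul c'
    rw [mul_zero] at l1 l2
    have s1 := hcl u ψ (fun n => (hu n).1) hψ (by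
      have up := hlim.sub l2
      rw [sub_zero] at up
      refine tendsto_of_tendsto_of_tendsto_of_le_of_le l1 up
        (fun p => hc _ (sub_mem (hu _).1 (hu _).1)) (fun p => ?_)
      have := hc' _ (sub_mem (hu p.1).2 (hu p.2).2)
      simp only
      linarith)
    have s2 := htc u ψ (fun n => (hu n).2) hψ (by
      have up := hlim.sub l1
      rw [sub_zero] at up
      refine tendsto_of_tendsto_of_tendsto_of_le_of_le l2 up
        (fun p => hc' _ (sub_mem (hu _).2 (hu _).2)) (fun p => ?_)
      have := hc _ (sub_mem (hu p.1).1 (hu p.2).1)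
      simp only
      linarith)
    exact ⟨⟨s1.1, s2.1⟩, by simpa [QForm.add] using s1.2.add s2.2⟩

/-- The KLMN theorem for forms that are relatively bounded with bound less than one. -/
theorem IsClosedSemibounded.add_of_relBounded (hs : s.IsClosedSemibounded) (ht : t.IsHermitian)
    (hdom : s.domain ≤ t.domain) {a b : ℝ} (ha : a < 1)
    (hb : ∀ ψ ∈ s.domain, |(t.val ψ ψ).re| ≤ a * (s.val ψ ψ).re + b * ‖ψ‖ ^ 2) :
    (s.add t).IsClosedSemibounded := by
  obtain ⟨hh, hd, ⟨c, hc⟩, hcl⟩ := hs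
  have hD : (s.add t).domain = s.domain := inf_eq_left.2 hdom
  refine ⟨hh.add ht, hD ▸ hd, ⟨(1 - a) * c - b, ?_⟩, ?_⟩
  · rw [hD]
    intro ψ hψ
    have h1 := hc ψ hψ
    have h2 := neg_le_of_abs_le (hb ψ hψ)
    simp only [QForm.add, Complex.add_re]
    nlinarith
  · intro u ψ hu hψ hlim
    rw [hD] at hu ⊢
    have h0 := cauchySeq_iff_tendsto_norm_sub_sq.1 hψ.cauchySeq
    have e : ∀ p : ℕ × ℕ, ((s.add t).val (u p.1 - u p.2) (u p.1 - u p.2)).re =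
      (s.val (u p.1 - u p.2) (u p.1 - u p.2)).re + (t.val (u p.1 - u p.2) (u p.1 - u p.2)).re :=
      fun p => rfl
    simp only [e] at hlim
    have l1 := h0.const_mul c
    rw [mul_zero] at l1
    have s1 := hcl u ψ hu hψ (by
      have up := (hlim.add (h0.const_mul b)).const_mul (1 - a)⁻¹
      rw [mul_zero, add_zero, mul_zero] at up
      refine tendsto_of_tendsto_of_tendsto_of_le_of_le l1 up
        (fun p => hc _ (sub_mem (hu _) (hu _))) (fun p => ?_)
      have := neg_le_of_abs_le (hb _ (sub_mem (hu p.1) (hu p.2)))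
      simp only
      rw [inv_mul_eq_div, le_div_iff₀ (by linarith)]
      linarith)
    refine ⟨s1.1, ?_⟩
    have h3 := (tendsto_iff_norm_sub_sq_tendsto_zero.1 hψ).const_mul b
    have s2 : Tendsto (fun n => (t.val (u n - ψ) (u n - ψ)).re) atTop (𝓝 0) := by
      refine squeeze_zero_norm (fun n => hb _ (sub_mem (hu n) s1.1)) ?_
      simpa using (s1.2.const_mul a).add h3
    simpa [QForm.add] using s1.2.add s2

end Add

end QForm
end AbstractForms
end

noncomputable section

section ExpSeries

open scoped Nat

/-- The exponential generating function of a sequence of vectors has infinite radius of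
convergence. -/
def IsEntireSeq {E : Type*} [NormedAddCommGroup E] (y : ℕ → E) : Prop :=
  ∀ r : ℝ, Summable fun n => |r| ^ n / n ! * ‖y n‖

theorem IsEntireSeq.shift {E : Type*} [NormedAddCommGroup E] {y : ℕ → E} (hy : IsEntireSeq y) : IsEntireSeq fun n => y (n + 1) := by
  intro r
  have h := (summable_nat_add_iff 1).2 (hy (2 * (|r| + 1)))
  refine h.of_nonneg_of_le (fun n => by positivity) fun n => ?_
  refine mul_le_mul_of_nonneg_right ?_ (norm_nonneg _)
  have h1 : ((n + 1 : ℕ) : ℝ) ≤ 2 ^ (n + 1) := by exact_mod_cast (Nat.lt_two_pow_self).le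
  have h2 : |r| ^ n ≤ (|r| + 1) ^ (n + 1) := by
    calc |r| ^ n ≤ (|r| + 1) ^ n := by gcongr; linarith
      _ ≤ (|r| + 1) ^ (n + 1) := pow_le_pow_right₀ (by linarith [abs_nonneg r]) (Nat.le_succ n)
  rw [abs_of_nonneg (by positivity : (0 : ℝ) ≤ 2 * (|r| + 1)), mul_pow, div_le_div_iff₀
    (by positivity) (by positivity), Nat.factorial_succ]
  push_cast at h1 ⊢
  calc |r| ^ n * ((n + 1) * (n ! : ℝ)) = ((n : ℝ) + 1) * |r| ^ n * n ! := by ring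
    _ ≤ 2 ^ (n + 1) * (|r| + 1) ^ (n + 1) * n ! := by gcongr

theorem isEntireSeq_of_norm_succ_le {E : Type*} [NormedAddCommGroup E] {y : ℕ → E} {C : ℝ} (hC : 0 ≤ C) {N : ℕ}
    (h : ∀ n, ‖y (n + 1)‖ ≤ C * √(N + n + 1) * ‖y n‖) : IsEntireSeq y := by
  intro r
  refine summable_of_ratio_norm_eventually_le (r := 1 / 2) (by norm_num) ?_
  have h1 : Tendsto (fun n : ℕ => √((n : ℝ) + 1)) atTop atTop :=
    Real.tendsto_sqrt_atTop.comp (tendsto_atTop_add_const_right _ _ tendsto_natCast_atTop_atTop)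
  filter_upwards [h1.eventually_ge_atTop (2 * (|r| * C * √(N + 1)))] with n hn
  rw [Real.norm_of_nonneg (by positivity), Real.norm_of_nonneg (by positivity)]
  have h2 : √((N : ℝ) + n + 1) ≤ √(N + 1) * √(n + 1) := by
    rw [← Real.sqrt_mul (by positivity)]
    apply Real.sqrt_le_sqrt
    have : (0 : ℝ) ≤ N * n := by positivity
    linarith
  have h3 : √((n : ℝ) + 1) * √(n + 1) = n + 1 := Real.mul_self_sqrt (by positivity)
  have h4 : |r| * (C * √(N + n + 1)) ≤ 1 / 2 * (n + 1) := by
    calc |r| * (C * √(N + n + 1)) ≤ |r| * (C * (√(N + 1) * √(n + 1))) := by gcongr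
      _ = (|r| * C * √(N + 1)) * √(n + 1) := by ring
      _ ≤ (1 / 2 * √(n + 1)) * √(n + 1) :=
        mul_le_mul_of_nonneg_right (by linarith) (Real.sqrt_nonneg _)
      _ = 1 / 2 * (n + 1) := by rw [mul_assoc, h3]
  rw [Nat.factorial_succ]
  push_cast
  calc |r| ^ (n + 1) / ((n + 1) * (n ! : ℝ)) * ‖y (n + 1)‖
      ≤ |r| ^ (n + 1) / ((n + 1) * (n ! : ℝ)) * (C * √(N + n + 1) * ‖y n‖) := by
        gcongr
        exact h n
    _ = (|r| * (C * √(N + n + 1))) / (n + 1) * (|r| ^ n / n ! * ‖y n‖) := by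
        field_simp
        ring
    _ ≤ 1 / 2 * (|r| ^ n / n ! * ‖y n‖) := by
        refine mul_le_mul_of_nonneg_right ?_ (by positivity)
        rw [div_le_iff₀ (by positivity)]
        exact h4

variable {E : Type*} [NormedAddCommGroup E] [NormedSpace ℝ E]

/-- The exponential generating function `∑ tⁿ/n! yₙ` of a sequence of vectors. -/
def expSeries (y : ℕ → E) (t : ℝ) : E := ∑' n, (t ^ n / n ! : ℝ) • y n

theorem expSeries_zero (y : ℕ → E) : expSeries y 0 = y 0 := by
  rw [expSeries, tsum_eq_single 0]
  · simp
  · intro n hn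
    simp [hn]

variable [CompleteSpace E]

theorem IsEntireSeq.summable {y : ℕ → E} (hy : IsEntireSeq y) (t : ℝ) :
    Summable fun n => (t ^ n / n ! : ℝ) • y n := by
  refine Summable.of_norm ((hy t).congr fun n => ?_)
  rw [norm_smul, norm_div, norm_pow, Real.norm_eq_abs, Real.norm_natCast]

theorem IsEntireSeq.hasDerivAt {y : ℕ → E} (hy : IsEntireSeq y) (t : ℝ) :
    HasDerivAt (expSeries y) (expSeries (fun n => y (n + 1)) t) t := by
  let g' : ℕ → ℝ → E := fun n t => Nat.casesOn n 0 fun n => (t ^ n / n ! : ℝ) • y (n + 1)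
  let u : ℕ → ℝ := fun n => Nat.casesOn n 0 fun n => |(|t| + 1)| ^ n / n ! * ‖y (n + 1)‖
  have hu : Summable u := (summable_nat_add_iff 1).1 (hy.shift (|t| + 1))
  have hR : (0 : ℝ) < |t| + 1 := by positivity
  have hb : ∀ n z, z ∈ Metric.ball (0 : ℝ) (|t| + 1) → ‖g' n z‖ ≤ u n := by
    intro n z hz
    rw [mem_ball_zero_iff, Real.norm_eq_abs] at hz
    cases n with
    | zero => simp [g', u]
    | succ n =>
      simp only [g', u, norm_smul, norm_div, norm_pow, Real.norm_eq_abs, abs_of_pos hR,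
        Nat.abs_cast]
      gcongr
  have ht : t ∈ Metric.ball (0 : ℝ) (|t| + 1) := by
    rw [mem_ball_zero_iff, Real.norm_eq_abs]
    linarith
  have h := hasDerivAt_tsum_of_isPreconnected (g := fun n z => (z ^ n / n ! : ℝ) • y n) (g' := g')
    hu Metric.isOpen_ball (convex_ball (0 : ℝ) _).isPreconnected ?_ hb ht (hy.summable t) ht
  · have hs : Summable fun n => g' n t := Summable.of_norm_bounded hu fun n => hb n t ht
    rw [hs.tsum_eq_zero_add] at h
    have e : g' 0 t + ∑' n, g' (n + 1) t = expSeries (fun n => y (n + 1)) t := by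
      simp [g', expSeries]
    rw [e] at h
    exact h
  · intro n z _
    cases n with
    | zero => simpa [g'] using hasDerivAt_const z (y 0)
    | succ n =>
      refine HasDerivAt.smul_const ?_ _
      have h1 := (hasDerivAt_pow (n + 1) z).div_const (((n + 1)! : ℕ) : ℝ)
      convert h1 using 1
      rw [Nat.factorial_succ]
      push_cast
      have := Nat.factorial_ne_zero n
      field_simp

theorem IsEntireSeq.expSeries_add {y z : ℕ → E} (hy : IsEntireSeq y) (hz : IsEntireSeq z) (t : ℝ) :
    expSeries (fun n => y n + z n) t = expSeries y t + expSeries z t := by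
  simp only [expSeries, smul_add]
  exact (hy.summable t).tsum_add (hz.summable t)

end ExpSeries

section UnitaryGroup

variable {H : Type*} [NormedAddCommGroup H] [InnerProductSpace ℂ H]

namespace IsUnitaryGroup

variable {A : H →ₗ.[ℂ] H} {W : ℝ → H →L[ℂ] H}

theorem apply_neg_apply (hW : IsUnitaryGroup A W) (t : ℝ) (ψ : H) : W t (W (-t) ψ) = ψ := by
  rw [← mul_apply_eq_comp, ← hW.add, add_neg_cancel, hW.zero]
  rfl

theorem adjoint_apply [CompleteSpace H] (hW : IsUnitaryGroup A W) (t : ℝ) (ψ : H) :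
    ContinuousLinearMap.adjoint (W t) ψ = W (-t) ψ := by
  refine ext_inner_right ℂ fun φ => ?_
  have h : ∀ x y, inner ℂ (W t x) (W t y) = inner ℂ x y := by
    have : ∀ x, ‖(W t).toLinearMap x‖ = ‖x‖ := hW.norm_map t
    exact (LinearIsometry.mk (W t).toLinearMap this).inner_map_map
  rw [ContinuousLinearMap.adjoint_inner_left]
  conv_lhs => rw [← hW.apply_neg_apply t ψ]
  exact h _ _

/-- A solution of `c' = i A c` is given by the unitary group generated by `A`. -/
theorem apply_eq_of_hasDerivAt (hW : IsUnitaryGroup A W) (c : ℝ → A.domain)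
    (hc : ∀ t, HasDerivAt (fun t => (c t : H)) (Complex.I • A (c t)) t) (t : ℝ) :
    W t (c 0) = c t := by
  have key : ∀ t, HasDerivAt (fun t => W (-t) (c t : H)) 0 t := by
    intro t
    rw [hasDerivAt_iff_tendsto_slope_zero]
    have h1 := hasDerivAt_iff_tendsto_slope_zero.1 (hc t)
    have h2 : Tendsto (fun h : ℝ => W (-h) (h⁻¹ • ((c (t + h) : H) - c t))) (𝓝[≠] 0)
        (𝓝 (Complex.I • A (c t))) := by
      rw [tendsto_iff_norm_sub_tendsto_zero] at h1 ⊢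
      have h3 : Tendsto (fun h : ℝ => ‖W (-h) (Complex.I • A (c t)) - Complex.I • A (c t)‖)
          (𝓝[≠] 0) (𝓝 0) := by
        have h4 : Continuous fun h : ℝ =>
            ‖W (-h) (Complex.I • A (c t)) - Complex.I • A (c t)‖ :=
          (((hW.continuous _).comp continuous_neg).sub continuous_const).norm
        have h5 := h4.tendsto 0
        rw [neg_zero, hW.zero] at h5
        simp only [one_apply_eq_self, sub_self, norm_zero] at h5
        exact h5.mono_left nhdsWithin_le_nhds
      have h6 := h1.add h3
      rw [add_zero] at h6
      refine squeeze_zero (fun _ => norm_nonneg _) (fun h => ?_) h6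
      calc _ = ‖W (-h) (h⁻¹ • ((c (t + h) : H) - c t) - Complex.I • A (c t)) +
            (W (-h) (Complex.I • A (c t)) - Complex.I • A (c t))‖ := by
              rw [map_sub (W (-h))]
              congr 1
              abel
        _ ≤ ‖W (-h) (h⁻¹ • ((c (t + h) : H) - c t) - Complex.I • A (c t))‖ +
            ‖W (-h) (Complex.I • A (c t)) - Complex.I • A (c t)‖ := norm_add_le _ _
        _ = _ := congrArg (· + _) (hW.norm_map _ _)
    have h3 : Tendsto (fun h : ℝ => h⁻¹ • (W (-h) (c t : H) - c t)) (𝓝[≠] 0)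
        (𝓝 (-(Complex.I • A (c t)))) := by
      have h4 := (hW.hasDerivAt (c t)).scomp_of_eq (0 : ℝ) (hasDerivAt_neg 0) (by simp)
      rw [neg_one_smul] at h4
      have h5 := hasDerivAt_iff_tendsto_slope_zero.1 h4
      simpa [Function.comp_def, hW.zero] using h5
    have h4 := (h2.add h3)
    rw [add_neg_cancel] at h4
    have h5 := ((W (-t)).continuous.tendsto 0).comp h4
    rw [map_zero] at h5
    refine h5.congr fun h => ?_
    simp only [Function.comp_apply]
    rw [neg_add, hW.add, mul_apply_eq_comp, ← map_sub,
      ← ContinuousLinearMap.map_smul_of_tower]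
    congr 1
    rw [ContinuousLinearMap.map_smul_of_tower, map_sub, ← smul_add]
    congr 1
    abel
  have h := is_const_of_deriv_eq_zero (fun t => (key t).differentiableAt) (fun t => (key t).deriv)
    0 t
  simp only [neg_zero, hW.zero, one_apply_eq_self] at h
  rw [h, hW.apply_neg_apply]

end IsUnitaryGroup

/-- `T` is the restriction of the closed operator `A` to an invariant core `D` on which it is
symmetric and all of whose vectors are entire. -/
structure IsEntireCore (A : H →ₗ.[ℂ] H) (D : Submodule ℂ H) (T : D →ₗ[ℂ] D) : Prop where
  dense : Dense (D : Set H)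
  symm : ∀ u v : D, inner ℂ (T u : H) (v : H) = inner ℂ (u : H) (T v : H)
  mem_graph : ∀ u : D, ((u : H), (T u : H)) ∈ A.graph
  isClosed : IsClosed (A.graph : Set (H × H))
  subset_closure : (A.graph : Set (H × H)) ⊆ closure (Set.range fun u : D => ((u : H), (T u : H)))
  entire : ∀ u : D, IsEntireSeq fun n => ((T ^ n) u : H)


theorem inner_expSeries [CompleteSpace H] {y : ℕ → H} (hy : IsEntireSeq y) (x : H) (t : ℝ) :
    inner ℂ x (expSeries y t) = expSeries (fun n => inner ℂ x (y n)) t := by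
  have h := (hy.summable t).hasSum.mapL ((innerSL ℂ x).restrictScalars ℝ)
  refine h.tsum_eq.symm.trans ?_
  simp only [expSeries, ContinuousLinearMap.coe_restrictScalars', map_smul]
  rfl

theorem smul_expSeries [CompleteSpace H] {y : ℕ → H} (hy : IsEntireSeq y) (c : ℂ) (t : ℝ) :
    expSeries (fun n => c • y n) t = c • expSeries y t := by
  rw [expSeries, expSeries, ← (hy.summable t).tsum_const_smul]
  refine tsum_congr fun n => ?_
  rw [smul_comm]

namespace IsEntireCore

variable {A : H →ₗ.[ℂ] H} {D : Submodule ℂ H} {T : D →ₗ[ℂ] D}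

/-- The exponential series `∑ (it)ⁿ/n! Tⁿ u`. -/
def expSum (T : D →ₗ[ℂ] D) (t : ℝ) (u : D) : H :=
  expSeries (fun n => Complex.I ^ n • ((T ^ n) u : H)) t

theorem isEntireSeq (h : IsEntireCore A D T) (u : D) :
    IsEntireSeq fun n => Complex.I ^ n • ((T ^ n) u : H) := by
  intro r
  refine (h.entire u r).congr fun n => ?_
  rw [norm_smul, norm_pow, Complex.norm_I, one_pow, one_mul]

theorem expSum_zero (u : D) : expSum T 0 u = u := by
  rw [expSum, expSeries_zero]
  simp

variable [CompleteSpace H]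

theorem hasDerivAt (h : IsEntireCore A D T) (u : D) (t : ℝ) :
    HasDerivAt (fun t => expSum T t u) (Complex.I • expSum T t (T u)) t := by
  have h1 := (h.isEntireSeq u).hasDerivAt t
  have e : (fun n => Complex.I ^ (n + 1) • ((T ^ (n + 1)) u : H)) =
      fun n => Complex.I • (Complex.I ^ n • ((T ^ n) (T u) : H)) := by
    ext n
    rw [smul_smul, ← pow_succ', pow_succ T, Module.End.mul_apply]
  rw [e, smul_expSeries (h.isEntireSeq _)] at h1
  exact h1

theorem expSum_add (h : IsEntireCore A D T) (t : ℝ) (u v : D) :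
    expSum T t (u + v) = expSum T t u + expSum T t v := by
  rw [expSum, expSum, expSum, ← (h.isEntireSeq u).expSeries_add (h.isEntireSeq v)]
  simp

theorem expSum_smul (h : IsEntireCore A D T) (t : ℝ) (c : ℂ) (u : D) :
    expSum T t (c • u) = c • expSum T t u := by
  rw [expSum, expSum, ← smul_expSeries (h.isEntireSeq u)]
  congr 1
  ext n
  rw [map_smul, Submodule.coe_smul, smul_comm]

theorem inner_expSum (h : IsEntireCore A D T) (t : ℝ) (u w : D) :
    inner ℂ (w : H) (expSum T t (T u)) = inner ℂ (T w : H) (expSum T t u) := by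
  rw [expSum, expSum, inner_expSeries (h.isEntireSeq _), inner_expSeries (h.isEntireSeq _)]
  congr 1
  ext n
  rw [inner_smul_right, inner_smul_right, h.symm, ← Module.End.mul_apply,
    ← Module.End.mul_apply, ← pow_succ, ← pow_succ']

theorem inner_expSum_expSum (h : IsEntireCore A D T) (s t : ℝ) (u v : D) :
    inner ℂ (expSum T s (T u)) (expSum T t v) = inner ℂ (expSum T s u) (expSum T t (T v)) := by
  rw [show expSum T t v = expSeries (fun n => Complex.I ^ n • ((T ^ n) v : H)) t from rfl,
    show expSum T t (T v) = expSeries (fun n => Complex.I ^ n • ((T ^ n) (T v) : H)) t from rfl,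
    inner_expSeries (h.isEntireSeq _), inner_expSeries (h.isEntireSeq _)]
  congr 1
  ext n
  rw [inner_smul_right, inner_smul_right, ← inner_conj_symm, h.inner_expSum, inner_conj_symm,
    ← Module.End.mul_apply, ← Module.End.mul_apply, ← pow_succ, ← pow_succ']

theorem inner_expSum_eq (h : IsEntireCore A D T) (s t : ℝ) (u v : D) :
    inner ℂ (expSum T s u) (expSum T t v) = inner ℂ (u : H) (expSum T (t - s) v) := by
  have key : ∀ r, HasDerivAt (fun r => inner ℂ (expSum T r u) (expSum T (t - s + r) v)) 0 r := by
    intro r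
    have h1 := h.hasDerivAt u r
    have h2 := (h.hasDerivAt v (t - s + r)).comp_const_add (t - s) r
    have h3 := HasDerivAt.inner ℂ h1 h2
    rw [inner_smul_left, inner_smul_right, h.inner_expSum_expSum] at h3
    simpa using h3
  have h1 := is_const_of_deriv_eq_zero (fun r => (key r).differentiableAt)
    (fun r => (key r).deriv) s 0
  simpa [expSum_zero] using h1

/-- The exponential series as an isometry on the core. -/
def expIsometry (h : IsEntireCore A D T) (t : ℝ) : D →ₗᵢ[ℂ] H where
  toFun := expSum T t
  map_add' := h.expSum_add t
  map_smul' := h.expSum_smul t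
  norm_map' u := by
    have h1 := h.inner_expSum_eq t t u u
    rw [sub_self, expSum_zero] at h1
    have h2 := congrArg Complex.re h1
    rw [inner_self_re, inner_self_re] at h2
    exact (sq_eq_sq₀ (norm_nonneg _) (norm_nonneg _)).1 h2

omit [CompleteSpace H] in
theorem denseRange (h : IsEntireCore A D T) : DenseRange D.subtypeL := by
  have h1 := h.dense
  rwa [← Subtype.range_coe (s := (D : Set H))] at h1

/-- The extension of the exponential series to the whole space. -/
def group (h : IsEntireCore A D T) (t : ℝ) : H →L[ℂ] H :=
  (h.expIsometry t).toContinuousLinearMap.extend D.subtypeL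

theorem group_apply (h : IsEntireCore A D T) (t : ℝ) (u : D) : h.group t u = expSum T t u :=
  ContinuousLinearMap.extend_eq _ h.denseRange
    isUniformEmbedding_subtype_val.isUniformInducing u

theorem inner_group (h : IsEntireCore A D T) (s t : ℝ) (φ ψ : H) :
    inner ℂ (h.group s φ) (h.group t ψ) = inner ℂ φ (h.group (t - s) ψ) := by
  refine h.denseRange.induction_on₂ (p := fun φ ψ => inner ℂ (h.group s φ) (h.group t ψ) =
    inner ℂ φ (h.group (t - s) ψ)) ?_ ?_ φ ψ
  · exact isClosed_eq (by fun_prop) (by fun_prop)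
  · intro u v
    simp only [Submodule.subtypeL_apply, group_apply]
    exact h.inner_expSum_eq s t u v

theorem group_zero (h : IsEntireCore A D T) : h.group 0 = 1 := by
  ext ψ
  refine h.denseRange.induction_on (p := fun ψ => h.group 0 ψ = (1 : H →L[ℂ] H) ψ) ψ ?_ ?_
  · exact isClosed_eq (by fun_prop) (by fun_prop)
  · intro u
    simp only [Submodule.subtypeL_apply, group_apply, expSum_zero]
    rfl

theorem norm_group (h : IsEntireCore A D T) (t : ℝ) (ψ : H) : ‖h.group t ψ‖ = ‖ψ‖ := by
  have h1 := h.inner_group t t ψ ψ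
  rw [sub_self, h.group_zero] at h1
  have h2 := congrArg Complex.re h1
  rw [one_apply_eq_self, inner_self_re, inner_self_re] at h2
  exact (sq_eq_sq₀ (norm_nonneg _) (norm_nonneg _)).1 h2

theorem continuous_group (h : IsEntireCore A D T) (ψ : H) : Continuous fun t => h.group t ψ := by
  refine continuous_of_uniform_approx_of_continuous fun U hU => ?_
  obtain ⟨ε, hε, hεU⟩ := Metric.mem_uniformity_dist.1 hU
  obtain ⟨u, hu⟩ := h.denseRange.exists_dist_lt ψ hε
  refine ⟨fun t => h.group t u, ?_, fun t => hεU ?_⟩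
  · simp only [group_apply]
    exact continuous_iff_continuousAt.2 fun t => (h.hasDerivAt u t).continuousAt
  · rw [dist_eq_norm, ← map_sub, h.norm_group, ← dist_eq_norm]
    exact hu

theorem hasDerivAt_group (h : IsEntireCore A D T) (ψ : A.domain) :
    HasDerivAt (fun t => h.group t ψ) (Complex.I • A ψ) 0 := by
  rw [hasDerivAt_iff_isLittleO_nhds_zero, Asymptotics.isLittleO_iff]
  intro ε hε
  have hc : ∀ᶠ t in 𝓝 (0 : ℝ), ‖h.group t (Complex.I • A ψ) - Complex.I • A ψ‖ < ε := by
    have h1 := ((h.continuous_group (Complex.I • A ψ)).sub continuous_const).norm.tendsto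
      (x := (0 : ℝ)) (f := fun t => ‖h.group t (Complex.I • A ψ) - Complex.I • A ψ‖)
    rw [h.group_zero] at h1
    simp only [one_apply_eq_self, sub_self, norm_zero] at h1
    exact h1.eventually_lt_const hε
  obtain ⟨δ, hδ, hball⟩ := Metric.eventually_nhds_iff_ball.1 hc
  filter_upwards [Metric.ball_mem_nhds (0 : ℝ) hδ] with t ht
  rw [zero_add, h.group_zero, one_apply_eq_self]
  obtain ⟨p, hp, hlim⟩ := mem_closure_iff_seq_limit.1 (h.subset_closure (A.mem_graph ψ))
  choose u hu using hp
  obtain rfl : (fun n => ((u n : H), (T (u n) : H))) = p := funext hu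
  have l1 : Tendsto (fun n => (u n : H)) atTop (𝓝 ψ) := hlim.fst_nhds
  have l2 : Tendsto (fun n => (T (u n) : H)) atTop (𝓝 (A ψ)) := hlim.snd_nhds
  have key : ∀ n, ‖h.group t (u n) - u n - t • (Complex.I • (T (u n) : H))‖ ≤
      (2 * ‖(T (u n) : H) - A ψ‖ + ε) * ‖t‖ := by
    intro n
    have hd : ∀ s ∈ Metric.ball (0 : ℝ) δ, HasDerivWithinAt
        (fun s => h.group s (u n) - s • (Complex.I • (T (u n) : H)))
        (Complex.I • h.group s (T (u n)) - Complex.I • (T (u n) : H)) (Metric.ball 0 δ) s := by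
      intro s _
      have h1 := h.hasDerivAt (u n) s
      simp only [← h.group_apply] at h1
      have h2 := (hasDerivAt_id s).smul_const (Complex.I • (T (u n) : H))
      rw [one_smul] at h2
      exact (h1.sub h2).hasDerivWithinAt
    have hb := (convex_ball (0 : ℝ) δ).norm_image_sub_le_of_norm_hasDerivWithin_le
      (C := 2 * ‖(T (u n) : H) - A ψ‖ + ε) hd (fun s hs => ?_) (Metric.mem_ball_self hδ) ht
    · rw [h.group_zero, zero_smul, sub_zero, sub_zero, one_apply_eq_self] at hb
      convert hb using 2
      abel
    · have e : Complex.I • h.group s (T (u n)) - Complex.I • (T (u n) : H) =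
        Complex.I • h.group s ((T (u n) : H) - A ψ) - Complex.I • ((T (u n) : H) - A ψ)
          + (h.group s (Complex.I • A ψ) - Complex.I • A ψ) := by
        rw [map_sub, map_smul, smul_sub, smul_sub]
        abel
      rw [e]
      refine (norm_add_le _ _).trans (add_le_add ((norm_sub_le _ _).trans ?_) (hball s hs).le)
      rw [norm_smul, norm_smul, h.norm_group, Complex.norm_I]
      linarith
  have t1 : Tendsto (fun n => ‖h.group t (u n) - u n - t • (Complex.I • (T (u n) : H))‖) atTop
      (𝓝 ‖h.group t ψ - ψ - t • (Complex.I • A ψ)‖) :=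
    (((((h.group t).continuous.tendsto _).comp l1).sub l1).sub
      ((l2.const_smul Complex.I).const_smul t)).norm
  have t2 : Tendsto (fun n => (2 * ‖(T (u n) : H) - A ψ‖ + ε) * ‖t‖) atTop
      (𝓝 ((2 * 0 + ε) * ‖t‖)) := by
    rw [tendsto_iff_norm_sub_tendsto_zero] at l2
    exact ((l2.const_mul 2).add_const ε).mul_const _
  have := le_of_tendsto_of_tendsto' t1 t2 key
  simpa using this

/-- Nelson's analytic vector theorem, for entire vectors in an invariant core. -/
theorem isUnitaryGroup (h : IsEntireCore A D T) : IsUnitaryGroup A h.group where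
  zero := h.group_zero
  add s t := by
    ext ψ
    refine ext_inner_left ℂ fun φ => ?_
    have h1 := h.inner_group (-s) t φ ψ
    have h2 := h.inner_group (-s) 0 φ (h.group t ψ)
    rw [h.group_zero, one_apply_eq_self, zero_sub, neg_neg] at h2
    rw [mul_apply_eq_comp, ← h2, h1]
    congr 3
    ring
  norm_map := h.norm_group
  continuous := h.continuous_group
  hasDerivAt := h.hasDerivAt_group

theorem expSum_mem_graph (h : IsEntireCore A D T) (t : ℝ) (u : D) :
    (expSum T t u, expSum T t (T u)) ∈ A.graph := by
  have l1 := (h.isEntireSeq u).summable t |>.hasSum.tendsto_sum_nat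
  have l2 := (h.isEntireSeq (T u)).summable t |>.hasSum.tendsto_sum_nat
  refine h.isClosed.mem_of_tendsto (l1.prodMk_nhds l2) (Eventually.of_forall fun N => ?_)
  have e : (∑ n ∈ Finset.range N, (t ^ n / n.factorial : ℝ) • (Complex.I ^ n • ((T ^ n) u : H)),
      ∑ n ∈ Finset.range N, (t ^ n / n.factorial : ℝ) • (Complex.I ^ n • ((T ^ n) (T u) : H))) =
      ∑ n ∈ Finset.range N, (t ^ n / n.factorial : ℝ) • (Complex.I ^ n •
        (((T ^ n) u : H), (T ((T ^ n) u) : H))) := by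
    refine Prod.ext ?_ ?_
    · simp only [Prod.fst_sum]
      rfl
    · simp only [Prod.snd_sum]
      refine Finset.sum_congr rfl fun n _ => ?_
      rw [← Module.End.mul_apply, ← Module.End.mul_apply, ← pow_succ, pow_succ']
      rfl
  rw [SetLike.mem_coe, e]
  refine sum_mem fun n _ => ?_
  rw [← algebraMap_smul ℂ (t ^ n / n.factorial : ℝ)]
  exact A.graph.smul_mem _ (A.graph.smul_mem _ (h.mem_graph _))

/-- Any unitary group generated by `A` is given by the exponential series on the core. -/
theorem unitaryGroup_apply (h : IsEntireCore A D T) {W : ℝ → H →L[ℂ] H} (hW : IsUnitaryGroup A W)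
    (t : ℝ) (u : D) : W t u = expSum T t u := by
  have hm : ∀ t, expSum T t u ∈ A.domain := fun t =>
    LinearPMap.mem_domain_of_mem_graph (h.expSum_mem_graph t u)
  have h1 := hW.apply_eq_of_hasDerivAt (fun t => ⟨expSum T t u, hm t⟩) (fun t => by
    have h2 : A ⟨expSum T t u, hm t⟩ = expSum T t (T u) :=
      A.mem_graph_snd_inj (A.mem_graph _) (h.expSum_mem_graph t u) rfl
    rw [h2]
    exact h.hasDerivAt u t) t
  simpa only [expSum_zero] using h1

theorem exists_expI_eq (h : IsEntireCore A D T) :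
    ∃ W, IsUnitaryGroup A W ∧ expI A = W 1 := by
  have hex : ∃ W, IsUnitaryGroup A W := ⟨_, h.isUnitaryGroup⟩
  exact ⟨hex.choose, hex.choose_spec, by rw [expI, dif_pos hex]⟩

end IsEntireCore

end UnitaryGroup
end

noncomputable section

section VectorL2

variable {d : ℕ} {F : Type*} [NormedAddCommGroup F] [InnerProductSpace ℂ F]

theorem coeFn_tensor (ψ : L2 d ℂ) (Φ : F) : tensor ψ Φ =ᵐ[volume] fun x => ψ x • Φ :=
  ContinuousLinearMap.coeFn_compLp _ _

/-- The elementary tensor as a continuous linear map of the first factor. -/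
def tensorL (Φ : F) : L2 d ℂ →L[ℂ] L2 d F :=
  (ContinuousLinearMap.toSpanSingleton ℂ Φ).compLpL 2 volume

theorem inner_tensor_left (ψ : L2 d ℂ) (Φ : F) (X : L2 d F) :
    inner ℂ (tensor ψ Φ) X = ∫ x, starRingEnd ℂ (ψ x) * inner ℂ Φ (X x) := by
  rw [L2.inner_def]
  refine integral_congr_ae ?_
  filter_upwards [coeFn_tensor ψ Φ] with x hx
  rw [hx, inner_smul_left]

theorem inner_tensor_tensor (ψ φ : L2 d ℂ) (Φ Θ : F) :
    inner ℂ (tensor ψ Φ) (tensor φ Θ) = inner ℂ ψ φ * inner ℂ Φ Θ := by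
  rw [inner_tensor_left, L2.inner_def, ← integral_mul_const]
  refine integral_congr_ae ?_
  filter_upwards [coeFn_tensor φ Θ] with x hx
  rw [hx, inner_smul_right, RCLike.inner_apply]
  ring

theorem norm_tensor (ψ : L2 d ℂ) (Φ : F) : ‖tensor ψ Φ‖ = ‖ψ‖ * ‖Φ‖ := by
  have h := congrArg Complex.re (inner_tensor_tensor ψ ψ Φ Φ)
  rw [inner_self_eq_norm_sq_to_K, inner_self_eq_norm_sq_to_K, inner_self_eq_norm_sq_to_K] at h
  have h' : ‖tensor ψ Φ‖ ^ 2 = ‖ψ‖ ^ 2 * ‖Φ‖ ^ 2 := by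
    simpa only [RCLike.ofReal_eq_complex_ofReal, ← Complex.ofReal_pow, ← Complex.ofReal_mul, Complex.ofReal_re] using h
  rw [← mul_pow] at h'
  exact (sq_eq_sq₀ (norm_nonneg _) (by positivity)).1 h'

theorem continuous_tensor_right (ψ : L2 d ℂ) : Continuous fun Φ : F => tensor ψ Φ := by
  let L : F →ₗ[ℂ] L2 d F :=
    { toFun := fun Φ => tensor ψ Φ
      map_add' := fun Φ Θ => by
        apply Lp.ext
        filter_upwards [coeFn_tensor ψ (Φ + Θ), coeFn_tensor ψ Φ, coeFn_tensor ψ Θ,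
          Lp.coeFn_add (tensor ψ Φ) (tensor ψ Θ)] with x h1 h2 h3 h4
        rw [h1, h4, Pi.add_apply, h2, h3, smul_add]
      map_smul' := fun c Φ => by
        apply Lp.ext
        filter_upwards [coeFn_tensor ψ (c • Φ), coeFn_tensor ψ Φ,
          Lp.coeFn_smul c (tensor ψ Φ)] with x h1 h2 h3
        rw [h1, RingHom.id_apply, h3, Pi.smul_apply, h2, smul_comm] }
  exact (L.mkContinuous ‖ψ‖ fun Φ => (norm_tensor ψ Φ).le).continuous

/-- The span of the elementary tensors of two dense subspaces. -/
def tensorSpan (D₁ : Submodule ℂ (L2 d ℂ)) (D₂ : Submodule ℂ F) : Submodule ℂ (L2 d F) :=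
  Submodule.span ℂ {X | ∃ ψ ∈ D₁, ∃ Φ ∈ D₂, X = tensor ψ Φ}

theorem eq_zero_of_inner_tensor [CompleteSpace F] {D₁ : Submodule ℂ (L2 d ℂ)} {D₂ : Submodule ℂ F}
    (h₁ : Dense (D₁ : Set (L2 d ℂ))) (h₂ : Dense (D₂ : Set F)) {X : L2 d F}
    (hX : ∀ ψ ∈ D₁, ∀ Φ ∈ D₂, inner ℂ (tensor ψ Φ) X = 0) : X = 0 := by
  have s1 : ∀ ψ, ∀ Φ ∈ D₂, inner ℂ (tensor ψ Φ) X = 0 := by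
    intro ψ Φ hΦ
    refine h₁.induction (fun ψ hψ => hX ψ hψ Φ hΦ)
      (isClosed_eq (f := fun ψ => inner ℂ (tensorL Φ ψ) X) (by fun_prop) continuous_const) ψ
  have s2 : ∀ ψ (Φ : F), inner ℂ (tensor ψ Φ) X = 0 := by
    intro ψ Φ
    refine h₂.induction (fun Φ hΦ => s1 ψ Φ hΦ)
      (isClosed_eq ((continuous_tensor_right ψ).inner continuous_const) continuous_const) Φ
  rw [Lp.eq_zero_iff_ae_eq_zero]
  refine Lp.ae_eq_zero_of_forall_setIntegral_eq_zero X (by norm_num) (by norm_num)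
    (fun s hs hμ => ?_) fun s hs hμ => ?_
  · have : IsFiniteMeasure (volume.restrict s) := ⟨by rwa [Measure.restrict_apply_univ]⟩
    exact MemLp.integrable (by norm_num) ((Lp.memLp X).restrict s)
  · refine ext_inner_left ℂ fun Φ => ?_
    rw [inner_zero_right, ← L2.inner_indicatorConstLp_eq_inner_setIntegral ℂ hs hμ.ne]
    rw [← s2 (indicatorConstLp 2 hs hμ.ne 1) Φ]
    congr 1
    apply Lp.ext
    filter_upwards [coeFn_tensor (indicatorConstLp 2 hs hμ.ne (1 : ℂ)) Φ,
      indicatorConstLp_coeFn (p := 2) (hs := hs) (hμs := hμ.ne) (c := (1 : ℂ)),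
      indicatorConstLp_coeFn (p := 2) (hs := hs) (hμs := hμ.ne) (c := Φ)] with x h1 h2 h3
    rw [h1, h2, h3]
    by_cases hx : x ∈ s <;> simp [hx]

theorem dense_tensorSpan [CompleteSpace F] {D₁ : Submodule ℂ (L2 d ℂ)} {D₂ : Submodule ℂ F}
    (h₁ : Dense (D₁ : Set (L2 d ℂ))) (h₂ : Dense (D₂ : Set F)) :
    Dense (tensorSpan D₁ D₂ : Set (L2 d F)) :=
  dense_of_forall_inner_eq_zero fun _ hX => eq_zero_of_inner_tensor h₁ h₂ fun ψ hψ Φ hΦ =>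
    hX _ (Submodule.subset_span ⟨ψ, hψ, Φ, hΦ, rfl⟩)

section DirectIntegral

theorem coeFn_directIntegral {T : Space d → F →L[ℂ] F} (h₁ : ∃ C : ℝ, ∀ ξ, ‖T ξ‖ ≤ C)
    (h₂ : ∀ Ψ : L2 d F, AEStronglyMeasurable (fun ξ => T ξ (Ψ ξ)) volume) (Ψ : L2 d F) :
    directIntegral T Ψ =ᵐ[volume] fun ξ => T ξ (Ψ ξ) := by
  rw [directIntegral, dif_pos ⟨h₁, h₂⟩]
  obtain ⟨C, hC⟩ := h₁
  exact MemLp.coeFn_toLp (MemLp.of_le_mul (c := C) (Lp.memLp Ψ) (h₂ Ψ)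
    (Eventually.of_forall fun ξ => (T ξ).le_of_opNorm_le (hC ξ) (Ψ ξ)))

/-- Multiplication by a bounded measurable function. -/
def mulOp (m : Space d → ℂ) : L2 d F →L[ℂ] L2 d F :=
  directIntegral fun x => m x • ContinuousLinearMap.id ℂ F

theorem coeFn_mulOp {m : Space d → ℂ} (hm : Measurable m) {C : ℝ} (hC : ∀ x, ‖m x‖ ≤ C)
    (X : L2 d F) : mulOp m X =ᵐ[volume] fun x => m x • X x := by
  refine coeFn_directIntegral ⟨C, fun ξ => ?_⟩ (fun Ψ => ?_) X
  · refine ContinuousLinearMap.opNorm_le_bound _ ((norm_nonneg _).trans (hC ξ)) fun x => ?_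
    change ‖m ξ • x‖ ≤ _
    rw [norm_smul]
    gcongr
    exact hC ξ
  · exact hm.aestronglyMeasurable.smul (Lp.aestronglyMeasurable Ψ)

theorem coeFn_mulOp_exp (θ : Space d → ℝ) (hθ : Measurable θ) (X : L2 d F) :
    mulOp (fun x => Complex.exp (θ x * Complex.I)) X =ᵐ[volume]
      fun x => Complex.exp (θ x * Complex.I) • X x :=
  coeFn_mulOp (by fun_prop) (C := 1) (fun x => (Complex.norm_exp_ofReal_mul_I _).le) X

end DirectIntegral

section Fourier

variable [CompleteSpace F] {G : Type*} [NormedAddCommGroup G] [InnerProductSpace ℂ G]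
  [CompleteSpace G]

theorem fourier_compLp (L : F →L[ℂ] G) (X : L2 d F) : 𝓕 (L.compLp X) = L.compLp (𝓕 X) := by
  refine DenseRange.induction_on (p := fun X : L2 d F => 𝓕 (L.compLp X) = L.compLp (𝓕 X))
    (SchwartzMap.denseRange_toLpCLM (E := Space d) (F := F) (p := 2) (μ := volume)
      ENNReal.ofNat_ne_top) X ?_ ?_
  · exact isClosed_eq ((Lp.fourierTransformₗᵢ (Space d) G).continuous.comp
      (L.compLpL 2 volume).continuous) ((L.compLpL 2 volume).continuous.comp
      (Lp.fourierTransformₗᵢ (Space d) F).continuous)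
  · intro f
    have e : ∀ f : 𝓢(Space d, F), L.compLp (f.toLp 2) =
        (f.postcompCLM L).toLp 2 volume := by
      intro f
      apply Lp.ext
      filter_upwards [L.coeFn_compLp (f.toLp 2), f.coeFn_toLp 2 volume,
        (f.postcompCLM L).coeFn_toLp 2 volume] with x h1 h2 h3
      rw [h1, h2, h3, SchwartzMap.postcompCLM_apply]
    rw [SchwartzMap.toLpCLM_apply, e, SchwartzMap.toLp_fourier_eq, SchwartzMap.toLp_fourier_eq, e]
    congr 1
    ext ξ
    rw [SchwartzMap.postcompCLM_apply, SchwartzMap.fourier_coe, SchwartzMap.fourier_coe,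
      Real.fourier_eq, Real.fourier_eq, ← ContinuousLinearMap.integral_comp_comm]
    · refine integral_congr_ae (Eventually.of_forall fun x => ?_)
      simp [Circle.smul_def]
    · exact (Real.fourierIntegral_convergent_iff ξ).2 f.integrable

theorem fourier_tensor (ψ : L2 d ℂ) (Φ : F) : 𝓕 (tensor ψ Φ) = tensor (𝓕 ψ) Φ :=
  fourier_compLp _ ψ

/-- Translation by `k` on `L²`. -/
def translateL2 (F : Type*) [NormedAddCommGroup F] [InnerProductSpace ℂ F] (k : Space d) :
    L2 d F →ₗᵢ[ℂ] L2 d F :=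
  Lp.compMeasurePreservingₗᵢ ℂ (fun x => x - k) (measurePreserving_sub_right volume k)

omit [CompleteSpace F] in
theorem coeFn_translateL2 (k : Space d) (X : L2 d F) :
    translateL2 F k X =ᵐ[volume] fun x => X (x - k) :=
  Lp.coeFn_compMeasurePreserving X (measurePreserving_sub_right volume k)

omit [CompleteSpace F] in
theorem translateL2_toLp (k : Space d) (f : 𝓢(Space d, F)) :
    translateL2 F k (f.toLp 2) = (f.compSubConstCLM ℂ k).toLp 2 volume := by
  apply Lp.ext
  filter_upwards [coeFn_translateL2 k (f.toLp 2),
    (measurePreserving_sub_right volume k).quasiMeasurePreserving.ae_eq_comp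
      (f.coeFn_toLp 2 volume), (f.compSubConstCLM ℂ k).coeFn_toLp 2 volume] with x h1 h2 h3
  rw [h1, h3, SchwartzMap.compSubConstCLM_apply]
  exact h2

theorem fourierInv_translateL2 (k : Space d) (X : L2 d F) :
    𝓕⁻ (translateL2 F k X) =
      mulOp (fun ξ => Complex.exp ((2 * Real.pi * (inner ℝ k ξ : ℝ) : ℝ) * Complex.I)) (𝓕⁻ X) := by
  refine DenseRange.induction_on (p := fun X : L2 d F => 𝓕⁻ (translateL2 F k X) =
    mulOp (fun ξ => Complex.exp ((2 * Real.pi * (inner ℝ k ξ : ℝ) : ℝ) * Complex.I)) (𝓕⁻ X))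
    (SchwartzMap.denseRange_toLpCLM (E := Space d) (F := F) (p := 2) (μ := volume)
      ENNReal.ofNat_ne_top) X ?_ ?_
  · exact isClosed_eq ((Lp.fourierTransformₗᵢ (Space d) F).symm.continuous.comp
      (translateL2 F k).continuous) ((ContinuousLinearMap.continuous _).comp
      (Lp.fourierTransformₗᵢ (Space d) F).symm.continuous)
  · intro f
    rw [SchwartzMap.toLpCLM_apply, translateL2_toLp, SchwartzMap.toLp_fourierInv_eq,
      SchwartzMap.toLp_fourierInv_eq]
    apply Lp.ext
    filter_upwards [coeFn_mulOp_exp (fun ξ => 2 * Real.pi * (inner ℝ k ξ : ℝ)) (by fun_prop)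
      ((𝓕⁻ f).toLp 2 volume), (𝓕⁻ f).coeFn_toLp 2 volume,
      (𝓕⁻ (f.compSubConstCLM ℂ k)).coeFn_toLp 2 volume] with ξ h1 h2 h3
    rw [h1, h2, h3, SchwartzMap.fourierInv_coe, SchwartzMap.fourierInv_coe, Real.fourierInv_eq',
      Real.fourierInv_eq', ← integral_add_right_eq_self _ k, ← integral_smul]
    refine integral_congr_ae (Eventually.of_forall fun x => ?_)
    simp only [SchwartzMap.compSubConstCLM_apply, add_sub_cancel_right, smul_smul]
    rw [← Complex.exp_add, inner_add_left]
    congr 2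
    push_cast
    ring

end Fourier

end VectorL2
end

noncomputable section
section Differential

variable {d : ℕ}

theorem toTemperedDistribution_eq_smulLeft_iff {g : Space d → ℂ} (hg : g.HasTemperateGrowth)
    (u v : L2 d ℂ) :
    (v : 𝓢'(Space d, ℂ)) = TemperedDistribution.smulLeftCLM ℂ g (u : 𝓢'(Space d, ℂ)) ↔
      v =ᵐ[volume] fun ξ => g ξ * u ξ := by
  have hgc : Continuous g := hg.1.continuous
  constructor
  · intro h
    have h0 : ∀ᵐ ξ, v ξ - g ξ * u ξ = 0 := by
      have hv : LocallyIntegrable v volume := (Lp.memLp v).locallyIntegrable (by norm_num)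
      have hu : LocallyIntegrable u volume := (Lp.memLp u).locallyIntegrable (by norm_num)
      have hgu : LocallyIntegrable (fun ξ => g ξ * u ξ) volume := by
        simpa only [smul_eq_mul] using hu.continuous_smul hgc
      refine ae_eq_zero_of_integral_contDiff_smul_eq_zero (hv.sub hgu) fun φ hφ hφc => ?_
      have hc₁ : HasCompactSupport (Complex.ofRealCLM ∘ φ) := hφc.comp_left rfl
      have hc₂ : ContDiff ℝ ((⊤ : ℕ∞) : WithTop ℕ∞) (Complex.ofRealCLM ∘ φ) := by fun_prop
      have h1 := congrArg (fun T : 𝓢'(Space d, ℂ) => T (hc₁.toSchwartzMap hc₂)) h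
      simp only [TemperedDistribution.smulLeftCLM_apply_apply, Lp.toTemperedDistribution_apply,
        SchwartzMap.smulLeftCLM_apply_apply hg] at h1
      have i1 : Integrable (fun ξ => φ ξ • v ξ) := hv.integrable_smul_left_of_hasCompactSupport
        hφ.continuous hφc
      have i2 : Integrable (fun ξ => φ ξ • (g ξ * u ξ)) :=
        hgu.integrable_smul_left_of_hasCompactSupport hφ.continuous hφc
      simp only [smul_sub]
      rw [integral_sub i1 i2, sub_eq_zero]
      simpa [mul_assoc, mul_comm, mul_left_comm] using h1
    filter_upwards [h0] with ξ hξ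
    exact sub_eq_zero.1 hξ
  · intro h
    ext φ
    rw [TemperedDistribution.smulLeftCLM_apply_apply, Lp.toTemperedDistribution_apply,
      Lp.toTemperedDistribution_apply]
    refine integral_congr_ae ?_
    filter_upwards [h] with ξ hξ
    rw [hξ, SchwartzMap.smulLeftCLM_apply_apply hg]
    simp only [smul_eq_mul]
    ring

theorem toTemperedDistribution_injective (u v : L2 d ℂ)
    (h : (u : 𝓢'(Space d, ℂ)) = (v : 𝓢'(Space d, ℂ))) : u = v := by
  have hk := Lp.ker_toTemperedDistributionCLM_eq_bot (E := Space d) (F := ℂ) (p := 2)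
    (μ := volume)
  rw [LinearMap.ker_eq_bot] at hk
  exact hk h

theorem fourier_temperedDistribution_injective {S T : 𝓢'(Space d, ℂ)} (h : 𝓕 S = 𝓕 T) :
    S = T := by
  have e : ∀ S : 𝓢'(Space d, ℂ), 𝓕⁻ (𝓕 S) = S := FourierTransform.fourierInv_fourier_eq
  rw [← e S, h, e]

theorem inner_single_right (ξ : Space d) (j : Fin d) :
    inner ℝ ξ (EuclideanSpace.single j (1 : ℝ)) = ξ j := by
  rw [EuclideanSpace.inner_single_right]
  simp

theorem hasTemperateGrowth_const_smul {g : Space d → ℂ} (hg : g.HasTemperateGrowth) (c : ℂ) :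
    (c • g).HasTemperateGrowth :=
  (Function.HasTemperateGrowth.const c).mul hg

theorem hasTemperateGrowth_coord (j : Fin d) :
    (fun ξ : Space d => ((ξ j : ℝ) : ℂ)).HasTemperateGrowth := by
  have h : (fun ξ : Space d => ((inner ℝ ξ (EuclideanSpace.single j (1 : ℝ)) : ℝ) :
    ℂ)).HasTemperateGrowth := by fun_prop
  simpa only [inner_single_right] using h

theorem fourier_lineDeriv_single (T : 𝓢'(Space d, ℂ)) (j : Fin d) :
    𝓕 (LineDeriv.lineDerivOp (EuclideanSpace.single j (1 : ℝ) : Space d) T) =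
      (2 * Real.pi * Complex.I) •
        TemperedDistribution.smulLeftCLM ℂ (fun ξ : Space d => ((ξ j : ℝ) : ℂ)) (𝓕 T) := by
  have h := TemperedDistribution.fourier_lineDerivOp_eq T (EuclideanSpace.single j (1 : ℝ))
  simpa only [inner_single_right] using h

/-- The graph of an operator which acts on Fourier transforms as multiplication by `g`. -/
theorem mem_graph_of_fourier_eq_smulLeft {L : 𝓢'(Space d, ℂ) →ₗ[ℂ] 𝓢'(Space d, ℂ)}
    {g : Space d → ℂ} (hg : g.HasTemperateGrowth)
    (hL : ∀ T, 𝓕 (L T) = TemperedDistribution.smulLeftCLM ℂ g (𝓕 T)) (p : L2 d ℂ × L2 d ℂ) :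
    p ∈ (LinearMap.eqLocus
      ((Lp.toTemperedDistributionCLM ℂ (volume : Measure (Space d)) 2).toLinearMap ∘ₗ
        LinearMap.snd ℂ (L2 d ℂ) (L2 d ℂ))
      (L ∘ₗ (Lp.toTemperedDistributionCLM ℂ (volume : Measure (Space d)) 2).toLinearMap ∘ₗ
        LinearMap.fst ℂ (L2 d ℂ) (L2 d ℂ))).toLinearPMap.graph ↔
      ⇑(𝓕 p.2 : L2 d ℂ) =ᵐ[volume] fun ξ => g ξ * (𝓕 p.1 : L2 d ℂ) ξ := by
  rw [Submodule.toLinearPMap_graph_eq]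
  · rw [LinearMap.mem_eqLocus, ← toTemperedDistribution_eq_smulLeft_iff hg,
      ← Lp.fourier_toTemperedDistribution_eq, ← Lp.fourier_toTemperedDistribution_eq, ← hL]
    exact ⟨fun h => congrArg _ h, fun h => fourier_temperedDistribution_injective h⟩
  · rintro ⟨u, v⟩ hp h0
    obtain rfl : u = 0 := h0
    have hp' : (v : 𝓢'(Space d, ℂ)) = L (Lp.toTemperedDistributionCLM ℂ volume 2 0) := hp
    rw [map_zero, map_zero] at hp'
    refine toTemperedDistribution_injective v 0 (hp'.trans ?_)
    exact (map_zero (Lp.toTemperedDistributionCLM ℂ (volume : Measure (Space d)) 2)).symm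

theorem mem_momentum_graph (hbar : ℝ) (j : Fin d) (p : L2 d ℂ × L2 d ℂ) :
    p ∈ (momentum hbar j).graph ↔
      ⇑(𝓕 p.2 : L2 d ℂ) =ᵐ[volume]
        fun ξ => ((2 * Real.pi * hbar * ξ j : ℝ) : ℂ) * (𝓕 p.1 : L2 d ℂ) ξ := by
  refine (mem_graph_of_fourier_eq_smulLeft (L := (-(Complex.I * hbar)) •
    (LineDeriv.lineDerivOpCLM ℂ 𝓢'(Space d, ℂ)
      (EuclideanSpace.single j (1 : ℝ) : Space d)).toLinearMap)
    (hasTemperateGrowth_const_smul (hasTemperateGrowth_coord j) (2 * Real.pi * hbar : ℂ)) (fun T => ?_) p).trans ?_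
  · change 𝓕 ((-(Complex.I * hbar)) •
      LineDeriv.lineDerivOp (EuclideanSpace.single j (1 : ℝ) : Space d) T) = _
    rw [FourierTransform.fourier_smul, fourier_lineDeriv_single, smul_smul]
    have h := congrArg (fun A => A (𝓕 T)) (TemperedDistribution.smulLeftCLM_smul (F := ℂ)
      (hasTemperateGrowth_coord j) (2 * Real.pi * hbar : ℂ))
    refine Eq.trans ?_ h.symm
    change _ = (2 * Real.pi * hbar : ℂ) • TemperedDistribution.smulLeftCLM ℂ _ (𝓕 T)
    congr 1
    linear_combination (-(2 * Real.pi * hbar : ℂ)) * Complex.I_sq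
  · push_cast
    rfl

theorem mem_laplacianOp_graph (p : L2 d ℂ × L2 d ℂ) :
    p ∈ (laplacianOp d).graph ↔
      ⇑(𝓕 p.2 : L2 d ℂ) =ᵐ[volume]
        fun ξ => ((-(4 * Real.pi ^ 2 * ‖ξ‖ ^ 2) : ℝ) : ℂ) * (𝓕 p.1 : L2 d ℂ) ξ := by
  have hg2 : ∀ j : Fin d, (fun ξ : Space d => ((ξ j : ℝ) : ℂ) * (ξ j : ℝ)).HasTemperateGrowth :=
    fun j => (hasTemperateGrowth_coord j).mul (hasTemperateGrowth_coord j)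
  have e : (fun ξ : Space d => ((-(4 * Real.pi ^ 2 * ‖ξ‖ ^ 2) : ℝ) : ℂ)) =
      (-(4 * Real.pi ^ 2) : ℂ) • fun ξ : Space d => ∑ j : Fin d, ((ξ j : ℝ) : ℂ) * (ξ j : ℝ) := by
    ext ξ
    rw [EuclideanSpace.norm_sq_eq]
    simp only [Real.norm_eq_abs, sq_abs, Pi.smul_apply, smul_eq_mul]
    push_cast
    simp only [← sq]
    ring
  have hs : (fun ξ : Space d => ∑ j : Fin d, ((ξ j : ℝ) : ℂ) * (ξ j : ℝ)).HasTemperateGrowth :=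
    Function.HasTemperateGrowth.sum fun j _ => hg2 j
  have hg : (fun ξ : Space d => ((-(4 * Real.pi ^ 2 * ‖ξ‖ ^ 2) : ℝ) : ℂ)).HasTemperateGrowth := by
    rw [e]
    exact hasTemperateGrowth_const_smul hs _
  refine mem_graph_of_fourier_eq_smulLeft (L := (∑ j : Fin d,
        LineDeriv.lineDerivOpCLM ℂ 𝓢'(Space d, ℂ) (EuclideanSpace.single j (1 : ℝ) : Space d) ∘L
        LineDeriv.lineDerivOpCLM ℂ 𝓢'(Space d, ℂ)
          (EuclideanSpace.single j (1 : ℝ) : Space d)).toLinearMap)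
    hg (fun T => ?_) p
  have e1 : ∀ j : Fin d, 𝓕 (LineDeriv.lineDerivOp (EuclideanSpace.single j (1 : ℝ) : Space d)
      (LineDeriv.lineDerivOp (EuclideanSpace.single j (1 : ℝ) : Space d) T)) =
      (-(4 * Real.pi ^ 2) : ℂ) • TemperedDistribution.smulLeftCLM ℂ
        (fun ξ : Space d => ((ξ j : ℝ) : ℂ) * (ξ j : ℝ)) (𝓕 T) := by
    intro j
    rw [fourier_lineDeriv_single, fourier_lineDeriv_single, map_smul, smul_smul,
      TemperedDistribution.smulLeftCLM_smulLeftCLM_apply (hasTemperateGrowth_coord j)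
        (hasTemperateGrowth_coord j)]
    congr 1
    linear_combination (4 * Real.pi ^ 2 : ℂ) * Complex.I_sq
  rw [e, TemperedDistribution.smulLeftCLM_smul hs,
    TemperedDistribution.smulLeftCLM_sum fun j _ => hg2 j]
  have e2 : ∀ S : Fin d → 𝓢'(Space d, ℂ), 𝓕 (∑ j, S j) = ∑ j, 𝓕 (S j) := fun S =>
    map_sum (FourierTransform.fourierCLM ℂ 𝓢'(Space d, ℂ)) S Finset.univ
  rw [smul_apply, sum_apply, Finset.smul_sum]
  simp only [← e1, ← e2]
  rw [ContinuousLinearMap.coe_coe, sum_apply]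
  rfl

end Differential
end

noncomputable section

namespace QForm

variable {H H' : Type*} [NormedAddCommGroup H] [InnerProductSpace ℂ H] [NormedAddCommGroup H']
  [InnerProductSpace ℂ H']

/-- The pullback of a form by a unitary operator. -/
def comap (s : QForm H') (J : H ≃ₗᵢ[ℂ] H') : QForm H where
  domain := s.domain.comap J.toLinearEquiv.toLinearMap
  val φ ψ := s.val (J φ) (J ψ)

theorem IsClosedSemibounded.comap {s : QForm H'} (hs : s.IsClosedSemibounded) (J : H ≃ₗᵢ[ℂ] H') :
    (s.comap J).IsClosedSemibounded := by
  obtain ⟨⟨h1, h2, h3⟩, h4, ⟨c, h5⟩, h6⟩ := hs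
  refine ⟨⟨?_, ?_, ?_⟩, ?_, ⟨c, ?_⟩, ?_⟩
  · intro φ hφ ψ hψ χ hχ
    change s.val (J φ) (J (ψ + χ)) = _
    rw [map_add]
    exact h1 _ hφ _ hψ _ hχ
  · intro c φ hφ ψ hψ
    change s.val (J φ) (J (c • ψ)) = _
    rw [map_smul]
    exact h2 _ _ hφ _ hψ
  · intro φ hφ ψ hψ
    exact h3 _ hφ _ hψ
  · exact h4.preimage J.toHomeomorph.isOpenMap
  · intro ψ hψ
    rw [← J.norm_map]
    exact h5 _ hψ
  · intro u ψ hu hψ hc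
    have := h6 (fun n => J (u n)) (J ψ) hu ((J.continuous.tendsto ψ).comp hψ) (by
      refine hc.congr fun p => ?_
      rw [← map_sub]
      rfl)
    refine ⟨this.1, this.2.congr fun n => ?_⟩
    rw [← map_sub]
    rfl

end QForm

section AERelation

variable {α : Type*} [MeasurableSpace α] {μ : Measure α} {F G : Type*} [NormedAddCommGroup F]
  [NormedAddCommGroup G]

theorem exists_subseq_tendsto_ae {u : ℕ → Lp F 2 μ} {ψ : Lp F 2 μ} (h : Tendsto u atTop (𝓝 ψ)) :
    ∃ ns : ℕ → ℕ, StrictMono ns ∧ ∀ᵐ x ∂μ, Tendsto (fun n => u (ns n) x) atTop (𝓝 (ψ x)) :=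
  (tendstoInMeasure_of_tendsto_Lp h).exists_seq_tendsto_ae

/-- A relation that holds pointwise almost everywhere, with closed fibers, is closed in `L²`. -/
theorem isClosed_ae_relation {R : α → Set (F × G)} (hR : ∀ᵐ x ∂μ, IsClosed (R x)) :
    IsClosed {p : Lp F 2 μ × Lp G 2 μ | ∀ᵐ x ∂μ, (p.1 x, p.2 x) ∈ R x} := by
  refine isClosed_iff_clusterPt.2 fun p hp => ?_
  obtain ⟨u, hu, hlim⟩ := mem_closure_iff_seq_limit.1 (mem_closure_iff_clusterPt.2 hp)
  obtain ⟨n₁, hn₁, h1⟩ := exists_subseq_tendsto_ae hlim.fst_nhds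
  obtain ⟨n₂, hn₂, h2⟩ := exists_subseq_tendsto_ae (hlim.snd_nhds.comp hn₁.tendsto_atTop)
  have h3 : ∀ᵐ x ∂μ, ∀ n, ((u n).1 x, (u n).2 x) ∈ R x := ae_all_iff.2 fun n => hu n
  filter_upwards [h1, h2, h3, hR] with x h1 h2 h3 h4
  exact h4.mem_of_tendsto ((h1.comp hn₂.tendsto_atTop).prodMk_nhds h2)
    (Eventually.of_forall fun n => h3 _)

end AERelation

section MulForm

variable {d : ℕ} {F : Type*} [NormedAddCommGroup F] [InnerProductSpace ℂ F]

theorem L2.norm_sq_eq_integral (X : L2 d F) : ‖X‖ ^ 2 = ∫ x, ‖X x‖ ^ 2 := by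
  rw [← inner_self_re, L2.inner_def]
  have h : ∀ x, inner ℂ (X x) (X x) = ((‖X x‖ ^ 2 : ℝ) : ℂ) := by
    intro x
    rw [inner_self_eq_norm_sq_to_K]
    norm_cast
  simp only [h, integral_complex_ofReal, Complex.ofReal_re]

theorem L2.integrable_norm_sq (X : L2 d F) : Integrable (fun x => ‖X x‖ ^ 2) :=
  (Lp.memLp X).integrable_norm_pow (by norm_num)

theorem tendsto_mulOp {m : ℕ → Space d → ℂ} (hm : ∀ n, Measurable (m n))
    (hb : ∀ n x, ‖m n x‖ ≤ 1) (hlim : ∀ x, Tendsto (fun n => m n x) atTop (𝓝 1)) (X : L2 d F) :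
    Tendsto (fun n => mulOp (m n) X) atTop (𝓝 X) := by
  rw [tendsto_iff_norm_sub_sq_tendsto_zero]
  have e : ∀ n, ‖mulOp (m n) X - X‖ ^ 2 = ∫ x, ‖m n x - 1‖ ^ 2 * ‖X x‖ ^ 2 := by
    intro n
    rw [L2.norm_sq_eq_integral]
    refine integral_congr_ae ?_
    filter_upwards [coeFn_mulOp (hm n) (hb n) X, Lp.coeFn_sub (mulOp (m n) X) X] with x h1 h2
    rw [h2, Pi.sub_apply, h1, ← mul_pow, ← norm_smul, sub_smul, one_smul]
  simp only [e]
  have h0 : ∫ x : Space d, (0 : ℝ) = 0 := by simp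
  rw [← h0]
  refine tendsto_integral_of_dominated_convergence (fun x => 4 * ‖X x‖ ^ 2) (fun n => ?_)
    ((L2.integrable_norm_sq X).const_mul 4) (fun n => Eventually.of_forall fun x => ?_)
    (Eventually.of_forall fun x => ?_)
  · exact ((((hm n).sub_const 1).norm.pow_const 2).aestronglyMeasurable).mul
      (L2.integrable_norm_sq X).aestronglyMeasurable
  · rw [Real.norm_of_nonneg (by positivity)]
    gcongr
    have h1 : ‖m n x - 1‖ ≤ 2 := (norm_sub_le _ _).trans (by
      rw [norm_one]
      linarith [hb n x])
    nlinarith [norm_nonneg (m n x - 1)]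
  · have h1 := (((hlim x).sub_const 1).norm.pow 2).mul_const (‖X x‖ ^ 2)
    simpa using h1

variable {W : Space d → ℝ}

theorem mem_mulForm_domain {X : L2 d F} : X ∈ (mulForm F W).domain ↔
    MemLp (fun x => ((√|W x| : ℝ) : ℂ) • X x) 2 volume := Iff.rfl

theorem norm_sqrt_smul_sq (w : ℝ) (x : F) : ‖((√|w| : ℝ) : ℂ) • x‖ ^ 2 = |w| * ‖x‖ ^ 2 := by
  rw [norm_smul, Complex.norm_real, Real.norm_of_nonneg (Real.sqrt_nonneg _), mul_pow,
    Real.sq_sqrt (abs_nonneg _)]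

theorem aestronglyMeasurable_sqrt_smul (hW : Measurable W) (X : L2 d F) :
    AEStronglyMeasurable (fun x => ((√|W x| : ℝ) : ℂ) • X x) volume := by
  refine AEStronglyMeasurable.smul (𝕜 := ℂ) ?_ (Lp.aestronglyMeasurable X)
  exact (Complex.measurable_ofReal.comp (Real.continuous_sqrt.measurable.comp
    (measurable_abs.comp hW))).aestronglyMeasurable

theorem mem_mulForm_domain_iff_integrable (hW : Measurable W) {X : L2 d F} :
    X ∈ (mulForm F W).domain ↔ Integrable (fun x => |W x| * ‖X x‖ ^ 2) volume := by
  rw [mem_mulForm_domain, memLp_two_iff_integrable_sq_norm (aestronglyMeasurable_sqrt_smul hW X)]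
  simp only [norm_sqrt_smul_sq]

theorem integrable_mul_inner (hW : Measurable W) {X Y : L2 d F} (hX : X ∈ (mulForm F W).domain)
    (hY : Y ∈ (mulForm F W).domain) :
    Integrable (fun x => (W x : ℂ) * inner ℂ (X x) (Y x)) volume := by
  rw [mem_mulForm_domain_iff_integrable hW] at hX hY
  refine (hX.add hY).mono' ?_ (Eventually.of_forall fun x => ?_)
  · exact (Complex.measurable_ofReal.comp hW).aestronglyMeasurable.mul
      ((Lp.aestronglyMeasurable X).inner (Lp.aestronglyMeasurable Y))
  · rw [norm_mul, Complex.norm_real, Real.norm_eq_abs, Pi.add_apply, ← mul_add]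
    refine mul_le_mul_of_nonneg_left ((norm_inner_le_norm _ _).trans ?_) (abs_nonneg _)
    nlinarith [sq_nonneg (‖X x‖ - ‖Y x‖), sq_nonneg (‖X x‖), sq_nonneg (‖Y x‖)]

theorem re_mulForm_val (X : L2 d F) :
    ((mulForm F W).val X X).re = ∫ x, W x * ‖X x‖ ^ 2 := by
  have h : ∀ x, (W x : ℂ) * inner ℂ (X x) (X x) = ((W x * ‖X x‖ ^ 2 : ℝ) : ℂ) := by
    intro x
    rw [inner_self_eq_norm_sq_to_K, Complex.ofReal_mul, Complex.ofReal_pow]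
    rfl
  simp only [mulForm, h, integral_complex_ofReal, Complex.ofReal_re]

theorem mulForm_isHermitian (hW : Measurable W) : (mulForm F W).IsHermitian := by
  refine ⟨?_, ?_, ?_⟩
  · intro X hX Y hY Z hZ
    simp only [mulForm]
    rw [← integral_add (integrable_mul_inner hW hX hY) (integrable_mul_inner hW hX hZ)]
    refine integral_congr_ae ?_
    filter_upwards [Lp.coeFn_add Y Z] with x hx
    rw [hx, Pi.add_apply, inner_add_right, mul_add]
  · intro c X hX Y hY
    simp only [mulForm]
    rw [← integral_const_mul]
    refine integral_congr_ae ?_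
    filter_upwards [Lp.coeFn_smul c Y] with x hx
    rw [hx, Pi.smul_apply, inner_smul_right]
    ring
  · intro X _ Y _
    simp only [mulForm]
    rw [← integral_conj]
    refine integral_congr_ae (Eventually.of_forall fun x => ?_)
    simp only [map_mul, Complex.conj_ofReal, inner_conj_symm]

theorem integrable_mul_norm_sq (hW : Measurable W) {X : L2 d F} (hX : X ∈ (mulForm F W).domain) :
    Integrable (fun x => W x * ‖X x‖ ^ 2) volume := by
  refine ((mem_mulForm_domain_iff_integrable hW).1 hX).mono (hW.aestronglyMeasurable.mul
    (L2.integrable_norm_sq X).aestronglyMeasurable) (Eventually.of_forall fun x => ?_)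
  rw [norm_mul, norm_mul, Real.norm_eq_abs, Real.norm_eq_abs |W x|, abs_abs]

theorem mulForm_boundedBelow (hW : Measurable W) {c : ℝ} (hc : ∀ x, c ≤ W x) :
    (mulForm F W).BoundedBelow := by
  refine ⟨c, fun X hX => ?_⟩
  rw [re_mulForm_val, L2.norm_sq_eq_integral, ← integral_const_mul]
  refine integral_mono ((L2.integrable_norm_sq X).const_mul c) (integrable_mul_norm_sq hW hX)
    fun x => ?_
  exact mul_le_mul_of_nonneg_right (hc x) (sq_nonneg _)

theorem mulForm_isClosed [CompleteSpace F] (hW : Measurable W) {c : ℝ} (hc : ∀ x, c ≤ W x) :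
    (mulForm F W).IsClosed := by
  intro u ψ hu hψ hlim
  have hc0 : ∀ x, 0 ≤ W x - c := fun x => sub_nonneg.2 (hc x)
  have hWc : Measurable fun x => W x - c := hW.sub_const c
  have hmem : ∀ X : L2 d F, X ∈ (mulForm F W).domain ↔
      X ∈ (mulForm F fun x => W x - c).domain := by
    intro X
    rw [mem_mulForm_domain_iff_integrable hW, mem_mulForm_domain_iff_integrable hWc]
    have hX := (L2.integrable_norm_sq X).const_mul |c|
    constructor
    · intro h
      refine (h.add hX).mono' (hWc.abs.aestronglyMeasurable.mul
        (L2.integrable_norm_sq X).aestronglyMeasurable) (Eventually.of_forall fun x => ?_)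
      rw [Real.norm_of_nonneg (by positivity), Pi.add_apply, ← add_mul]
      exact mul_le_mul_of_nonneg_right (abs_sub _ _) (sq_nonneg _)
    · intro h
      refine (h.add hX).mono' (hW.abs.aestronglyMeasurable.mul
        (L2.integrable_norm_sq X).aestronglyMeasurable) (Eventually.of_forall fun x => ?_)
      rw [Real.norm_of_nonneg (by positivity), Pi.add_apply, ← add_mul]
      refine mul_le_mul_of_nonneg_right ?_ (sq_nonneg _)
      simpa using abs_add_le (W x - c) c
  have hval : ∀ X ∈ (mulForm F W).domain, ((mulForm F W).val X X).re - c * ‖X‖ ^ 2 =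
      ∫ x, (W x - c) * ‖X x‖ ^ 2 := by
    intro X hX
    rw [re_mulForm_val, L2.norm_sq_eq_integral, ← integral_const_mul,
      ← integral_sub (integrable_mul_norm_sq hW hX) ((L2.integrable_norm_sq X).const_mul c)]
    simp only [sub_mul]
  have hmv : ∀ n, MemLp (fun x => ((√|W x - c| : ℝ) : ℂ) • u n x) 2 volume := fun n =>
    (hmem _).1 (hu n)
  let v : ℕ → L2 d F := fun n => (hmv n).toLp _
  have hv : ∀ n, v n =ᵐ[volume] fun x => ((√|W x - c| : ℝ) : ℂ) • u n x := fun n =>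
    (hmv n).coeFn_toLp
  have hvc : CauchySeq v := by
    rw [cauchySeq_iff_tendsto_norm_sub_sq]
    have h1 := hlim.sub ((cauchySeq_iff_tendsto_norm_sub_sq.1 hψ.cauchySeq).const_mul c)
    simp only [mul_zero, sub_zero] at h1
    refine h1.congr fun p => ?_
    rw [hval _ (sub_mem (hu _) (hu _)), L2.norm_sq_eq_integral]
    refine integral_congr_ae ?_
    filter_upwards [hv p.1, hv p.2, Lp.coeFn_sub (v p.1) (v p.2),
      Lp.coeFn_sub (u p.1) (u p.2)] with x h1 h2 h3 h4
    rw [h3, h4, Pi.sub_apply, Pi.sub_apply, h1, h2, ← smul_sub, norm_sqrt_smul_sq,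
      abs_of_nonneg (hc0 x)]
  obtain ⟨w, hw⟩ := cauchySeq_tendsto_of_complete hvc
  have hwψ : w =ᵐ[volume] fun x => ((√|W x - c| : ℝ) : ℂ) • ψ x := by
    have hcl := isClosed_ae_relation (μ := (volume : Measure (Space d))) (F := F) (G := F)
      (R := fun x => {p | p.2 = ((√|W x - c| : ℝ) : ℂ) • p.1})
      (Eventually.of_forall fun x => isClosed_eq continuous_snd (continuous_fst.const_smul _))
    exact hcl.mem_of_tendsto (hψ.prodMk_nhds hw) (Eventually.of_forall fun n => hv n)
  have hψd : ψ ∈ (mulForm F W).domain := (hmem ψ).2 ((Lp.memLp w).ae_eq hwψ)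
  refine ⟨hψd, ?_⟩
  have h1 := (tendsto_iff_norm_sub_sq_tendsto_zero.1 hw).add
    ((tendsto_iff_norm_sub_sq_tendsto_zero.1 hψ).const_mul c)
  simp only [mul_zero, add_zero] at h1
  refine h1.congr fun n => ?_
  have h2 := hval _ (sub_mem (hu n) hψd)
  have h3 : ‖v n - w‖ ^ 2 = ∫ x, (W x - c) * ‖(u n - ψ : L2 d F) x‖ ^ 2 := by
    rw [L2.norm_sq_eq_integral]
    refine integral_congr_ae ?_
    filter_upwards [hv n, hwψ, Lp.coeFn_sub (v n) w, Lp.coeFn_sub (u n) ψ] with x h1 h2 h3 h4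
    rw [h3, h4, Pi.sub_apply, Pi.sub_apply, h1, h2, ← smul_sub, norm_sqrt_smul_sq,
      abs_of_nonneg (hc0 x)]
  rw [h3, ← h2]
  ring

open Classical in
/-- The indicator function of `{w ≤ n}`. -/
def cutoff (w : Space d → ℝ) (n : ℝ) (x : Space d) : ℂ := if w x ≤ n then 1 else 0

theorem measurable_cutoff {w : Space d → ℝ} (hw : Measurable w) (n : ℝ) :
    Measurable (cutoff w n) :=
  Measurable.ite (hw measurableSet_Iic) measurable_const measurable_const

theorem norm_cutoff_le (w : Space d → ℝ) (n : ℝ) (x : Space d) : ‖cutoff w n x‖ ≤ 1 := by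
  rw [cutoff]
  split_ifs <;> simp

theorem tendsto_cutoff (w : Space d → ℝ) (x : Space d) :
    Tendsto (fun n : ℕ => cutoff w n x) atTop (𝓝 1) := by
  refine tendsto_const_nhds.congr' ?_
  filter_upwards [eventually_ge_atTop ⌈w x⌉₊] with n hn
  rw [cutoff, if_pos ((Nat.le_ceil _).trans (by exact_mod_cast hn))]

theorem coeFn_mulOp_cutoff {w : Space d → ℝ} (hw : Measurable w) (n : ℝ) (X : L2 d F) :
    mulOp (cutoff w n) X =ᵐ[volume] fun x => cutoff w n x • X x :=
  coeFn_mulOp (measurable_cutoff hw n) (norm_cutoff_le w n) X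

theorem tendsto_mulOp_cutoff {w : Space d → ℝ} (hw : Measurable w) (X : L2 d F) :
    Tendsto (fun n : ℕ => mulOp (cutoff w n) X) atTop (𝓝 X) :=
  tendsto_mulOp (fun n => measurable_cutoff hw n) (fun n => norm_cutoff_le w n)
    (tendsto_cutoff w) X

theorem mulForm_dense (hW : Measurable W) : Dense ((mulForm F W).domain : Set (L2 d F)) := by
  intro X
  refine mem_closure_of_tendsto (tendsto_mulOp_cutoff (hW.abs) X)
    (Eventually.of_forall fun n => ?_)
  rw [SetLike.mem_coe, mem_mulForm_domain_iff_integrable hW]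
  refine ((L2.integrable_norm_sq X).const_mul (n : ℝ)).mono' (hW.abs.aestronglyMeasurable.mul
    (L2.integrable_norm_sq _).aestronglyMeasurable) ?_
  filter_upwards [coeFn_mulOp_cutoff hW.abs n X] with x hx
  rw [Real.norm_of_nonneg (by positivity), hx, norm_smul, mul_pow, ← mul_assoc]
  refine mul_le_mul_of_nonneg_right ?_ (sq_nonneg _)
  rw [cutoff]
  split_ifs with h
  · simpa using h
  · simp

theorem mulForm_isClosedSemibounded [CompleteSpace F] (hW : Measurable W) {c : ℝ}
    (hc : ∀ x, c ≤ W x) : (mulForm F W).IsClosedSemibounded :=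
  ⟨mulForm_isHermitian hW, mulForm_dense hW, mulForm_boundedBelow hW hc, mulForm_isClosed hW hc⟩

/-- The form of an operator that acts as multiplication by `w` on Fourier transforms. -/
theorem formOf_fourier_mul {A : L2 d ℂ →ₗ.[ℂ] L2 d ℂ} {w : Space d → ℝ} (hw : Measurable w)
    (hw0 : ∀ ξ, 0 ≤ w ξ)
    (hA : ∀ p, p ∈ A.graph ↔
      ⇑(𝓕 p.2 : L2 d ℂ) =ᵐ[volume] fun ξ => (w ξ : ℂ) * (𝓕 p.1 : L2 d ℂ) ξ) :
    (formOf A).domain =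
      ((mulForm ℂ w).comap (Lp.fourierTransformₗᵢ (Space d) ℂ)).domain ∧
    ∀ φ ∈ ((mulForm ℂ w).comap (Lp.fourierTransformₗᵢ (Space d) ℂ)).domain,
    ∀ ψ ∈ ((mulForm ℂ w).comap (Lp.fourierTransformₗᵢ (Space d) ℂ)).domain,
      (formOf A).val φ ψ =
        ((mulForm ℂ w).comap (Lp.fourierTransformₗᵢ (Space d) ℂ)).val φ ψ := by
  have hs := (mulForm_isClosedSemibounded (F := ℂ) hw hw0).comap (Lp.fourierTransformₗᵢ (Space d) ℂ)
  have hu : ∀ u : A.domain, ⇑(𝓕 (A u) : L2 d ℂ) =ᵐ[volume]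
      fun ξ => (w ξ : ℂ) * (𝓕 (u : L2 d ℂ) : L2 d ℂ) ξ := fun u => (hA _).1 (A.mem_graph u)
  refine hs.formOf_eq (fun u => ?_) (fun u v => ?_) (fun ψ hψ => ?_)
  · change 𝓕 (u : L2 d ℂ) ∈ (mulForm ℂ w).domain
    rw [mem_mulForm_domain]
    refine MemLp.mono ((Lp.memLp (𝓕 (u : L2 d ℂ))).norm.add (Lp.memLp (𝓕 (A u))).norm)
      (aestronglyMeasurable_sqrt_smul hw _) ?_
    filter_upwards [hu u] with ξ hξ
    rw [Pi.add_apply, hξ, norm_mul, Complex.norm_real, norm_smul,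
      Complex.norm_real, Real.norm_of_nonneg (Real.sqrt_nonneg _), Real.norm_eq_abs (w ξ),
      Real.norm_of_nonneg (add_nonneg (norm_nonneg _) (mul_nonneg (abs_nonneg _) (norm_nonneg _))),
      ← one_add_mul]
    refine mul_le_mul_of_nonneg_right (Real.sqrt_le_iff.2 ⟨by positivity, ?_⟩) (norm_nonneg _)
    nlinarith [abs_nonneg (w ξ)]
  · rw [← Lp.inner_fourier_eq, L2.inner_def]
    change _ = ∫ ξ, (w ξ : ℂ) * inner ℂ ((𝓕 (u : L2 d ℂ) : L2 d ℂ) ξ) ((𝓕 (v : L2 d ℂ) : L2 d ℂ) ξ)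
    refine integral_congr_ae ?_
    filter_upwards [hu v] with ξ hξ
    rw [hξ, RCLike.inner_apply, RCLike.inner_apply]
    ring
  · have hψ' : 𝓕 ψ ∈ (mulForm ℂ w).domain := hψ
    rw [mem_mulForm_domain_iff_integrable hw] at hψ'
    have hgr : ∀ n : ℕ, (𝓕⁻ (mulOp (cutoff w n) (𝓕 ψ)),
        𝓕⁻ (mulOp (fun ξ => (w ξ : ℂ) * cutoff w n ξ) (𝓕 ψ))) ∈ A.graph := by
      intro n
      rw [hA, FourierTransform.fourier_fourierInv_eq, FourierTransform.fourier_fourierInv_eq]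
      filter_upwards [coeFn_mulOp_cutoff hw n (𝓕 ψ), coeFn_mulOp
        (m := fun ξ => (w ξ : ℂ) * cutoff w n ξ) (C := n)
        ((Complex.measurable_ofReal.comp hw).mul (measurable_cutoff hw n)) (fun ξ => by
          rw [cutoff]
          split_ifs with h
          · simpa [abs_of_nonneg (hw0 ξ)] using h
          · simp) (𝓕 ψ)] with ξ h1 h2
      rw [h1, h2, smul_eq_mul, smul_eq_mul, mul_assoc]
    refine ⟨fun n => ⟨_, LinearPMap.mem_domain_of_mem_graph (hgr n)⟩, ?_, ?_⟩
    · have h1 := ((Lp.fourierTransformₗᵢ (Space d) ℂ).symm.continuous.tendsto _).comp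
        (tendsto_mulOp_cutoff hw (𝓕 ψ))
      have e : (Lp.fourierTransformₗᵢ (Space d) ℂ).symm (𝓕 ψ) = ψ :=
        (Lp.fourierTransformₗᵢ (Space d) ℂ).symm_apply_apply ψ
      rw [e] at h1
      exact h1
    · have e : ∀ n : ℕ, (((mulForm ℂ w).comap (Lp.fourierTransformₗᵢ (Space d) ℂ)).val
          (𝓕⁻ (mulOp (cutoff w n) (𝓕 ψ)) - ψ) (𝓕⁻ (mulOp (cutoff w n) (𝓕 ψ)) - ψ)).re =
          ∫ ξ, ‖cutoff w n ξ - 1‖ ^ 2 * (w ξ * ‖(𝓕 ψ : L2 d ℂ) ξ‖ ^ 2) := by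
        intro n
        have e1 : (Lp.fourierTransformₗᵢ (Space d) ℂ) (𝓕⁻ (mulOp (cutoff w n) (𝓕 ψ)) - ψ) =
            mulOp (cutoff w n) (𝓕 ψ) - 𝓕 ψ := by
          rw [map_sub]
          congr 1
          exact (Lp.fourierTransformₗᵢ (Space d) ℂ).apply_symm_apply _
        change ((mulForm ℂ w).val _ _).re = _
        rw [e1, re_mulForm_val]
        refine integral_congr_ae ?_
        filter_upwards [coeFn_mulOp_cutoff hw n (𝓕 ψ),
          Lp.coeFn_sub (mulOp (cutoff w n) (𝓕 ψ)) (𝓕 ψ)] with ξ h1 h2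
        rw [h2, Pi.sub_apply, h1, smul_eq_mul, ← sub_one_mul, norm_mul]
        ring
      simp only [e]
      have h0 : ∫ x : Space d, (0 : ℝ) = 0 := by simp
      rw [← h0]
      refine tendsto_integral_of_dominated_convergence
        (fun ξ => 4 * (|w ξ| * ‖(𝓕 ψ : L2 d ℂ) ξ‖ ^ 2)) (fun n => ?_)
        (hψ'.const_mul 4) (fun n => Eventually.of_forall fun ξ => ?_)
        (Eventually.of_forall fun ξ => ?_)
      · exact ((((measurable_cutoff hw n).sub_const 1).norm.pow_const 2).aestronglyMeasurable).mul
          (hw.aestronglyMeasurable.mul (L2.integrable_norm_sq _).aestronglyMeasurable)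
      · rw [abs_of_nonneg (hw0 ξ), Real.norm_of_nonneg (by have := hw0 ξ; positivity)]
        refine mul_le_mul_of_nonneg_right ?_ (by have := hw0 ξ; positivity)
        have h1 : ‖cutoff w n ξ - 1‖ ≤ 2 := (norm_sub_le _ _).trans (by
          rw [norm_one]
          linarith [norm_cutoff_le w n ξ])
        nlinarith [norm_nonneg (cutoff w n ξ - 1)]
      · have h1 := (((tendsto_cutoff w ξ).sub_const 1).norm.pow 2).mul_const
          (w ξ * ‖(𝓕 ψ : L2 d ℂ) ξ‖ ^ 2)
        simpa using h1

end MulForm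
end

noncomputable section

section Kinetic

variable {d : ℕ} {F : Type*} [NormedAddCommGroup F] [InnerProductSpace ℂ F]

/-- The symbol of `-Δ`. -/
def laplaceSymbol (d : ℕ) (ξ : Space d) : ℝ := 4 * Real.pi ^ 2 * ‖ξ‖ ^ 2

theorem measurable_laplaceSymbol : Measurable (laplaceSymbol d) := by
  unfold laplaceSymbol
  fun_prop

theorem laplaceSymbol_nonneg (ξ : Space d) : 0 ≤ laplaceSymbol d ξ := by
  unfold laplaceSymbol
  positivity

/-- The form of `-Δ ⊗ 1`. -/
def kinForm (d : ℕ) (F : Type*) [NormedAddCommGroup F] [InnerProductSpace ℂ F] [CompleteSpace F] :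
    QForm (L2 d F) :=
  (mulForm F (laplaceSymbol d)).comap (Lp.fourierTransformₗᵢ (Space d) F)

theorem kinForm_isClosedSemibounded [CompleteSpace F] : (kinForm d F).IsClosedSemibounded :=
  (mulForm_isClosedSemibounded measurable_laplaceSymbol laplaceSymbol_nonneg).comap _

theorem mem_kinForm_domain [CompleteSpace F] {X : L2 d F} : X ∈ (kinForm d F).domain ↔
    Integrable (fun ξ => laplaceSymbol d ξ * ‖(𝓕 X : L2 d F) ξ‖ ^ 2) volume := by
  change 𝓕 X ∈ (mulForm F (laplaceSymbol d)).domain ↔ _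
  rw [mem_mulForm_domain_iff_integrable measurable_laplaceSymbol]
  simp only [abs_of_nonneg (laplaceSymbol_nonneg _)]

theorem re_kinForm_val [CompleteSpace F] (X : L2 d F) :
    ((kinForm d F).val X X).re = ∫ ξ, laplaceSymbol d ξ * ‖(𝓕 X : L2 d F) ξ‖ ^ 2 :=
  re_mulForm_val (W := laplaceSymbol d) (𝓕 X : L2 d F)

theorem kineticForm_eq : (kineticForm d).domain = (kinForm d ℂ).domain ∧
    ∀ φ ∈ (kinForm d ℂ).domain, ∀ ψ ∈ (kinForm d ℂ).domain,
      (kineticForm d).val φ ψ = (kinForm d ℂ).val φ ψ := by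
  refine formOf_fourier_mul measurable_laplaceSymbol laplaceSymbol_nonneg fun p => ?_
  have h : p ∈ (-laplacianOp d).graph ↔ (p.1, -p.2) ∈ (laplacianOp d).graph := by
    rw [LinearPMap.neg_graph, Submodule.mem_map]
    constructor
    · rintro ⟨q, hq, rfl⟩
      simpa using hq
    · intro h
      exact ⟨_, h, by simp⟩
  rw [h, mem_laplacianOp_graph]
  have e : (𝓕 (-p.2) : L2 d ℂ) = -𝓕 p.2 := map_neg (Lp.fourierTransformₗᵢ (Space d) ℂ) p.2
  simp only [e]
  constructor
  · intro h
    filter_upwards [h, Lp.coeFn_neg (𝓕 p.2 : L2 d ℂ)] with ξ h1 h2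
    rw [h2, Pi.neg_apply, neg_eq_iff_eq_neg] at h1
    rw [h1, laplaceSymbol, Complex.ofReal_neg, neg_mul, neg_neg]
  · intro h
    filter_upwards [h, Lp.coeFn_neg (𝓕 p.2 : L2 d ℂ)] with ξ h1 h2
    rw [h2, Pi.neg_apply, h1, laplaceSymbol, Complex.ofReal_neg, neg_mul]

theorem formOf_smul_laplacian {c : ℝ} (hc : 0 < c) :
    (formOf ((-(c : ℂ)) • laplacianOp d)).domain = (kinForm d ℂ).domain ∧
    ∀ φ ∈ (kinForm d ℂ).domain, ∀ ψ ∈ (kinForm d ℂ).domain,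
      (formOf ((-(c : ℂ)) • laplacianOp d)).val φ ψ = c * (kinForm d ℂ).val φ ψ := by
  have hm : Measurable fun ξ => c * laplaceSymbol d ξ := measurable_laplaceSymbol.const_mul c
  have key := formOf_fourier_mul (d := d) (A := (-(c : ℂ)) • laplacianOp d) hm
    (fun ξ => mul_nonneg hc.le (laplaceSymbol_nonneg ξ)) fun p => ?_
  · have hdom : ((mulForm ℂ fun ξ => c * laplaceSymbol d ξ).comap
        (Lp.fourierTransformₗᵢ (Space d) ℂ)).domain = (kinForm d ℂ).domain := by
      ext X
      rw [mem_kinForm_domain]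
      change 𝓕 X ∈ (mulForm ℂ fun ξ => c * laplaceSymbol d ξ).domain ↔ _
      rw [mem_mulForm_domain_iff_integrable hm]
      simp only [abs_mul, abs_of_pos hc, abs_of_nonneg (laplaceSymbol_nonneg _), mul_assoc]
      exact integrable_const_mul_iff (IsUnit.mk0 _ hc.ne') _
    rw [hdom] at key
    refine ⟨key.1, fun φ hφ ψ hψ => (key.2 φ hφ ψ hψ).trans ?_⟩
    simp only [kinForm, QForm.comap, mulForm]
    rw [← integral_const_mul]
    refine integral_congr_ae (Eventually.of_forall fun ξ => ?_)
    simp only [Complex.ofReal_mul]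
    ring
  · have hc' : (-(c : ℂ)) ≠ 0 := by simpa using hc.ne'
    have h : p ∈ ((-(c : ℂ)) • laplacianOp d).graph ↔
        (p.1, (-(c : ℂ))⁻¹ • p.2) ∈ (laplacianOp d).graph := by
      rw [LinearPMap.smul_graph, Submodule.mem_map]
      constructor
      · rintro ⟨q, hq, rfl⟩
        change (q.1, (-(c : ℂ))⁻¹ • (-(c : ℂ)) • q.2) ∈ _
        rwa [inv_smul_smul₀ hc']
      · intro h
        refine ⟨_, h, Prod.ext rfl ?_⟩
        change (-(c : ℂ)) • (-(c : ℂ))⁻¹ • p.2 = p.2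
        rw [smul_inv_smul₀ hc']
    rw [h, mem_laplacianOp_graph]
    have e : (𝓕 ((-(c : ℂ))⁻¹ • p.2) : L2 d ℂ) = (-(c : ℂ))⁻¹ • 𝓕 p.2 :=
      map_smul (Lp.fourierTransformₗᵢ (Space d) ℂ) _ p.2
    simp only [e]
    constructor
    · intro h
      filter_upwards [h, Lp.coeFn_smul (-(c : ℂ))⁻¹ (𝓕 p.2 : L2 d ℂ)] with ξ h1 h2
      rw [h2, Pi.smul_apply, smul_eq_mul, inv_mul_eq_iff_eq_mul₀ hc'] at h1
      rw [h1, laplaceSymbol]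
      push_cast
      ring
    · intro h
      filter_upwards [h, Lp.coeFn_smul (-(c : ℂ))⁻¹ (𝓕 p.2 : L2 d ℂ)] with ξ h1 h2
      rw [h2, Pi.smul_apply, smul_eq_mul, inv_mul_eq_iff_eq_mul₀ hc', h1, laplaceSymbol]
      push_cast
      ring

theorem countable_of_orthonormal [TopologicalSpace.SeparableSpace F] {ι : Type*} {e : ι → F}
    (he : Orthonormal ℂ e) : Countable ι := by
  rw [← Set.countable_univ_iff]
  refine Set.PairwiseDisjoint.countable_of_isOpen (s := fun i => Metric.ball (e i) (1 / 2))
    (fun i _ j _ hij => ?_) (fun i _ => Metric.isOpen_ball)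
    (fun i _ => ⟨e i, Metric.mem_ball_self (by norm_num)⟩)
  refine Metric.ball_disjoint_ball ?_
  have h : ‖e i - e j‖ ^ 2 = 2 := by
    rw [@norm_sub_sq ℂ, he.1 i, he.1 j, he.2 hij]
    norm_num
  rw [dist_eq_norm]
  nlinarith [norm_nonneg (e i - e j)]

/-- A countable orthonormal system that is complete for the values of a vector valued function. -/
theorem exists_countable_parseval [CompleteSpace F] (X : L2 d F) :
    ∃ (ι : Set F) (e : ι → F), Countable ι ∧ Orthonormal ℂ e ∧
      ∀ x, HasSum (fun i => ‖inner ℂ (e i) (X x)‖ ^ 2) (‖X x‖ ^ 2) := by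
  set K : Submodule ℂ F := (Submodule.span ℂ (Set.range X)).topologicalClosure with hK
  have hsep : TopologicalSpace.IsSeparable (K : Set F) := by
    rw [hK, Submodule.topologicalClosure_coe]
    exact ((Lp.stronglyMeasurable X).isSeparable_range.span (R := ℂ)).closure
  have hsep' : TopologicalSpace.SeparableSpace K := hsep.separableSpace
  have hcomp : CompleteSpace K := by
    rw [hK]
    infer_instance
  obtain ⟨w, b, hb⟩ := exists_hilbertBasis ℂ K
  have hinj : Function.Injective ((↑) : K → F) := Subtype.val_injective
  let f : ((↑) '' w : Set F) ≃ w := (Equiv.Set.image _ w hinj).symm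
  refine ⟨(↑) '' w, fun i => ((b (f i) : K) : F), ?_, ?_, fun x => ?_⟩
  · have : Countable w := countable_of_orthonormal b.orthonormal
    exact f.injective.countable
  · exact (b.orthonormal.comp f f.injective).comp_linearIsometry K.subtypeₗᵢ
  · have hx : X x ∈ K := Submodule.le_topologicalClosure _ (Submodule.subset_span ⟨x, rfl⟩)
    have h := b.hasSum_inner_mul_inner ⟨X x, hx⟩ ⟨X x, hx⟩
    have h1 := f.hasSum_iff.2 (Complex.hasSum_re h)
    convert h1 using 1
    · ext i
      change ‖inner ℂ ((b (f i) : K) : F) (X x)‖ ^ 2 =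
        (inner ℂ (X x) ((b (f i) : K) : F) * inner ℂ ((b (f i) : K) : F) (X x)).re
      rw [← inner_conj_symm (X x), ← Complex.normSq_eq_conj_mul_self, Complex.ofReal_re,
        Complex.normSq_eq_norm_sq]
    · exact (inner_self_re (X x)).symm

/-- The component of a vector valued function along a vector. -/
def component (e : F) (X : L2 d F) : L2 d ℂ := (innerSL ℂ e).compLp X

theorem coeFn_component (e : F) (X : L2 d F) :
    component e X =ᵐ[volume] fun x => inner ℂ e (X x) :=
  ContinuousLinearMap.coeFn_compLp' _ _

theorem tsum_lintegral_component {ι : Type*} [Countable ι] {w : Space d → ℝ} (hw : Measurable w)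
    (e : ι → F) (X : L2 d F) :
    ∑' i, ∫⁻ x, ENNReal.ofReal (|w x| * ‖component (e i) X x‖ ^ 2) =
      ∫⁻ x, ENNReal.ofReal |w x| * ∑' i, ENNReal.ofReal (‖inner ℂ (e i) (X x)‖ ^ 2) := by
  rw [← lintegral_tsum]
  · refine lintegral_congr_ae ?_
    filter_upwards [ae_all_iff.2 fun i => coeFn_component (e i) X] with x hx
    rw [← ENNReal.tsum_mul_left]
    congr with i
    rw [hx, ENNReal.ofReal_mul (abs_nonneg _)]
  · intro i
    exact ((hw.abs.aestronglyMeasurable (μ := volume)).mul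
      (L2.integrable_norm_sq (component (e i) X)).aestronglyMeasurable).aemeasurable.ennreal_ofReal

theorem tsum_lintegral_component_le {ι : Type*} [Countable ι] {w : Space d → ℝ} (hw : Measurable w)
    {e : ι → F} (he : Orthonormal ℂ e) (X : L2 d F) :
    ∑' i, ∫⁻ x, ENNReal.ofReal (|w x| * ‖component (e i) X x‖ ^ 2) ≤
      ∫⁻ x, ENNReal.ofReal (|w x| * ‖X x‖ ^ 2) := by
  rw [tsum_lintegral_component hw]
  refine lintegral_mono fun x => ?_
  rw [ENNReal.ofReal_mul (abs_nonneg _)]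
  refine mul_le_mul_right ?_ _
  rw [← ENNReal.ofReal_tsum_of_nonneg (fun _ => sq_nonneg _) (he.inner_products_summable _)]
  exact ENNReal.ofReal_le_ofReal (he.tsum_inner_products_le _)

theorem tsum_lintegral_component_eq {ι : Type*} [Countable ι] {w : Space d → ℝ} (hw : Measurable w)
    {e : ι → F} {X : L2 d F} (h : ∀ x, HasSum (fun i => ‖inner ℂ (e i) (X x)‖ ^ 2) (‖X x‖ ^ 2)) :
    ∑' i, ∫⁻ x, ENNReal.ofReal (|w x| * ‖component (e i) X x‖ ^ 2) =
      ∫⁻ x, ENNReal.ofReal (|w x| * ‖X x‖ ^ 2) := by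
  rw [tsum_lintegral_component hw]
  refine lintegral_congr fun x => ?_
  rw [ENNReal.ofReal_mul (abs_nonneg _),
    ← ENNReal.ofReal_tsum_of_nonneg (fun _ => sq_nonneg _) (h x).summable, (h x).tsum_eq]

theorem fourier_component [CompleteSpace F] (e : F) (X : L2 d F) :
    (𝓕 (component e X) : L2 d ℂ) = component e (𝓕 X) :=
  fourier_compLp (innerSL ℂ e) X

theorem component_mem_kinForm [CompleteSpace F] (e : F) {X : L2 d F}
    (hX : X ∈ (kinForm d F).domain) : component e X ∈ (kinForm d ℂ).domain := by
  rw [mem_kinForm_domain] at hX ⊢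
  refine (hX.const_mul (‖e‖ ^ 2)).mono' (measurable_laplaceSymbol.aestronglyMeasurable.mul
    (L2.integrable_norm_sq _).aestronglyMeasurable) ?_
  rw [fourier_component]
  filter_upwards [coeFn_component e (𝓕 X : L2 d F)] with ξ hξ
  rw [Real.norm_of_nonneg (mul_nonneg (laplaceSymbol_nonneg _) (sq_nonneg _)), hξ, mul_left_comm,
    ← mul_pow]
  exact mul_le_mul_of_nonneg_left (pow_le_pow_left₀ (norm_nonneg _) (norm_inner_le_norm _ _) 2)
    (laplaceSymbol_nonneg _)

/-- An infinitesimal form bound extends to vector valued functions. -/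
theorem InfinitesimallyFormBounded.vector [CompleteSpace F] {V : Space d → ℝ} (hV : Measurable V)
    (h : InfinitesimallyFormBounded V) {α : ℝ} (hα : 0 < α) :
    ∃ β : ℝ, 0 ≤ β ∧ ∀ X ∈ (kinForm d F).domain, X ∈ (mulForm F V).domain ∧
      ∫ x, |V x| * ‖X x‖ ^ 2 ≤ α * ((kinForm d F).val X X).re + β * ‖X‖ ^ 2 := by
  obtain ⟨h1, h2⟩ := h
  obtain ⟨β, hβ, hb⟩ := h2 α hα
  refine ⟨β, hβ, fun X hX => ?_⟩
  have hsc : ∀ ψ ∈ (kinForm d ℂ).domain, ∫⁻ x, ENNReal.ofReal (|V x| * ‖ψ x‖ ^ 2) ≤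
      ENNReal.ofReal α * (∫⁻ ξ, ENNReal.ofReal (|laplaceSymbol d ξ| * ‖(𝓕 ψ : L2 d ℂ) ξ‖ ^ 2)) +
      ENNReal.ofReal β * ∫⁻ x, ENNReal.ofReal (|(1 : ℝ)| * ‖ψ x‖ ^ 2) := by
    intro ψ hψ
    have hψ' : ψ ∈ (kineticForm d).domain := by rwa [kineticForm_eq.1]
    have h3 := hb ψ hψ'
    have h4 := (mem_mulForm_domain_iff_integrable hV).1 (h1 hψ' : ψ ∈ (mulForm ℂ V).domain)
    rw [kineticForm_eq.2 ψ hψ ψ hψ, re_kinForm_val, L2.norm_sq_eq_integral] at h3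
    have hψ2 := mem_kinForm_domain.1 hψ
    simp only [abs_of_nonneg (laplaceSymbol_nonneg _), abs_one, one_mul]
    rw [← ofReal_integral_eq_lintegral_ofReal h4 (Eventually.of_forall fun x => by positivity),
      ← ofReal_integral_eq_lintegral_ofReal hψ2 (Eventually.of_forall fun x =>
        mul_nonneg (laplaceSymbol_nonneg _) (sq_nonneg _)),
      ← ofReal_integral_eq_lintegral_ofReal (L2.integrable_norm_sq ψ)
        (Eventually.of_forall fun x => sq_nonneg _), ← ENNReal.ofReal_mul hα.le,
      ← ENNReal.ofReal_mul hβ, ← ENNReal.ofReal_add]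
    · exact ENNReal.ofReal_le_ofReal h3
    · exact mul_nonneg hα.le (integral_nonneg fun x =>
        mul_nonneg (laplaceSymbol_nonneg _) (sq_nonneg _))
    · exact mul_nonneg hβ (integral_nonneg fun x => sq_nonneg _)
  obtain ⟨ι, e, hι, he, hsum⟩ := exists_countable_parseval X
  have hX' := mem_kinForm_domain.1 hX
  have key : ∫⁻ x, ENNReal.ofReal (|V x| * ‖X x‖ ^ 2) ≤
      ENNReal.ofReal (α * ((kinForm d F).val X X).re + β * ‖X‖ ^ 2) := by
    rw [re_kinForm_val, L2.norm_sq_eq_integral, ENNReal.ofReal_add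
      (mul_nonneg hα.le (integral_nonneg fun x =>
        mul_nonneg (laplaceSymbol_nonneg _) (sq_nonneg _)))
      (mul_nonneg hβ (integral_nonneg fun x => sq_nonneg _)),
      ENNReal.ofReal_mul hα.le, ENNReal.ofReal_mul hβ,
      ofReal_integral_eq_lintegral_ofReal hX' (Eventually.of_forall fun x =>
        mul_nonneg (laplaceSymbol_nonneg _) (sq_nonneg _)),
      ofReal_integral_eq_lintegral_ofReal (L2.integrable_norm_sq X)
        (Eventually.of_forall fun x => sq_nonneg _)]
    have e1 := tsum_lintegral_component_eq (w := fun _ => (1 : ℝ)) measurable_const hsum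
    have e2 := tsum_lintegral_component_le measurable_laplaceSymbol he (𝓕 X : L2 d F)
    simp only [abs_of_nonneg (laplaceSymbol_nonneg _)] at e2
    simp only [abs_one, one_mul] at e1
    rw [← tsum_lintegral_component_eq hV hsum, ← e1]
    refine (ENNReal.tsum_le_tsum fun i => hsc _ (component_mem_kinForm (e i) hX)).trans ?_
    rw [ENNReal.tsum_add, ENNReal.tsum_mul_left, ENNReal.tsum_mul_left]
    simp only [fourier_component, abs_of_nonneg (laplaceSymbol_nonneg _), abs_one, one_mul]
    gcongr
  have hm : AEStronglyMeasurable (fun x => |V x| * ‖X x‖ ^ 2) volume :=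
    hV.abs.aestronglyMeasurable.mul (L2.integrable_norm_sq X).aestronglyMeasurable
  have hi : Integrable (fun x => |V x| * ‖X x‖ ^ 2) volume := by
    refine ⟨hm, ?_⟩
    rw [hasFiniteIntegral_iff_ofReal (Eventually.of_forall fun x => by positivity)]
    exact key.trans_lt ENNReal.ofReal_lt_top
  refine ⟨(mem_mulForm_domain_iff_integrable hV).2 hi, ?_⟩
  rw [← ofReal_integral_eq_lintegral_ofReal hi (Eventually.of_forall fun x => by positivity)] at key
  refine (ENNReal.ofReal_le_ofReal_iff ?_).1 key
  rw [re_kinForm_val]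
  exact add_nonneg (mul_nonneg hα.le (integral_nonneg fun x =>
    mul_nonneg (laplaceSymbol_nonneg _) (sq_nonneg _))) (mul_nonneg hβ (sq_nonneg _))

/-- The form sum of a form that dominates the kinetic energy and of a potential. -/
theorem QForm.IsClosedSemibounded.add_mulForm [CompleteSpace F] {s : QForm (L2 d F)}
    (hs : s.IsClosedSemibounded) {κ : ℝ} (hκ : 0 < κ)
    (hdom : s.domain ≤ (kinForm d F).domain)
    (hkin : ∀ X ∈ s.domain, κ * ((kinForm d F).val X X).re ≤ (s.val X X).re)
    {V : Space d → ℝ} (hV : Measurable V)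
    (h : InfinitesimallyFormBounded V ∨
      (∃ c : ℝ, ∀ x, c ≤ V x) ∧ Dense ((s.domain ⊓ (mulForm F V).domain : Submodule ℂ (L2 d F)) :
        Set (L2 d F))) :
    (s.add (mulForm F V)).IsClosedSemibounded := by
  rcases h with h | ⟨⟨c, hc⟩, hd⟩
  · obtain ⟨β, hβ, hb⟩ := h.vector (F := F) hV (α := κ / 2) (by positivity)
    refine hs.add_of_relBounded (mulForm_isHermitian hV) (fun X hX => (hb X (hdom hX)).1)
      (a := 1 / 2) (b := β) (by norm_num) fun X hX => ?_
    rw [re_mulForm_val]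
    refine (abs_integral_le_integral_abs).trans ?_
    simp only [abs_mul, abs_of_nonneg (sq_nonneg (‖X _‖))]
    have h1 := (hb X (hdom hX)).2
    have h2 := hkin X hX
    linarith
  · exact hs.add (mulForm_isHermitian hV) (mulForm_boundedBelow hV hc) (mulForm_isClosed hV hc) hd

end Kinetic
end

noncomputable section

section Sectors

variable {d : ℕ} {n : ℕ}

/-- `L²` functions of `n` photon variables. -/
abbrev Sector (d n : ℕ) := Lp ℂ 2 (photonMeasureN d n)

/-- The one-photon space. -/
abbrev OnePhoton (d : ℕ) := Lp ℂ 2 (photonMeasure d)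

/-- Permutation of the photon variables. -/
def permL (σ : Equiv.Perm (Fin n)) : Sector d n →ₗᵢ[ℂ] Sector d n :=
  Lp.compMeasurePreservingₗᵢ ℂ (fun k : Fin n → PhotonSpace d => k ∘ σ)
    (measurePreserving_perm d n σ)

theorem coeFn_permL (σ : Equiv.Perm (Fin n)) (X : Sector d n) :
    permL σ X =ᵐ[photonMeasureN d n] fun k => X (k ∘ σ) :=
  Lp.coeFn_compMeasurePreserving X (measurePreserving_perm d n σ)

theorem mem_symSector {X : Sector d n} : X ∈ symSector d n ↔ ∀ σ, permL σ X = X := by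
  rw [symSector, Submodule.mem_iInf]
  rfl

theorem permL_permL (σ τ : Equiv.Perm (Fin n)) (X : Sector d n) :
    permL σ (permL τ X) = permL (σ * τ) X := by
  apply Lp.ext
  filter_upwards [coeFn_permL σ (permL τ X), coeFn_permL (σ * τ) X,
    (measurePreserving_perm d n σ).quasiMeasurePreserving.ae (coeFn_permL τ X)] with k h1 h2 h3
  rw [h1, h2, h3]
  rfl

theorem permL_one (X : Sector d n) : permL 1 X = X := by
  apply Lp.ext
  filter_upwards [coeFn_permL 1 X] with k h1
  rw [h1]
  rfl

theorem inner_permL_left (σ : Equiv.Perm (Fin n)) (X Y : Sector d n) :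
    inner ℂ (permL σ X) Y = inner ℂ X (permL σ⁻¹ Y) := by
  rw [← (permL σ⁻¹).inner_map_map, permL_permL, inv_mul_cancel, permL_one]

/-- Separation of the first photon variable. -/
def splitFirst (d n : ℕ) : (Fin (n + 1) → PhotonSpace d) ≃ᵐ PhotonSpace d × (Fin n → PhotonSpace d) :=
  MeasurableEquiv.piFinSuccAbove (fun _ => PhotonSpace d) 0

theorem splitFirst_apply (k : Fin (n + 1) → PhotonSpace d) :
    splitFirst d n k = (k 0, fun j => k j.succ) := by
  rfl

theorem splitFirst_symm_apply (y : PhotonSpace d) (k : Fin n → PhotonSpace d) :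
    (splitFirst d n).symm (y, k) = Fin.cons y k := by
  rw [MeasurableEquiv.symm_apply_eq, splitFirst_apply]
  simp

theorem measurePreserving_splitFirst (d n : ℕ) : MeasurePreserving (splitFirst d n)
    (photonMeasureN d (n + 1)) ((photonMeasure d).prod (photonMeasureN d n)) :=
  measurePreserving_piFinSuccAbove (fun _ => photonMeasure d) 0

theorem ae_first {p : PhotonSpace d → Prop} (h : ∀ᵐ y ∂photonMeasure d, p y) :
    ∀ᵐ k ∂photonMeasureN d (n + 1), p (k 0) :=
  (Measure.quasiMeasurePreserving_fst.comp
    (measurePreserving_splitFirst d n).quasiMeasurePreserving).ae h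

theorem ae_rest {p : (Fin n → PhotonSpace d) → Prop} (h : ∀ᵐ k ∂photonMeasureN d n, p k) :
    ∀ᵐ k ∂photonMeasureN d (n + 1), p fun j => k j.succ :=
  (Measure.quasiMeasurePreserving_snd.comp
    (measurePreserving_splitFirst d n).quasiMeasurePreserving).ae h

theorem ae_coord {p : PhotonSpace d → Prop} (h : ∀ᵐ y ∂photonMeasure d, p y) (i : Fin n) :
    ∀ᵐ k ∂photonMeasureN d n, p (k i) :=
  (Measure.quasiMeasurePreserving_eval (fun _ => photonMeasure d) i).ae h

theorem memLp_prepend {f : PhotonSpace d → ℂ} (hf : MemLp f 2 (photonMeasure d)) (X : Sector d n) :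
    MemLp (fun k : Fin (n + 1) → PhotonSpace d => f (k 0) * X fun j => k j.succ) 2
      (photonMeasureN d (n + 1)) := by
  have h : MemLp (fun p : PhotonSpace d × (Fin n → PhotonSpace d) => f p.1 * X p.2) 2
      ((photonMeasure d).prod (photonMeasureN d n)) := by
    have hm : AEStronglyMeasurable (fun p : PhotonSpace d × (Fin n → PhotonSpace d) =>
        f p.1 * X p.2) ((photonMeasure d).prod (photonMeasureN d n)) :=
      hf.1.comp_fst.mul (Lp.aestronglyMeasurable X).comp_snd
    rw [memLp_two_iff_integrable_sq_norm hm]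
    have := (hf.integrable_norm_pow (by norm_num)).mul_prod
      ((Lp.memLp X).integrable_norm_pow (by norm_num))
    refine this.congr (Eventually.of_forall fun p => ?_)
    simp [mul_pow]
  exact h.comp_measurePreserving (measurePreserving_splitFirst d n)

/-- The tensor product `f ⊗ X`, with `f` in the first variable. -/
def prependFn (f : OnePhoton d) (X : Sector d n) : Sector d (n + 1) :=
  (memLp_prepend (Lp.memLp f) X).toLp _

theorem coeFn_prependFn (f : OnePhoton d) (X : Sector d n) :
    prependFn f X =ᵐ[photonMeasureN d (n + 1)] fun k => f (k 0) * X fun j => k j.succ :=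
  MemLp.coeFn_toLp _

theorem integral_splitFirst {E : Type*} [NormedAddCommGroup E] [NormedSpace ℝ E]
    (G : PhotonSpace d × (Fin n → PhotonSpace d) → E) :
    ∫ k, G (k 0, fun j => k j.succ) ∂photonMeasureN d (n + 1) =
      ∫ p, G p ∂(photonMeasure d).prod (photonMeasureN d n) :=
  (measurePreserving_splitFirst d n).integral_comp (splitFirst d n).measurableEmbedding G

theorem inner_prependFn (f g : OnePhoton d) (X Y : Sector d n) :
    inner ℂ (prependFn f X) (prependFn g Y) = inner ℂ f g * inner ℂ X Y := by
  rw [L2.inner_def, L2.inner_def, L2.inner_def, ← integral_prod_mul, ← integral_splitFirst]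
  refine integral_congr_ae ?_
  filter_upwards [coeFn_prependFn f X, coeFn_prependFn g Y] with k h1 h2
  rw [h1, h2]
  simp only [RCLike.inner_apply, map_mul]
  ring

theorem norm_prependFn (f : OnePhoton d) (X : Sector d n) : ‖prependFn f X‖ = ‖f‖ * ‖X‖ := by
  have h := inner_prependFn f f X X
  simp only [inner_self_eq_norm_sq_to_K] at h
  have h' : ‖prependFn f X‖ ^ 2 = ‖f‖ ^ 2 * ‖X‖ ^ 2 := by exact_mod_cast h
  rw [← mul_pow] at h'
  exact (pow_left_inj₀ (norm_nonneg _) (by positivity) two_ne_zero).1 h'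

/-- `f ⊗ X` as a continuous bilinear map. -/
def prepend (d n : ℕ) : OnePhoton d →L[ℂ] Sector d n →L[ℂ] Sector d (n + 1) :=
  LinearMap.mkContinuous₂ (LinearMap.mk₂ ℂ prependFn
    (fun f g X => by
      apply Lp.ext
      filter_upwards [coeFn_prependFn (f + g) X, coeFn_prependFn f X, coeFn_prependFn g X,
        Lp.coeFn_add (prependFn f X) (prependFn g X), ae_first (Lp.coeFn_add f g)]
        with k h1 h2 h3 h4 h5
      rw [h1, h4, Pi.add_apply, h2, h3, h5, Pi.add_apply, add_mul])
    (fun c f X => by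
      apply Lp.ext
      filter_upwards [coeFn_prependFn (c • f) X, coeFn_prependFn f X,
        Lp.coeFn_smul c (prependFn f X), ae_first (Lp.coeFn_smul c f)] with k h1 h2 h3 h4
      rw [h1, h3, Pi.smul_apply, h2, h4, Pi.smul_apply, smul_eq_mul, smul_eq_mul, mul_assoc])
    (fun f X Y => by
      apply Lp.ext
      filter_upwards [coeFn_prependFn f (X + Y), coeFn_prependFn f X, coeFn_prependFn f Y,
        Lp.coeFn_add (prependFn f X) (prependFn f Y), ae_rest (Lp.coeFn_add X Y)]
        with k h1 h2 h3 h4 h5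
      rw [h1, h4, Pi.add_apply, h2, h3, h5, Pi.add_apply, mul_add])
    (fun c f X => by
      apply Lp.ext
      filter_upwards [coeFn_prependFn f (c • X), coeFn_prependFn f X,
        Lp.coeFn_smul c (prependFn f X), ae_rest (Lp.coeFn_smul c X)] with k h1 h2 h3 h4
      rw [h1, h3, Pi.smul_apply, h2, h4, Pi.smul_apply, smul_eq_mul, smul_eq_mul,
        mul_left_comm])) 1 fun f X => by
    rw [one_mul]
    exact (norm_prependFn f X).le

theorem coeFn_prepend (f : OnePhoton d) (X : Sector d n) :
    prepend d n f X =ᵐ[photonMeasureN d (n + 1)] fun k => f (k 0) * X fun j => k j.succ :=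
  coeFn_prependFn f X

theorem inner_prepend (f g : OnePhoton d) (X Y : Sector d n) :
    inner ℂ (prepend d n f X) (prepend d n g Y) = inner ℂ f g * inner ℂ X Y :=
  inner_prependFn f g X Y

theorem norm_prepend (f : OnePhoton d) (X : Sector d n) : ‖prepend d n f X‖ = ‖f‖ * ‖X‖ :=
  norm_prependFn f X

/-- A permutation that fixes the first variable. -/
def liftPerm (σ : Equiv.Perm (Fin n)) : Equiv.Perm (Fin (n + 1)) :=
  Equiv.Perm.decomposeFin.symm (0, σ)

theorem liftPerm_zero (σ : Equiv.Perm (Fin n)) : liftPerm σ 0 = 0 := by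
  simp [liftPerm]

theorem liftPerm_succ (σ : Equiv.Perm (Fin n)) (j : Fin n) : liftPerm σ j.succ = (σ j).succ := by
  simp [liftPerm]

theorem exists_eq_liftPerm {σ : Equiv.Perm (Fin (n + 1))} (h : σ 0 = 0) :
    ∃ τ, σ = liftPerm τ := by
  refine ⟨(Equiv.Perm.decomposeFin σ).2, ?_⟩
  have h1 : (Equiv.Perm.decomposeFin σ).1 = 0 := by
    rw [← h]
    conv_rhs => rw [← Equiv.Perm.decomposeFin.symm_apply_apply σ]
    exact (Equiv.Perm.decomposeFin_symm_apply_zero _ _).symm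
  rw [liftPerm, ← h1, Prod.mk.eta, Equiv.symm_apply_apply]

theorem permL_liftPerm_prepend (σ : Equiv.Perm (Fin n)) (f : OnePhoton d) (X : Sector d n) :
    permL (liftPerm σ) (prepend d n f X) = prepend d n f (permL σ X) := by
  apply Lp.ext
  filter_upwards [coeFn_permL (liftPerm σ) (prepend d n f X), coeFn_prepend f (permL σ X),
    (measurePreserving_perm d _ (liftPerm σ)).quasiMeasurePreserving.ae (coeFn_prepend f X),
    ae_rest (coeFn_permL σ X)] with k h1 h2 h3 h4
  rw [h1, h2, h3, h4]
  simp only [Function.comp_apply, liftPerm_zero, liftPerm_succ]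
  rfl

/-- The partial inner product with `f` in the first variable. -/
def contract (f : OnePhoton d) : Sector d (n + 1) →L[ℂ] Sector d n :=
  ContinuousLinearMap.adjoint (prepend d n f)

theorem inner_contract (f : OnePhoton d) (X : Sector d n) (Y : Sector d (n + 1)) :
    inner ℂ X (contract f Y) = inner ℂ (prepend d n f X) Y :=
  ContinuousLinearMap.adjoint_inner_right _ _ _

theorem norm_contract_le (f : OnePhoton d) (Y : Sector d (n + 1)) :
    ‖contract f Y‖ ≤ ‖f‖ * ‖Y‖ := by
  refine ContinuousLinearMap.le_of_opNorm_le _ ?_ _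
  rw [contract, LinearIsometryEquiv.norm_map]
  exact ContinuousLinearMap.opNorm_le_bound _ (norm_nonneg _) fun X => (norm_prepend f X).le

theorem contract_prepend (f g : OnePhoton d) (X : Sector d n) :
    contract f (prepend d n g X) = inner ℂ f g • X := by
  refine ext_inner_left ℂ fun Y => ?_
  rw [inner_contract, inner_prepend, inner_smul_right]

theorem coeFn_contract (f : OnePhoton d) (Y : Sector d (n + 1)) :
    contract f Y =ᵐ[photonMeasureN d n]
      fun k => ∫ y, starRingEnd ℂ (f y) * Y (Fin.cons y k) ∂photonMeasure d := by
  have hY : MemLp (fun p : PhotonSpace d × (Fin n → PhotonSpace d) =>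
      Y ((splitFirst d n).symm p)) 2 ((photonMeasure d).prod (photonMeasureN d n)) :=
    (Lp.memLp Y).comp_measurePreserving (measurePreserving_splitFirst d n).symm
  have hint : ∀ X : Sector d n, Integrable (fun p : PhotonSpace d × (Fin n → PhotonSpace d) =>
      starRingEnd ℂ (f p.1 * X p.2) * Y (Fin.cons p.1 p.2))
      ((photonMeasure d).prod (photonMeasureN d n)) := by
    intro X
    have h := L2.integrable_inner (𝕜 := ℂ) (prepend d n f X) Y
    have h' := ((measurePreserving_splitFirst d n).symm).integrable_comp_of_integrable h
    refine h'.congr ?_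
    filter_upwards [(measurePreserving_splitFirst d n).symm.quasiMeasurePreserving.ae
      (coeFn_prepend f X)] with p hp
    simp only [Function.comp_apply, RCLike.inner_apply]
    rw [hp, splitFirst_symm_apply p.1 p.2, mul_comm]
    simp
  set G : (Fin n → PhotonSpace d) → ℂ :=
    fun k => ∫ y, starRingEnd ℂ (f y) * Y (Fin.cons y k) ∂photonMeasure d with hG
  have hin : ∀ X : Sector d n, ∀ k, ∫ y, starRingEnd ℂ (f y * X k) * Y (Fin.cons y k)
      ∂photonMeasure d = starRingEnd ℂ (X k) * G k := by
    intro X k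
    rw [hG, ← integral_const_mul]
    refine integral_congr_ae (Eventually.of_forall fun y => ?_)
    simp only [map_mul]
    ring
  have hval : ∀ X : Sector d n, inner ℂ X (contract f Y) =
      ∫ k, starRingEnd ℂ (X k) * G k ∂photonMeasureN d n := by
    intro X
    have h1 := integral_splitFirst (d := d) (n := n) fun p =>
      starRingEnd ℂ (f p.1 * X p.2) * Y (Fin.cons p.1 p.2)
    rw [integral_prod_symm _ (hint X)] at h1
    simp only [hin] at h1
    rw [inner_contract, L2.inner_def, ← h1]
    refine integral_congr_ae ?_
    filter_upwards [coeFn_prepend f X] with k hk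
    have e : (Fin.cons (k 0) fun j => k j.succ : Fin (n + 1) → PhotonSpace d) = k :=
      Fin.cons_self_tail k
    rw [hk, e, RCLike.inner_apply, mul_comm]
  have hind : ∀ {s : Set (Fin n → PhotonSpace d)} (hs : MeasurableSet s)
      (hμ : photonMeasureN d n s ≠ ∞), (fun k => starRingEnd ℂ
        (indicatorConstLp 2 hs hμ (1 : ℂ) k) * G k) =ᵐ[photonMeasureN d n] s.indicator G := by
    intro s hs hμ
    filter_upwards [indicatorConstLp_coeFn (p := 2) (hs := hs) (hμs := hμ) (c := (1 : ℂ))]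
      with k hk
    rw [hk]
    by_cases h : k ∈ s <;> simp [h]
  refine ae_eq_of_forall_setIntegral_eq_of_sigmaFinite (fun s hs hμ => ?_) (fun s hs hμ => ?_)
    fun s hs hμ => ?_
  · have : IsFiniteMeasure ((photonMeasureN d n).restrict s) :=
      ⟨by rwa [Measure.restrict_apply_univ]⟩
    exact MemLp.integrable (by norm_num) ((Lp.memLp (contract f Y)).restrict s)
  · rw [← integrable_indicator_iff hs]
    refine Integrable.congr ?_ (hind hs hμ.ne)
    have := (hint (indicatorConstLp 2 hs hμ.ne (1 : ℂ))).integral_prod_right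
    simpa only [hin] using this
  · rw [← integral_indicator (f := G) hs, ← integral_congr_ae (hind hs hμ.ne), ← hval,
      L2.inner_indicatorConstLp_one]

end Sectors
end

noncomputable section

section Ladder

variable {d : ℕ} {n : ℕ}

theorem permL_eq_of_zero {X : Sector d (n + 1)} (hX : ∀ σ : Equiv.Perm (Fin n), permL (liftPerm σ) X = X)
    {σ τ : Equiv.Perm (Fin (n + 1))} (h : σ 0 = τ 0) : permL σ X = permL τ X := by
  obtain ⟨ρ, hρ⟩ := exists_eq_liftPerm (σ := τ⁻¹ * σ) (by simp [h])
  have e : σ = τ * liftPerm ρ := by rw [← hρ, mul_inv_cancel_left]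
  rw [e, ← permL_permL, hX]

/-- The sum over all insertions of the variable of `f` into `X`. -/
def insertSum (f : OnePhoton d) (X : Sector d n) : Sector d (n + 1) :=
  ∑ i : Fin (n + 1), permL i.cycleRange.symm (prepend d n f X)

theorem insertSum_mem_symSector (f : OnePhoton d) {X : Sector d n} (hX : X ∈ symSector d n) :
    insertSum f X ∈ symSector d (n + 1) := by
  rw [mem_symSector] at hX ⊢
  intro σ
  have h : ∀ τ : Equiv.Perm (Fin n), permL (liftPerm τ) (prepend d n f X) = prepend d n f X := by
    intro τ
    rw [permL_liftPerm_prepend, hX]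
  rw [insertSum, map_sum]
  refine Fintype.sum_equiv σ _ _ fun i => ?_
  rw [permL_permL]
  refine permL_eq_of_zero h ?_
  rw [Equiv.Perm.mul_apply, Fin.cycleRange_symm_zero, Fin.cycleRange_symm_zero]

theorem inner_insertSum {X : Sector d (n + 1)} (hX : X ∈ symSector d (n + 1)) (f : OnePhoton d)
    (Y : Sector d n) : inner ℂ (insertSum f Y) X = (n + 1 : ℂ) * inner ℂ Y (contract f X) := by
  rw [insertSum, sum_inner]
  simp only [inner_permL_left, mem_symSector.1 hX, inner_contract]
  simp

theorem coeFn_finset_sum {α ι : Type*} [MeasurableSpace α] {μ : Measure α} (s : Finset ι)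
    (X : ι → Lp ℂ 2 μ) : ⇑(∑ i ∈ s, X i) =ᵐ[μ] fun k => ∑ i ∈ s, X i k := by
  classical
  induction s using Finset.induction_on with
  | empty =>
    rw [Finset.sum_empty]
    exact (Lp.coeFn_zero ℂ 2 μ).trans (Eventually.of_forall fun k => by simp)
  | insert a s ha ih =>
    rw [Finset.sum_insert ha]
    filter_upwards [Lp.coeFn_add (X a) (∑ i ∈ s, X i), ih] with k h1 h2
    rw [h1, Pi.add_apply, h2, Finset.sum_insert ha]

theorem coeFn_insertSum (f : OnePhoton d) (X : Sector d n) :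
    insertSum f X =ᵐ[photonMeasureN d (n + 1)]
      fun k => ∑ i, f (k i) * X fun j => k (i.succAbove j) := by
  filter_upwards [coeFn_finset_sum Finset.univ fun i : Fin (n + 1) =>
    permL i.cycleRange.symm (prepend d n f X), ae_all_iff.2 fun i : Fin (n + 1) =>
      coeFn_permL i.cycleRange.symm (prepend d n f X), ae_all_iff.2 fun i : Fin (n + 1) =>
      (measurePreserving_perm d _ i.cycleRange.symm).quasiMeasurePreserving.ae
        (coeFn_prepend f X)] with k h1 h2 h3
  rw [insertSum, h1]
  refine Finset.sum_congr rfl fun i _ => ?_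
  rw [h2, h3]
  simp only [Function.comp_apply, Fin.cycleRange_symm_zero, Fin.cycleRange_symm_succ]

theorem norm_insertSum_le (f : OnePhoton d) (X : Sector d n) :
    ‖insertSum f X‖ ≤ (n + 1) * (‖f‖ * ‖X‖) := by
  refine (norm_sum_le _ _).trans ?_
  simp only [LinearIsometry.norm_map, norm_prepend]
  simp

theorem sqrt_inv_mul (n : ℕ) : (√(n + 1 : ℝ))⁻¹ * (n + 1) = √(n + 1 : ℝ) := by
  have h : (0 : ℝ) < n + 1 := by positivity
  rw [inv_mul_eq_div, Real.div_sqrt]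

/-- Creation on the `n`-photon sector. -/
def create (d n : ℕ) : OnePhoton d →L[ℂ] symSector d n →L[ℂ] symSector d (n + 1) :=
  LinearMap.mkContinuous₂ (LinearMap.mk₂ ℂ
    (fun f X => ((√(n + 1 : ℝ))⁻¹ : ℂ) • ⟨insertSum f X, insertSum_mem_symSector f X.2⟩)
    (fun f g X => by
      rw [← smul_add]
      congr 1
      apply Subtype.ext
      simp [insertSum, Finset.sum_add_distrib])
    (fun c f X => by
      rw [smul_comm]
      congr 1
      apply Subtype.ext
      simp [insertSum, Finset.smul_sum])
    (fun f X Y => by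
      rw [← smul_add]
      congr 1
      apply Subtype.ext
      simp [insertSum, Finset.sum_add_distrib])
    (fun c f X => by
      rw [smul_comm]
      congr 1
      apply Subtype.ext
      simp [insertSum, Finset.smul_sum])) √(n + 1 : ℝ) fun f X => by
    rw [LinearMap.mk₂_apply, norm_smul, norm_inv, Complex.norm_real,
      Real.norm_of_nonneg (Real.sqrt_nonneg _)]
    refine (mul_le_mul_of_nonneg_left (norm_insertSum_le f (X : Sector d n))
      (inv_nonneg.2 (Real.sqrt_nonneg _))).trans_eq ?_
    rw [← mul_assoc, sqrt_inv_mul, mul_assoc]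
    rfl

theorem coe_create (f : OnePhoton d) (X : symSector d n) :
    (create d n f X : Sector d (n + 1)) = ((√(n + 1 : ℝ))⁻¹ : ℂ) • insertSum f X := rfl

theorem norm_create_le (f : OnePhoton d) (X : symSector d n) :
    ‖create d n f X‖ ≤ √(n + 1 : ℝ) * ‖f‖ * ‖X‖ := by
  refine ContinuousLinearMap.le_of_opNorm_le _ ?_ _
  exact ContinuousLinearMap.le_of_opNorm_le _
    (LinearMap.mkContinuous₂_norm_le _ (Real.sqrt_nonneg _) _) _

theorem contract_mem_symSector (f : OnePhoton d) {X : Sector d (n + 1)}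
    (hX : X ∈ symSector d (n + 1)) : contract f X ∈ symSector d n := by
  rw [mem_symSector] at hX ⊢
  intro σ
  refine ext_inner_left ℂ fun Y => ?_
  have h := inner_permL_left σ⁻¹ Y (contract f X)
  rw [inv_inv] at h
  rw [← h, inner_contract, ← permL_liftPerm_prepend, inner_permL_left, hX, inner_contract]

theorem contract_add (f g : OnePhoton d) (X : Sector d (n + 1)) :
    contract (f + g) X = contract f X + contract g X := by
  simp [contract]

theorem contract_smul (c : ℂ) (f : OnePhoton d) (X : Sector d (n + 1)) :
    contract (c • f) X = starRingEnd ℂ c • contract f X := by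
  rw [contract, contract, map_smul, LinearIsometryEquiv.map_smulₛₗ]
  rfl

/-- Annihilation on the `n + 1`-photon sector. -/
def annihilate (d n : ℕ) : OnePhoton d →L⋆[ℂ] symSector d (n + 1) →L[ℂ] symSector d n :=
  LinearMap.mkContinuous₂ (LinearMap.mk₂'ₛₗ (starRingEnd ℂ) (RingHom.id ℂ)
    (fun f X => (√(n + 1 : ℝ) : ℂ) • ⟨contract f X, contract_mem_symSector f X.2⟩)
    (fun f g X => by
      rw [← smul_add]
      congr 1
      apply Subtype.ext
      simp [contract_add])
    (fun c f X => by
      rw [smul_comm]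
      congr 1
      apply Subtype.ext
      simp [contract_smul])
    (fun f X Y => by
      rw [← smul_add]
      congr 1
      apply Subtype.ext
      simp)
    (fun c f X => by
      rw [smul_comm]
      congr 1
      apply Subtype.ext
      simp)) √(n + 1 : ℝ) fun f X => by
    rw [LinearMap.mk₂'ₛₗ_apply, norm_smul, Complex.norm_real,
      Real.norm_of_nonneg (Real.sqrt_nonneg _), mul_assoc]
    exact mul_le_mul_of_nonneg_left (norm_contract_le f (X : Sector d (n + 1)))
      (Real.sqrt_nonneg _)

theorem coe_annihilate (f : OnePhoton d) (X : symSector d (n + 1)) :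
    (annihilate d n f X : Sector d n) = (√(n + 1 : ℝ) : ℂ) • contract f X := rfl

theorem norm_annihilate_le (f : OnePhoton d) (X : symSector d (n + 1)) :
    ‖annihilate d n f X‖ ≤ √(n + 1 : ℝ) * ‖f‖ * ‖X‖ := by
  rw [mul_assoc]
  change ‖(annihilate d n f X : Sector d n)‖ ≤ _
  rw [coe_annihilate, norm_smul, Complex.norm_real,
    Real.norm_of_nonneg (Real.sqrt_nonneg _)]
  exact mul_le_mul_of_nonneg_left (norm_contract_le f (X : Sector d (n + 1))) (Real.sqrt_nonneg _)

theorem inner_create (f : OnePhoton d) (X : symSector d n) (Y : symSector d (n + 1)) :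
    inner ℂ (create d n f X) Y = inner ℂ X (annihilate d n f Y) := by
  rw [Submodule.coe_inner, Submodule.coe_inner, coe_create, coe_annihilate, inner_smul_left,
    inner_smul_right, inner_insertSum Y.2, ← mul_assoc]
  congr 1
  rw [← Complex.ofReal_inv, Complex.conj_ofReal]
  exact_mod_cast sqrt_inv_mul n

end Ladder

section Field

variable {d : ℕ}

/-- The `n`-photon component of a Fock vector. -/
def evalFock (d n : ℕ) : Fock d →L[ℂ] symSector d n :=
  lp.evalCLM ℂ (fun n : ℕ => symSector d n) 2 n

theorem evalFock_apply (Ψ : Fock d) (n : ℕ) : evalFock d n Ψ = Ψ n := rfl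

/-- The components of `a*(f)Ψ`. -/
def createComp (f : OnePhoton d) : (n : ℕ) → Fock d →L[ℂ] symSector d n
  | 0 => 0
  | n + 1 => create d n f ∘L evalFock d n

/-- The components of `Φ_S(f)Ψ`. -/
def fieldComp (f : OnePhoton d) (n : ℕ) : Fock d →L[ℂ] symSector d n :=
  (√2 : ℂ)⁻¹ • (annihilate d n f ∘L evalFock d (n + 1) + createComp f n)

theorem fieldComp_apply (f : OnePhoton d) (n : ℕ) (Ψ : Fock d) :
    fieldComp f n Ψ = (√2 : ℂ)⁻¹ • (annihilate d n f (Ψ (n + 1)) + createComp f n Ψ) := rfl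

theorem createComp_add (f g : OnePhoton d) (n : ℕ) (Ψ : Fock d) :
    createComp (f + g) n Ψ = createComp f n Ψ + createComp g n Ψ := by
  cases n with
  | zero => exact (add_zero _).symm
  | succ n =>
    exact congrArg (fun L : symSector d n →L[ℂ] symSector d (n + 1) => L (Ψ n))
      (map_add (create d n) f g)

theorem createComp_smul (c : ℂ) (f : OnePhoton d) (n : ℕ) (Ψ : Fock d) :
    createComp (c • f) n Ψ = c • createComp f n Ψ := by
  cases n with
  | zero => exact (smul_zero _).symm
  | succ n =>
    exact congrArg (fun L : symSector d n →L[ℂ] symSector d (n + 1) => L (Ψ n))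
      (map_smul (create d n) c f)

theorem annihilate_add (f g : OnePhoton d) {n : ℕ} (X : symSector d (n + 1)) :
    annihilate d n (f + g) X = annihilate d n f X + annihilate d n g X :=
  congrArg (fun L : symSector d (n + 1) →L[ℂ] symSector d n => L X) (map_add (annihilate d n) f g)

theorem annihilate_smul (c : ℂ) (f : OnePhoton d) {n : ℕ} (X : symSector d (n + 1)) :
    annihilate d n (c • f) X = starRingEnd ℂ c • annihilate d n f X :=
  congrArg (fun L : symSector d (n + 1) →L[ℂ] symSector d n => L X)
    ((annihilate d n).map_smulₛₗ c f)

theorem smul_add_add_eq {E : Type*} [AddCommGroup E] [Module ℂ E] (c : ℂ) {x y x₁ x₂ y₁ y₂ : E}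
    (hx : x = x₁ + x₂) (hy : y = y₁ + y₂) : c • (x + y) = c • (x₁ + y₁) + c • (x₂ + y₂) := by
  rw [hx, hy]
  module

theorem smul_add_smul_eq {E : Type*} [AddCommGroup E] [Module ℂ E] (c a : ℂ) {x y x₁ y₁ : E}
    (hx : x = a • x₁) (hy : y = a • y₁) : c • (x + y) = a • c • (x₁ + y₁) := by
  rw [hx, hy]
  module

theorem fieldComp_add (f g : OnePhoton d) (n : ℕ) (Ψ : Fock d) :
    fieldComp (f + g) n Ψ = fieldComp f n Ψ + fieldComp g n Ψ :=
  smul_add_add_eq _ (annihilate_add f g _) (createComp_add f g n Ψ)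

theorem fieldComp_real_smul (c : ℝ) (f : OnePhoton d) (n : ℕ) (Ψ : Fock d) :
    fieldComp ((c : ℂ) • f) n Ψ = (c : ℂ) • fieldComp f n Ψ :=
  smul_add_smul_eq _ _ ((annihilate_smul (c : ℂ) f _).trans (by rw [Complex.conj_ofReal]; rfl))
    (createComp_smul (c : ℂ) f n Ψ)

theorem photonFn_fieldComp {f : PhotonSpace d → ℂ} (hf : MemLp f 2 (photonMeasure d))
    (Ψ : Fock d) (n : ℕ) :
    ((fieldComp (hf.toLp f) n Ψ : symSector d n) : Sector d n) =ᵐ[photonMeasureN d n] fun k =>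
      (√2 : ℂ)⁻¹ * (annihilation f Ψ n k + creation f Ψ n k) := by
  have h1 : ((annihilate d n (hf.toLp f) (Ψ (n + 1)) : symSector d n) : Sector d n)
      =ᵐ[photonMeasureN d n] annihilation f Ψ n := by
    rw [coe_annihilate]
    filter_upwards [Lp.coeFn_smul (√(n + 1 : ℝ) : ℂ) (contract (hf.toLp f)
      (Ψ (n + 1) : Sector d (n + 1))), coeFn_contract (hf.toLp f) (Ψ (n + 1) : Sector d (n + 1))]
      with k h1 h2
    rw [h1, Pi.smul_apply, h2, smul_eq_mul, annihilation]
    congr 1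
    refine integral_congr_ae ?_
    filter_upwards [hf.coeFn_toLp] with y hy
    rw [hy]
    rfl
  have h2 : ((createComp (hf.toLp f) n Ψ : symSector d n) : Sector d n)
      =ᵐ[photonMeasureN d n] creation f Ψ n := by
    cases n with
    | zero =>
      filter_upwards [Lp.coeFn_zero ℂ 2 (photonMeasureN d 0)] with k hk
      rw [creation]
      exact hk
    | succ n =>
      have e : ((createComp (hf.toLp f) (n + 1) Ψ : symSector d (n + 1)) : Sector d (n + 1)) =
          ((√(n + 1 : ℝ))⁻¹ : ℂ) • insertSum (hf.toLp f) (Ψ n : Sector d n) := rfl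
      rw [e]
      filter_upwards [Lp.coeFn_smul ((√(n + 1 : ℝ))⁻¹ : ℂ) (insertSum (hf.toLp f)
        (Ψ n : Sector d n)), coeFn_insertSum (hf.toLp f) (Ψ n : Sector d n),
        ae_all_iff.2 fun i : Fin (n + 1) => ae_coord (n := n + 1) hf.coeFn_toLp i] with k h1 h2 h3
      rw [h1, Pi.smul_apply, h2, smul_eq_mul, creation]
      simp only [h3]
      rfl
  have h3 : ((fieldComp (hf.toLp f) n Ψ : symSector d n) : Sector d n) =
      (√2 : ℂ)⁻¹ • (((annihilate d n (hf.toLp f) (Ψ (n + 1)) : symSector d n) : Sector d n) +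
        ((createComp (hf.toLp f) n Ψ : symSector d n) : Sector d n)) := rfl
  rw [h3]
  filter_upwards [h1, h2, Lp.coeFn_smul (√2 : ℂ)⁻¹
    (((annihilate d n (hf.toLp f) (Ψ (n + 1)) : symSector d n) : Sector d n) +
      ((createComp (hf.toLp f) n Ψ : symSector d n) : Sector d n)),
    Lp.coeFn_add ((annihilate d n (hf.toLp f) (Ψ (n + 1)) : symSector d n) : Sector d n)
      ((createComp (hf.toLp f) n Ψ : symSector d n) : Sector d n)] with k h1 h2 h3 h4
  rw [h3, Pi.smul_apply, h4, Pi.add_apply, h1, h2, smul_eq_mul]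

end Field
end

noncomputable section

section Graded

theorem lp_two_hasSum_norm_sq {E : ℕ → Type*} [∀ n, NormedAddCommGroup (E n)] (Ψ : lp E 2) : HasSum (fun n => ‖Ψ n‖ ^ 2) (‖Ψ‖ ^ 2) := by
  have h := lp.hasSum_norm (p := 2) (by norm_num) Ψ
  simpa using h

theorem memℓp_two_of_summable {E : ℕ → Type*} [∀ n, NormedAddCommGroup (E n)] {f : ∀ n, E n}
    (h : Summable fun n => ‖f n‖ ^ 2) : Memℓp f 2 :=
  memℓp_gen (by simpa using h)

variable {E : ℕ → Type*} [∀ n, NormedAddCommGroup (E n)] [∀ n, InnerProductSpace ℂ (E n)]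

/-- The sequences with finitely many nonzero components. -/
def finiteVectors (E : ℕ → Type*) [∀ n, NormedAddCommGroup (E n)]
    [∀ n, InnerProductSpace ℂ (E n)] : Submodule ℂ (lp E 2) where
  carrier := {Ψ | ∃ N, ∀ n ≥ N, Ψ n = 0}
  add_mem' := by
    rintro Ψ Θ ⟨N, hN⟩ ⟨M, hM⟩
    refine ⟨max N M, fun n hn => ?_⟩
    rw [lp.coeFn_add, Pi.add_apply, hN n (le_of_max_le_left hn), hM n (le_of_max_le_right hn),
      add_zero]
  zero_mem' := ⟨0, fun n _ => rfl⟩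
  smul_mem' := by
    rintro c Ψ ⟨N, hN⟩
    refine ⟨N, fun n hn => ?_⟩
    rw [lp.coeFn_smul, Pi.smul_apply, hN n hn, smul_zero]

theorem single_mem_finiteVectors (n : ℕ) (x : E n) : lp.single 2 n x ∈ finiteVectors E :=
  ⟨n + 1, fun m hm => lp.single_apply_ne 2 n x (by omega)⟩

theorem dense_finiteVectors : Dense (finiteVectors E : Set (lp E 2)) := by
  intro Ψ
  refine mem_closure_of_tendsto (lp.hasSum_single (by norm_num) Ψ)
    (Eventually.of_forall fun s => ?_)
  exact Submodule.sum_mem _ fun n _ => single_mem_finiteVectors n _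

/-- A pair of mutually adjoint lowering and raising operators on a graded Hilbert space, with the
bounds of annihilation and creation operators. -/
structure LadderPair (E : ℕ → Type*) [∀ n, NormedAddCommGroup (E n)]
    [∀ n, InnerProductSpace ℂ (E n)] where
  lower : ∀ n, E (n + 1) →L[ℂ] E n
  raise : ∀ n, E n →L[ℂ] E (n + 1)
  adj : ∀ n x y, inner ℂ (raise n x) y = inner ℂ x (lower n y)
  bound : ℝ
  bound_nonneg : 0 ≤ bound
  norm_lower : ∀ n x, ‖lower n x‖ ≤ bound * √(n + 1 : ℝ) * ‖x‖
  norm_raise : ∀ n x, ‖raise n x‖ ≤ bound * √(n + 1 : ℝ) * ‖x‖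

namespace LadderPair

variable (L : LadderPair E)

theorem adj' (n : ℕ) (x : E (n + 1)) (y : E n) :
    inner ℂ (L.lower n x) y = inner ℂ x (L.raise n y) := by
  rw [← inner_conj_symm, ← L.adj, inner_conj_symm]

/-- The components of the raised vector. -/
def raiseComp : (n : ℕ) → lp E 2 →L[ℂ] E n
  | 0 => 0
  | n + 1 => L.raise n ∘L lp.evalCLM ℂ E 2 n

/-- The components of the sum of the lowered and the raised vector. -/
def comp (n : ℕ) : lp E 2 →L[ℂ] E n :=
  L.lower n ∘L lp.evalCLM ℂ E 2 (n + 1) + L.raiseComp n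

theorem comp_apply (n : ℕ) (Ψ : lp E 2) :
    L.comp n Ψ = L.lower n (Ψ (n + 1)) + L.raiseComp n Ψ := rfl

theorem raiseComp_succ (n : ℕ) (Ψ : lp E 2) : L.raiseComp (n + 1) Ψ = L.raise n (Ψ n) := rfl

theorem comp_eq_zero {Ψ : lp E 2} {N : ℕ} (h : ∀ n ≥ N, Ψ n = 0) {n : ℕ} (hn : N + 1 ≤ n) :
    L.comp n Ψ = 0 := by
  obtain ⟨n, rfl⟩ : ∃ k, n = k + 1 := ⟨n - 1, by omega⟩
  rw [comp_apply, raiseComp_succ, h _ (by omega), h _ (by omega), map_zero, map_zero, add_zero]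

theorem norm_comp_sq_le {Ψ : lp E 2} {N : ℕ} (h : ∀ n ≥ N, Ψ n = 0) (n : ℕ) :
    ‖L.comp n Ψ‖ ^ 2 ≤ 2 * L.bound ^ 2 * (N + 1) * ‖Ψ (n + 1)‖ ^ 2 +
      2 * L.bound ^ 2 * (N + 1) * (if n = 0 then 0 else ‖Ψ (n - 1)‖ ^ 2) := by
  have h1 : ‖L.lower n (Ψ (n + 1))‖ ^ 2 ≤ L.bound ^ 2 * (N + 1) * ‖Ψ (n + 1)‖ ^ 2 := by
    by_cases hn : N ≤ n + 1
    · rw [h _ hn, map_zero, norm_zero]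
      simp
    · refine (pow_le_pow_left₀ (norm_nonneg _) (L.norm_lower n _) 2).trans ?_
      rw [mul_pow, mul_pow, Real.sq_sqrt (by positivity)]
      have : (n : ℝ) ≤ N := by exact_mod_cast (by omega : n ≤ N)
      gcongr
  have h2 : ‖L.raiseComp n Ψ‖ ^ 2 ≤
      L.bound ^ 2 * (N + 1) * (if n = 0 then 0 else ‖Ψ (n - 1)‖ ^ 2) := by
    cases n with
    | zero => simp [raiseComp]
    | succ n =>
      rw [raiseComp_succ, if_neg (Nat.succ_ne_zero n), Nat.add_sub_cancel]
      by_cases hn : N ≤ n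
      · rw [h _ hn, map_zero, norm_zero]
        simp
      · refine (pow_le_pow_left₀ (norm_nonneg _) (L.norm_raise n _) 2).trans ?_
        rw [mul_pow, mul_pow, Real.sq_sqrt (by positivity)]
        have : (n : ℝ) ≤ N := by exact_mod_cast (by omega : n ≤ N)
        gcongr
  have h3 : ‖L.comp n Ψ‖ ^ 2 ≤ 2 * ‖L.lower n (Ψ (n + 1))‖ ^ 2 + 2 * ‖L.raiseComp n Ψ‖ ^ 2 := by
    have := norm_add_le (L.lower n (Ψ (n + 1))) (L.raiseComp n Ψ)
    rw [← comp_apply] at this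
    nlinarith [norm_nonneg (L.comp n Ψ), sq_nonneg (‖L.lower n (Ψ (n + 1))‖ - ‖L.raiseComp n Ψ‖)]
  linarith

theorem hasSum_shift (Ψ : lp E 2) :
    HasSum (fun n => if n = 0 then 0 else ‖Ψ (n - 1)‖ ^ 2) (‖Ψ‖ ^ 2) := by
  rw [← hasSum_nat_add_iff' 1]
  simpa using lp_two_hasSum_norm_sq Ψ

theorem summable_succ (Ψ : lp E 2) : Summable fun n => ‖Ψ (n + 1)‖ ^ 2 :=
  (summable_nat_add_iff 1).2 (lp_two_hasSum_norm_sq Ψ).summable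

theorem tsum_succ_le (Ψ : lp E 2) : ∑' n, ‖Ψ (n + 1)‖ ^ 2 ≤ ‖Ψ‖ ^ 2 := by
  have h := (lp_two_hasSum_norm_sq Ψ).summable.tsum_eq_zero_add
  rw [(lp_two_hasSum_norm_sq Ψ).tsum_eq] at h
  rw [h]
  linarith [sq_nonneg ‖Ψ 0‖]

theorem summable_comp {Ψ : lp E 2} (hΨ : Ψ ∈ finiteVectors E) :
    Summable fun n => ‖L.comp n Ψ‖ ^ 2 := by
  obtain ⟨N, hN⟩ := hΨ
  exact Summable.of_nonneg_of_le (fun n => sq_nonneg _) (L.norm_comp_sq_le hN)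
    (((summable_succ Ψ).mul_left _).add ((hasSum_shift Ψ).summable.mul_left _))

/-- The sum of the lowering and the raising operator on finite vectors. -/
def onFinite : finiteVectors E →ₗ[ℂ] finiteVectors E where
  toFun Ψ := ⟨⟨fun n => L.comp n Ψ, memℓp_two_of_summable (L.summable_comp Ψ.2)⟩, by
    obtain ⟨N, hN⟩ := Ψ.2
    exact ⟨N + 1, fun n hn => L.comp_eq_zero hN hn⟩⟩
  map_add' Ψ Θ := by
    ext n
    exact map_add (L.comp n) _ _
  map_smul' c Ψ := by
    ext n
    exact map_smul (L.comp n) _ _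

theorem onFinite_apply (Ψ : finiteVectors E) (n : ℕ) :
    ((L.onFinite Ψ : finiteVectors E) : lp E 2) n = L.comp n Ψ := rfl

theorem norm_onFinite_le {Ψ : finiteVectors E} {N : ℕ} (h : ∀ n ≥ N, (Ψ : lp E 2) n = 0) :
    ‖(L.onFinite Ψ : lp E 2)‖ ≤ 2 * L.bound * √(N + 1 : ℝ) * ‖(Ψ : lp E 2)‖ := by
  refine (pow_le_pow_iff_left₀ (norm_nonneg _) (mul_nonneg (mul_nonneg (mul_nonneg two_pos.le
    L.bound_nonneg) (Real.sqrt_nonneg _)) (norm_nonneg _)) two_ne_zero).1 ?_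
  rw [← (lp_two_hasSum_norm_sq _).tsum_eq]
  have h2 := (hasSum_shift (Ψ : lp E 2)).summable.mul_left (2 * L.bound ^ 2 * (N + 1))
  have h1 := (summable_succ (Ψ : lp E 2)).mul_left (2 * L.bound ^ 2 * (N + 1))
  refine ((L.summable_comp Ψ.2).tsum_le_tsum (L.norm_comp_sq_le h) (h1.add h2)).trans ?_
  rw [h1.tsum_add h2, tsum_mul_left, tsum_mul_left, (hasSum_shift _).tsum_eq, mul_pow, mul_pow,
    mul_pow, Real.sq_sqrt (by positivity)]
  have h3 := mul_le_mul_of_nonneg_left (tsum_succ_le (Ψ : lp E 2))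
    (by positivity : 0 ≤ 2 * L.bound ^ 2 * ((N : ℝ) + 1))
  linarith

theorem hasSum_inner_raiseComp {Ψ Θ : lp E 2} {s : ℂ}
    (h : HasSum (fun n => inner ℂ (L.lower n (Ψ (n + 1))) (Θ n)) s) :
    HasSum (fun n => inner ℂ (Ψ n) (L.raiseComp n Θ)) s := by
  rw [← hasSum_nat_add_iff' 1]
  have e : inner ℂ (Ψ 0) (L.raiseComp 0 Θ) = 0 := inner_zero_right _
  simp only [raiseComp_succ, Finset.range_one, Finset.sum_singleton, e, sub_zero, ← adj']
  exact h

theorem inner_onFinite (Ψ Θ : finiteVectors E) :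
    inner ℂ (L.onFinite Ψ : lp E 2) (Θ : lp E 2) =
      inner ℂ (Ψ : lp E 2) (L.onFinite Θ : lp E 2) := by
  obtain ⟨N, hN⟩ := Ψ.2
  obtain ⟨M, hM⟩ := Θ.2
  have h1 : Summable fun n => inner ℂ (L.lower n ((Ψ : lp E 2) (n + 1))) ((Θ : lp E 2) n) :=
    summable_of_ne_finset_zero (s := Finset.range M) fun n hn => by
      rw [hM n (by simpa using hn), inner_zero_right]
  have h2 : Summable fun n => inner ℂ (L.lower n ((Θ : lp E 2) (n + 1))) ((Ψ : lp E 2) n) :=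
    summable_of_ne_finset_zero (s := Finset.range N) fun n hn => by
      rw [hN n (by simpa using hn), inner_zero_right]
  have h3 := L.hasSum_inner_raiseComp h1.hasSum
  have h4 := (L.hasSum_inner_raiseComp h2.hasSum).mapL (Complex.conjCLE : ℂ →L[ℝ] ℂ)
  have h5 := h2.hasSum.mapL (Complex.conjCLE : ℂ →L[ℝ] ℂ)
  have e : ∀ x : ℂ, (Complex.conjCLE : ℂ →L[ℝ] ℂ) x = starRingEnd ℂ x := fun x => rfl
  simp only [e, inner_conj_symm] at h4 h5
  have h6 := h1.hasSum.add h4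
  have h7 := h5.add h3
  rw [add_comm] at h7
  have h8 := lp.hasSum_inner (𝕜 := ℂ) (L.onFinite Ψ : lp E 2) (Θ : lp E 2)
  have h9 := lp.hasSum_inner (𝕜 := ℂ) (Ψ : lp E 2) (L.onFinite Θ : lp E 2)
  simp only [onFinite_apply, comp_apply, inner_add_left] at h8
  simp only [onFinite_apply, comp_apply, inner_add_right] at h9
  rw [h8.unique h6, h9.unique h7]

/-- The closed relation `χ = comp Ψ` between sequences. -/
def relation : Submodule ℂ (lp E 2 × lp E 2) where
  carrier := {p | ∀ n, p.2 n = L.comp n p.1}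
  add_mem' := by
    intro p q hp hq n
    rw [Prod.fst_add, map_add, ← hp, ← hq]
    rfl
  zero_mem' := by
    intro n
    rw [Prod.fst_zero, map_zero]
    rfl
  smul_mem' := by
    intro c p hp n
    rw [Prod.smul_fst, map_smul, ← hp]
    rfl

theorem isClosed_relation : IsClosed (L.relation : Set (lp E 2 × lp E 2)) := by
  have : (L.relation : Set (lp E 2 × lp E 2)) =
      ⋂ n, {p | lp.evalCLM ℂ E 2 n p.2 = L.comp n p.1} := by
    ext p
    simp only [Set.mem_iInter]
    rfl
  rw [this]
  exact isClosed_iInter fun n => isClosed_eq (by fun_prop) (by fun_prop)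

/-- The graph of the restriction to finite vectors. -/
def finiteGraph : Submodule ℂ (lp E 2 × lp E 2) :=
  LinearMap.range ((finiteVectors E).subtype.prod ((finiteVectors E).subtype ∘ₗ L.onFinite))

theorem finiteGraph_le_relation : L.finiteGraph ≤ L.relation := by
  rintro _ ⟨Ψ, rfl⟩
  exact fun n => rfl

theorem mem_finiteGraph_iff {p : lp E 2 × lp E 2} :
    p ∈ L.finiteGraph ↔ (∃ N, ∀ n ≥ N, p.1 n = 0) ∧ ∀ n, p.2 n = L.comp n p.1 := by
  constructor
  · rintro ⟨Ψ, rfl⟩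
    exact ⟨Ψ.2, fun n => rfl⟩
  · rintro ⟨h1, h2⟩
    exact ⟨⟨p.1, h1⟩, Prod.ext rfl (lp.ext (funext fun n => (h2 n).symm))⟩

theorem closure_le_relation : L.finiteGraph.topologicalClosure ≤ L.relation :=
  Submodule.topologicalClosure_minimal _ L.finiteGraph_le_relation L.isClosed_relation

theorem toLinearPMap_graph_of_le_relation {G : Submodule ℂ (lp E 2 × lp E 2)}
    (hG : G ≤ L.relation) : G.toLinearPMap.graph = G := by
  refine Submodule.toLinearPMap_graph_eq _ fun p hp hp1 => ?_
  refine lp.ext (funext fun n => ?_)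
  rw [hG hp n, hp1, map_zero]
  rfl

theorem isEntireCore : IsEntireCore L.finiteGraph.topologicalClosure.toLinearPMap
    (finiteVectors E) L.onFinite where
  dense := dense_finiteVectors
  symm := L.inner_onFinite
  mem_graph Ψ := by
    rw [L.toLinearPMap_graph_of_le_relation L.closure_le_relation]
    exact Submodule.le_topologicalClosure _ ⟨Ψ, rfl⟩
  isClosed := by
    rw [L.toLinearPMap_graph_of_le_relation L.closure_le_relation]
    exact Submodule.isClosed_topologicalClosure _
  subset_closure := by
    rw [L.toLinearPMap_graph_of_le_relation L.closure_le_relation,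
      Submodule.topologicalClosure_coe]
    exact closure_mono (by rintro _ ⟨Ψ, rfl⟩; exact ⟨Ψ, rfl⟩)
  entire Ψ := by
    obtain ⟨N, hN⟩ := Ψ.2
    have hs : ∀ k, ∀ n ≥ N + k, (((L.onFinite ^ k) Ψ : finiteVectors E) : lp E 2) n = 0 := by
      intro k
      induction k with
      | zero => simpa using hN
      | succ k ih =>
        intro n hn
        rw [pow_succ', Module.End.mul_apply, onFinite_apply]
        exact L.comp_eq_zero ih hn
    refine isEntireSeq_of_norm_succ_le (C := 2 * L.bound) (N := N)
      (mul_nonneg two_pos.le L.bound_nonneg) fun k => ?_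
    rw [pow_succ', Module.End.mul_apply]
    have := L.norm_onFinite_le (hs k)
    push_cast at this
    exact this

theorem norm_inner_le_of_mem_relation {Ψ Θ : lp E 2} (h : (Ψ, Θ) ∈ L.relation) {b : ℕ → ℝ}
    {B : ℝ} (hb : ∀ n, ‖L.lower n (Ψ (n + 1))‖ ≤ b n) (hB : HasSum (fun n => b n ^ 2) B) :
    ‖(inner ℂ Ψ Θ : ℂ)‖ ≤ 2 * √B * ‖Ψ‖ := by
  have hb0 : ∀ n, 0 ≤ b n := fun n => (norm_nonneg _).trans (hb n)
  have hΨ := lp_two_hasSum_norm_sq Ψ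
  obtain ⟨hs, hle⟩ := Real.summable_and_inner_le_Lp_mul_Lq_tsum_of_nonneg (p := 2) (q := 2)
    (f := fun n => ‖Ψ n‖) (g := b) Real.HolderConjugate.two_two (fun n => norm_nonneg _) hb0
    (by simpa using hΨ.summable) (by simpa using hB.summable)
  simp only [Real.rpow_two] at hle
  rw [hΨ.tsum_eq, hB.tsum_eq, ← Real.sqrt_eq_rpow, ← Real.sqrt_eq_rpow,
    Real.sqrt_sq (norm_nonneg _)] at hle
  set S := ∑' n, ‖Ψ n‖ * b n with hS
  have h2 : HasSum (fun n => if n = 0 then 0 else ‖Ψ (n - 1)‖ * b (n - 1)) S := by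
    rw [← hasSum_nat_add_iff' 1]
    simpa using hs.hasSum
  have h3 := lp.hasSum_inner (𝕜 := ℂ) Ψ Θ
  have h4 := hs.hasSum.add h2
  have h5 : ∀ n, ‖(inner ℂ (Ψ n) (Θ n) : ℂ)‖ ≤
      ‖Ψ n‖ * b n + (if n = 0 then 0 else ‖Ψ (n - 1)‖ * b (n - 1)) := by
    intro n
    have e : Θ n = L.comp n Ψ := h n
    rw [e, comp_apply, inner_add_right]
    refine (norm_add_le _ _).trans (add_le_add ?_ ?_)
    · exact (norm_inner_le_norm _ _).trans (mul_le_mul_of_nonneg_left (hb n) (norm_nonneg _))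
    · cases n with
      | zero => simp [raiseComp]
      | succ n =>
        rw [raiseComp_succ, if_neg (Nat.succ_ne_zero n), Nat.add_sub_cancel, ← adj']
        refine (norm_inner_le_norm _ _).trans ?_
        rw [mul_comm]
        exact mul_le_mul_of_nonneg_left (hb n) (norm_nonneg _)
  have h6 := h3.norm_le_of_bounded h4 h5
  linarith

end LadderPair

end Graded
end

noncomputable section

section Segal

variable {d : ℕ}

/-- The annihilation and creation parts of the Segal field operator. -/
def segalPair (f : OnePhoton d) : LadderPair fun n : ℕ => symSector d n where
  lower n := (√2 : ℂ)⁻¹ • annihilate d n f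
  raise n := (√2 : ℂ)⁻¹ • create d n f
  adj n x y := by
    refine (inner_smul_left (𝕜 := ℂ) (create d n f x) y (√2 : ℂ)⁻¹).trans ?_
    refine Eq.trans ?_ (inner_smul_right (𝕜 := ℂ) x (annihilate d n f y) (√2 : ℂ)⁻¹).symm
    rw [← Complex.ofReal_inv, Complex.conj_ofReal]
    exact congrArg _ (inner_create f x y)
  bound := (√2)⁻¹ * ‖f‖
  bound_nonneg := by positivity
  norm_lower n x := by
    refine (norm_smul (√2 : ℂ)⁻¹ (annihilate d n f x)).trans_le ?_
    rw [norm_inv, Complex.norm_real, Real.norm_of_nonneg (Real.sqrt_nonneg _)]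
    refine (mul_le_mul_of_nonneg_left (norm_annihilate_le f x) (by positivity)).trans_eq ?_
    ring
  norm_raise n x := by
    refine (norm_smul (√2 : ℂ)⁻¹ (create d n f x)).trans_le ?_
    rw [norm_inv, Complex.norm_real, Real.norm_of_nonneg (Real.sqrt_nonneg _)]
    refine (mul_le_mul_of_nonneg_left (norm_create_le f x) (by positivity)).trans_eq ?_
    ring

theorem segalPair_comp (f : OnePhoton d) (n : ℕ) (Ψ : Fock d) :
    (segalPair f).comp n Ψ = fieldComp f n Ψ := by
  rw [fieldComp_apply]
  refine Eq.trans ?_ (smul_add (√2 : ℂ)⁻¹ (annihilate d n f (Ψ (n + 1))) (createComp f n Ψ)).symm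
  cases n with
  | zero => exact congrArg (fun z => (√2 : ℂ)⁻¹ • annihilate d 0 f (Ψ 1) + z) (smul_zero _).symm
  | succ n => rfl

theorem symSector_ext {n : ℕ} {X Y : symSector d n}
    (h : (X : Sector d n) =ᵐ[photonMeasureN d n] (Y : Sector d n)) : X = Y :=
  Subtype.ext (Lp.ext h)

theorem fock_ext {Ψ Θ : Fock d} (h : ∀ n, photonFn Ψ n =ᵐ[photonMeasureN d n] photonFn Θ n) :
    Ψ = Θ :=
  lp.ext (funext fun n => symSector_ext (h n))

theorem segalField_eq {f : PhotonSpace d → ℂ} (hf : MemLp f 2 (photonMeasure d)) :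
    segalField f = (segalPair (hf.toLp f)).finiteGraph.topologicalClosure.toLinearPMap := by
  have h : {p : Fock d × Fock d | (∃ N, ∀ n ≥ N, p.1 n = 0) ∧
      ∀ n, photonFn p.2 n =ᵐ[photonMeasureN d n] fun k =>
        (√2 : ℂ)⁻¹ * (annihilation f p.1 n k + creation f p.1 n k)} =
      ((segalPair (hf.toLp f)).finiteGraph : Set (Fock d × Fock d)) := by
    ext p
    rw [SetLike.mem_coe, LadderPair.mem_finiteGraph_iff]
    refine and_congr_right fun _ => forall_congr' fun n => ?_
    rw [segalPair_comp]
    refine ⟨fun h => symSector_ext (h.trans (photonFn_fieldComp hf p.1 n).symm), fun h => ?_⟩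
    have := photonFn_fieldComp hf p.1 n
    rw [← h] at this
    exact this
  exact congrArg (fun G : Submodule ℂ (Fock d × Fock d) => G.topologicalClosure.toLinearPMap)
    ((congrArg (Submodule.span ℂ) h).trans (Submodule.span_eq _))

theorem segalField_graph {f : PhotonSpace d → ℂ} (hf : MemLp f 2 (photonMeasure d)) :
    (segalField f).graph = (segalPair (hf.toLp f)).finiteGraph.topologicalClosure := by
  rw [segalField_eq hf]
  exact (segalPair _).toLinearPMap_graph_of_le_relation (segalPair _).closure_le_relation

/-- Multiplication of a symmetric function by a bounded symmetric function. -/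
theorem exists_symSector_mul {n : ℕ} {m : (Fin n → PhotonSpace d) → ℂ} (hm : Measurable m) {C : ℝ}
    (hC : ∀ k, ‖m k‖ ≤ C) (hsymm : ∀ (σ : Equiv.Perm (Fin n)) k, m (k ∘ σ) = m k)
    (X : symSector d n) : ∃ Y : symSector d n,
      (Y : Sector d n) =ᵐ[photonMeasureN d n] fun k => m k * (X : Sector d n) k := by
  have hmem : MemLp (fun k => m k * (X : Sector d n) k) 2 (photonMeasureN d n) :=
    MemLp.of_le_mul (c := C) (Lp.memLp (X : Sector d n))
      (hm.aestronglyMeasurable.mul (Lp.aestronglyMeasurable _)) (Eventually.of_forall fun k => by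
        rw [norm_mul]
        exact mul_le_mul_of_nonneg_right (hC k) (norm_nonneg _))
  refine ⟨⟨hmem.toLp _, mem_symSector.2 fun σ => Lp.ext ?_⟩, hmem.coeFn_toLp⟩
  have hX := mem_symSector.1 X.2 σ
  have hX' : (X : Sector d n) =ᵐ[photonMeasureN d n] fun k => (X : Sector d n) (k ∘ σ) := by
    conv_lhs => rw [← hX]
    exact coeFn_permL σ _
  filter_upwards [coeFn_permL σ (hmem.toLp _), hmem.coeFn_toLp,
    (measurePreserving_perm d n σ).quasiMeasurePreserving.ae hmem.coeFn_toLp, hX'] with k h1 h2 h3 h4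
  rw [h1, h2, h3, hsymm, h4]

end Segal

section SecondQuantization

variable {d : ℕ} {w : PhotonSpace d → ℝ}

theorem mem_secondQuantization_graph {p : Fock d × Fock d} :
    p ∈ (secondQuantization w).graph ↔ ∀ n, photonFn p.2 n =ᵐ[photonMeasureN d n]
      fun k => ((∑ i, w (k i) : ℝ) : ℂ) * photonFn p.1 n k := by
  rw [secondQuantization, Submodule.toLinearPMap_graph_eq]
  · rfl
  · intro p hp hp1
    refine fock_ext fun n => (hp n).trans ?_
    rw [hp1]
    have h0 : photonFn (0 : Fock d) n =ᵐ[photonMeasureN d n] 0 := Lp.coeFn_zero _ _ _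
    filter_upwards [h0] with k hk
    rw [hk, Pi.zero_apply, mul_zero]

theorem isClosed_secondQuantization_graph :
    IsClosed ((secondQuantization w).graph : Set (Fock d × Fock d)) := by
  have : ((secondQuantization w).graph : Set (Fock d × Fock d)) =
      ⋂ n, (fun p : Fock d × Fock d => (((p.1 n : symSector d n) : Sector d n),
        ((p.2 n : symSector d n) : Sector d n))) ⁻¹' {q : Sector d n × Sector d n |
          ∀ᵐ k ∂photonMeasureN d n,
            (q.1 k, q.2 k) ∈ {z : ℂ × ℂ | z.2 = ((∑ i, w (k i) : ℝ) : ℂ) * z.1}} := by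
    ext p
    rw [SetLike.mem_coe, mem_secondQuantization_graph, Set.mem_iInter]
    rfl
  rw [this]
  refine isClosed_iInter fun n => IsClosed.preimage ?_ (isClosed_ae_relation
    (Eventually.of_forall fun k => isClosed_eq (by fun_prop) (by fun_prop)))
  have h : Continuous fun Ψ : Fock d => ((Ψ n : symSector d n) : Sector d n) :=
    continuous_subtype_val.comp (evalFock d n).continuous
  exact (h.comp continuous_fst).prodMk (h.comp continuous_snd)

theorem inner_secondQuantization {p q : Fock d × Fock d} (hp : p ∈ (secondQuantization w).graph)
    (hq : q ∈ (secondQuantization w).graph) : inner ℂ p.2 q.1 = inner ℂ p.1 q.2 := by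
  rw [mem_secondQuantization_graph] at hp hq
  rw [lp.inner_eq_tsum, lp.inner_eq_tsum]
  refine tsum_congr fun n => ?_
  rw [Submodule.coe_inner, Submodule.coe_inner, L2.inner_def, L2.inner_def]
  refine integral_congr_ae ?_
  filter_upwards [hp n, hq n] with k h1 h2
  change inner ℂ (photonFn p.2 n k) (photonFn q.1 n k) = inner ℂ (photonFn p.1 n k) (photonFn q.2 n k)
  rw [h1, h2, RCLike.inner_apply, RCLike.inner_apply, map_mul, Complex.conj_ofReal]
  ring

/-- The finite particle vectors in the domain of `dΓ(w)`. -/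
def secondQuantizationCore (w : PhotonSpace d → ℝ) : Submodule ℂ (Fock d) :=
  finiteVectors (fun n : ℕ => symSector d n) ⊓ (secondQuantization w).domain

theorem dense_secondQuantizationCore (hw : Measurable w) :
    Dense (secondQuantizationCore w : Set (Fock d)) := by
  refine dense_of_forall_inner_eq_zero fun Ψ hΨ => fock_ext fun n => ?_
  have hS : Measurable fun k : Fin n → PhotonSpace d => ∑ i, w (k i) :=
    Finset.measurable_sum _ fun i _ => hw.comp (measurable_pi_apply i)
  have hsymm : ∀ (σ : Equiv.Perm (Fin n)) (k : Fin n → PhotonSpace d),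
      ∑ i, w ((k ∘ σ) i) = ∑ i, w (k i) := fun σ k => Equiv.sum_comp σ fun i => w (k i)
  have hS' : ∀ R : ℕ, MeasurableSet {k : Fin n → PhotonSpace d | |∑ i, w (k i)| ≤ R} :=
    fun R => measurableSet_le hS.abs measurable_const
  have key : ∀ R : ℕ, ∀ᵐ k ∂photonMeasureN d n, |∑ i, w (k i)| ≤ R → photonFn Ψ n k = 0 := by
    intro R
    obtain ⟨Y, hY⟩ := exists_symSector_mul (d := d) (n := n)
      (m := fun k => if |∑ i, w (k i)| ≤ R then 1 else 0) (C := 1)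
      (Measurable.ite (hS' R) measurable_const measurable_const)
      (fun k => by split_ifs <;> simp) (fun σ k => by simp only [hsymm σ k]) (Ψ n)
    obtain ⟨Z, hZ⟩ := exists_symSector_mul (d := d) (n := n)
      (m := fun k => if |∑ i, w (k i)| ≤ R then ((∑ i, w (k i) : ℝ) : ℂ) else 0) (C := R)
      (Measurable.ite (hS' R) (Complex.measurable_ofReal.comp hS) measurable_const)
      (fun k => by
        split_ifs with h
        · rwa [Complex.norm_real, Real.norm_eq_abs]
        · simp) (fun σ k => by simp only [hsymm σ k]) (Ψ n)
    have hYd : (lp.single 2 n Y, lp.single 2 n Z) ∈ (secondQuantization w).graph := by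
      rw [mem_secondQuantization_graph]
      intro m
      by_cases hm : m = n
      · subst hm
        have e1 : photonFn (lp.single 2 m Y : Fock d) m = (Y : Sector d m) := by
          rw [photonFn, lp.single_apply_self]
        have e2 : photonFn (lp.single 2 m Z : Fock d) m = (Z : Sector d m) := by
          rw [photonFn, lp.single_apply_self]
        simp only [e1, e2]
        filter_upwards [hY, hZ] with k h1 h2
        rw [h1, h2]
        split_ifs <;> simp
      · have e : ∀ W : symSector d n, photonFn (lp.single 2 n W : Fock d) m
            =ᵐ[photonMeasureN d m] 0 := by
          intro W
          rw [photonFn, lp.single_apply_ne _ _ _ hm]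
          exact Lp.coeFn_zero _ _ _
        filter_upwards [e Y, e Z] with k h1 h2
        simp only [h1, h2, Pi.zero_apply, mul_zero]
    have h0 := hΨ (lp.single 2 n Y)
      ⟨single_mem_finiteVectors (E := fun n : ℕ => symSector d n) n Y, LinearPMap.mem_domain_of_mem_graph hYd⟩
    rw [lp.inner_single_left, Submodule.coe_inner, L2.inner_def] at h0
    have h1 : ∫ k, (if |∑ i, w (k i)| ≤ R then ‖photonFn Ψ n k‖ ^ 2 else 0) ∂photonMeasureN d n
        = 0 := by
      rw [← Complex.ofReal_inj, ← integral_complex_ofReal, Complex.ofReal_zero, ← h0]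
      refine integral_congr_ae ?_
      filter_upwards [hY] with k hk
      rw [hk, RCLike.inner_apply]
      split_ifs
      · rw [one_mul, mul_comm, ← Complex.normSq_eq_conj_mul_self, Complex.normSq_eq_norm_sq]
        rfl
      · simp
    have hi : Integrable (fun k => if |∑ i, w (k i)| ≤ R then ‖photonFn Ψ n k‖ ^ 2 else 0)
        (photonMeasureN d n) := by
      have h2 := ((Lp.memLp ((Ψ n : symSector d n) : Sector d n)).integrable_norm_pow
        (by norm_num)).indicator (hS' R)
      refine h2.congr (Eventually.of_forall fun k => ?_)
      simp only [Set.indicator_apply]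
      rfl
    rw [integral_eq_zero_iff_of_nonneg (fun k => by positivity) hi] at h1
    filter_upwards [h1] with k hk hR
    simpa [hR] using hk
  have h0 : photonFn (0 : Fock d) n =ᵐ[photonMeasureN d n] 0 := Lp.coeFn_zero _ _ _
  filter_upwards [ae_all_iff.2 key, h0] with k hk h0
  obtain ⟨R, hR⟩ := exists_nat_ge |∑ i, w (k i)|
  rw [hk R hR, h0]
  rfl

end SecondQuantization
end

noncomputable section

theorem hasSum_re_inner {E : ℕ → Type*} [∀ n, NormedAddCommGroup (E n)]
    [∀ n, InnerProductSpace ℂ (E n)] (Ψ Θ : lp E 2) :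
    HasSum (fun n => (inner ℂ (Ψ n) (Θ n) : ℂ).re) (inner ℂ Ψ Θ : ℂ).re :=
  Complex.hasSum_re (lp.hasSum_inner (𝕜 := ℂ) Ψ Θ)

theorem LadderPair.norm_inner_le_of_hasSum {E : ℕ → Type*} [∀ n, NormedAddCommGroup (E n)]
    [∀ n, InnerProductSpace ℂ (E n)] (L : LadderPair E) {Ψ Θ : lp E 2} (h : (Ψ, Θ) ∈ L.relation)
    {e : ℕ → ℝ} {A γ : ℝ} (hγ : 0 ≤ γ) (he0 : ∀ n, 0 ≤ e n) (hsum : HasSum e A)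
    (hL : ∀ n, ‖L.lower n (Ψ (n + 1))‖ ≤ (√2)⁻¹ * γ * √(e (n + 1))) :
    ‖(inner ℂ Ψ Θ : ℂ)‖ ≤ √2 * γ * √A * ‖Ψ‖ := by
  have hsum' : HasSum (fun n => ((√2)⁻¹ * γ * √(e (n + 1))) ^ 2) (2⁻¹ * γ ^ 2 * (A - e 0)) := by
    have h := ((hasSum_nat_add_iff' 1).2 hsum).mul_left (2⁻¹ * γ ^ 2)
    rw [Finset.sum_range_one] at h
    have e1 : (fun n => ((√2)⁻¹ * γ * √(e (n + 1))) ^ 2) = fun n => 2⁻¹ * γ ^ 2 * e (n + 1) := by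
      funext n
      rw [mul_pow, mul_pow, Real.sq_sqrt (he0 _), inv_pow, Real.sq_sqrt two_pos.le]
    exact e1 ▸ h
  refine (L.norm_inner_le_of_mem_relation h hL hsum').trans
    (mul_le_mul_of_nonneg_right ?_ (norm_nonneg _))
  have h2 : √(2⁻¹ * γ ^ 2 * (A - e 0)) ≤ (√2)⁻¹ * γ * √A := by
    rw [Real.sqrt_mul (by positivity), Real.sqrt_mul (by positivity), Real.sqrt_sq hγ,
      Real.sqrt_inv]
    exact mul_le_mul_of_nonneg_left (Real.sqrt_le_sqrt (by linarith [he0 0])) (by positivity)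
  refine (mul_le_mul_of_nonneg_left h2 two_pos.le).trans_eq ?_
  have h3 : 2 * (√2)⁻¹ = √2 := by
    rw [← div_eq_mul_inv, Real.div_sqrt]
  rw [← mul_assoc, ← mul_assoc, h3]

section EnergyBound

variable {d : ℕ} {w : PhotonSpace d → ℝ}

theorem integrable_conj_mul {n : ℕ} (X Y : Sector d n) :
    Integrable (fun k => starRingEnd ℂ (X k) * Y k) (photonMeasureN d n) := by
  have h := L2.integrable_inner (𝕜 := ℂ) X Y
  refine h.congr (Eventually.of_forall fun k => ?_)
  simp only [RCLike.inner_apply]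
  ring

theorem norm_annihilate_sq_le (hw : Measurable w) (hw0 : ∀ y, 0 ≤ w y) {g G : OnePhoton d}
    (hG : g =ᵐ[photonMeasure d] fun y => (√(w y) : ℂ) * G y) {n : ℕ} {X : symSector d (n + 1)}
    {Y : Sector d (n + 1)} (hY : Y =ᵐ[photonMeasureN d (n + 1)]
      fun k => ((∑ i, w (k i) : ℝ) : ℂ) * (X : Sector d (n + 1)) k) :
    ‖annihilate d n g X‖ ^ 2 ≤ ‖G‖ ^ 2 * (inner ℂ (X : Sector d (n + 1)) Y).re := by
  set X' : Sector d (n + 1) := X.1 with hX'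
  have hi : Integrable (fun k => ∑ i, w (k i) * ‖X' k‖ ^ 2) (photonMeasureN d (n + 1)) := by
    refine (integrable_conj_mul X' Y).re.congr ?_
    filter_upwards [hY] with k hk
    rw [hk, mul_left_comm, ← Complex.normSq_eq_conj_mul_self, Complex.normSq_eq_norm_sq,
      ← Finset.sum_mul, ← Complex.ofReal_mul]
    rfl
  have hm : ∀ i, AEStronglyMeasurable (fun k : Fin (n + 1) → PhotonSpace d =>
      w (k i) * ‖X' k‖ ^ 2) (photonMeasureN d (n + 1)) := fun i =>
    (hw.comp (measurable_pi_apply i)).aestronglyMeasurable.mul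
      ((Lp.aestronglyMeasurable X').norm.pow 2)
  have hi' : ∀ i, Integrable (fun k => w (k i) * ‖X' k‖ ^ 2) (photonMeasureN d (n + 1)) := by
    intro i
    refine hi.mono' (hm i) (Eventually.of_forall fun k => ?_)
    have h0 : ∀ j, 0 ≤ w (k j) * ‖X' k‖ ^ 2 := fun j => mul_nonneg (hw0 _) (sq_nonneg _)
    rw [Real.norm_of_nonneg (h0 i)]
    exact Finset.single_le_sum (f := fun j => w (k j) * ‖X' k‖ ^ 2) (fun j _ => h0 j)
      (Finset.mem_univ i)
  have hZ : MemLp (fun k => (√(w (k 0)) : ℂ) * X' k) 2 (photonMeasureN d (n + 1)) := by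
    rw [memLp_two_iff_integrable_sq_norm]
    · refine (hi' 0).congr (Eventually.of_forall fun k => ?_)
      simp only [norm_mul, mul_pow, Complex.norm_real, Real.norm_eq_abs, sq_abs,
        Real.sq_sqrt (hw0 _)]
    · exact ((Complex.measurable_ofReal.comp (hw.comp (measurable_pi_apply 0)).sqrt
        ).aestronglyMeasurable).mul (Lp.aestronglyMeasurable X')
  have hc : contract g X' = contract G (hZ.toLp _) := by
    refine ext_inner_left ℂ fun Φ => ?_
    rw [inner_contract, inner_contract, L2.inner_def, L2.inner_def]
    refine integral_congr_ae ?_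
    filter_upwards [coeFn_prepend g Φ, coeFn_prepend G Φ, hZ.coeFn_toLp, ae_first hG]
      with k h1 h2 h3 h4
    rw [h1, h2, h3, h4, RCLike.inner_apply, RCLike.inner_apply]
    simp only [map_mul, Complex.conj_ofReal]
    ring
  have hperm : ∀ i, ∫ k, w (k i) * ‖X' k‖ ^ 2 ∂photonMeasureN d (n + 1) =
      ∫ k, w (k 0) * ‖X' k‖ ^ 2 ∂photonMeasureN d (n + 1) := by
    intro i
    set σ : Equiv.Perm (Fin (n + 1)) := Equiv.swap 0 i
    have h1 := coeFn_permL σ X'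
    rw [mem_symSector.1 X.2 σ] at h1
    have h2 := (measurePreserving_perm d (n + 1) σ).integral_comp'
      (f := MeasurableEquiv.arrowCongr' σ.symm (MeasurableEquiv.refl (PhotonSpace d)))
      (fun k => w (k 0) * ‖X' k‖ ^ 2)
    rw [← h2]
    refine integral_congr_ae ?_
    filter_upwards [h1] with k hk
    have e : (MeasurableEquiv.arrowCongr' σ.symm (MeasurableEquiv.refl (PhotonSpace d))) k
        = k ∘ σ := rfl
    rw [e, Function.comp_apply, Equiv.swap_apply_left, hk]
  have hnorm : ((n : ℝ) + 1) * ‖hZ.toLp _‖ ^ 2 = (inner ℂ X' Y).re := by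
    have h1 : ‖hZ.toLp _‖ ^ 2 = ∫ k, w (k 0) * ‖X' k‖ ^ 2 ∂photonMeasureN d (n + 1) := by
      rw [← inner_self_re, L2.inner_def, ← RCLike.re_eq_complex_re, ← integral_re
        (L2.integrable_inner _ _)]
      refine integral_congr_ae ?_
      filter_upwards [hZ.coeFn_toLp] with k hk
      rw [hk, RCLike.re_eq_complex_re, inner_self_re, norm_mul, mul_pow, Complex.norm_real,
        Real.norm_eq_abs, sq_abs, Real.sq_sqrt (hw0 _)]
    have h2 : (inner ℂ X' Y).re =
        ∫ k, ∑ i, w (k i) * ‖X' k‖ ^ 2 ∂photonMeasureN d (n + 1) := by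
      rw [L2.inner_def, ← RCLike.re_eq_complex_re, ← integral_re (L2.integrable_inner _ _)]
      refine integral_congr_ae ?_
      filter_upwards [hY] with k hk
      rw [hk, RCLike.inner_apply, mul_assoc, Complex.mul_conj, Complex.normSq_eq_norm_sq,
        ← Finset.sum_mul, ← Complex.ofReal_mul]
      rfl
    rw [h2, integral_finsetSum _ fun i _ => hi' i]
    simp only [hperm, h1]
    simp
  have h1 : ‖annihilate d n g X‖ = √(n + 1 : ℝ) * ‖contract g X'‖ := by
    change ‖(annihilate d n g X : Sector d n)‖ = _
    rw [coe_annihilate, norm_smul, Complex.norm_real, Real.norm_of_nonneg (Real.sqrt_nonneg _)]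
  rw [h1, mul_pow, Real.sq_sqrt (by positivity), hc, ← hnorm]
  have h2 := pow_le_pow_left₀ (norm_nonneg _) (norm_contract_le G (hZ.toLp _)) 2
  rw [mul_pow] at h2
  nlinarith [mul_le_mul_of_nonneg_left h2 (by positivity : (0 : ℝ) ≤ n + 1)]

/-- The sector contributions to the energy. -/
theorem hasSum_energy (Ψ χ : Fock d) :
    HasSum (fun n => (inner ℂ (evalFock d n Ψ) (evalFock d n χ) : ℂ).re) (inner ℂ Ψ χ : ℂ).re := by
  have h := hasSum_re_inner (E := fun n : ℕ => symSector d n) Ψ χ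
  simp only [evalFock_apply]
  exact h

theorem energy_nonneg (hw0 : ∀ y, 0 ≤ w y) {p : Fock d × Fock d}
    (hp : p ∈ (secondQuantization w).graph) (n : ℕ) :
    0 ≤ (inner ℂ (evalFock d n p.1) (evalFock d n p.2) : ℂ).re := by
  rw [Submodule.coe_inner, L2.inner_def, ← RCLike.re_eq_complex_re, ← integral_re (L2.integrable_inner _ _)]
  refine integral_nonneg_of_ae ?_
  filter_upwards [mem_secondQuantization_graph.1 hp n] with k hk
  change 0 ≤ RCLike.re (inner ℂ (photonFn p.1 n k) (photonFn p.2 n k))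
  rw [hk, RCLike.inner_apply, mul_assoc, Complex.mul_conj, ← Complex.ofReal_mul]
  exact mul_nonneg (Finset.sum_nonneg fun i _ => hw0 _) (Complex.normSq_nonneg _)

theorem norm_segalPair_lower_le (hw : Measurable w) (hw0 : ∀ y, 0 ≤ w y) {g G : OnePhoton d}
    (hG : g =ᵐ[photonMeasure d] fun y => (√(w y) : ℂ) * G y) {Ψ χ : Fock d}
    (hχ : (Ψ, χ) ∈ (secondQuantization w).graph) (n : ℕ) :
    ‖(segalPair g).lower n (Ψ (n + 1))‖ ≤ (√2)⁻¹ * ‖G‖ *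
      √(inner ℂ (evalFock d (n + 1) Ψ) (evalFock d (n + 1) χ) : ℂ).re := by
  have h2 := norm_annihilate_sq_le hw hw0 hG (X := Ψ (n + 1))
    (mem_secondQuantization_graph.1 hχ (n + 1))
  have h3 := Real.abs_le_sqrt h2
  rw [abs_norm, Real.sqrt_mul (sq_nonneg _), Real.sqrt_sq (norm_nonneg _)] at h3
  refine (norm_smul (√2 : ℂ)⁻¹ (annihilate d n g (Ψ (n + 1)))).trans_le ?_
  rw [norm_inv, Complex.norm_real, Real.norm_of_nonneg (Real.sqrt_nonneg _), mul_assoc]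
  exact mul_le_mul_of_nonneg_left h3 (by positivity)

theorem norm_inner_segal_le (hw : Measurable w) (hw0 : ∀ y, 0 ≤ w y) {g G : OnePhoton d}
    (hG : g =ᵐ[photonMeasure d] fun y => (√(w y) : ℂ) * G y) {Ψ Θ χ : Fock d}
    (hχ : (Ψ, χ) ∈ (secondQuantization w).graph) (hΘ : (Ψ, Θ) ∈ (segalPair g).relation) :
    ‖(inner ℂ Ψ Θ : ℂ)‖ ≤ √2 * ‖G‖ * √(inner ℂ Ψ χ).re * ‖Ψ‖ :=
  (segalPair g).norm_inner_le_of_hasSum hΘ (norm_nonneg G) (energy_nonneg hw0 hχ)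
    (hasSum_energy Ψ χ) (norm_segalPair_lower_le hw hw0 hG hχ)

theorem add_mul_ge_of_abs_le {e t G N c : ℝ} (he : 0 ≤ e) (h : |t| ≤ √2 * G * √e * N) :
    -(c ^ 2 / 2 * G ^ 2 * N ^ 2) ≤ e + c * t := by
  obtain ⟨x, rfl, hx⟩ : ∃ x, x ^ 2 = e ∧ √e = x := ⟨√e, Real.sq_sqrt he, rfl⟩
  rw [hx] at h
  have h4 : |c * t| ≤ |c| * (√2 * G * x * N) := by
    rw [abs_mul]
    exact mul_le_mul_of_nonneg_left h (abs_nonneg c)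
  have h5 := (abs_le.1 h4).1
  have h6 : √2 ^ 2 = (2 : ℝ) := Real.sq_sqrt (by norm_num)
  have h7 := sq_nonneg (x - |c| * √2 * G * N / 2)
  have h8 : (|c| * √2 * G * N / 2) ^ 2 = c ^ 2 / 2 * G ^ 2 * N ^ 2 := by
    rw [div_pow, mul_pow, mul_pow, mul_pow, h6, sq_abs]
    ring
  nlinarith

/-- Completing the square. -/
theorem energy_add_segal_ge (hw : Measurable w) (hw0 : ∀ y, 0 ≤ w y) {g G : OnePhoton d}
    (hG : g =ᵐ[photonMeasure d] fun y => (√(w y) : ℂ) * G y) {Ψ Θ χ : Fock d}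
    (hχ : (Ψ, χ) ∈ (secondQuantization w).graph) (hΘ : (Ψ, Θ) ∈ (segalPair g).relation) (c : ℝ) :
    -(c ^ 2 / 2 * ‖G‖ ^ 2 * ‖Ψ‖ ^ 2) ≤ (inner ℂ Ψ χ : ℂ).re + c * (inner ℂ Ψ Θ : ℂ).re :=
  add_mul_ge_of_abs_le ((hasSum_energy Ψ χ).nonneg (energy_nonneg hw0 hχ))
    ((Complex.abs_re_le_norm _).trans (norm_inner_segal_le hw hw0 hG hχ hΘ))

end EnergyBound
end

noncomputable section

section ExpSeriesShift

open scoped Nat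

theorem IsEntireSeq.hasSum_shift {E : Type*} [NormedAddCommGroup E] [NormedSpace ℝ E]
    [CompleteSpace E] {v : ℕ → E} (hv : IsEntireSeq v) (t : ℝ) :
    HasSum (fun n : ℕ => (t ^ n / n ! : ℝ) • (n : ℝ) • v (n - 1)) (t • expSeries v t) := by
  rw [← hasSum_nat_add_iff' 1]
  simp only [Finset.range_one, Finset.sum_singleton, Nat.cast_zero, zero_smul, smul_zero, sub_zero,
    add_tsub_cancel_right]
  refine ((hv.summable t).hasSum.const_smul t).congr_fun ?_ |> fun h => h
  intro n
  rw [smul_smul, smul_smul, Nat.factorial_succ]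
  congr 1
  have := Nat.factorial_ne_zero n
  push_cast
  field_simp
  ring

theorem real_smul_mem_of_mem {H : Type*} [NormedAddCommGroup H] [NormedSpace ℂ H]
    {G : Submodule ℂ (H × H)} {a b z : H} {α : ℂ} (h : (a, α • b + z) ∈ G) (c : ℝ) :
    (c • a, α • c • b + c • z) ∈ G := by
  convert G.smul_mem (c : ℂ) h using 1
  rw [Prod.smul_mk, smul_add, Complex.coe_smul, Complex.coe_smul, Complex.coe_smul, smul_comm α]

theorem smul_natCast_succ_smul {H : Type*} [NormedAddCommGroup H] [NormedSpace ℂ H] (α : ℂ) (n : ℕ)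
    (b : H) : α • ((n + 1 : ℕ) : ℝ) • b = ((n : ℂ) + 1) • α • b := by
  rw [smul_comm α, ← Complex.coe_smul]
  push_cast
  rfl

variable {E : ℕ → Type*} [∀ n, NormedAddCommGroup (E n)] [∀ n, InnerProductSpace ℂ (E n)]

theorem expSeries_single_apply [∀ n, CompleteSpace (E n)] {Y : ∀ n, E n} (hY : IsEntireSeq fun n => lp.single (E := E) 2 n (Y n))
    (t : ℝ) (n : ℕ) :
    expSeries (fun n => lp.single (E := E) 2 n (Y n)) t n = (t ^ n / n ! : ℝ) • Y n := by
  have h := (hY.summable t).hasSum.mapL ((lp.evalCLM ℂ E 2 n).restrictScalars ℝ)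
  refine h.unique ?_
  have e : (fun b => ((lp.evalCLM ℂ E 2 n).restrictScalars ℝ)
      ((t ^ b / b ! : ℝ) • lp.single (E := E) 2 b (Y b))) =
      fun b => (t ^ b / b ! : ℝ) • (lp.single (E := E) 2 b (Y b)) n := rfl
  rw [e]
  convert hasSum_single n ?_ using 1
  · rw [lp.single_apply_self]
  · intro b hb
    rw [lp.single_apply_ne 2 b _ (Ne.symm hb), smul_zero]

namespace LadderPair

variable (L : LadderPair E)

theorem comp_single_mem (n : ℕ) (x : E (n + 1)) : (lp.single (E := E) 2 (n + 1) x,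
    lp.single (E := E) 2 n (L.lower n x) + lp.single (E := E) 2 (n + 2) (L.raise (n + 1) x)) ∈
      L.finiteGraph := by
  refine L.mem_finiteGraph_iff.2 ⟨single_mem_finiteVectors (n + 1) x, fun m => ?_⟩
  rw [comp_apply, lp.coeFn_add, Pi.add_apply]
  congr 1
  · by_cases h : m = n
    · subst h
      rw [lp.single_apply_self, lp.single_apply_self]
    · rw [lp.single_apply_ne 2 _ _ h, lp.single_apply_ne 2 _ _ (by omega), map_zero]
  · cases m with
    | zero => exact lp.single_apply_ne 2 _ _ (by omega)
    | succ m =>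
      rw [raiseComp_succ]
      by_cases h : m = n + 1
      · subst h
        rw [lp.single_apply_self, lp.single_apply_self]
      · rw [lp.single_apply_ne 2 _ _ (by omega), lp.single_apply_ne 2 _ _ h, map_zero]

theorem comp_single_zero_mem (x : E 0) : (lp.single (E := E) 2 0 x,
    lp.single (E := E) 2 1 (L.raise 0 x)) ∈ L.finiteGraph := by
  refine L.mem_finiteGraph_iff.2 ⟨single_mem_finiteVectors 0 x, fun m => ?_⟩
  have h0 : (lp.single (E := E) 2 0 x) (m + 1) = 0 := lp.single_apply_ne 2 0 _ (by omega)
  rw [comp_apply, h0, map_zero]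
  refine Eq.trans ?_ (zero_add _).symm
  cases m with
  | zero => exact lp.single_apply_ne 2 _ _ (by omega)
  | succ m =>
    rw [raiseComp_succ]
    by_cases h : m = 0
    · subst h
      rw [lp.single_apply_self, lp.single_apply_self]
    · rw [lp.single_apply_ne 2 _ _ (by omega), lp.single_apply_ne 2 _ _ h, map_zero]

/-- The action of the closure on a vector built from simultaneous eigenvectors of lowering. -/
theorem expSeries_mem_closure [∀ n, CompleteSpace (E n)] {Y : ∀ n, E n} {z : ℕ → lp E 2} {α : ℂ}
    (hl : ∀ n, L.lower n (Y (n + 1)) = ((n : ℂ) + 1) • α • Y n)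
    (hY : IsEntireSeq fun n => lp.single (E := E) 2 n (Y n))
    (hz : ∀ n, lp.single (E := E) 2 (n + 1) (L.raise n (Y n)) = z n) (hZ : IsEntireSeq z) (t : ℝ) :
    (expSeries (fun n => lp.single (E := E) 2 n (Y n)) t,
      α • (t : ℂ) • expSeries (fun n => lp.single (E := E) 2 n (Y n)) t + expSeries z t) ∈
      L.finiteGraph.topologicalClosure := by
  have e : (t : ℂ) • expSeries (fun n => lp.single (E := E) 2 n (Y n)) t =
      t • expSeries (fun n => lp.single (E := E) 2 n (Y n)) t := Complex.coe_smul _ _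
  rw [e]
  have h1 := (hY.summable t).hasSum
  have h2 := (hY.hasSum_shift t).const_smul α
  have h3 := (hZ.summable t).hasSum
  have h := h1.prodMk (h2.add h3)
  refine (Submodule.isClosed_topologicalClosure _).mem_of_tendsto h
    (Eventually.of_forall fun s => ?_)
  refine Submodule.sum_mem _ fun n _ => Submodule.le_topologicalClosure _ ?_
  have key : (lp.single (E := E) 2 n (Y n), α • (n : ℝ) • lp.single (E := E) 2 (n - 1) (Y (n - 1)) +
      z n) ∈ L.finiteGraph := by
    rw [← hz]
    cases n with
    | zero =>
      rw [Nat.cast_zero, zero_smul, smul_zero, zero_add]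
      exact L.comp_single_zero_mem _
    | succ n =>
      convert L.comp_single_mem n (Y (n + 1)) using 3
      rw [hl, lp.single_smul, lp.single_smul]
      exact smul_natCast_succ_smul α n _
  exact real_smul_mem_of_mem key _

end LadderPair

end ExpSeriesShift

section CoherentPowers

open scoped Nat

variable {d : ℕ}

/-- The function `√(n!) h(k₁) ⋯ h(kₙ)`. -/
def powSector (h : OnePhoton d) : (n : ℕ) → Sector d n
  | 0 => (memLp_one_zero d).toLp _
  | n + 1 => ((√(n + 1 : ℝ) : ℝ) : ℂ) • prepend d n h (powSector h n)

theorem coeFn_powSector (h : OnePhoton d) (n : ℕ) :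
    powSector h n =ᵐ[photonMeasureN d n] fun k => ((√(n ! : ℝ) : ℝ) : ℂ) * ∏ i, h (k i) := by
  induction n with
  | zero =>
    refine (memLp_one_zero d).coeFn_toLp.trans (Eventually.of_forall fun k => ?_)
    simp
  | succ n ih =>
    filter_upwards [Lp.coeFn_smul ((√(n + 1 : ℝ) : ℝ) : ℂ) (prepend d n h (powSector h n)),
      coeFn_prepend h (powSector h n), ae_rest ih] with k h1 h2 h3
    rw [powSector, h1, Pi.smul_apply, h2, h3, Fin.prod_univ_succ, Nat.factorial_succ, smul_eq_mul]
    push_cast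
    rw [Real.sqrt_mul (by positivity)]
    push_cast
    ring

theorem powSector_mem_symSector (h : OnePhoton d) (n : ℕ) : powSector h n ∈ symSector d n := by
  refine mem_symSector.2 fun σ => Lp.ext ?_
  filter_upwards [coeFn_permL σ (powSector h n), coeFn_powSector h n,
    (measurePreserving_perm d n σ).quasiMeasurePreserving.ae (coeFn_powSector h n)] with k h1 h2 h3
  rw [h1, h2, h3]
  congr 1
  exact Equiv.prod_comp σ fun i => h (k i)

theorem ofReal_sqrt_ne_zero (n : ℕ) : ((√(n + 1 : ℝ) : ℝ) : ℂ) ≠ 0 := by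
  rw [Complex.ofReal_ne_zero]
  positivity

theorem prepend_powSector (h : OnePhoton d) (n : ℕ) :
    prepend d n h (powSector h n) = ((√(n + 1 : ℝ) : ℝ) : ℂ)⁻¹ • powSector h (n + 1) := by
  rw [powSector, inv_smul_smul₀ (ofReal_sqrt_ne_zero n)]

theorem permL_prepend_powSector (h : OnePhoton d) (n : ℕ) (σ : Equiv.Perm (Fin (n + 1))) :
    permL σ (prepend d n h (powSector h n)) =
      ((√(n + 1 : ℝ) : ℝ) : ℂ)⁻¹ • powSector h (n + 1) := by
  rw [prepend_powSector, map_smul, mem_symSector.1 (powSector_mem_symSector h (n + 1))]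

theorem ofReal_sqrt_inv_mul_inv (n : ℕ) : ((√(n + 1 : ℝ) : ℝ) : ℂ)⁻¹ * ((√(n + 1 : ℝ) : ℝ) : ℂ)⁻¹ =
    ((n : ℂ) + 1)⁻¹ := by
  rw [← mul_inv, ← Complex.ofReal_mul, Real.mul_self_sqrt (by positivity)]
  push_cast
  rfl

/-- The symmetric tensor powers `√(n!) h^{⊗n}`. -/
def symPow (h : OnePhoton d) (n : ℕ) : symSector d n :=
  ⟨powSector h n, powSector_mem_symSector h n⟩

theorem create_symPow (h : OnePhoton d) (n : ℕ) : create d n h (symPow h n) = symPow h (n + 1) := by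
  refine Subtype.ext ?_
  rw [coe_create, insertSum]
  change _ • ∑ i : Fin (n + 1), permL i.cycleRange.symm (prepend d n h (powSector h n)) =
    powSector h (n + 1)
  simp only [permL_prepend_powSector]
  rw [Finset.sum_const, Finset.card_univ, Fintype.card_fin, ← Nat.cast_smul_eq_nsmul ℂ, smul_smul,
    smul_smul, mul_right_comm, ofReal_sqrt_inv_mul_inv]
  push_cast
  rw [inv_mul_cancel₀ (Nat.cast_add_one_ne_zero n), one_smul]

theorem annihilate_symPow (f h : OnePhoton d) (n : ℕ) :
    annihilate d n f (symPow h (n + 1)) = ((n : ℂ) + 1) • (inner ℂ f h : ℂ) • symPow h n := by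
  refine Subtype.ext ?_
  rw [coe_annihilate]
  change _ • contract f (powSector h (n + 1)) = ((n : ℂ) + 1) • (inner ℂ f h : ℂ) • powSector h n
  rw [powSector, map_smul, contract_prepend, smul_smul, ← Complex.ofReal_mul,
    Real.mul_self_sqrt (by positivity)]
  push_cast
  rfl

theorem inner_symPow (h h' : OnePhoton d) (n : ℕ) :
    inner ℂ (symPow h n) (symPow h' n) = (n ! : ℂ) * (inner ℂ h h' : ℂ) ^ n := by
  rw [Submodule.coe_inner]
  change inner ℂ (powSector h n) (powSector h' n) = _
  induction n with
  | zero =>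
    rw [powSector, powSector, L2.inner_def]
    have : (fun k : Fin 0 → PhotonSpace d => inner ℂ (((memLp_one_zero d).toLp _ : Sector d 0) k)
        (((memLp_one_zero d).toLp _ : Sector d 0) k)) =ᵐ[photonMeasureN d 0] fun _ => (1 : ℂ) := by
      filter_upwards [(memLp_one_zero d).coeFn_toLp] with k hk
      rw [hk]
      simp
    rw [integral_congr_ae this]
    simp [photonMeasureN, Measure.real]
  | succ n ih =>
    rw [powSector, powSector, inner_smul_left, inner_smul_right, inner_prepend, ih,
      Complex.conj_ofReal, ← mul_assoc, ← Complex.ofReal_mul, Real.mul_self_sqrt (by positivity),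
      Nat.factorial_succ]
    push_cast
    ring

theorem norm_symPow (h : OnePhoton d) (n : ℕ) : ‖symPow h n‖ = √(n ! : ℝ) * ‖h‖ ^ n := by
  have h1 : ‖symPow h n‖ ^ 2 = (√(n ! : ℝ) * ‖h‖ ^ n) ^ 2 := by
    have h2 := inner_symPow h h n
    rw [Submodule.coe_inner, inner_self_eq_norm_sq_to_K, inner_self_eq_norm_sq_to_K] at h2
    rw [mul_pow, Real.sq_sqrt (by positivity), ← pow_mul, mul_comm n 2, pow_mul]
    refine Complex.ofReal_injective ?_
    push_cast
    exact h2
  exact (pow_left_inj₀ (norm_nonneg _) (by positivity) two_ne_zero).1 h1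

theorem coeFn_create_symPow {w : PhotonSpace d → ℝ} {h G : OnePhoton d}
    (hG : G =ᵐ[photonMeasure d] fun κ => (w κ : ℂ) * h κ) (n : ℕ) :
    ((((n : ℂ) + 1) • create d n G (symPow h n) : symSector d (n + 1)) : Sector d (n + 1))
      =ᵐ[photonMeasureN d (n + 1)]
      fun k => ((∑ i, w (k i) : ℝ) : ℂ) * powSector h (n + 1) k := by
  have e : ((((n : ℂ) + 1) • create d n G (symPow h n) : symSector d (n + 1)) : Sector d (n + 1)) =
      (((n : ℂ) + 1) * ((√(n + 1 : ℝ) : ℝ) : ℂ)⁻¹) • insertSum G (powSector h n) :=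
    smul_smul _ _ _
  rw [e]
  have h4 : ∀ᵐ k ∂photonMeasureN d (n + 1), ∀ i : Fin (n + 1), h (k i) *
      powSector h n (fun j => k (i.succAbove j)) =
        ((√(n + 1 : ℝ) : ℝ) : ℂ)⁻¹ * powSector h (n + 1) k := by
    refine ae_all_iff.2 fun i => ?_
    have h5 := coeFn_permL i.cycleRange.symm (prepend d n h (powSector h n))
    rw [permL_prepend_powSector] at h5
    filter_upwards [h5, Lp.coeFn_smul ((√(n + 1 : ℝ) : ℝ) : ℂ)⁻¹ (powSector h (n + 1)),
      (measurePreserving_perm d _ i.cycleRange.symm).quasiMeasurePreserving.ae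
        (coeFn_prepend h (powSector h n))] with k h6 h7 h8
    rw [h7, h8, Pi.smul_apply] at h6
    rw [← smul_eq_mul (_⁻¹), h6]
    simp only [Function.comp_apply, Fin.cycleRange_symm_zero, Fin.cycleRange_symm_succ]
  filter_upwards [Lp.coeFn_smul (((n : ℂ) + 1) * ((√(n + 1 : ℝ) : ℝ) : ℂ)⁻¹)
    (insertSum G (powSector h n)), coeFn_insertSum G (powSector h n), h4,
    ae_all_iff.2 fun i : Fin (n + 1) => ae_coord hG i] with k h1 h2 h3 h5
  rw [h1, Pi.smul_apply, h2, smul_eq_mul]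
  have : ∀ i : Fin (n + 1), G (k i) * powSector h n (fun j => k (i.succAbove j)) =
      (w (k i) : ℂ) * (((√(n + 1 : ℝ) : ℝ) : ℂ)⁻¹ * powSector h (n + 1) k) := by
    intro i
    rw [h5 i, mul_assoc, h3 i]
  rw [Finset.sum_congr rfl fun i _ => this i, ← Finset.sum_mul]
  push_cast
  have h6 := ofReal_sqrt_inv_mul_inv n
  have h7 : ((n : ℂ) + 1) ≠ 0 := Nat.cast_add_one_ne_zero n
  calc _ = ((n : ℂ) + 1) * (((√(n + 1 : ℝ) : ℝ) : ℂ)⁻¹ * ((√(n + 1 : ℝ) : ℝ) : ℂ)⁻¹) *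
        ((∑ i, (w (k i) : ℂ)) * powSector h (n + 1) k) := by ring
    _ = _ := by rw [h6, mul_inv_cancel₀ h7, one_mul]

end CoherentPowers
end

noncomputable section

section Coherent

open scoped Nat

theorem smul_smul_mul_smul {H : Type*} [AddCommGroup H] [Module ℂ H] (c m a : ℂ) (x : H) :
    c • m • a • x = m • (c * a) • x := by
  rw [smul_comm c, smul_smul c]

theorem inner_smul_smul {H : Type*} [NormedAddCommGroup H] [InnerProductSpace ℂ H]
    (a b : ℂ) (x y : H) : inner ℂ (a • x) (b • y) = starRingEnd ℂ a * b * inner ℂ x y := by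
  rw [inner_smul_left, inner_smul_right, mul_assoc]

theorem mk_add_mem_of_eq {H : Type*} [Add H] {S : Set (H × H)} {x a b c : H} (h : (x, a + b) ∈ S)
    (e : b = c) : (x, a + c) ∈ S := e ▸ h

section Graded

variable {E : ℕ → Type*} [∀ n, NormedAddCommGroup (E n)] [∀ n, InnerProductSpace ℂ (E n)]
  [∀ n, CompleteSpace (E n)]

theorem expSeries_single_one_apply {Y : ∀ n, E n}
    (hY : IsEntireSeq fun n => lp.single (E := E) 2 n (Y n)) (n : ℕ) :
    expSeries (fun n => lp.single (E := E) 2 n (Y n)) 1 n = (n ! : ℂ)⁻¹ • Y n := by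
  rw [expSeries_single_apply hY, one_pow, ← Complex.coe_smul]
  push_cast
  rw [one_div]

theorem expSeries_single_succ_one_apply {Z : ∀ n, E (n + 1)}
    (hZ : IsEntireSeq fun n => lp.single (E := E) 2 (n + 1) (Z n)) (n : ℕ) :
    expSeries (fun n => lp.single (E := E) 2 (n + 1) (Z n)) 1 (n + 1) = (n ! : ℂ)⁻¹ • Z n := by
  have h := (hZ.summable 1).hasSum.mapL ((lp.evalCLM ℂ E 2 (n + 1)).restrictScalars ℝ)
  refine h.unique ?_
  have e : (fun b => ((lp.evalCLM ℂ E 2 (n + 1)).restrictScalars ℝ)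
      ((1 ^ b / b ! : ℝ) • lp.single (E := E) 2 (b + 1) (Z b))) =
      fun b => (1 ^ b / b ! : ℝ) • (lp.single (E := E) 2 (b + 1) (Z b)) (n + 1) := rfl
  rw [e]
  convert hasSum_single n ?_ using 1
  · rw [lp.single_apply_self, one_pow, ← Complex.coe_smul]
    push_cast
    rw [one_div]
  · intro b hb
    rw [lp.single_apply_ne 2 (b + 1) _ (by omega), smul_zero]

theorem expSeries_single_succ_one_apply_zero {Z : ∀ n, E (n + 1)}
    (hZ : IsEntireSeq fun n => lp.single (E := E) 2 (n + 1) (Z n)) :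
    expSeries (fun n => lp.single (E := E) 2 (n + 1) (Z n)) 1 0 = 0 := by
  have h := (hZ.summable 1).hasSum.mapL ((lp.evalCLM ℂ E 2 0).restrictScalars ℝ)
  refine h.unique ?_
  have e : (fun b => ((lp.evalCLM ℂ E 2 0).restrictScalars ℝ)
      ((1 ^ b / b ! : ℝ) • lp.single (E := E) 2 (b + 1) (Z b))) =
      fun b => (1 ^ b / b ! : ℝ) • (lp.single (E := E) 2 (b + 1) (Z b)) 0 := rfl
  rw [e]
  convert hasSum_zero with b
  rw [lp.single_apply_ne 2 (b + 1) _ (by omega), smul_zero]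

end Graded

variable {d : ℕ}

/-- The symmetric tensor powers of `h`, as Fock vectors. -/
def cohTerm (h : OnePhoton d) (n : ℕ) : Fock d :=
  lp.single (E := fun n : ℕ => symSector d n) 2 n (symPow h n)

/-- The vectors `a*(f) (√(n!) h^{⊗n})`. -/
def creTerm (f h : OnePhoton d) (n : ℕ) : Fock d :=
  lp.single (E := fun n : ℕ => symSector d n) 2 (n + 1) (create d n f (symPow h n))

theorem cohTerm_zero (h : OnePhoton d) : cohTerm h 0 = vacuum d := rfl

theorem creTerm_self (h : OnePhoton d) (n : ℕ) : creTerm h h n = cohTerm h (n + 1) :=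
  congrArg (lp.single (E := fun n : ℕ => symSector d n) 2 (n + 1)) (create_symPow h n)

theorem creTerm_smul (c : ℂ) (f h : OnePhoton d) (n : ℕ) :
    creTerm (c • f) h n = c • creTerm f h n := by
  have e : create d n (c • f) (symPow h n) = c • create d n f (symPow h n) :=
    congrArg (fun T : symSector d n →L[ℂ] symSector d (n + 1) => T (symPow h n))
      ((create d n).map_smul c f)
  exact (congrArg (lp.single (E := fun n : ℕ => symSector d n) 2 (n + 1)) e).trans
    (lp.single_smul (E := fun n : ℕ => symSector d n) (𝕜 := ℂ) 2 (n + 1) c _)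

theorem norm_cohTerm (h : OnePhoton d) (n : ℕ) : ‖cohTerm h n‖ = √(n ! : ℝ) * ‖h‖ ^ n :=
  (lp.norm_single (E := fun n : ℕ => symSector d n) (p := 2) (by norm_num) n _).trans
    (norm_symPow h n)

theorem norm_creTerm_le (f h : OnePhoton d) (n : ℕ) :
    ‖creTerm f h n‖ ≤ ‖f‖ * (√((n + 1)! : ℝ) * ‖h‖ ^ n) := by
  refine ((lp.norm_single (E := fun n : ℕ => symSector d n) (p := 2) (by norm_num) (n + 1)
    (create d n f (symPow h n))).le.trans (norm_create_le f (symPow h n))).trans_eq ?_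
  rw [norm_symPow, Nat.factorial_succ]
  push_cast
  rw [Real.sqrt_mul (by positivity)]
  ring

theorem isEntireSeq_of_factorial (C : ℝ) (hC : 0 ≤ C) :
    IsEntireSeq fun n : ℕ => √((n + 1)! : ℝ) * C ^ n := by
  refine isEntireSeq_of_norm_succ_le (C := C) (N := 1) hC fun n => ?_
  rw [Real.norm_of_nonneg (by positivity), Real.norm_of_nonneg (by positivity),
    Nat.factorial_succ (n + 1)]
  push_cast
  rw [Real.sqrt_mul (by positivity), pow_succ]
  refine le_of_eq ?_
  rw [show (1 : ℝ) + n + 1 = n + 1 + 1 by ring]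
  ring

theorem isEntireSeq_creTerm (f h : OnePhoton d) : IsEntireSeq (creTerm f h) := by
  intro r
  refine ((isEntireSeq_of_factorial ‖h‖ (norm_nonneg h) r).mul_left ‖f‖).of_nonneg_of_le
    (fun n => by positivity) fun n => ?_
  rw [Real.norm_of_nonneg (by positivity)]
  refine (mul_le_mul_of_nonneg_left (norm_creTerm_le f h n) (by positivity)).trans_eq ?_
  ring

theorem isEntireSeq_cohTerm (h : OnePhoton d) : IsEntireSeq (cohTerm h) := by
  refine isEntireSeq_of_norm_succ_le (C := ‖h‖) (N := 0) (norm_nonneg h) fun n => ?_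
  rw [norm_cohTerm, norm_cohTerm, Nat.factorial_succ]
  push_cast
  rw [Real.sqrt_mul (by positivity), zero_add, pow_succ]
  refine le_of_eq ?_
  ring

/-- The exponential vector `∑ tⁿ/n! a*(h)ⁿ Ω`. -/
def cohSum (h : OnePhoton d) (t : ℝ) : Fock d := expSeries (cohTerm h) t

/-- The vector `a*(f) ∑ tⁿ/n! a*(h)ⁿ Ω`. -/
def creSum (f h : OnePhoton d) (t : ℝ) : Fock d := expSeries (creTerm f h) t

theorem cohSum_zero (h : OnePhoton d) : cohSum h 0 = vacuum d :=
  (expSeries_zero (cohTerm h)).trans (cohTerm_zero h)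

theorem hasDerivAt_cohSum (h : OnePhoton d) (t : ℝ) : HasDerivAt (cohSum h) (creSum h h t) t := by
  have e : creTerm h h = fun n => cohTerm h (n + 1) := funext (creTerm_self h)
  have := (isEntireSeq_cohTerm h).hasDerivAt t
  rw [← e] at this
  exact this

theorem creSum_smul (c : ℂ) (f h : OnePhoton d) (t : ℝ) : creSum (c • f) h t = c • creSum f h t := by
  have e : creTerm (c • f) h = fun n => c • creTerm f h n := funext (creTerm_smul c f h)
  rw [creSum, e]
  exact smul_expSeries (isEntireSeq_creTerm f h) c t

theorem cohSum_one_apply (h : OnePhoton d) (n : ℕ) :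
    evalFock d n (cohSum h 1) = (n ! : ℂ)⁻¹ • symPow h n :=
  expSeries_single_one_apply (E := fun n : ℕ => symSector d n) (Y := symPow h)
    (isEntireSeq_cohTerm h) n

theorem creSum_one_apply_succ (f h : OnePhoton d) (n : ℕ) :
    evalFock d (n + 1) (creSum f h 1) = (n ! : ℂ)⁻¹ • create d n f (symPow h n) :=
  expSeries_single_succ_one_apply (E := fun n : ℕ => symSector d n)
    (Z := fun n => create d n f (symPow h n)) (isEntireSeq_creTerm f h) n

theorem creSum_one_apply_zero (f h : OnePhoton d) : evalFock d 0 (creSum f h 1) = 0 :=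
  expSeries_single_succ_one_apply_zero (E := fun n : ℕ => symSector d n)
    (Z := fun n => create d n f (symPow h n)) (isEntireSeq_creTerm f h)

theorem inner_cohSum_one (h h' : OnePhoton d) :
    inner ℂ (cohSum h 1) (cohSum h' 1) = Complex.exp (inner ℂ h h') := by
  have h1 := lp.hasSum_inner (𝕜 := ℂ) (cohSum h 1) (cohSum h' 1)
  have h2 := NormedSpace.expSeries_div_hasSum_exp (𝔸 := ℂ) (inner ℂ h h')
  rw [← Complex.exp_eq_exp_ℂ] at h2
  refine h1.unique (h2.congr_fun fun n => ?_)
  have e1 := cohSum_one_apply h n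
  have e2 := cohSum_one_apply h' n
  rw [evalFock_apply] at e1 e2
  rw [e1, e2]
  refine (inner_smul_smul _ _ (symPow h n) (symPow h' n)).trans ?_
  rw [inner_symPow, map_inv₀, map_natCast]
  have := Nat.factorial_ne_zero n
  field_simp

/-- The action of the Segal field operator on exponential vectors. -/
theorem cohSum_mem_segal (f h : OnePhoton d) (t : ℝ) :
    (cohSum h t, ((√2 : ℂ)⁻¹ * inner ℂ f h) • (t : ℂ) • cohSum h t + (√2 : ℂ)⁻¹ • creSum f h t) ∈
      (segalPair f).finiteGraph.topologicalClosure := by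
  have hz : ∀ n, lp.single (E := fun n : ℕ => symSector d n) 2 (n + 1)
      ((segalPair f).raise n (symPow h n)) = creTerm ((√2 : ℂ)⁻¹ • f) h n := fun n =>
    (lp.single_smul (E := fun n : ℕ => symSector d n) (𝕜 := ℂ) 2 (n + 1) (√2 : ℂ)⁻¹
      (create d n f (symPow h n))).trans (creTerm_smul (√2 : ℂ)⁻¹ f h n).symm
  have hl : ∀ n, (segalPair f).lower n (symPow h (n + 1)) =
      ((n : ℂ) + 1) • ((√2 : ℂ)⁻¹ * inner ℂ f h) • symPow h n := by
    intro n
    refine Eq.trans ?_ (smul_smul_mul_smul (√2 : ℂ)⁻¹ ((n : ℂ) + 1) (inner ℂ f h) (symPow h n))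
    exact congrArg (fun X : symSector d n => (√2 : ℂ)⁻¹ • X) (annihilate_symPow f h n)
  exact mk_add_mem_of_eq ((segalPair f).expSeries_mem_closure (Y := symPow h) hl
    (isEntireSeq_cohTerm h) hz (isEntireSeq_creTerm _ h) t) (creSum_smul (√2 : ℂ)⁻¹ f h t)

theorem cohSum_mem_secondQuantization {w : PhotonSpace d → ℝ} {h G : OnePhoton d}
    (hG : G =ᵐ[photonMeasure d] fun κ => (w κ : ℂ) * h κ) :
    (cohSum h 1, creSum G h 1) ∈ (secondQuantization w).graph := by
  refine mem_secondQuantization_graph.2 fun n => ?_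
  have e : ∀ Ψ : Fock d, photonFn Ψ n = (evalFock d n Ψ : Sector d n) := fun _ => rfl
  change photonFn (creSum G h 1) n =ᵐ[photonMeasureN d n]
    fun k => ((∑ i, w (k i) : ℝ) : ℂ) * photonFn (cohSum h 1) n k
  rw [e, e]
  cases n with
  | zero =>
    rw [creSum_one_apply_zero]
    filter_upwards [Lp.coeFn_zero ℂ 2 (photonMeasureN d 0)] with k hk
    refine hk.trans ?_
    simp
  | succ n =>
    rw [creSum_one_apply_succ, cohSum_one_apply]
    have h1 : ((n ! : ℂ)⁻¹ • create d n G (symPow h n) : symSector d (n + 1)) =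
        ((n + 1)! : ℂ)⁻¹ • (((n : ℂ) + 1) • create d n G (symPow h n)) := by
      refine Eq.trans ?_ (smul_smul _ _ (create d n G (symPow h n))).symm
      congr 1
      have := Nat.factorial_ne_zero n
      have := Nat.cast_add_one_ne_zero (R := ℂ) n
      rw [Nat.factorial_succ]
      push_cast
      field_simp
    rw [h1]
    filter_upwards [coeFn_create_symPow hG n,
      Lp.coeFn_smul ((n + 1)! : ℂ)⁻¹ (((((n : ℂ) + 1) • create d n G (symPow h n) :
        symSector d (n + 1)) : Sector d (n + 1))),
      Lp.coeFn_smul ((n + 1)! : ℂ)⁻¹ (powSector h (n + 1))] with k h2 h3 h4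
    refine (h3.trans ?_).trans (congrArg _ h4).symm
    rw [Pi.smul_apply, Pi.smul_apply, h2, smul_eq_mul, smul_eq_mul]
    ring

end Coherent
end

noncomputable section

section EntireCoreSmul

open scoped Nat

variable {H : Type*} [NormedAddCommGroup H] [InnerProductSpace ℂ H]

theorem LinearPMap.mem_smul_graph_iff {A : H →ₗ.[ℂ] H} {c : ℂ} (hc : c ≠ 0) {p : H × H} :
    p ∈ (c • A).graph ↔ (p.1, c⁻¹ • p.2) ∈ A.graph := by
  rw [LinearPMap.mem_graph_iff, LinearPMap.mem_graph_iff]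
  constructor
  · rintro ⟨y, h1, h2⟩
    refine ⟨y, h1, ?_⟩
    rw [← h2, LinearPMap.smul_apply, inv_smul_smul₀ hc]
  · rintro ⟨y, h1, h2⟩
    refine ⟨y, h1, ?_⟩
    simp only at h2
    rw [LinearPMap.smul_apply, h2, smul_inv_smul₀ hc]

theorem IsEntireCore.smul {A : H →ₗ.[ℂ] H} {D : Submodule ℂ H} {T : D →ₗ[ℂ] D}
    (h : IsEntireCore A D T) {κ : ℝ} (hκ : κ ≠ 0) :
    IsEntireCore ((κ : ℂ) • A) D ((κ : ℂ) • T) where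
  dense := h.dense
  symm u v := by
    have := h.symm u v
    simp only [LinearMap.smul_apply, Submodule.coe_smul, inner_smul_left, inner_smul_right,
      Complex.conj_ofReal, this]
  mem_graph u := by
    rw [LinearPMap.mem_smul_graph_iff (Complex.ofReal_ne_zero.2 hκ)]
    simp only [LinearMap.smul_apply, Submodule.coe_smul]
    rw [inv_smul_smul₀ (Complex.ofReal_ne_zero.2 hκ)]
    exact h.mem_graph u
  isClosed := by
    have : (((κ : ℂ) • A).graph : Set (H × H)) =
        (fun p : H × H => (p.1, (κ : ℂ)⁻¹ • p.2)) ⁻¹' (A.graph : Set (H × H)) := by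
      ext p
      exact LinearPMap.mem_smul_graph_iff (Complex.ofReal_ne_zero.2 hκ)
    rw [this]
    exact h.isClosed.preimage (by fun_prop)
  subset_closure := by
    intro p hp
    have h1 := h.subset_closure ((LinearPMap.mem_smul_graph_iff (Complex.ofReal_ne_zero.2 hκ)).1 hp)
    have h2 : Continuous fun p : H × H => (p.1, (κ : ℂ) • p.2) := by fun_prop
    have h3 := map_mem_closure h2 h1 (t := Set.range fun u : D =>
      ((u : H), ((((κ : ℂ) • T) u : D) : H))) (by
        rintro _ ⟨u, rfl⟩
        exact ⟨u, rfl⟩)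
    simpa only [smul_inv_smul₀ (Complex.ofReal_ne_zero.2 hκ)] using h3
  entire u r := by
    refine (h.entire u (r * κ)).congr fun n => ?_
    have e : ((κ : ℂ) • T) ^ n = (κ : ℂ) ^ n • T ^ n := smul_pow _ _ _
    simp only [e, LinearMap.smul_apply, Submodule.coe_smul, norm_smul, norm_pow, Complex.norm_real,
      abs_mul, mul_pow, Real.norm_eq_abs]
    ring

theorem IsUnitaryGroup.apply_gaussian {A : H →ₗ.[ℂ] H} {W : ℝ → H →L[ℂ] H}
    (hW : IsUnitaryGroup A W) {S C : ℝ → H} {N : ℝ} (hS : ∀ t, HasDerivAt S (C t) t)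
    (hA : ∀ t, (S t, (((-(N * t) : ℝ) : ℂ) * Complex.I) • S t + Complex.I • C t) ∈ A.graph) :
    W (-1) (S 0) = ((Real.exp (-N / 2) : ℝ) : ℂ) • S 1 := by
  have hc : ∀ t, ∃ y : A.domain, (y : H) = S t ∧
      A y = (((-(N * t) : ℝ) : ℂ) * Complex.I) • S t + Complex.I • C t := fun t => by
    simpa using (LinearPMap.mem_graph_iff _).1 (hA t)
  choose y hy1 hy2 using hc
  let c : ℝ → A.domain := fun t => ((Real.exp (-N * t ^ 2 / 2) : ℝ) : ℂ) • y (-t)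
  have hd : ∀ t, HasDerivAt (fun t => (c t : H)) (Complex.I • A (c t)) t := by
    intro t
    have h1 : HasDerivAt (fun t : ℝ => Real.exp (-N * t ^ 2 / 2))
        (Real.exp (-N * t ^ 2 / 2) * (-N * t)) t := by
      have := (((hasDerivAt_pow 2 t).const_mul (-N)).div_const 2).exp
      convert this using 1
      push_cast
      ring
    have h2 : HasDerivAt (fun t => S (-t)) (-C (-t)) t := by
      have := (hS (-t)).scomp t (hasDerivAt_neg t)
      rw [neg_one_smul] at this
      exact this
    have h3 : HasDerivAt (fun t => Real.exp (-N * t ^ 2 / 2) • S (-t)) _ t := h1.smul h2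
    have e1 : (fun t => (c t : H)) = fun t => Real.exp (-N * t ^ 2 / 2) • S (-t) := by
      funext t
      change ((Real.exp (-N * t ^ 2 / 2) : ℝ) : ℂ) • (y (-t) : H) = _
      rw [hy1, Complex.coe_smul]
    rw [e1]
    refine h3.congr_deriv ?_
    change _ = Complex.I • A (((Real.exp (-N * t ^ 2 / 2) : ℝ) : ℂ) • y (-t))
    rw [LinearPMap.map_smul, hy2]
    simp only [← Complex.coe_smul, smul_add, smul_smul, smul_neg]
    rw [add_comm]
    have e2 : Complex.I * (((Real.exp (-N * t ^ 2 / 2) : ℝ) : ℂ) * Complex.I) =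
        -((Real.exp (-N * t ^ 2 / 2) : ℝ) : ℂ) := by
      linear_combination ((Real.exp (-N * t ^ 2 / 2) : ℝ) : ℂ) * Complex.I_mul_I
    congr 1
    · congr 1
      push_cast at e2 ⊢
      linear_combination (-(N * t : ℂ)) * e2
    · rw [e2, neg_smul]
  have h := hW.apply_eq_of_hasDerivAt c hd (-1)
  have e : ∀ t, (c t : H) = ((Real.exp (-N * t ^ 2 / 2) : ℝ) : ℂ) • S (-t) := fun t => by
    change ((Real.exp (-N * t ^ 2 / 2) : ℝ) : ℂ) • (y (-t) : H) = _
    rw [hy1]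
  rw [e, e] at h
  simpa using h

theorem IsEntireCore.adjoint_expI_gaussian [CompleteSpace H] {A : H →ₗ.[ℂ] H} {D : Submodule ℂ H}
    {T : D →ₗ[ℂ] D} (h : IsEntireCore A D T) {κ : ℝ} (hκ : κ ≠ 0) {S C : ℝ → H} {N : ℝ}
    (hS : ∀ t, HasDerivAt S (C t) t) (hA : ∀ t, (S t, (((-(N * t) : ℝ) : ℂ) * Complex.I) • S t +
      Complex.I • C t) ∈ ((κ : ℂ) • A).graph) :
    ContinuousLinearMap.adjoint (expI ((κ : ℂ) • A)) (S 0) =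
      ((Real.exp (-N / 2) : ℝ) : ℂ) • S 1 := by
  obtain ⟨W, hW, hW1⟩ := (h.smul hκ).exists_expI_eq
  rw [hW1, hW.adjoint_apply]
  exact hW.apply_gaussian hS hA

end EntireCoreSmul

section Coherent

variable {d : ℕ}

/-- The normalized coherent state `e^{-‖h‖²/2} ∑ a*(h)ⁿ Ω / n!`. -/
def coherent (h : OnePhoton d) : Fock d := ((Real.exp (-‖h‖ ^ 2 / 2) : ℝ) : ℂ) • cohSum h 1

/-- The vector `a*(f)` applied to the coherent state of `h`. -/
def coherentCre (f h : OnePhoton d) : Fock d :=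
  ((Real.exp (-‖h‖ ^ 2 / 2) : ℝ) : ℂ) • creSum f h 1

theorem graph_mem_combination {H : Type*} [NormedAddCommGroup H] [InnerProductSpace ℂ H]
    {A : H →ₗ.[ℂ] H} {κ α β : ℂ} {t : ℝ} {s c c' : H} {N : ℝ}
    (h : (s, α • (t : ℂ) • s + β • c) ∈ A.graph) (h1 : κ * α = -(N * Complex.I)) (hκ : κ ≠ 0)
    (h2 : (κ * β) • c = Complex.I • c') :
    (s, (((-(N * t) : ℝ) : ℂ) * Complex.I) • s + Complex.I • c') ∈ (κ • A).graph := by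
  rw [LinearPMap.mem_smul_graph_iff hκ]
  convert h using 2
  rw [smul_add, smul_smul, ← h2, smul_smul, smul_smul]
  congr 2
  · field_simp
    push_cast
    linear_combination (-(t : ℂ)) * h1
  · field_simp

set_option maxHeartbeats 1000000 in
theorem segalField_isEntireCore {f : PhotonSpace d → ℂ} (hf : MemLp f 2 (photonMeasure d)) :
    IsEntireCore (segalField f) (finiteVectors fun n : ℕ => symSector d n)
      (segalPair (hf.toLp f)).onFinite :=
  (congrArg (fun A => IsEntireCore A (finiteVectors fun n : ℕ => symSector d n)
    (segalPair (hf.toLp f)).onFinite) (segalField_eq hf)).mpr (segalPair (hf.toLp f)).isEntireCore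

theorem sqrt_two_ne_zero : ((√2 : ℝ) : ℂ) ≠ 0 := by
  rw [Complex.ofReal_ne_zero]
  positivity

theorem mul_inner_eq_of_smul_eq {H : Type*} [NormedAddCommGroup H] [InnerProductSpace ℂ H] {κ : ℝ}
    {F h : H} (hfh : (κ : ℂ) • F = ((√2 : ℝ) * Complex.I : ℂ) • h) :
    (κ : ℂ) * (((√2 : ℝ) : ℂ)⁻¹ * inner ℂ F h) = -(((‖h‖ ^ 2 : ℝ) : ℂ) * Complex.I) := by
  have h3 := congrArg (fun v : H => (inner ℂ v h : ℂ)) hfh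
  simp only [inner_smul_left, map_mul, Complex.conj_ofReal, Complex.conj_I,
    inner_self_eq_norm_sq_to_K] at h3
  have h2 := sqrt_two_ne_zero
  rw [mul_left_comm, h3]
  push_cast
  field_simp
  rfl

theorem creSum_eq_of_smul_eq {κ : ℝ} {F h : OnePhoton d}
    (hfh : (κ : ℂ) • F = ((√2 : ℝ) * Complex.I : ℂ) • h) (t : ℝ) :
    ((κ : ℂ) * ((√2 : ℝ) : ℂ)⁻¹) • creSum F h t = Complex.I • creSum h h t := by
  have e : ((κ : ℂ) * ((√2 : ℝ) : ℂ)⁻¹) • F = Complex.I • h := by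
    rw [mul_comm, ← smul_smul, hfh, smul_smul, inv_mul_cancel_left₀ sqrt_two_ne_zero]
  refine (creSum_smul _ F h t).symm.trans (Eq.trans ?_ (creSum_smul _ h h t))
  rw [e]

theorem cohSum_mem_smul_segal {f : PhotonSpace d → ℂ} (hf : MemLp f 2 (photonMeasure d)) {κ : ℝ}
    (hκ : κ ≠ 0) {h : OnePhoton d}
    (hfh : (κ : ℂ) • hf.toLp f = ((√2 : ℝ) * Complex.I : ℂ) • h) (t : ℝ) :
    (cohSum h t, (((-(‖h‖ ^ 2 * t) : ℝ) : ℂ) * Complex.I) • cohSum h t +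
      Complex.I • creSum h h t) ∈ ((κ : ℂ) • segalField f).graph :=
  graph_mem_combination ((SetLike.ext_iff.1 (segalField_graph hf) _).2 (cohSum_mem_segal _ _ _))
    (mul_inner_eq_of_smul_eq hfh) (Complex.ofReal_ne_zero.2 hκ) (creSum_eq_of_smul_eq hfh t)

theorem adjoint_expI_vacuum {f : PhotonSpace d → ℂ} (hf : MemLp f 2 (photonMeasure d)) {κ : ℝ}
    (hκ : κ ≠ 0) {h : OnePhoton d}
    (hfh : (κ : ℂ) • hf.toLp f = ((√2 : ℝ) * Complex.I : ℂ) • h) :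
    ContinuousLinearMap.adjoint (expI ((κ : ℂ) • segalField f)) (vacuum d) = coherent h :=
  (congrArg _ (cohSum_zero h).symm).trans ((segalField_isEntireCore hf).adjoint_expI_gaussian hκ
    (hasDerivAt_cohSum h) (cohSum_mem_smul_segal hf hκ hfh))

end Coherent
end

noncomputable section

section Coherent

open scoped Nat

variable {d : ℕ}

theorem creTerm_add (f g h : OnePhoton d) (n : ℕ) :
    creTerm (f + g) h n = creTerm f h n + creTerm g h n := by
  have e : create d n (f + g) (symPow h n) = create d n f (symPow h n) + create d n g (symPow h n) :=
    congrArg (fun T : symSector d n →L[ℂ] symSector d (n + 1) => T (symPow h n))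
      ((create d n).map_add f g)
  exact (congrArg (lp.single (E := fun n : ℕ => symSector d n) 2 (n + 1)) e).trans
    (lp.single_add (E := fun n : ℕ => symSector d n) 2 (n + 1) _ _)

theorem creSum_add (f g h : OnePhoton d) (t : ℝ) :
    creSum (f + g) h t = creSum f h t + creSum g h t := by
  have e : creTerm (f + g) h = fun n => creTerm f h n + creTerm g h n := funext (creTerm_add f g h)
  rw [creSum, e]
  exact (isEntireSeq_creTerm f h).expSeries_add (isEntireSeq_creTerm g h) t

/-- The map `f ↦ a*(f) η` for the coherent state `η` of `h`. -/
def coherentCreₗ (h : OnePhoton d) : OnePhoton d →ₗ[ℂ] Fock d where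
  toFun f := coherentCre f h
  map_add' f g := by
    rw [coherentCre, creSum_add]
    exact smul_add _ _ _
  map_smul' c f := by
    rw [coherentCre, creSum_smul]
    exact smul_comm _ _ _

theorem smul_add_smul_graph {H : Type*} [AddCommGroup H] [Module ℂ H] {G : Submodule ℂ (H × H)}
    {α β t : ℂ} {s c : H} (h : (s, α • t • s + β • c) ∈ G) (ht : t = 1) (r : ℂ) :
    (r • s, α • r • s + β • r • c) ∈ G := by
  subst ht
  have := G.smul_mem r h
  rw [one_smul, Prod.smul_mk, smul_add, smul_comm r, smul_comm r] at this
  exact this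

theorem coherent_mem_segalField {f : PhotonSpace d → ℂ} (hf : MemLp f 2 (photonMeasure d))
    (h : OnePhoton d) : (coherent h, (((√2 : ℝ) : ℂ)⁻¹ * inner ℂ (hf.toLp f) h) • coherent h +
      ((√2 : ℝ) : ℂ)⁻¹ • coherentCre (hf.toLp f) h) ∈ (segalField f).graph :=
  smul_add_smul_graph ((SetLike.ext_iff.1 (segalField_graph hf) _).2 (cohSum_mem_segal _ h 1))
    Complex.ofReal_one _

theorem smul_pair_mem {H : Type*} [AddCommGroup H] [Module ℂ H] {G : Submodule ℂ (H × H)}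
    {a b : H} (h : (a, b) ∈ G) (c : ℂ) : (c • a, c • b) ∈ G := G.smul_mem c h

theorem coherent_mem_secondQuantization {w : PhotonSpace d → ℝ} {h G : OnePhoton d}
    (hG : G =ᵐ[photonMeasure d] fun κ => (w κ : ℂ) * h κ) :
    (coherent h, coherentCre G h) ∈ (secondQuantization w).graph :=
  smul_pair_mem (cohSum_mem_secondQuantization hG) _

theorem inner_coherent (h h' : OnePhoton d) : inner ℂ (coherent h) (coherent h') =
    Complex.exp (inner ℂ h h' - ‖h‖ ^ 2 / 2 - ‖h'‖ ^ 2 / 2) := by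
  refine (inner_smul_smul _ _ (cohSum h 1) (cohSum h' 1)).trans ?_
  rw [inner_cohSum_one, Complex.conj_ofReal, Complex.ofReal_exp, Complex.ofReal_exp,
    ← Complex.exp_add, ← Complex.exp_add]
  congr 1
  push_cast
  ring

theorem norm_coherent (h : OnePhoton d) : ‖coherent h‖ = 1 := by
  have h1 := inner_coherent h h
  rw [inner_self_eq_norm_sq_to_K, inner_self_eq_norm_sq_to_K] at h1
  have h2 : (((‖coherent h‖ ^ 2 : ℝ)) : ℂ) = 1 := by
    push_cast
    refine h1.trans ?_
    rw [← Complex.exp_zero]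
    congr 1
    simp only [Complex.coe_algebraMap]
    ring
  have h3 : ‖coherent h‖ ^ 2 = 1 := by exact_mod_cast h2
  exact (pow_eq_one_iff_of_nonneg (norm_nonneg _) two_ne_zero).1 h3

theorem continuous_powSector (n : ℕ) : Continuous fun h : OnePhoton d => powSector h n := by
  induction n with
  | zero => exact continuous_const
  | succ n ih =>
    have h1 : Continuous fun h : OnePhoton d => prepend d n h (powSector h n) :=
      ((prepend d n).continuous.clm_apply ih)
    exact Continuous.const_smul h1 ((√(n + 1 : ℝ) : ℝ) : ℂ)

theorem continuous_symPow (n : ℕ) : Continuous fun h : OnePhoton d => symPow h n :=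
  (continuous_powSector n).subtype_mk _

theorem continuous_lp_single {E : ℕ → Type*} [∀ n, NormedAddCommGroup (E n)]
    [∀ n, InnerProductSpace ℂ (E n)] (n : ℕ) : Continuous (lp.single (E := E) 2 n) :=
  (lp.isometry_single (E := E) (p := 2) n).continuous

theorem continuous_creTerm (n : ℕ) :
    Continuous fun p : OnePhoton d × OnePhoton d => creTerm p.1 p.2 n := by
  refine (continuous_lp_single (E := fun n : ℕ => symSector d n) (n + 1)).comp ?_
  exact ((create d n).continuous.comp continuous_fst).clm_apply
    ((continuous_symPow n).comp continuous_snd)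

theorem continuous_cohTerm (n : ℕ) : Continuous fun h : OnePhoton d => cohTerm h n :=
  (continuous_lp_single (E := fun n : ℕ => symSector d n) n).comp (continuous_symPow n)

theorem stronglyMeasurable_expSeries {X E : Type*} [TopologicalSpace X] [MeasurableSpace X]
    [OpensMeasurableSpace X] [SecondCountableTopology X] [NormedAddCommGroup E] [NormedSpace ℝ E]
    [CompleteSpace E] {y : X → ℕ → E} (hy : ∀ x, IsEntireSeq (y x))
    (hc : ∀ n, Continuous fun x => y x n) (t : ℝ) :
    StronglyMeasurable fun x => expSeries (y x) t := by
  refine stronglyMeasurable_of_tendsto atTop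
    (f := fun N x => ∑ n ∈ Finset.range N, (t ^ n / n ! : ℝ) • y x n) (fun N => ?_)
    (tendsto_pi_nhds.2 fun x => ((hy x).summable t).hasSum.tendsto_sum_nat)
  exact (continuous_finsetSum _ fun n _ => (hc n).const_smul _).stronglyMeasurable

theorem stronglyMeasurable_smul_complex {X E : Type*} [MeasurableSpace X]
    [NormedAddCommGroup E] [NormedSpace ℂ E]
    {c : X → ℂ} {s : X → E} (hc : StronglyMeasurable c) (hs : StronglyMeasurable s) :
    StronglyMeasurable fun x => c x • s x :=
  hc.smul hs

variable {X : Type*} [TopologicalSpace X] [MeasurableSpace X] [OpensMeasurableSpace X]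
  [SecondCountableTopology X]

theorem stronglyMeasurable_gaussian {h : X → OnePhoton d} (hh : Continuous h) :
    StronglyMeasurable fun x => ((Real.exp (-‖h x‖ ^ 2 / 2) : ℝ) : ℂ) :=
  Continuous.stronglyMeasurable (by fun_prop)

theorem stronglyMeasurable_cohSum {h : X → OnePhoton d} (hh : Continuous h) :
    StronglyMeasurable fun x => cohSum (h x) 1 :=
  stronglyMeasurable_expSeries (y := fun x => cohTerm (h x)) (fun x => isEntireSeq_cohTerm (h x))
    (fun n => (continuous_cohTerm n).comp hh) 1

theorem stronglyMeasurable_creSum {f h : X → OnePhoton d} (hf : Continuous f)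
    (hh : Continuous h) : StronglyMeasurable fun x => creSum (f x) (h x) 1 :=
  stronglyMeasurable_expSeries (y := fun x => creTerm (f x) (h x))
    (fun x => isEntireSeq_creTerm (f x) (h x))
    (fun n => Continuous.comp (g := fun p : OnePhoton d × OnePhoton d => creTerm p.1 p.2 n)
      (f := fun x => (f x, h x)) (continuous_creTerm n) (hf.prodMk hh)) 1

theorem stronglyMeasurable_coherent {h : X → OnePhoton d} (hh : Continuous h) :
    StronglyMeasurable fun x => coherent (h x) :=
  stronglyMeasurable_smul_complex (stronglyMeasurable_gaussian hh) (stronglyMeasurable_cohSum hh)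

theorem stronglyMeasurable_coherentCre {f h : X → OnePhoton d} (hf : Continuous f)
    (hh : Continuous h) : StronglyMeasurable fun x => coherentCre (f x) (h x) :=
  stronglyMeasurable_smul_complex (stronglyMeasurable_gaussian hh)
    (stronglyMeasurable_creSum hf hh)

theorem norm_expSeries_one_le {E : Type*} [NormedAddCommGroup E] [NormedSpace ℝ E]
    {y : ℕ → E} {b : ℕ → ℝ} {B : ℝ} (hb : ∀ n, ‖y n‖ ≤ b n)
    (hB : HasSum (fun n => 1 / (n ! : ℝ) * b n) B) : ‖expSeries y 1‖ ≤ B := by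
  refine tsum_of_norm_bounded hB fun n => ?_
  rw [norm_smul, one_pow, Real.norm_of_nonneg (by positivity)]
  exact mul_le_mul_of_nonneg_left (hb n) (by positivity)

theorem exists_norm_coherentCre_le (R : ℝ) : ∃ C, 0 ≤ C ∧ ∀ f h : OnePhoton d, ‖h‖ ≤ R →
    ‖coherentCre f h‖ ≤ C * ‖f‖ := by
  rcases lt_or_ge R 0 with hR | hR
  · exact ⟨0, le_rfl, fun f h hh => absurd (norm_nonneg h) (by linarith)⟩
  have hs := isEntireSeq_of_factorial R hR 1
  simp only [abs_one, one_pow] at hs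
  refine ⟨∑' n : ℕ, 1 / (n ! : ℝ) * ‖√((n + 1)! : ℝ) * R ^ n‖, tsum_nonneg fun n => by positivity,
    fun f h hh => ?_⟩
  have h1 : ‖creSum f h 1‖ ≤ (∑' n : ℕ, 1 / (n ! : ℝ) * ‖√((n + 1)! : ℝ) * R ^ n‖) * ‖f‖ := by
    refine norm_expSeries_one_le (b := fun n => ‖√((n + 1)! : ℝ) * R ^ n‖ * ‖f‖) (fun n => ?_) ?_
    · refine (norm_creTerm_le f h n).trans ?_
      rw [mul_comm, Real.norm_of_nonneg (by positivity)]
      gcongr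
    · exact (hs.hasSum.mul_right ‖f‖).congr_fun fun n => by ring
  refine (norm_smul_le ((Real.exp (-‖h‖ ^ 2 / 2) : ℝ) : ℂ) (creSum f h 1)).trans ?_
  refine (mul_le_of_le_one_left (norm_nonneg _) ?_).trans h1
  rw [Complex.norm_real, Real.norm_of_nonneg (Real.exp_nonneg _), Real.exp_le_one_iff]
  have := sq_nonneg ‖h‖
  linarith

end Coherent
end

noncomputable section

section Radial

variable {d : ℕ}

theorem integral_comp_isometry {E : Type*} [NormedAddCommGroup E] [NormedSpace ℝ E]
    (T : Space d ≃ₗᵢ[ℝ] Space d) (F : Space d → E) : ∫ k, F (T k) = ∫ k, F k :=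
  T.measurePreserving.integral_comp T.toHomeomorph.measurableEmbedding F

theorem norm_coord_le_norm (k : Space d) (i : Fin d) : |k i| ≤ ‖k‖ := by
  simpa using PiLp.norm_apply_le k i

theorem abs_inv_norm_mul_coord_le (k : Space d) (i : Fin d) : |‖k‖⁻¹ * k i| ≤ 1 := by
  rw [abs_mul, abs_of_nonneg (by positivity : 0 ≤ ‖k‖⁻¹), inv_mul_eq_div]
  exact div_le_one_of_le₀ (norm_coord_le_norm k i) (norm_nonneg _)

theorem integrable_radial_mul {F : Space d → ℝ} (hF : Integrable F) (i j : Fin d) :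
    Integrable fun k => F k * ((‖k‖⁻¹ * k i) * (‖k‖⁻¹ * k j)) := by
  refine hF.mul_bdd (c := 1) (Measurable.aestronglyMeasurable (by fun_prop))
    (Eventually.of_forall fun k => ?_)
  rw [norm_mul]
  exact mul_le_one₀ (abs_inv_norm_mul_coord_le k i) (norm_nonneg _) (abs_inv_norm_mul_coord_le k j)

/-- The average of `k_i k_j / |k|²` against an integrable radial function. -/
theorem integral_radial_mul {F : Space d → ℝ} (hF : Integrable F)
    (hrad : ∀ k k', ‖k‖ = ‖k'‖ → F k = F k') (i j : Fin d) :
    ∫ k, F k * ((‖k‖⁻¹ * k i) * (‖k‖⁻¹ * k j)) = if i = j then (∫ k, F k) / d else 0 := by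
  have hd : (d : ℝ) ≠ 0 := by
    have := i.pos
    positivity
  have : Nonempty (Fin d) := ⟨i⟩
  by_cases hij : i = j
  · subst hij
    rw [if_pos rfl]
    have hperm : ∀ l, ∫ k, F k * ((‖k‖⁻¹ * k l) * (‖k‖⁻¹ * k l)) =
        ∫ k, F k * ((‖k‖⁻¹ * k i) * (‖k‖⁻¹ * k i)) := by
      intro l
      rw [← integral_comp_isometry (LinearIsometryEquiv.piLpCongrLeft 2 ℝ ℝ (Equiv.swap i l))]
      refine integral_congr_ae (Eventually.of_forall fun k => ?_)
      simp only [LinearIsometryEquiv.norm_map]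
      rw [hrad _ k (LinearIsometryEquiv.norm_map _ _)]
      simp [LinearIsometryEquiv.piLpCongrLeft_apply]
    have hsum : ∑ l, ∫ k, F k * ((‖k‖⁻¹ * k l) * (‖k‖⁻¹ * k l)) = ∫ k, F k := by
      rw [← integral_finsetSum _ fun l _ => integrable_radial_mul hF l l]
      refine integral_congr_ae ?_
      have h0 : ∀ᵐ k : Space d, k ≠ 0 := by
        have : Nontrivial (Space d) := inferInstance
        exact Measure.ae_ne volume 0
      filter_upwards [h0] with k hk
      rw [← Finset.mul_sum]
      have : ∑ l, ‖k‖⁻¹ * k l * (‖k‖⁻¹ * k l) = 1 := by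
        have h1 := EuclideanSpace.real_norm_sq_eq k
        have h2 : ‖k‖ ≠ 0 := norm_ne_zero_iff.2 hk
        calc ∑ l, ‖k‖⁻¹ * k l * (‖k‖⁻¹ * k l) = (‖k‖⁻¹) ^ 2 * ∑ l, k l ^ 2 := by
              rw [Finset.mul_sum]
              exact Finset.sum_congr rfl fun l _ => by ring
          _ = 1 := by rw [← h1]; field_simp
      rw [this, mul_one]
    rw [Finset.sum_congr rfl fun l _ => hperm l, Finset.sum_const, Finset.card_univ,
      Fintype.card_fin, nsmul_eq_mul] at hsum
    rw [← hsum]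
    field_simp
  · rw [if_neg hij]
    have h := integral_comp_isometry (LinearIsometryEquiv.piLpCongrRight 2 fun l : Fin d =>
      if l = i then LinearIsometryEquiv.neg ℝ (E := ℝ) else LinearIsometryEquiv.refl ℝ ℝ)
      fun k => F k * ((‖k‖⁻¹ * k i) * (‖k‖⁻¹ * k j))
    have h2 : ∀ k, F (LinearIsometryEquiv.piLpCongrRight 2 (fun l : Fin d =>
      if l = i then LinearIsometryEquiv.neg ℝ (E := ℝ) else LinearIsometryEquiv.refl ℝ ℝ) k) = F k :=
        fun k => hrad _ _ (LinearIsometryEquiv.norm_map _ _)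
    simp only [h2, LinearIsometryEquiv.norm_map] at h
    have h3 : ∀ k : Space d, F k * ((‖k‖⁻¹ * (LinearIsometryEquiv.piLpCongrRight 2 (fun l : Fin d =>
      if l = i then LinearIsometryEquiv.neg ℝ (E := ℝ) else LinearIsometryEquiv.refl ℝ ℝ) k) i) *
      (‖k‖⁻¹ * (LinearIsometryEquiv.piLpCongrRight 2 (fun l : Fin d =>
      if l = i then LinearIsometryEquiv.neg ℝ (E := ℝ) else LinearIsometryEquiv.refl ℝ ℝ) k) j)) =
        -(F k * ((‖k‖⁻¹ * k i) * (‖k‖⁻¹ * k j))) := by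
      intro k
      simp [LinearIsometryEquiv.piLpCongrRight_apply, Ne.symm hij]
    rw [integral_congr_ae (Eventually.of_forall h3), integral_neg] at h
    linarith

end Radial

namespace PauliFierzModel

variable {d : ℕ} (M : PauliFierzModel d)

theorem ae_sum_polarization (hd : 2 ≤ d) : ∀ᵐ k, ∀ i j, ∑ l, M.e l k i * M.e l k j =
    (if i = j then 1 else 0) - (‖k‖⁻¹ * k i) * (‖k‖⁻¹ * k j) := by
  filter_upwards [M.e_orthonormal] with k hk i j
  have hcard : Fintype.card (Option (Fin (d - 1))) = Module.finrank ℝ (Space d) := by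
    rw [Fintype.card_option, Fintype.card_fin, finrank_euclideanSpace_fin]
    omega
  have : Nonempty (Option (Fin (d - 1))) := ⟨none⟩
  let b := (basisOfOrthonormalOfCardEqFinrank hk hcard).toOrthonormalBasis (by simpa using hk)
  have hb : ∀ o, b o = o.elim (‖k‖⁻¹ • k) (fun l => M.e l k) := fun o => by
    simp [b]
  have h := b.sum_inner_mul_inner (EuclideanSpace.single i (1 : ℝ)) (EuclideanSpace.single j (1 : ℝ))
  rw [Fintype.sum_option] at h
  simp only [hb, Option.elim, EuclideanSpace.inner_single_left, EuclideanSpace.inner_single_right,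
    PiLp.smul_apply, smul_eq_mul, map_one, one_mul, conj_trivial] at h
  have h2 : (EuclideanSpace.single i (1 : ℝ) : Space d) j = if i = j then 1 else 0 := by
    simp [PiLp.single_apply, eq_comm]
  rw [h2] at h
  linarith

theorem ae_abs_polarization_le (j : Fin d) : ∀ᵐ κ ∂photonMeasure d, |M.e κ.2 κ.1 j| ≤ 1 := by
  have h : ∀ᵐ k, ∀ l, |M.e l k j| ≤ 1 := by
    filter_upwards [M.e_orthonormal] with k hk l
    refine (norm_coord_le_norm _ j).trans ?_
    have := hk.1 (some l)
    exact le_of_eq this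
  have h2 : ∀ᵐ κ : PhotonSpace d ∂photonMeasure d, ∀ l, |M.e l κ.1 j| ≤ 1 :=
    Measure.quasiMeasurePreserving_fst.ae h
  filter_upwards [h2] with κ hκ
  exact hκ κ.2

theorem measurable_polarization (j : Fin d) : Measurable fun κ : PhotonSpace d => M.e κ.2 κ.1 j := by
  refine measurable_from_prod_countable_left fun l => ?_
  have h := M.e_measurable l
  have h2 : Measurable fun k : Space d => k j := by fun_prop
  exact h2.comp h

theorem memLp_polarized {F : Space d → ℝ} (hF : MemLp F 2 volume) (j : Fin d) :
    MemLp (fun κ : PhotonSpace d => ((F κ.1 * M.e κ.2 κ.1 j : ℝ) : ℂ)) 2 (photonMeasure d) := by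
  have h1 : MemLp (fun κ : PhotonSpace d => F κ.1) 2 (photonMeasure d) :=
    MemLp.comp_fst hF Measure.count
  refine MemLp.ofReal (h1.of_le_mul (c := 1)
    (h1.1.mul (M.measurable_polarization j).aestronglyMeasurable) ?_)
  filter_upwards [M.ae_abs_polarization_le j] with κ hκ
  change ‖F κ.1 * M.e κ.2 κ.1 j‖ ≤ _
  rw [norm_mul, mul_comm]
  exact mul_le_mul_of_nonneg_right hκ (norm_nonneg _)

/-- The one-photon function `F(k) e_j^{(λ)}(k)`. -/
def polarized (F : Space d → ℝ) (j : Fin d) : OnePhoton d :=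
  open Classical in
  if hF : MemLp F 2 volume then (M.memLp_polarized hF j).toLp _ else 0

theorem coeFn_polarized {F : Space d → ℝ} (hF : MemLp F 2 volume) (j : Fin d) :
    M.polarized F j =ᵐ[photonMeasure d] fun κ => ((F κ.1 * M.e κ.2 κ.1 j : ℝ) : ℂ) := by
  rw [polarized, dif_pos hF]
  exact (M.memLp_polarized hF j).coeFn_toLp

theorem inner_polarized (hd : 2 ≤ d) {F G : Space d → ℝ} (hF : MemLp F 2 volume)
    (hG : MemLp G 2 volume) (hrF : ∀ k k', ‖k‖ = ‖k'‖ → F k = F k')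
    (hrG : ∀ k k', ‖k‖ = ‖k'‖ → G k = G k') (i j : Fin d) :
    inner ℂ (M.polarized F i) (M.polarized G j) =
      (((if i = j then ((d : ℝ) - 1) / d * ∫ k, F k * G k else 0) : ℝ) : ℂ) := by
  have hdR : (d : ℝ) ≠ 0 := by positivity
  have hFG : Integrable (fun k => F k * G k) volume := hF.integrable_mul hG
  have hint : Integrable (fun κ : PhotonSpace d => (F κ.1 * M.e κ.2 κ.1 i) * (G κ.1 * M.e κ.2 κ.1 j))
      (photonMeasure d) := by
    have h := (M.memLp_polarized hF i).integrable_mul (M.memLp_polarized hG j)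
    have h2 := h.re
    refine h2.congr (Eventually.of_forall fun κ => ?_)
    simp [← Complex.ofReal_mul]
  rw [L2.inner_def]
  have h1 : (fun κ => inner ℂ (M.polarized F i κ) (M.polarized G j κ)) =ᵐ[photonMeasure d]
      fun κ => (((F κ.1 * M.e κ.2 κ.1 i) * (G κ.1 * M.e κ.2 κ.1 j) : ℝ) : ℂ) := by
    filter_upwards [M.coeFn_polarized hF i, M.coeFn_polarized hG j] with κ h1 h2
    rw [h1, h2, RCLike.inner_apply, Complex.conj_ofReal, ← Complex.ofReal_mul, mul_comm]
  rw [integral_congr_ae h1, integral_complex_ofReal]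
  congr 1
  have h2 : ∫ κ, (F κ.1 * M.e κ.2 κ.1 i) * (G κ.1 * M.e κ.2 κ.1 j) ∂photonMeasure d =
      ∫ k, ∑ l, (F k * M.e l k i) * (G k * M.e l k j) := by
    rw [photonMeasure] at hint ⊢
    rw [integral_prod _ hint]
    refine integral_congr_ae (Eventually.of_forall fun k => ?_)
    simp only [integral_count]
  rw [h2]
  have h3 : (fun k => ∑ l, (F k * M.e l k i) * (G k * M.e l k j)) =ᵐ[volume]
      fun k => (if i = j then 1 else 0) * (F k * G k) -
        (F k * G k) * ((‖k‖⁻¹ * k i) * (‖k‖⁻¹ * k j)) := by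
    filter_upwards [M.ae_sum_polarization hd] with k hk
    rw [Finset.sum_congr rfl fun l _ => show (F k * M.e l k i) * (G k * M.e l k j) =
      (F k * G k) * (M.e l k i * M.e l k j) by ring, ← Finset.mul_sum, hk]
    ring
  rw [integral_congr_ae h3, integral_sub (hFG.const_mul _) (integrable_radial_mul hFG i j),
    integral_const_mul, integral_radial_mul hFG (fun k k' h => by rw [hrF k k' h, hrG k k' h])]
  split_ifs
  · field_simp
  · simp

end PauliFierzModel
end

noncomputable section

namespace PauliFierzModel

variable {d : ℕ} (M : PauliFierzModel d)

/-- The radial part of the coupling functions `g_j`. -/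
def amp (k : Space d) : ℝ := √(M.hbar / (M.eps0 * M.ω k)) * M.ρ k

/-- The radial part of `g_j / ω`. -/
def ampDiv (k : Space d) : ℝ := M.amp k / M.ω k

/-- The radial part of `g_j / (ħω)^{1/2}`. -/
def ampSqrt (k : Space d) : ℝ := M.amp k / √(M.hbar * M.ω k)

theorem measurable_amp : Measurable M.amp := by
  have := M.ω_measurable
  have := M.ρ_measurable
  unfold amp
  fun_prop

theorem ae_amp_eq : M.amp =ᵐ[volume] fun k => √(M.hbar / M.eps0) * (M.ρ k / M.ω k ^ (1 / 2 : ℝ)) := by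
  filter_upwards [M.ω_pos] with k hk
  rw [amp, ← div_div, Real.sqrt_div' _ hk.le, ← Real.sqrt_eq_rpow]
  ring

theorem ae_ampDiv_eq :
    M.ampDiv =ᵐ[volume] fun k => √(M.hbar / M.eps0) * (M.ρ k / M.ω k ^ (3 / 2 : ℝ)) := by
  filter_upwards [M.ω_pos, M.ae_amp_eq] with k hk h
  rw [ampDiv, h, show (3 / 2 : ℝ) = 1 / 2 + 1 by norm_num, Real.rpow_add_one hk.ne']
  field_simp

theorem memLp_amp : MemLp M.amp 2 volume :=
  (M.ρ_div_memLp.const_mul _).ae_eq M.ae_amp_eq.symm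

theorem memLp_ampDiv : MemLp M.ampDiv 2 volume :=
  (M.ρ_div_memLp'.const_mul _).ae_eq M.ae_ampDiv_eq.symm

theorem ae_ampSqrt_sq : (fun k => M.ampSqrt k * M.ampSqrt k) =ᵐ[volume]
    fun k => M.hbar⁻¹ * (M.amp k * M.ampDiv k) := by
  filter_upwards [M.ω_pos] with k hk
  have h := M.hbar_pos
  have h2 : √(M.hbar * M.ω k) * √(M.hbar * M.ω k) = M.hbar * M.ω k :=
    Real.mul_self_sqrt (by positivity)
  rw [ampSqrt, ampDiv, div_mul_div_comm, h2]
  field_simp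

theorem memLp_ampSqrt : MemLp M.ampSqrt 2 volume := by
  have hm : AEStronglyMeasurable M.ampSqrt volume := by
    have h1 := M.measurable_amp
    have h2 := M.ω_measurable
    have : Measurable M.ampSqrt := by
      unfold ampSqrt
      fun_prop
    exact this.aestronglyMeasurable
  rw [memLp_two_iff_integrable_sq hm]
  have h := (M.memLp_amp.integrable_mul M.memLp_ampDiv).const_mul M.hbar⁻¹
  refine h.congr (M.ae_ampSqrt_sq.symm.trans (Eventually.of_forall fun k => ?_))
  exact (sq _).symm

theorem amp_radial (k k' : Space d) (h : ‖k‖ = ‖k'‖) : M.amp k = M.amp k' := by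
  rw [amp, amp, M.ω_radial k k' h, M.ρ_radial k k' h]

theorem ampDiv_radial (k k' : Space d) (h : ‖k‖ = ‖k'‖) : M.ampDiv k = M.ampDiv k' := by
  rw [ampDiv, ampDiv, M.ω_radial k k' h, M.amp_radial k k' h]

theorem ampSqrt_radial (k k' : Space d) (h : ‖k‖ = ‖k'‖) : M.ampSqrt k = M.ampSqrt k' := by
  rw [ampSqrt, ampSqrt, M.ω_radial k k' h, M.amp_radial k k' h]

theorem integral_amp_mul_ampDiv :
    ∫ k, M.amp k * M.ampDiv k = M.hbar / M.eps0 * ∫ k, |M.ρ k| ^ 2 / M.ω k ^ 2 := by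
  rw [← integral_const_mul]
  refine integral_congr_ae ?_
  filter_upwards [M.ω_pos] with k hk
  have h1 := M.hbar_pos
  have h2 := M.eps0_pos
  have h3 : √(M.hbar / (M.eps0 * M.ω k)) ^ 2 = M.hbar / (M.eps0 * M.ω k) :=
    Real.sq_sqrt (by positivity)
  calc _ = √(M.hbar / (M.eps0 * M.ω k)) ^ 2 * M.ρ k ^ 2 / M.ω k := by
        rw [ampDiv, amp]
        ring
    _ = _ := by
        rw [h3, sq_abs]
        field_simp

theorem integral_ampDiv_mul_ampDiv :
    ∫ k, M.ampDiv k * M.ampDiv k = M.hbar / M.eps0 * ∫ k, |M.ρ k| ^ 2 / M.ω k ^ 3 := by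
  rw [← integral_const_mul]
  refine integral_congr_ae ?_
  filter_upwards [M.ω_pos] with k hk
  have h1 := M.hbar_pos
  have h2 := M.eps0_pos
  have h3 : √(M.hbar / (M.eps0 * M.ω k)) ^ 2 = M.hbar / (M.eps0 * M.ω k) :=
    Real.sq_sqrt (by positivity)
  calc _ = √(M.hbar / (M.eps0 * M.ω k)) ^ 2 * M.ρ k ^ 2 / M.ω k ^ 2 := by
        rw [ampDiv, amp]
        ring
    _ = _ := by
        rw [h3, sq_abs]
        field_simp

theorem integral_ampSqrt_mul_ampSqrt :
    ∫ k, M.ampSqrt k * M.ampSqrt k = M.eps0⁻¹ * ∫ k, |M.ρ k| ^ 2 / M.ω k ^ 2 := by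
  have h1 := M.hbar_pos
  rw [integral_congr_ae M.ae_ampSqrt_sq, integral_const_mul, M.integral_amp_mul_ampDiv]
  field_simp

/-- The one-photon function `F(k) P·e^{(λ)}(k)`. -/
def polarizedSum (F : Space d → ℝ) (P : Space d) : OnePhoton d :=
  ∑ j, ((P j : ℝ) : ℂ) • M.polarized F j

theorem continuous_polarizedSum (F : Space d → ℝ) : Continuous (M.polarizedSum F) := by
  refine continuous_finsetSum _ fun j _ => ?_
  have h : Continuous fun P : Space d => ((P j : ℝ) : ℂ) := by fun_prop
  exact h.smul continuous_const

theorem coeFn_polarizedSum {F : Space d → ℝ} (hF : MemLp F 2 volume) (P : Space d) :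
    M.polarizedSum F P =ᵐ[photonMeasure d]
      fun κ => ((∑ j, P j * (F κ.1 * M.e κ.2 κ.1 j) : ℝ) : ℂ) := by
  filter_upwards [coeFn_finset_sum Finset.univ fun j => ((P j : ℝ) : ℂ) • M.polarized F j,
    ae_all_iff.2 fun j => Lp.coeFn_smul ((P j : ℝ) : ℂ) (M.polarized F j),
    ae_all_iff.2 fun j => M.coeFn_polarized hF j] with κ h1 h2 h3
  rw [polarizedSum, h1]
  push_cast
  refine Finset.sum_congr rfl fun j _ => ?_
  rw [h2, Pi.smul_apply, h3, smul_eq_mul]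
  push_cast
  rfl

theorem inner_polarized_polarizedSum (hd : 2 ≤ d) {F G : Space d → ℝ} (hF : MemLp F 2 volume)
    (hG : MemLp G 2 volume) (hrF : ∀ k k', ‖k‖ = ‖k'‖ → F k = F k')
    (hrG : ∀ k k', ‖k‖ = ‖k'‖ → G k = G k') (i : Fin d) (P : Space d) :
    inner ℂ (M.polarized F i) (M.polarizedSum G P) =
      ((((d : ℝ) - 1) / d * (∫ k, F k * G k) * P i : ℝ) : ℂ) := by
  rw [polarizedSum, inner_sum]
  simp only [inner_smul_right, M.inner_polarized hd hF hG hrF hrG]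
  rw [Finset.sum_eq_single i]
  · rw [if_pos rfl]
    push_cast
    ring
  · intro j _ hj
    rw [if_neg (Ne.symm hj)]
    simp
  · simp

theorem inner_polarizedSum (hd : 2 ≤ d) {F G : Space d → ℝ} (hF : MemLp F 2 volume)
    (hG : MemLp G 2 volume) (hrF : ∀ k k', ‖k‖ = ‖k'‖ → F k = F k')
    (hrG : ∀ k k', ‖k‖ = ‖k'‖ → G k = G k') (P Q : Space d) :
    inner ℂ (M.polarizedSum F P) (M.polarizedSum G Q) =
      ((((d : ℝ) - 1) / d * (∫ k, F k * G k) * inner ℝ P Q : ℝ) : ℂ) := by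
  rw [polarizedSum, sum_inner]
  simp only [inner_smul_left, M.inner_polarized_polarizedSum hd hF hG hrF hrG, Complex.conj_ofReal]
  rw [PiLp.inner_apply, Finset.mul_sum]
  push_cast
  refine Finset.sum_congr rfl fun j _ => ?_
  simp
  ring

theorem norm_polarizedSum_sq (hd : 2 ≤ d) {F : Space d → ℝ} (hF : MemLp F 2 volume)
    (hrF : ∀ k k', ‖k‖ = ‖k'‖ → F k = F k') (P : Space d) :
    ‖M.polarizedSum F P‖ ^ 2 = ((d : ℝ) - 1) / d * (∫ k, F k * F k) * ‖P‖ ^ 2 := by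
  have h := M.inner_polarizedSum hd hF hF hrF hrF P P
  rw [inner_self_eq_norm_sq_to_K, real_inner_self_eq_norm_sq] at h
  refine Complex.ofReal_injective ?_
  rw [← h]
  push_cast
  rfl

theorem g_eq (j : Fin d) (κ : PhotonSpace d) : M.g j κ = M.amp κ.1 * M.e κ.2 κ.1 j := rfl

theorem memLp_g (j : Fin d) : MemLp (fun κ => (M.g j κ : ℂ)) 2 (photonMeasure d) :=
  M.memLp_polarized M.memLp_amp j

theorem toLp_g (j : Fin d) : (M.memLp_g j).toLp _ = M.polarized M.amp j := by
  rw [polarized, dif_pos M.memLp_amp]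
  rfl

/-- The one-photon function of the coherent state of the dressed electron with momentum `P`. -/
def shift (P : Space d) : OnePhoton d :=
  ((M.q / (M.m * M.hbar) / √2 : ℝ) : ℂ) • M.polarizedSum M.ampDiv P

theorem continuous_shift : Continuous M.shift :=
  (M.continuous_polarizedSum M.ampDiv).const_smul ((M.q / (M.m * M.hbar) / √2 : ℝ) : ℂ)

theorem dressing_coe (P : Space d) : (fun κ : PhotonSpace d =>
    Complex.I * ((∑ j, P j * M.g j κ : ℝ) : ℂ) / (M.ω κ.1 : ℂ)) = fun κ =>
      Complex.I * ((∑ j, P j * (M.ampDiv κ.1 * M.e κ.2 κ.1 j) : ℝ) : ℂ) := by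
  funext κ
  rw [mul_div_assoc, ← Complex.ofReal_div, Finset.sum_div]
  congr 2
  refine Finset.sum_congr rfl fun j _ => ?_
  rw [g_eq, ampDiv]
  ring

theorem ae_dressing_eq (P : Space d) : (fun κ : PhotonSpace d =>
    Complex.I * ((∑ j, P j * M.g j κ : ℝ) : ℂ) / (M.ω κ.1 : ℂ)) =ᵐ[photonMeasure d]
      ⇑(Complex.I • M.polarizedSum M.ampDiv P) := by
  rw [dressing_coe]
  filter_upwards [M.coeFn_polarizedSum M.memLp_ampDiv P,
    Lp.coeFn_smul Complex.I (M.polarizedSum M.ampDiv P)] with κ h1 h2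
  rw [h2, Pi.smul_apply, h1, smul_eq_mul]

theorem memLp_dressing (P : Space d) : MemLp (fun κ : PhotonSpace d =>
    Complex.I * ((∑ j, P j * M.g j κ : ℝ) : ℂ) / (M.ω κ.1 : ℂ)) 2 (photonMeasure d) :=
  (Lp.memLp (Complex.I • M.polarizedSum M.ampDiv P)).ae_eq (M.ae_dressing_eq P).symm

theorem toLp_dressing (P : Space d) :
    (M.memLp_dressing P).toLp _ = Complex.I • M.polarizedSum M.ampDiv P :=
  Lp.ext ((M.memLp_dressing P).coeFn_toLp.trans (M.ae_dressing_eq P))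

theorem coupling_ne_zero : M.q / (M.m * M.hbar) ≠ 0 :=
  div_ne_zero M.q_ne_zero (mul_pos M.m_pos M.hbar_pos).ne'

theorem dressingFiber_eq (P : Space d) : M.dressingFiber P =
    expI (((M.q / (M.m * M.hbar) : ℝ) : ℂ) • segalField fun κ : PhotonSpace d =>
      Complex.I * ((∑ j, P j * M.g j κ : ℝ) : ℂ) / (M.ω κ.1 : ℂ)) := by
  rw [dressingFiber]
  push_cast
  rfl

theorem smul_toLp_dressing (P : Space d) :
    ((M.q / (M.m * M.hbar) : ℝ) : ℂ) • (M.memLp_dressing P).toLp _ =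
      ((√2 : ℝ) * Complex.I : ℂ) • M.shift P := by
  rw [toLp_dressing, shift, smul_smul, smul_smul]
  congr 1
  have := sqrt_two_ne_zero
  push_cast
  field_simp

theorem adjoint_dressingFiber_vacuum (P : Space d) :
    ContinuousLinearMap.adjoint (M.dressingFiber P) (vacuum d) = coherent (M.shift P) :=
  (congrArg (fun T => ContinuousLinearMap.adjoint T (vacuum d)) (M.dressingFiber_eq P)).trans
    (adjoint_expI_vacuum (M.memLp_dressing P) M.coupling_ne_zero (M.smul_toLp_dressing P))

theorem a_pos (hd : 2 ≤ d) : 0 < M.a := by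
  have h1 := M.hbar_pos
  have h2 := M.eps0_pos
  have h3 := M.m_pos
  have h4 := M.q_ne_zero
  have hd' : (0 : ℝ) < (d : ℝ) - 1 := by
    have : (2 : ℝ) ≤ d := by exact_mod_cast hd
    linarith
  have hint : 0 < ∫ k, |M.ρ k| ^ 2 / M.ω k ^ 3 := by
    have h5 : (0 : ℝ) < M.hbar / M.eps0 := by positivity
    refine pos_of_mul_pos_right (a := M.hbar / M.eps0) ?_ h5.le
    rw [← M.integral_ampDiv_mul_ampDiv]
    refine (integral_pos_iff_support_of_nonneg (fun k => mul_self_nonneg _)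
      (M.memLp_ampDiv.integrable_mul M.memLp_ampDiv)).2 ?_
    rw [pos_iff_ne_zero]
    intro h0
    refine M.ρ_div_ne_zero' ?_
    have h6 : ∀ᵐ k, M.ampDiv k * M.ampDiv k = 0 := by
      rw [ae_iff]
      exact h0
    filter_upwards [h6, M.ae_ampDiv_eq] with k h7 h8
    rw [mul_self_eq_zero, h8] at h7
    exact (mul_eq_zero.1 h7).resolve_left (Real.sqrt_pos.2 h5).ne'
  have hd2 : (0 : ℝ) < d := by linarith
  unfold a
  positivity

theorem inner_shift (hd : 2 ≤ d) (P Q : Space d) : inner ℂ (M.shift P) (M.shift Q) =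
    ((2 * M.a / M.hbar ^ 2 * inner ℝ P Q : ℝ) : ℂ) := by
  rw [shift, shift, inner_smul_left, inner_smul_right, Complex.conj_ofReal, M.inner_polarizedSum hd
    M.memLp_ampDiv M.memLp_ampDiv M.ampDiv_radial M.ampDiv_radial, M.integral_ampDiv_mul_ampDiv,
    ← Complex.ofReal_mul, ← Complex.ofReal_mul, a]
  congr 1
  have h1 := M.hbar_pos
  have h2 := M.eps0_pos
  have h3 := M.m_pos
  have h5 : (√2 : ℝ) ^ 2 = 2 := Real.sq_sqrt two_pos.le
  have h4 : (0 : ℝ) < d := by positivity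
  field_simp
  rw [h5]
  ring

theorem norm_shift_sq (hd : 2 ≤ d) (P : Space d) :
    ‖M.shift P‖ ^ 2 = 2 * M.a / M.hbar ^ 2 * ‖P‖ ^ 2 := by
  have h := M.inner_shift hd P P
  rw [inner_self_eq_norm_sq_to_K, real_inner_self_eq_norm_sq] at h
  refine Complex.ofReal_injective ?_
  rw [← h]
  push_cast
  rfl

theorem inner_coherent_shift (hd : 2 ≤ d) (P Q : Space d) :
    inner ℂ (coherent (M.shift P)) (coherent (M.shift Q)) =
      ((Real.exp (-(M.a / M.hbar ^ 2 * ‖P - Q‖ ^ 2)) : ℝ) : ℂ) := by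
  rw [inner_coherent, M.inner_shift hd, ← Complex.ofReal_pow, ← Complex.ofReal_pow,
    M.norm_shift_sq hd, M.norm_shift_sq hd, Complex.ofReal_exp, norm_sub_sq_real]
  congr 1
  push_cast
  ring

end PauliFierzModel
end

noncomputable section

section MeasurableField

theorem stronglyMeasurable_apply_of_forall {X E F : Type*} [MeasurableSpace X]
    [NormedAddCommGroup E] [NormedSpace ℂ E] [NormedAddCommGroup F] [NormedSpace ℂ F]
    {T : X → E →L[ℂ] F} (hT : ∀ u, StronglyMeasurable fun x => T x u) {s : X → E}
    (hs : StronglyMeasurable s) : StronglyMeasurable fun x => T x (s x) := by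
  have simple : ∀ s : SimpleFunc X E, StronglyMeasurable fun x => T x (s x) := by
    intro s
    have e : (fun x => T x (s x)) =
        fun x => ∑ v ∈ s.range, (s ⁻¹' {v}).indicator (fun x => T x v) x := by
      funext x
      rw [Finset.sum_eq_single (s x)]
      · rw [Set.indicator_of_mem (show x ∈ s ⁻¹' {s x} from rfl)]
      · intro v _ hv
        exact Set.indicator_of_notMem (fun h => hv h.symm) _
      · intro h
        exact absurd (s.mem_range_self x) h
    rw [e]
    exact Finset.stronglyMeasurable_fun_sum _ fun v _ => (hT v).indicator (s.measurableSet_fiber v)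
  refine stronglyMeasurable_of_tendsto atTop (f := fun n x => T x (hs.approx n x))
    (fun n => simple _) (tendsto_pi_nhds.2 fun x => ?_)
  exact ((T x).continuous.tendsto _).comp (hs.tendsto_approx x)

variable {E : ℕ → Type*} [∀ n, NormedAddCommGroup (E n)] [∀ n, InnerProductSpace ℂ (E n)]

theorem eq_sum_single_of_forall_ge {E : ℕ → Type*} [∀ n, NormedAddCommGroup (E n)] {Ψ : lp E 2} {N : ℕ} (h : ∀ n ≥ N, Ψ n = 0) :
    Ψ = ∑ m ∈ Finset.range N, lp.single 2 m (Ψ m) := by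
  have h1 := lp.hasSum_single (E := E) (p := 2) (by norm_num) Ψ
  refine h1.unique (hasSum_sum_of_ne_finset_zero fun n hn => ?_)
  rw [h n (by simpa using hn), lp.single_zero]

namespace LadderPair

variable {X : Type*} [TopologicalSpace X] {L : X → LadderPair E}

theorem onFinite_pow_eq_zero (L : LadderPair E) {u : finiteVectors E} {N : ℕ}
    (h : ∀ n ≥ N, (u : lp E 2) n = 0) (k : ℕ) :
    ∀ n ≥ N + k, (((L.onFinite ^ k) u : finiteVectors E) : lp E 2) n = 0 := by
  induction k with
  | zero => simpa using h
  | succ k ih =>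
    intro n hn
    rw [pow_succ', Module.End.mul_apply, onFinite_apply]
    exact L.comp_eq_zero ih hn

/-- Continuous dependence of the powers on a parameter. -/
theorem continuous_onFinite_pow
    (hl : ∀ n (v : X → E (n + 1)), Continuous v → Continuous fun x => (L x).lower n (v x))
    (hr : ∀ n (v : X → E n), Continuous v → Continuous fun x => (L x).raise n (v x))
    (u : finiteVectors E) (k : ℕ) :
    Continuous fun x => ((((L x).onFinite ^ k) u : finiteVectors E) : lp E 2) := by
  obtain ⟨N, hN⟩ := u.2
  have hcomp : ∀ m, Continuous fun x => ((((L x).onFinite ^ k) u : finiteVectors E) : lp E 2) m := by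
    induction k with
    | zero => exact fun m => continuous_const (y := (u : lp E 2) m)
    | succ k ih =>
      intro m
      simp only [pow_succ', Module.End.mul_apply, onFinite_apply, comp_apply]
      refine (hl m _ (ih (m + 1))).add ?_
      cases m with
      | zero => exact continuous_const
      | succ m => exact hr m _ (ih m)
  have e : (fun x => ((((L x).onFinite ^ k) u : finiteVectors E) : lp E 2)) =
      fun x => ∑ m ∈ Finset.range (N + k),
        lp.single 2 m (((((L x).onFinite ^ k) u : finiteVectors E) : lp E 2) m) :=
    funext fun x => eq_sum_single_of_forall_ge ((L x).onFinite_pow_eq_zero hN k)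
  rw [e]
  exact continuous_finsetSum _ fun m _ => (continuous_lp_single m).comp (hcomp m)

variable [MeasurableSpace X] [OpensMeasurableSpace X] [SecondCountableTopology X]
  [∀ n, CompleteSpace (E n)]

theorem stronglyMeasurable_expI {A : X → lp E 2 →ₗ.[ℂ] lp E 2}
    (hA : ∀ x, A x = (L x).finiteGraph.topologicalClosure.toLinearPMap) {κ : ℝ} (hκ : κ ≠ 0)
    (hl : ∀ n (v : X → E (n + 1)), Continuous v → Continuous fun x => (L x).lower n (v x))
    (hr : ∀ n (v : X → E n), Continuous v → Continuous fun x => (L x).raise n (v x))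
    (u : lp E 2) : StronglyMeasurable fun x => expI ((κ : ℂ) • A x) u := by
  have hfin : ∀ u : finiteVectors E, StronglyMeasurable fun x => expI ((κ : ℂ) • A x) (u : lp E 2) := by
    intro u
    have hcore := fun x => (L x).isEntireCore.smul hκ
    have e : (fun x => expI ((κ : ℂ) • A x) (u : lp E 2)) = fun x => expSeries (fun n =>
        Complex.I ^ n • (((((κ : ℂ) • (L x).onFinite) ^ n) u : finiteVectors E) : lp E 2)) 1 := by
      funext x
      obtain ⟨W, hW, hW1⟩ := (hcore x).exists_expI_eq
      rw [hA, hW1, (hcore x).unitaryGroup_apply hW 1 u]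
      rfl
    rw [e]
    refine stronglyMeasurable_expSeries (fun x => (hcore x).isEntireSeq u) (fun n => ?_) 1
    have h1 : ∀ x, (((((κ : ℂ) • (L x).onFinite) ^ n) u : finiteVectors E) : lp E 2) =
        (κ : ℂ) ^ n • ((((L x).onFinite ^ n) u : finiteVectors E) : lp E 2) := by
      intro x
      have : ((κ : ℂ) • (L x).onFinite) ^ n = (κ : ℂ) ^ n • (L x).onFinite ^ n := smul_pow _ _ _
      rw [this]
      rfl
    simp only [h1]
    exact Continuous.const_smul ((continuous_onFinite_pow hl hr u n).const_smul ((κ : ℂ) ^ n))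
      (Complex.I ^ n)
  refine stronglyMeasurable_of_tendsto atTop
    (f := fun N x => expI ((κ : ℂ) • A x) (∑ m ∈ Finset.range N, lp.single 2 m (u m)))
    (fun N => hfin ⟨∑ m ∈ Finset.range N, lp.single 2 m (u m), Submodule.sum_mem _ fun m _ => single_mem_finiteVectors m (u m)⟩)
    (tendsto_pi_nhds.2 fun x => ?_)
  exact ((expI ((κ : ℂ) • A x)).continuous.tendsto _).comp
    (lp.hasSum_single (by norm_num) u).tendsto_sum_nat

end LadderPair

theorem IsEntireCore.norm_expI_le {H : Type*} [NormedAddCommGroup H] [InnerProductSpace ℂ H]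
    [CompleteSpace H] {A : H →ₗ.[ℂ] H} {D : Submodule ℂ H} {T : D →ₗ[ℂ] D}
    (h : IsEntireCore A D T) {κ : ℝ} (hκ : κ ≠ 0) : ‖expI ((κ : ℂ) • A)‖ ≤ 1 := by
  obtain ⟨W, hW, hW1⟩ := (h.smul hκ).exists_expI_eq
  rw [hW1]
  exact ContinuousLinearMap.opNorm_le_bound _ zero_le_one fun ψ => by rw [hW.norm_map, one_mul]

end MeasurableField

section Decomposable

variable {d : ℕ} {F : Type*} [NormedAddCommGroup F] [InnerProductSpace ℂ F] [CompleteSpace F]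

theorem inner_fourierIso (X Y : L2 d F) :
    inner ℂ (Lp.fourierTransformₗᵢ (Space d) F X) (Lp.fourierTransformₗᵢ (Space d) F Y) =
      inner ℂ X Y :=
  LinearIsometryEquiv.inner_map_map _ _ _

theorem fourier_adjoint_directIntegral {T : Space d → F →L[ℂ] F} (h₁ : ∃ C : ℝ, ∀ ξ, ‖T ξ‖ ≤ C)
    (h₂ : ∀ Ψ : L2 d F, AEStronglyMeasurable (fun ξ => T ξ (Ψ ξ)) volume) {v : F} {η : Space d → F}
    (hη : ∀ ξ, ContinuousLinearMap.adjoint (T ξ) v = η ξ) (hm : StronglyMeasurable η)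
    (hn : ∀ ξ, ‖η ξ‖ ≤ 1) (ψ : L2 d ℂ) :
    ⇑(𝓕 (ContinuousLinearMap.adjoint
      ((Lp.fourierTransformₗᵢ (Space d) F).symm.toContinuousLinearEquiv.toContinuousLinearMap ∘L
        directIntegral T ∘L
        (Lp.fourierTransformₗᵢ (Space d) F).toContinuousLinearEquiv.toContinuousLinearMap)
      (tensor ψ v)) : L2 d F) =ᵐ[volume] fun ξ => (𝓕 ψ : L2 d ℂ) ξ • η ξ := by
  have hZ : MemLp (fun ξ => (𝓕 ψ : L2 d ℂ) ξ • η ξ) 2 volume := by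
    refine MemLp.of_le_mul (c := 1) (Lp.memLp (𝓕 ψ : L2 d ℂ))
      ((Lp.aestronglyMeasurable _).smul hm.aestronglyMeasurable) (Eventually.of_forall fun ξ => ?_)
    rw [norm_smul, mul_comm]
    exact mul_le_mul_of_nonneg_right (hn ξ) (norm_nonneg _)
  have key : ContinuousLinearMap.adjoint
      ((Lp.fourierTransformₗᵢ (Space d) F).symm.toContinuousLinearEquiv.toContinuousLinearMap ∘L
        directIntegral T ∘L
        (Lp.fourierTransformₗᵢ (Space d) F).toContinuousLinearEquiv.toContinuousLinearMap)
      (tensor ψ v) = (Lp.fourierTransformₗᵢ (Space d) F).symm (hZ.toLp _) := by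
    refine ext_inner_left ℂ fun X => ?_
    rw [ContinuousLinearMap.adjoint_inner_right]
    change inner ℂ ((Lp.fourierTransformₗᵢ (Space d) F).symm
      (directIntegral T (Lp.fourierTransformₗᵢ (Space d) F X))) _ = _
    rw [← inner_fourierIso, LinearIsometryEquiv.apply_symm_apply, ← inner_fourierIso X,
      LinearIsometryEquiv.apply_symm_apply]
    change inner ℂ (directIntegral T (𝓕 X : L2 d F)) (𝓕 (tensor ψ v) : L2 d F) =
      inner ℂ (𝓕 X : L2 d F) (hZ.toLp _)
    rw [fourier_tensor, L2.inner_def, L2.inner_def]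
    refine integral_congr_ae ?_
    filter_upwards [coeFn_directIntegral h₁ h₂ (𝓕 X : L2 d F), coeFn_tensor (𝓕 ψ : L2 d ℂ) v,
      hZ.coeFn_toLp] with ξ e1 e2 e3
    rw [e1, e2, e3, inner_smul_right, inner_smul_right, ← hη,
      ContinuousLinearMap.adjoint_inner_right]
  rw [key]
  change ⇑(Lp.fourierTransformₗᵢ (Space d) F ((Lp.fourierTransformₗᵢ (Space d) F).symm
    (hZ.toLp _))) =ᵐ[volume] _
  rw [LinearIsometryEquiv.apply_symm_apply]
  exact hZ.coeFn_toLp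

end Decomposable
end

noncomputable section

section TensorOp

variable {d : ℕ} {F : Type*} [NormedAddCommGroup F] [InnerProductSpace ℂ F] [CompleteSpace F]

theorem L2.tendsto_of_dominated {X : ℕ → L2 d F} {Y : L2 d F} {b : Space d → ℝ}
    (hb : MemLp b 2 volume) (hle : ∀ n, ∀ᵐ x, ‖X n x - Y x‖ ≤ b x)
    (hlim : ∀ᵐ x, Tendsto (fun n => X n x) atTop (𝓝 (Y x))) : Tendsto X atTop (𝓝 Y) := by
  rw [tendsto_iff_norm_sub_tendsto_zero]
  have h1 : Tendsto (fun n => ‖X n - Y‖ ^ 2) atTop (𝓝 0) := by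
    have e : ∀ n, ‖X n - Y‖ ^ 2 = ∫ x, ‖X n x - Y x‖ ^ 2 := by
      intro n
      rw [L2.norm_sq_eq_integral]
      refine integral_congr_ae ?_
      filter_upwards [Lp.coeFn_sub (X n) Y] with x hx
      rw [hx, Pi.sub_apply]
    simp only [e]
    rw [← integral_zero (Space d) ℝ (μ := volume)]
    refine tendsto_integral_of_dominated_convergence (fun x => b x ^ 2) (fun n => ?_)
      hb.integrable_sq (fun n => ?_) ?_
    · exact (((Lp.aestronglyMeasurable (X n)).sub (Lp.aestronglyMeasurable Y)).norm.pow 2)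
    · filter_upwards [hle n] with x hx
      rw [Real.norm_of_nonneg (by positivity)]
      exact pow_le_pow_left₀ (norm_nonneg _) hx 2
    · filter_upwards [hlim] with x hx
      have := ((hx.sub_const (Y x)).norm).pow 2
      simpa using this
  have h2 := h1.sqrt
  simpa [Real.sqrt_sq] using h2

theorem tendsto_of_fourier {X : ℕ → L2 d F} {Y : L2 d F}
    (h : Tendsto (fun n => (𝓕 (X n) : L2 d F)) atTop (𝓝 (𝓕 Y : L2 d F))) :
    Tendsto X atTop (𝓝 Y) := by
  have := ((Lp.fourierTransformₗᵢ (Space d) F).symm.continuous.tendsto _).comp h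
  have e : ∀ X : L2 d F, (Lp.fourierTransformₗᵢ (Space d) F).symm (𝓕 X : L2 d F) = X := fun X =>
    (Lp.fourierTransformₗᵢ (Space d) F).symm_apply_apply X
  simpa only [Function.comp_def, e] using this

/-- The pairs of vectors whose Fourier transforms are related pointwise. -/
def fiberRelation (R : Space d → Submodule ℂ (F × F)) : Submodule ℂ (L2 d F × L2 d F) where
  carrier := {p | ∀ᵐ ξ, ((𝓕 p.1 : L2 d F) ξ, (𝓕 p.2 : L2 d F) ξ) ∈ R ξ}
  add_mem' := by
    intro p q hp hq
    have e : ∀ X Y : L2 d F, (𝓕 (X + Y) : L2 d F) = 𝓕 X + 𝓕 Y :=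
      map_add (Lp.fourierTransformₗᵢ (Space d) F)
    filter_upwards [hp, hq, Lp.coeFn_add (𝓕 p.1 : L2 d F) (𝓕 q.1),
      Lp.coeFn_add (𝓕 p.2 : L2 d F) (𝓕 q.2)] with ξ h1 h2 h3 h4
    rw [Prod.fst_add, Prod.snd_add, e, e, h3, h4]
    exact (R ξ).add_mem h1 h2
  zero_mem' := by
    have e : (𝓕 (0 : L2 d F) : L2 d F) = 0 := map_zero (Lp.fourierTransformₗᵢ (Space d) F)
    filter_upwards [Lp.coeFn_zero F 2 (volume : Measure (Space d))] with ξ h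
    rw [Prod.fst_zero, Prod.snd_zero, e, h]
    exact (R ξ).zero_mem
  smul_mem' := by
    intro c p hp
    have e : ∀ X : L2 d F, (𝓕 (c • X) : L2 d F) = c • 𝓕 X :=
      map_smul (Lp.fourierTransformₗᵢ (Space d) F) c
    filter_upwards [hp, Lp.coeFn_smul c (𝓕 p.1 : L2 d F), Lp.coeFn_smul c (𝓕 p.2 : L2 d F)]
      with ξ h1 h2 h3
    rw [Prod.smul_fst, Prod.smul_snd, e, e, h2, h3]
    exact (R ξ).smul_mem c h1

theorem isClosed_fiberRelation {R : Space d → Submodule ℂ (F × F)}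
    (hR : ∀ ξ, IsClosed (R ξ : Set (F × F))) :
    IsClosed (fiberRelation R : Set (L2 d F × L2 d F)) := by
  have h := isClosed_ae_relation (μ := (volume : Measure (Space d)))
    (R := fun ξ => (R ξ : Set (F × F))) (Eventually.of_forall hR)
  have hc : Continuous fun p : L2 d F × L2 d F => ((𝓕 p.1 : L2 d F), (𝓕 p.2 : L2 d F)) :=
    ((Lp.fourierTransformₗᵢ (Space d) F).continuous.comp continuous_fst).prodMk
      ((Lp.fourierTransformₗᵢ (Space d) F).continuous.comp continuous_snd)
  exact h.preimage hc

/-- `A` is multiplication by `a` in Fourier space. -/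
def HasSymbol (A : L2 d ℂ →ₗ.[ℂ] L2 d ℂ) (a : Space d → ℝ) : Prop :=
  ∀ p, p ∈ A.graph ↔ ⇑(𝓕 p.2 : L2 d ℂ) =ᵐ[volume] fun ξ => (a ξ : ℂ) * (𝓕 p.1 : L2 d ℂ) ξ

theorem inner_fourier (X Y : L2 d F) : inner ℂ (𝓕 X : L2 d F) (𝓕 Y : L2 d F) = inner ℂ X Y :=
  inner_fourierIso X Y

theorem HasSymbol.inner_eq {A : L2 d ℂ →ₗ.[ℂ] L2 d ℂ} {a : Space d → ℝ} (hA : HasSymbol A a)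
    {p q : L2 d ℂ × L2 d ℂ} (hp : p ∈ A.graph) (hq : q ∈ A.graph) :
    inner ℂ p.2 q.1 = inner ℂ p.1 q.2 := by
  rw [← inner_fourier, ← inner_fourier p.1, L2.inner_def, L2.inner_def]
  refine integral_congr_ae ?_
  filter_upwards [(hA p).1 hp, (hA q).1 hq] with ξ h1 h2
  rw [h1, h2, RCLike.inner_apply, RCLike.inner_apply, map_mul, Complex.conj_ofReal]
  ring

/-- The algebraic tensor product of two operators. -/
def tensorCore (A : L2 d ℂ →ₗ.[ℂ] L2 d ℂ) (B : F →ₗ.[ℂ] F) : Submodule ℂ (L2 d F × L2 d F) :=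
  Submodule.span ℂ {p : L2 d F × L2 d F | ∃ (ψ : A.domain) (Φ : B.domain),
    p = (tensor (ψ : L2 d ℂ) (Φ : F), tensor (A ψ) (B Φ))}

variable {A : L2 d ℂ →ₗ.[ℂ] L2 d ℂ} {a : Space d → ℝ} {B : F →ₗ.[ℂ] F}

theorem tensor_pair_mem_tensorCore {p : L2 d ℂ × L2 d ℂ} {q : F × F} (hp : p ∈ A.graph)
    (hq : q ∈ B.graph) : (tensor p.1 q.1, tensor p.2 q.2) ∈ tensorCore A B := by
  obtain ⟨ψ, h1, h2⟩ := (LinearPMap.mem_graph_iff _).1 hp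
  obtain ⟨Φ, h3, h4⟩ := (LinearPMap.mem_graph_iff _).1 hq
  refine Submodule.subset_span ⟨ψ, Φ, ?_⟩
  rw [h1, h2, h3, h4]

theorem tensorCore_le_fiberRelation (hA : HasSymbol A a) {R : Space d → Submodule ℂ (F × F)}
    (hgen : ∀ ξ, ∀ q ∈ B.graph, (q.1, (a ξ : ℂ) • q.2) ∈ R ξ) :
    tensorCore A B ≤ fiberRelation R := by
  refine Submodule.span_le.2 ?_
  rintro _ ⟨ψ, Φ, rfl⟩
  change ∀ᵐ ξ, _ ∈ R ξ
  filter_upwards [coeFn_tensor (𝓕 (ψ : L2 d ℂ) : L2 d ℂ) (Φ : F),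
    coeFn_tensor (𝓕 (A ψ) : L2 d ℂ) (B Φ), (hA _).1 (A.mem_graph ψ)] with ξ h1 h2 h3
  rw [fourier_tensor, fourier_tensor, h1, h2, h3, mul_comm, ← smul_smul]
  exact (R ξ).smul_mem _ (hgen ξ _ (B.mem_graph Φ))

theorem tensorOp_graph (hA : HasSymbol A a) {R : Space d → Submodule ℂ (F × F)}
    (hR : ∀ ξ, IsClosed (R ξ : Set (F × F))) (hR0 : ∀ ξ u, (0, u) ∈ R ξ → u = 0)
    (hgen : ∀ ξ, ∀ q ∈ B.graph, (q.1, (a ξ : ℂ) • q.2) ∈ R ξ) :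
    (tensorOp A B).graph = (tensorCore A B).topologicalClosure ∧
      (tensorOp A B).graph ≤ fiberRelation R := by
  have hle : (tensorCore A B).topologicalClosure ≤ fiberRelation R :=
    Submodule.topologicalClosure_minimal _ (tensorCore_le_fiberRelation hA hgen)
      (isClosed_fiberRelation hR)
  have e : (tensorOp A B).graph = (tensorCore A B).topologicalClosure := by
    refine Submodule.toLinearPMap_graph_eq _ fun p hp hp1 => ?_
    have h1 : ∀ᵐ ξ, ((𝓕 p.1 : L2 d F) ξ, (𝓕 p.2 : L2 d F) ξ) ∈ R ξ := hle hp
    have e0 : (𝓕 (0 : L2 d F) : L2 d F) = 0 := map_zero (Lp.fourierTransformₗᵢ (Space d) F)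
    rw [hp1, e0] at h1
    have h2 : (𝓕 p.2 : L2 d F) = 0 := by
      refine Lp.ext ?_
      filter_upwards [h1, Lp.coeFn_zero F 2 (volume : Measure (Space d))] with ξ h3 h4
      rw [h4] at h3 ⊢
      exact hR0 ξ _ h3
    exact (Lp.fourierTransformₗᵢ (Space d) F).injective (h2.trans e0.symm)
  exact ⟨e, e ▸ hle⟩

theorem inner_eq_of_mem_closure {K : Type*} [NormedAddCommGroup K] [InnerProductSpace ℂ K]
    {S : Set (K × K)} (hS : ∀ p ∈ S, ∀ q ∈ S, inner ℂ p.2 q.1 = inner ℂ p.1 q.2) {p q : K × K}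
    (hp : p ∈ (Submodule.span ℂ S).topologicalClosure)
    (hq : q ∈ (Submodule.span ℂ S).topologicalClosure) :
    inner ℂ p.2 q.1 = inner ℂ p.1 q.2 := by
  have s1 : ∀ p ∈ S, ∀ q ∈ Submodule.span ℂ S, inner ℂ p.2 q.1 = inner ℂ p.1 q.2 := by
    intro p hp q hq
    induction hq using Submodule.span_induction with
    | mem q hq => exact hS p hp q hq
    | zero => simp
    | add x y _ _ hx hy => simp [hx, hy]
    | smul c x _ hx => simp [hx]
  have s2 : ∀ p ∈ Submodule.span ℂ S, ∀ q ∈ Submodule.span ℂ S,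
      inner ℂ p.2 q.1 = inner ℂ p.1 q.2 := by
    intro p hp q hq
    induction hp using Submodule.span_induction with
    | mem p hp => exact s1 p hp q hq
    | zero => simp
    | add x y _ _ hx hy => simp [hx, hy]
    | smul c x _ hx => simp [hx]
  have hcl : IsClosed {z : (K × K) × (K × K) | inner ℂ z.1.2 z.2.1 = (inner ℂ z.1.1 z.2.2 : ℂ)} :=
    isClosed_eq (by fun_prop) (by fun_prop)
  have h : (p, q) ∈ closure ((Submodule.span ℂ S : Set (K × K)) ×ˢ
      (Submodule.span ℂ S : Set (K × K))) := by
    rw [closure_prod_eq]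
    exact ⟨hp, hq⟩
  exact closure_minimal (fun z hz => s2 z.1 hz.1 z.2 hz.2) hcl h

theorem inner_tensorOp (hA : HasSymbol A a)
    (hB : ∀ p ∈ B.graph, ∀ q ∈ B.graph, inner ℂ p.2 q.1 = inner ℂ p.1 q.2)
    (hg : (tensorOp A B).graph = (tensorCore A B).topologicalClosure) {p q : L2 d F × L2 d F}
    (hp : p ∈ (tensorOp A B).graph) (hq : q ∈ (tensorOp A B).graph) :
    inner ℂ p.2 q.1 = inner ℂ p.1 q.2 := by
  rw [hg] at hp hq
  refine inner_eq_of_mem_closure ?_ hp hq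
  rintro _ ⟨ψ, Φ, rfl⟩ _ ⟨ψ', Φ', rfl⟩
  simp only [inner_tensor_tensor]
  rw [hA.inner_eq (A.mem_graph ψ) (A.mem_graph ψ'), hB _ (B.mem_graph Φ) _ (B.mem_graph Φ')]

theorem exists_fourier_eq_indicator (S : Set (Space d)) (hS : MeasurableSet S) (ψ : L2 d ℂ) :
    ∃ ψ' : L2 d ℂ, ⇑(𝓕 ψ' : L2 d ℂ) =ᵐ[volume] S.indicator (𝓕 ψ : L2 d ℂ) := by
  have h : MemLp (S.indicator (𝓕 ψ : L2 d ℂ)) 2 volume := (Lp.memLp _).indicator hS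
  refine ⟨(Lp.fourierTransformₗᵢ (Space d) ℂ).symm (h.toLp _), ?_⟩
  have : (𝓕 ((Lp.fourierTransformₗᵢ (Space d) ℂ).symm (h.toLp _)) : L2 d ℂ) = h.toLp _ :=
    (Lp.fourierTransformₗᵢ (Space d) ℂ).apply_symm_apply _
  rw [this]
  exact h.coeFn_toLp

theorem coeFn_finsetSum {ι : Type*} (s : Finset ι) (X : ι → L2 d F) :
    ⇑(∑ i ∈ s, X i) =ᵐ[volume] fun x => ∑ i ∈ s, X i x := by
  classical
  induction s using Finset.induction_on with
  | empty =>
    rw [Finset.sum_empty]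
    exact (Lp.coeFn_zero F 2 volume).trans (Eventually.of_forall fun k => by simp)
  | insert a s ha ih =>
    rw [Finset.sum_insert ha]
    filter_upwards [Lp.coeFn_add (X a) (∑ i ∈ s, X i), ih] with k h1 h2
    rw [h1, Pi.add_apply, h2, Finset.sum_insert ha]

theorem fourier_sum_tensor_simple {V : Type*} (s : SimpleFunc (Space d) V) {φ : L2 d ℂ}
    {f : V → L2 d ℂ} (hf : ∀ v, ⇑(𝓕 (f v) : L2 d ℂ) =ᵐ[volume]
      (s ⁻¹' {v}).indicator (𝓕 φ : L2 d ℂ)) (w : V → F) :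
    ⇑(𝓕 (∑ v ∈ s.range, tensor (f v) (w v)) : L2 d F) =ᵐ[volume]
      fun ξ => (𝓕 φ : L2 d ℂ) ξ • w (s ξ) := by
  have e : (𝓕 (∑ v ∈ s.range, tensor (f v) (w v)) : L2 d F) =
      ∑ v ∈ s.range, tensor (𝓕 (f v) : L2 d ℂ) (w v) := by
    rw [← Finset.sum_congr rfl fun v _ => fourier_tensor (f v) (w v)]
    exact map_sum (Lp.fourierTransformₗᵢ (Space d) F) _ _
  rw [e]
  filter_upwards [coeFn_finsetSum s.range fun v => tensor (𝓕 (f v) : L2 d ℂ) (w v),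
    (ae_ball_iff s.range.countable_toSet).2 fun v _ => coeFn_tensor (𝓕 (f v) : L2 d ℂ) (w v),
    (ae_ball_iff s.range.countable_toSet).2 fun v _ => hf v] with ξ h1 h2 h3
  rw [h1, Finset.sum_eq_single (s ξ)]
  · have hm := s.mem_range_self ξ
    rw [h2 _ hm, h3 _ hm, Set.indicator_of_mem (show ξ ∈ s ⁻¹' {s ξ} from rfl)]
  · intro v hv hne
    rw [h2 _ hv, h3 _ hv, Set.indicator_of_notMem (fun h => hne h.symm), zero_smul]
  · intro h
    exact absurd (s.mem_range_self ξ) h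

theorem exists_mem_tensorCore_simple (hA : HasSymbol A a) {p : L2 d ℂ × L2 d ℂ}
    (hp : p ∈ A.graph) (s : SimpleFunc (Space d) B.graph) : ∃ Y ∈ tensorCore A B,
      (⇑(𝓕 Y.1 : L2 d F) =ᵐ[volume] fun ξ => (𝓕 p.1 : L2 d ℂ) ξ • (s ξ : F × F).1) ∧
      ⇑(𝓕 Y.2 : L2 d F) =ᵐ[volume] fun ξ => (𝓕 p.2 : L2 d ℂ) ξ • (s ξ : F × F).2 := by
  have hg := fun v : B.graph => exists_fourier_eq_indicator (s ⁻¹' {v}) (s.measurableSet_fiber v)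
  choose f hf using hg
  refine ⟨∑ v ∈ s.range, (tensor (f v p.1) (v : F × F).1, tensor (f v p.2) (v : F × F).2),
    Submodule.sum_mem _ fun v _ => tensor_pair_mem_tensorCore (p := (f v p.1, f v p.2)) ?_ v.2,
    ?_, ?_⟩
  · rw [hA]
    filter_upwards [hf v p.1, hf v p.2, (hA p).1 hp] with ξ h1 h2 h3
    rw [h1, h2]
    by_cases h : ξ ∈ s ⁻¹' {v}
    · rw [Set.indicator_of_mem h, Set.indicator_of_mem h, h3]
    · rw [Set.indicator_of_notMem h, Set.indicator_of_notMem h, mul_zero]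
  · rw [Prod.fst_sum]
    exact fourier_sum_tensor_simple s (fun v => hf v p.1) fun v => (v : F × F).1
  · rw [Prod.snd_sum]
    exact fourier_sum_tensor_simple s (fun v => hf v p.2) fun v => (v : F × F).2

/-- Membership in the closure of the algebraic tensor product, for a measurable field of vectors. -/
theorem mem_closure_tensorCore (hA : HasSymbol A a) {p : L2 d ℂ × L2 d ℂ} (hp : p ∈ A.graph)
    {η : Space d → F × F} (hη : StronglyMeasurable η) (hηB : ∀ ξ, η ξ ∈ B.graph) {C : ℝ}
    (hC : ∀ᵐ ξ, (𝓕 p.1 : L2 d ℂ) ξ ≠ 0 → ‖η ξ‖ ≤ C) {X : L2 d F × L2 d F}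
    (h1 : ⇑(𝓕 X.1 : L2 d F) =ᵐ[volume] fun ξ => (𝓕 p.1 : L2 d ℂ) ξ • (η ξ).1)
    (h2 : ⇑(𝓕 X.2 : L2 d F) =ᵐ[volume] fun ξ => (𝓕 p.2 : L2 d ℂ) ξ • (η ξ).2) :
    X ∈ (tensorCore A B).topologicalClosure := by
  replace hC : ∀ᵐ ξ, (𝓕 p.1 : L2 d ℂ) ξ ≠ 0 → ‖η ξ‖ ≤ |C| := by
    filter_upwards [hC] with ξ h h'
    exact (h h').trans (le_abs_self C)
  have hC0 := abs_nonneg C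
  generalize |C| = C at hC hC0
  let E : Space d → B.graph := fun ξ => ⟨η ξ, hηB ξ⟩
  have hE : StronglyMeasurable E := (Embedding.comp_stronglyMeasurable_iff Topology.IsEmbedding.subtypeVal).1 hη
  choose Y hY hY1 hY2 using fun n => exists_mem_tensorCore_simple hA hp (hE.approxBounded C n)
  have hC' : ∀ᵐ ξ, (𝓕 p.2 : L2 d ℂ) ξ ≠ 0 → ‖η ξ‖ ≤ C := by
    filter_upwards [hC, (hA p).1 hp] with ξ h3 h4 h5
    refine h3 fun h6 => h5 ?_
    rw [h4, h6, mul_zero]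
  have key : ∀ {φ : L2 d ℂ} {Z : ℕ → L2 d F} {W : L2 d F} (π : F × F →L[ℂ] F)
      (_ : ∀ z, ‖π z‖ ≤ ‖z‖) (_ : ∀ᵐ ξ, (𝓕 φ : L2 d ℂ) ξ ≠ 0 → ‖η ξ‖ ≤ C)
      (_ : ∀ n, ⇑(𝓕 (Z n) : L2 d F) =ᵐ[volume] fun ξ => (𝓕 φ : L2 d ℂ) ξ •
        π (hE.approxBounded C n ξ : F × F))
      (_ : ⇑(𝓕 W : L2 d F) =ᵐ[volume] fun ξ => (𝓕 φ : L2 d ℂ) ξ • π (η ξ)),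
      Tendsto Z atTop (𝓝 W) := by
    intro φ Z W π hπ hb hZ hW
    refine tendsto_of_fourier (L2.tendsto_of_dominated (b := fun ξ => 2 * C * ‖(𝓕 φ : L2 d ℂ) ξ‖)
      ((Lp.memLp (𝓕 φ : L2 d ℂ)).norm.const_mul _) (fun n => ?_) ?_)
    · filter_upwards [hZ n, hW, hb] with ξ e1 e2 e3
      rw [e1, e2, ← smul_sub, ← map_sub, norm_smul, mul_comm]
      by_cases h : (𝓕 φ : L2 d ℂ) ξ = 0
      · rw [h, norm_zero, mul_zero, mul_zero]
      · refine mul_le_mul_of_nonneg_right ((hπ _).trans ((norm_sub_le _ _).trans ?_)) (norm_nonneg _)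
        have e4 : ‖(hE.approxBounded C n ξ : F × F)‖ ≤ C := hE.norm_approxBounded_le hC0 n ξ
        linarith [e3 h]
    · filter_upwards [ae_all_iff.2 hZ, hW, hb] with ξ e1 e2 e3
      simp only [e1, e2]
      by_cases h : (𝓕 φ : L2 d ℂ) ξ = 0
      · simp [h]
      · have e4 := hE.tendsto_approxBounded_of_norm_le (c := C) (x := ξ) (e3 h)
        exact (((π.continuous.comp continuous_subtype_val).tendsto _).comp e4).const_smul _
  have t1 := key (φ := p.1) (Z := fun n => (Y n).1) (W := X.1) (ContinuousLinearMap.fst ℂ F F)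
    (fun z => norm_fst_le z) hC hY1 h1
  have t2 := key (φ := p.2) (Z := fun n => (Y n).2) (W := X.2) (ContinuousLinearMap.snd ℂ F F)
    (fun z => norm_snd_le z) hC' hY2 h2
  exact mem_closure_of_tendsto (t1.prodMk_nhds t2) (Eventually.of_forall hY)

end TensorOp
end

noncomputable section

section LinearPMapGraph

variable {H : Type*} [NormedAddCommGroup H] [InnerProductSpace ℂ H]

theorem LinearPMap.mem_add_graph_iff {A B : H →ₗ.[ℂ] H} {x y : H} :
    (x, y) ∈ (A + B).graph ↔ ∃ u v, (x, u) ∈ A.graph ∧ (x, v) ∈ B.graph ∧ y = u + v := by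
  constructor
  · intro h
    obtain ⟨z, rfl, rfl⟩ := (LinearPMap.mem_graph_iff _).1 h
    exact ⟨_, _, A.mem_graph ⟨z, z.2.1⟩, B.mem_graph ⟨z, z.2.2⟩, LinearPMap.add_apply _ _ _⟩
  · rintro ⟨u, v, hu, hv, rfl⟩
    obtain ⟨z, hz, rfl⟩ := (LinearPMap.mem_graph_iff _).1 hu
    obtain ⟨w, hw, rfl⟩ := (LinearPMap.mem_graph_iff _).1 hv
    dsimp only at hz hw
    subst hz
    have hzB : (z : H) ∈ B.domain := hw ▸ w.2
    refine (LinearPMap.mem_graph_iff _).2 ⟨⟨z, z.2, hzB⟩, rfl, ?_⟩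
    rw [LinearPMap.add_apply]
    congr 2
    exact Subtype.ext hw.symm

theorem LinearPMap.mem_sub_graph_iff {A B : H →ₗ.[ℂ] H} {x y : H} :
    (x, y) ∈ (A - B).graph ↔ ∃ u v, (x, u) ∈ A.graph ∧ (x, v) ∈ B.graph ∧ y = u - v := by
  constructor
  · intro h
    obtain ⟨z, rfl, rfl⟩ := (LinearPMap.mem_graph_iff _).1 h
    exact ⟨_, _, A.mem_graph ⟨z, z.2.1⟩, B.mem_graph ⟨z, z.2.2⟩, LinearPMap.sub_apply _ _ _⟩
  · rintro ⟨u, v, hu, hv, rfl⟩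
    obtain ⟨z, hz, rfl⟩ := (LinearPMap.mem_graph_iff _).1 hu
    obtain ⟨w, hw, rfl⟩ := (LinearPMap.mem_graph_iff _).1 hv
    dsimp only at hz hw
    subst hz
    have hzB : (z : H) ∈ B.domain := hw ▸ w.2
    refine (LinearPMap.mem_graph_iff _).2 ⟨⟨z, z.2, hzB⟩, rfl, ?_⟩
    rw [LinearPMap.sub_apply]
    congr 2
    exact Subtype.ext hw.symm

theorem LinearPMap.mem_finsetSum_graph_iff {ι : Type*} [DecidableEq ι] (s : Finset ι)
    {A : ι → H →ₗ.[ℂ] H} {x y : H} :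
    (x, y) ∈ (∑ i ∈ s, A i).graph ↔
      ∃ u : ι → H, (∀ i ∈ s, (x, u i) ∈ (A i).graph) ∧ y = ∑ i ∈ s, u i := by
  induction s using Finset.induction_on generalizing y with
  | empty =>
    simp only [Finset.sum_empty, Finset.notMem_empty, false_imp_iff, implies_true, true_and,
      exists_const]
    constructor
    · intro h
      obtain ⟨z, -, rfl⟩ := (LinearPMap.mem_graph_iff _).1 h
      exact LinearPMap.zero_apply z
    · rintro rfl
      exact (LinearPMap.mem_graph_iff _).2 ⟨⟨x, Submodule.mem_top⟩, rfl, LinearPMap.zero_apply _⟩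
  | insert i s hi ih =>
    rw [Finset.sum_insert hi, LinearPMap.mem_add_graph_iff]
    constructor
    · rintro ⟨u, v, hu, hv, rfl⟩
      obtain ⟨w, hw, rfl⟩ := ih.1 hv
      refine ⟨Function.update w i u, fun j hj => ?_, ?_⟩
      · rcases Finset.mem_insert.1 hj with rfl | hj
        · rwa [Function.update_self]
        · rw [Function.update_of_ne (ne_of_mem_of_not_mem hj hi)]
          exact hw j hj
      · rw [Finset.sum_insert hi, Function.update_self]
        congr 1
        refine Finset.sum_congr rfl fun j hj => ?_
        rw [Function.update_of_ne (ne_of_mem_of_not_mem hj hi)]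
    · rintro ⟨u, hu, rfl⟩
      exact ⟨_, _, hu i (Finset.mem_insert_self _ _),
        ih.2 ⟨u, fun j hj => hu j (Finset.mem_insert_of_mem hj), rfl⟩, Finset.sum_insert hi⟩

theorem LinearPMap.mem_idOp_graph_iff {p : H × H} : p ∈ (idOp H).graph ↔ p.2 = p.1 := by
  constructor
  · intro h
    obtain ⟨z, h1, h2⟩ := (LinearPMap.mem_graph_iff _).1 h
    rw [← h1, ← h2]
    rfl
  · intro h
    refine (LinearPMap.mem_graph_iff _).2 ⟨⟨p.1, Submodule.mem_top⟩, rfl, ?_⟩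
    rw [h]
    rfl

/-- The graph of multiplication by a number. -/
def scalarRelation (F : Type*) [NormedAddCommGroup F] [InnerProductSpace ℂ F] (c : ℂ) :
    Submodule ℂ (F × F) :=
  LinearMap.eqLocus (LinearMap.snd ℂ F F) (c • LinearMap.fst ℂ F F)

theorem mem_scalarRelation {c : ℂ} {p : H × H} : p ∈ scalarRelation H c ↔ p.2 = c • p.1 := Iff.rfl

theorem isClosed_scalarRelation (c : ℂ) : IsClosed (scalarRelation H c : Set (H × H)) :=
  isClosed_eq continuous_snd (continuous_fst.const_smul c)

variable {E : ℕ → Type*} [∀ n, NormedAddCommGroup (E n)] [∀ n, InnerProductSpace ℂ (E n)]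

/-- The pairs `(Ψ, Θ)` for which `Θ` is `c` times the field applied to `Ψ`, componentwise. -/
def LadderPair.smulRelation (L : LadderPair E) (c : ℂ) : Submodule ℂ (lp E 2 × lp E 2) :=
  ⨅ n, LinearMap.eqLocus
    ((lp.evalCLM ℂ E 2 n).toLinearMap ∘ₗ LinearMap.snd ℂ (lp E 2) (lp E 2))
    ((c • L.comp n).toLinearMap ∘ₗ LinearMap.fst ℂ (lp E 2) (lp E 2))

theorem LadderPair.mem_smulRelation {L : LadderPair E} {c : ℂ} {p : lp E 2 × lp E 2} :
    p ∈ L.smulRelation c ↔ ∀ n, p.2 n = c • L.comp n p.1 := by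
  rw [smulRelation, Submodule.mem_iInf]
  exact Iff.rfl

theorem LadderPair.isClosed_smulRelation (L : LadderPair E) (c : ℂ) :
    IsClosed (L.smulRelation c : Set (lp E 2 × lp E 2)) := by
  rw [smulRelation, Submodule.coe_iInf]
  exact isClosed_iInter fun n => isClosed_eq ((lp.evalCLM ℂ E 2 n).continuous.comp continuous_snd)
    ((c • L.comp n).continuous.comp continuous_fst)

theorem LadderPair.eq_zero_of_mem_smulRelation {L : LadderPair E} {c : ℂ} {u : lp E 2}
    (h : (0, u) ∈ L.smulRelation c) : u = 0 := by
  refine lp.ext (funext fun n => ?_)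
  have := mem_smulRelation.1 h n
  simpa using this

theorem LadderPair.smul_mem_smulRelation {L : LadderPair E} {p : lp E 2 × lp E 2}
    (h : p ∈ L.finiteGraph.topologicalClosure) (c : ℂ) : (p.1, c • p.2) ∈ L.smulRelation c := by
  refine mem_smulRelation.2 fun n => ?_
  have := L.closure_le_relation h n
  exact congrArg (c • ·) this

theorem LadderPair.inner_mem_closure {L : LadderPair E} {p q : lp E 2 × lp E 2}
    (hp : p ∈ L.finiteGraph.topologicalClosure) (hq : q ∈ L.finiteGraph.topologicalClosure) :
    inner ℂ p.2 q.1 = inner ℂ p.1 q.2 := by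
  have e : L.finiteGraph = Submodule.span ℂ (L.finiteGraph : Set (lp E 2 × lp E 2)) :=
    (Submodule.span_eq _).symm
  rw [e] at hp hq
  refine inner_eq_of_mem_closure ?_ hp hq
  intro p hp q hq
  obtain ⟨u, rfl⟩ := hp
  obtain ⟨v, rfl⟩ := hq
  exact L.inner_onFinite u v

end LinearPMapGraph

section Continuity

variable {d : ℕ}

theorem continuous_segalPair_lower {X : Type*} [TopologicalSpace X] {f : X → OnePhoton d}
    (hf : Continuous f) {n : ℕ} {v : X → symSector d (n + 1)} (hv : Continuous v) :
    Continuous fun x => (segalPair (f x)).lower n (v x) :=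
  Continuous.const_smul (((annihilate d n).continuous.comp hf).clm_apply hv) ((√2 : ℂ)⁻¹)

theorem continuous_segalPair_raise {X : Type*} [TopologicalSpace X] {f : X → OnePhoton d}
    (hf : Continuous f) {n : ℕ} {v : X → symSector d n} (hv : Continuous v) :
    Continuous fun x => (segalPair (f x)).raise n (v x) :=
  Continuous.const_smul (((create d n).continuous.comp hf).clm_apply hv) ((√2 : ℂ)⁻¹)

theorem inner_segalField {f : PhotonSpace d → ℂ} (hf : MemLp f 2 (photonMeasure d))
    {p q : Fock d × Fock d} (hp : p ∈ (segalField f).graph) (hq : q ∈ (segalField f).graph) :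
    inner ℂ p.2 q.1 = inner ℂ p.1 q.2 :=
  LadderPair.inner_mem_closure (E := fun n : ℕ => symSector d n)
    ((SetLike.ext_iff.1 (segalField_graph hf) _).1 hp)
    ((SetLike.ext_iff.1 (segalField_graph hf) _).1 hq)

end Continuity

namespace PauliFierzModel

variable {d : ℕ} (M : PauliFierzModel d)

theorem norm_dressingFiber_le (P : Space d) : ‖M.dressingFiber P‖ ≤ 1 :=
  (congrArg (fun T => ‖T‖) (M.dressingFiber_eq P)).trans_le
    ((segalField_isEntireCore (M.memLp_dressing P)).norm_expI_le M.coupling_ne_zero)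

theorem stronglyMeasurable_dressingFiber (Ψ : Fock d) :
    StronglyMeasurable fun P => M.dressingFiber P Ψ := by
  have hc : Continuous fun P : Space d => (M.memLp_dressing P).toLp _ := by
    simp only [toLp_dressing]
    exact Continuous.const_smul (M.continuous_polarizedSum M.ampDiv) Complex.I
  have h := LadderPair.stronglyMeasurable_expI (E := fun n : ℕ => symSector d n)
    (L := fun P : Space d => segalPair ((M.memLp_dressing P).toLp _))
    (fun P => segalField_eq (M.memLp_dressing P)) M.coupling_ne_zero
    (fun n v hv => continuous_segalPair_lower hc hv)
    (fun n v hv => continuous_segalPair_raise hc hv) Ψ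
  have e : (fun P => M.dressingFiber P Ψ) = fun P =>
    expI (((M.q / (M.m * M.hbar) : ℝ) : ℂ) • segalField fun κ : PhotonSpace d =>
      Complex.I * ((∑ j, P j * M.g j κ : ℝ) : ℂ) / (M.ω κ.1 : ℂ)) Ψ :=
    funext fun P => congrArg (fun T : Fock d →L[ℂ] Fock d => T Ψ) (M.dressingFiber_eq P)
  exact (congrArg StronglyMeasurable e).mpr h

/-- The momentum `P = 2πħξ`. -/
def mom (ξ : Space d) : Space d := (2 * Real.pi * M.hbar) • ξ

theorem continuous_mom : Continuous M.mom := continuous_const_smul _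

/-- The coherent state that dresses an electron of momentum `2πħξ`. -/
def cloud (ξ : Space d) : Fock d := coherent (M.shift (M.mom ξ))

theorem stronglyMeasurable_cloud : StronglyMeasurable M.cloud :=
  stronglyMeasurable_coherent (M.continuous_shift.comp M.continuous_mom)

theorem norm_cloud (ξ : Space d) : ‖M.cloud ξ‖ = 1 := norm_coherent _

theorem fourier_dressed (ψ : L2 d ℂ) : ⇑(𝓕 (M.dressed ψ) : L2 d (Fock d)) =ᵐ[volume]
    fun ξ => (𝓕 ψ : L2 d ℂ) ξ • M.cloud ξ := by
  refine fourier_adjoint_directIntegral (T := fun ξ => M.dressingFiber (M.mom ξ))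
    ⟨1, fun ξ => M.norm_dressingFiber_le _⟩ (fun Ψ => ?_)
    (fun ξ => M.adjoint_dressingFiber_vacuum (M.mom ξ)) M.stronglyMeasurable_cloud
    (fun ξ => (M.norm_cloud ξ).le) ψ
  obtain ⟨Ψ', hΨ', h⟩ := Lp.aestronglyMeasurable Ψ
  refine ⟨fun ξ => M.dressingFiber (M.mom ξ) (Ψ' ξ), ?_, ?_⟩
  · exact stronglyMeasurable_apply_of_forall
      (fun u => (M.stronglyMeasurable_dressingFiber u).comp_measurable
        M.continuous_mom.measurable) hΨ'
  · filter_upwards [h] with ξ hξ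
    rw [hξ]

end PauliFierzModel
end

noncomputable section

section Symbols

variable {d : ℕ} {F : Type*} [NormedAddCommGroup F] [InnerProductSpace ℂ F] [CompleteSpace F]

theorem hasSymbol_laplacianOp :
    HasSymbol (laplacianOp d) fun ξ => -(4 * Real.pi ^ 2 * ‖ξ‖ ^ 2) :=
  mem_laplacianOp_graph

theorem hasSymbol_momentum (hbar : ℝ) (j : Fin d) :
    HasSymbol (momentum hbar j) fun ξ => 2 * Real.pi * hbar * ξ j :=
  mem_momentum_graph hbar j

theorem hasSymbol_idOp : HasSymbol (idOp (L2 d ℂ)) fun _ => 1 := by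
  intro p
  rw [LinearPMap.mem_idOp_graph_iff]
  simp only [Complex.ofReal_one, one_mul]
  refine ⟨fun h => by rw [h], fun h => ?_⟩
  exact (Lp.fourierTransformₗᵢ (Space d) ℂ).injective (Lp.ext h)

theorem tensorOp_idOp_graph {A : L2 d ℂ →ₗ.[ℂ] L2 d ℂ} {a : Space d → ℝ} (hA : HasSymbol A a) :
    (tensorOp A (idOp F)).graph = (tensorCore A (idOp F)).topologicalClosure ∧
      (tensorOp A (idOp F)).graph ≤ fiberRelation fun ξ => scalarRelation F (a ξ) := by
  refine tensorOp_graph hA (fun ξ => isClosed_scalarRelation _) (fun ξ u hu => ?_)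
    fun ξ q hq => ?_
  · simpa [mem_scalarRelation] using hu
  · rw [mem_scalarRelation, LinearPMap.mem_idOp_graph_iff.1 hq]

theorem idOp_tensorOp_graph {B : F →ₗ.[ℂ] F} (hB : IsClosed (B.graph : Set (F × F))) :
    (tensorOp (idOp (L2 d ℂ)) B).graph = (tensorCore (idOp (L2 d ℂ)) B).topologicalClosure ∧
      (tensorOp (idOp (L2 d ℂ)) B).graph ≤ fiberRelation fun _ => B.graph := by
  refine tensorOp_graph hasSymbol_idOp (fun _ => hB)
    (fun _ u hu => B.graph_fst_eq_zero_snd hu rfl) fun ξ q hq => ?_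
  rwa [Complex.ofReal_one, one_smul]

/-- Removal of the frequencies above `n`. -/
def lowPass (n : ℝ) (ψ : L2 d ℂ) : L2 d ℂ :=
  (Lp.fourierTransformₗᵢ (Space d) ℂ).symm (mulOp (cutoff (fun ξ : Space d => ‖ξ‖) n) (𝓕 ψ))

theorem fourier_symm_apply (X : L2 d F) :
    (𝓕 ((Lp.fourierTransformₗᵢ (Space d) F).symm X) : L2 d F) = X :=
  (Lp.fourierTransformₗᵢ (Space d) F).apply_symm_apply X

theorem fourier_lowPass (n : ℝ) (ψ : L2 d ℂ) : ⇑(𝓕 (lowPass n ψ) : L2 d ℂ) =ᵐ[volume]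
    fun ξ => cutoff (fun ξ : Space d => ‖ξ‖) n ξ * (𝓕 ψ : L2 d ℂ) ξ := by
  rw [lowPass, fourier_symm_apply]
  exact coeFn_mulOp_cutoff measurable_norm n _

theorem tendsto_lowPass (ψ : L2 d ℂ) : Tendsto (fun n : ℕ => lowPass n ψ) atTop (𝓝 ψ) := by
  have h := ((Lp.fourierTransformₗᵢ (Space d) ℂ).symm.continuous.tendsto _).comp
    (tendsto_mulOp_cutoff (measurable_norm (α := Space d)) (𝓕 ψ : L2 d ℂ))
  have e : (Lp.fourierTransformₗᵢ (Space d) ℂ).symm (𝓕 ψ : L2 d ℂ) = ψ :=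
    (Lp.fourierTransformₗᵢ (Space d) ℂ).symm_apply_apply ψ
  rwa [e] at h

theorem exists_fourier_eq_mul_lowPass {a : Space d → ℝ} (ha : Measurable a) {n C : ℝ}
    (hC : ∀ ξ, ‖ξ‖ ≤ n → |a ξ| ≤ C) (ψ : L2 d ℂ) : ∃ χ : L2 d ℂ,
      ⇑(𝓕 χ : L2 d ℂ) =ᵐ[volume] fun ξ => (a ξ : ℂ) * (𝓕 (lowPass n ψ) : L2 d ℂ) ξ := by
  let m : Space d → ℂ := fun ξ => (a ξ : ℂ) * cutoff (fun ξ : Space d => ‖ξ‖) n ξ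
  have hm : Measurable m :=
    (Complex.measurable_ofReal.comp ha).mul (measurable_cutoff measurable_norm n)
  have hmC : ∀ ξ, ‖m ξ‖ ≤ |C| := by
    intro ξ
    simp only [m, cutoff]
    split_ifs with h
    · simpa using (hC ξ h).trans (le_abs_self C)
    · simp
  refine ⟨(Lp.fourierTransformₗᵢ (Space d) ℂ).symm (mulOp m (𝓕 ψ)), ?_⟩
  rw [fourier_symm_apply]
  filter_upwards [coeFn_mulOp hm hmC (𝓕 ψ : L2 d ℂ), fourier_lowPass n ψ] with ξ h1 h2
  rw [h1, h2, smul_eq_mul, mul_assoc]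

theorem exists_lowPass_mem_graph {A : L2 d ℂ →ₗ.[ℂ] L2 d ℂ} {a : Space d → ℝ}
    (hA : HasSymbol A a) (ha : Continuous a) (n : ℝ) (ψ : L2 d ℂ) :
    ∃ χ, (lowPass n ψ, χ) ∈ A.graph := by
  obtain ⟨C, hC⟩ := (isCompact_closedBall (0 : Space d) n).exists_bound_of_continuousOn
    ha.continuousOn
  obtain ⟨χ, hχ⟩ := exists_fourier_eq_mul_lowPass ha.measurable (n := n) (C := C)
    (fun ξ hξ => hC ξ (mem_closedBall_zero_iff.2 hξ)) ψ
  exact ⟨χ, (hA _).2 hχ⟩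

theorem continuous_coord_mul (c : ℝ) (j : Fin d) : Continuous fun ξ : Space d => c * ξ j := by
  fun_prop

/-- The wave functions in the domains of the Laplacian and of the momentum operators. -/
def smoothDomain (d : ℕ) (hbar : ℝ) : Submodule ℂ (L2 d ℂ) :=
  (laplacianOp d).domain ⊓ ⨅ j, (momentum hbar j).domain

theorem dense_smoothDomain (hbar : ℝ) : Dense (smoothDomain d hbar : Set (L2 d ℂ)) := by
  intro ψ
  refine mem_closure_of_tendsto (tendsto_lowPass ψ) (Eventually.of_forall fun n => ?_)
  refine ⟨?_, ?_⟩
  · exact LinearPMap.mem_domain_iff.2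
      (exists_lowPass_mem_graph hasSymbol_laplacianOp (by fun_prop) n ψ)
  · refine Submodule.mem_iInf _ |>.2 fun j => LinearPMap.mem_domain_iff.2
      (exists_lowPass_mem_graph (hasSymbol_momentum hbar j) (continuous_coord_mul _ j) n ψ)

end Symbols

section Combination

variable {H : Type*} [NormedAddCommGroup H] [InnerProductSpace ℂ H]

theorem re_inner_combination (x v w : H) (a b c : ℝ) :
    (inner ℂ x ((-(a : ℂ)) • ((-b : ℝ) : ℂ) • x + v - (c : ℂ) • w)).re =
      a * b * ‖x‖ ^ 2 + (inner ℂ x v : ℂ).re + -c * (inner ℂ x w : ℂ).re := by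
  rw [smul_smul, inner_sub_right, inner_add_right, inner_smul_right, inner_smul_right,
    Complex.sub_re, Complex.add_re, Complex.re_ofReal_mul, ← inner_self_re]
  have e : (-(a : ℂ)) * ((-b : ℝ) : ℂ) = ((a * b : ℝ) : ℂ) := by push_cast; ring
  rw [e, Complex.re_ofReal_mul]
  ring

theorem inner_combination {ι : Type*} (s : Finset ι) {x x' u u' v v' : H} {w w' : ι → H}
    (a c : ℝ) (hu : inner ℂ u x' = (inner ℂ x u' : ℂ)) (hv : inner ℂ v x' = (inner ℂ x v' : ℂ))
    (hw : ∀ i, inner ℂ (w i) x' = (inner ℂ x (w' i) : ℂ)) :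
    inner ℂ ((-(a : ℂ)) • u + v - (c : ℂ) • ∑ i ∈ s, w i) x' =
      (inner ℂ x ((-(a : ℂ)) • u' + v' - (c : ℂ) • ∑ i ∈ s, w' i) : ℂ) := by
  simp only [inner_sub_left, inner_sub_right, inner_add_left, inner_add_right, inner_smul_left,
    inner_smul_right, sum_inner, inner_sum, map_neg, Complex.conj_ofReal, hu, hv, hw]

theorem fourier_combination {d : ℕ} {F : Type*} [NormedAddCommGroup F] [InnerProductSpace ℂ F]
    [CompleteSpace F] {ι : Type*} (s : Finset ι) (u v : L2 d F) (w : ι → L2 d F) (a c : ℂ) :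
    ⇑(𝓕 (a • u + v - c • ∑ i ∈ s, w i) : L2 d F) =ᵐ[volume] fun ξ =>
      a • (𝓕 u : L2 d F) ξ + (𝓕 v : L2 d F) ξ - c • ∑ i ∈ s, (𝓕 (w i) : L2 d F) ξ := by
  have e : (𝓕 (a • u + v - c • ∑ i ∈ s, w i) : L2 d F) =
      a • (𝓕 u : L2 d F) + 𝓕 v - c • ∑ i ∈ s, (𝓕 (w i) : L2 d F) := by
    have : ∀ X : L2 d F, (𝓕 X : L2 d F) = Lp.fourierTransformₗᵢ (Space d) F X := fun _ => rfl
    simp only [this, map_sub, map_add, map_smul, map_sum]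
  rw [e]
  filter_upwards [Lp.coeFn_sub (a • (𝓕 u : L2 d F) + 𝓕 v) (c • ∑ i ∈ s, (𝓕 (w i) : L2 d F)),
    Lp.coeFn_add (a • (𝓕 u : L2 d F)) (𝓕 v), Lp.coeFn_smul a (𝓕 u : L2 d F),
    Lp.coeFn_smul c (∑ i ∈ s, (𝓕 (w i) : L2 d F)), coeFn_finsetSum s fun i => (𝓕 (w i) : L2 d F)]
    with ξ h1 h2 h3 h4 h5
  rw [h1, Pi.sub_apply, h2, Pi.add_apply, h3, Pi.smul_apply, h4, Pi.smul_apply, h5]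

end Combination

section SegalSum

variable {d : ℕ}

theorem fieldComp_sum_real_smul {ι : Type*} [DecidableEq ι] (s : Finset ι) (c : ι → ℝ)
    (f : ι → OnePhoton d) (n : ℕ) (Ψ : Fock d) :
    fieldComp (∑ i ∈ s, (c i : ℂ) • f i) n Ψ = ∑ i ∈ s, (c i : ℂ) • fieldComp (f i) n Ψ := by
  induction s using Finset.induction_on with
  | empty =>
    rw [Finset.sum_empty, Finset.sum_empty]
    have h := fieldComp_real_smul 0 (0 : OnePhoton d) n Ψ
    rw [Complex.ofReal_zero, zero_smul] at h
    exact h.trans (zero_smul ℂ _)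
  | insert i s hi ih =>
    rw [Finset.sum_insert hi, Finset.sum_insert hi, fieldComp_add]
    exact congrArg₂ _ (fieldComp_real_smul (c i) (f i) n Ψ) ih

theorem sum_mem_segal_relation {ι : Type*} [DecidableEq ι] (s : Finset ι) (c : ι → ℝ)
    (f : ι → OnePhoton d) {Ψ : Fock d} {w : ι → Fock d}
    (h : ∀ i, (Ψ, w i) ∈ (segalPair (f i)).smulRelation (c i)) :
    (Ψ, ∑ i ∈ s, w i) ∈ (segalPair (∑ i ∈ s, (c i : ℂ) • f i)).relation := by
  intro n
  refine Eq.trans ?_ (segalPair_comp (∑ i ∈ s, (c i : ℂ) • f i) n Ψ).symm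
  rw [fieldComp_sum_real_smul]
  refine (map_sum (evalFock d n) w s).trans (Finset.sum_congr rfl fun i _ => ?_)
  refine (LadderPair.mem_smulRelation (E := fun n : ℕ => symSector d n).1 (h i) n).trans ?_
  exact congrArg (fun z => (c i : ℂ) • z) (segalPair_comp (f i) n Ψ)

end SegalSum
end

noncomputable section

theorem QForm.IsClosedSemibounded.tendsto_re_val {H : Type*} [NormedAddCommGroup H]
    [InnerProductSpace ℂ H] [CompleteSpace H] {s : QForm H} (hs : s.IsClosedSemibounded)
    {u : ℕ → H} {ψ : H} (hu : ∀ n, u n ∈ s.domain) (hψ : ψ ∈ s.domain)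
    (h : Tendsto u atTop (𝓝 ψ))
    (h' : Tendsto (fun n => (s.val (u n - ψ) (u n - ψ)).re) atTop (𝓝 0)) :
    Tendsto (fun n => (s.val (u n) (u n)).re) atTop (𝓝 (s.val ψ ψ).re) := by
  obtain ⟨K, _, _, _, ⟨m⟩⟩ := hs.exists_model
  choose x hx using fun n => (m.mem_domain _).1 (hu n)
  obtain ⟨y, rfl⟩ := (m.mem_domain _).1 hψ
  have e : ∀ n, ‖x n - y‖ ^ 2 = (s.val (u n - m.j y) (u n - m.j y)).re +
      m.shift * ‖u n - m.j y‖ ^ 2 := by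
    intro n
    rw [← hx, ← map_sub, m.re_val]
    ring
  have hxy : Tendsto x atTop (𝓝 y) := by
    rw [tendsto_iff_norm_sub_sq_tendsto_zero]
    simp only [e]
    have := h'.add ((tendsto_iff_norm_sub_sq_tendsto_zero.1 h).const_mul m.shift)
    simpa using this
  have h2 : Tendsto (fun n => m.j (x n)) atTop (𝓝 (m.j y)) := by simpa only [hx] using h
  simp only [← hx, m.re_val]
  exact (hxy.norm.pow 2).sub ((h2.norm.pow 2).const_mul _)

/-- An electron with kinetic energy `-a Δ` whose momentum is coupled with strength `c` to the fields
`C j` of a system with state space `F` and energy `B`. -/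
structure DipoleSystem (d : ℕ) (F : Type*) [NormedAddCommGroup F] [InnerProductSpace ℂ F] where
  a : ℝ
  c : ℝ
  hbar : ℝ
  B : F →ₗ.[ℂ] F
  C : Fin d → F →ₗ.[ℂ] F
  /-- A closed relation that extends the momentum component `2πħξ_j` times the field `C j`. -/
  R : Fin d → Space d → Submodule ℂ (F × F)
  a_ne_zero : a ≠ 0
  c_ne_zero : c ≠ 0
  isClosed_B : IsClosed (B.graph : Set (F × F))
  inner_B : ∀ p ∈ B.graph, ∀ q ∈ B.graph, inner ℂ p.2 q.1 = (inner ℂ p.1 q.2 : ℂ)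
  inner_C : ∀ j, ∀ p ∈ (C j).graph, ∀ q ∈ (C j).graph, inner ℂ p.2 q.1 = (inner ℂ p.1 q.2 : ℂ)
  isClosed_R : ∀ j ξ, IsClosed (R j ξ : Set (F × F))
  eq_zero_of_mem_R : ∀ j ξ u, (0, u) ∈ R j ξ → u = 0
  mem_R : ∀ j (ξ : Space d), ∀ q ∈ (C j).graph,
    (q.1, ((2 * Real.pi * hbar * ξ j : ℝ) : ℂ) • q.2) ∈ R j ξ

namespace DipoleSystem

variable {d : ℕ} {F : Type*} [NormedAddCommGroup F] [InnerProductSpace ℂ F] [CompleteSpace F]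
  (S : DipoleSystem d F)

/-- The Hamiltonian of the system. -/
def hamiltonian : L2 d F →ₗ.[ℂ] L2 d F :=
  (-(S.a : ℂ)) • tensorOp (laplacianOp d) (idOp F) + tensorOp (idOp (L2 d ℂ)) S.B
    - (S.c : ℂ) • ∑ j : Fin d, tensorOp (momentum S.hbar j) (S.C j)

theorem mem_graph_iff {X Y : L2 d F} : (X, Y) ∈ S.hamiltonian.graph ↔
    ∃ (u v : L2 d F) (w : Fin d → L2 d F),
      (X, u) ∈ (tensorOp (laplacianOp d) (idOp F)).graph ∧
      (X, v) ∈ (tensorOp (idOp (L2 d ℂ)) S.B).graph ∧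
      (∀ j, (X, w j) ∈ (tensorOp (momentum S.hbar j) (S.C j)).graph) ∧
      Y = (-(S.a : ℂ)) • u + v - (S.c : ℂ) • ∑ j, w j := by
  have n1 : -(S.a : ℂ) ≠ 0 := neg_ne_zero.2 (Complex.ofReal_ne_zero.2 S.a_ne_zero)
  have n2 : (S.c : ℂ) ≠ 0 := Complex.ofReal_ne_zero.2 S.c_ne_zero
  rw [hamiltonian]
  generalize -(S.a : ℂ) = α at n1
  generalize (S.c : ℂ) = β at n2
  constructor
  · intro h
    obtain ⟨y, z, hy, hz, rfl⟩ := LinearPMap.mem_sub_graph_iff.1 h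
    obtain ⟨u, v, hu, hv, rfl⟩ := LinearPMap.mem_add_graph_iff.1 hy
    obtain ⟨w, hw, e⟩ := (LinearPMap.mem_finsetSum_graph_iff _).1
      ((LinearPMap.mem_smul_graph_iff n2).1 hz)
    dsimp only at e
    refine ⟨_, v, w, (LinearPMap.mem_smul_graph_iff n1).1 hu, hv,
      fun j => hw j (Finset.mem_univ j), ?_⟩
    rw [← e, smul_inv_smul₀ n1, smul_inv_smul₀ n2]
  · rintro ⟨u, v, w, hu, hv, hw, rfl⟩
    refine LinearPMap.mem_sub_graph_iff.2 ⟨_, _, LinearPMap.mem_add_graph_iff.2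
      ⟨α • u, v, (LinearPMap.mem_smul_graph_iff n1).2 ?_, hv, rfl⟩,
      (LinearPMap.mem_smul_graph_iff n2).2 ?_, rfl⟩
    · dsimp only
      rwa [inv_smul_smul₀ n1]
    · dsimp only
      rw [inv_smul_smul₀ n2]
      exact (LinearPMap.mem_finsetSum_graph_iff _).2 ⟨w, fun j _ => hw j, rfl⟩

theorem energy_graph : (tensorOp (idOp (L2 d ℂ)) S.B).graph =
      (tensorCore (idOp (L2 d ℂ)) S.B).topologicalClosure ∧
    (tensorOp (idOp (L2 d ℂ)) S.B).graph ≤ fiberRelation fun _ => S.B.graph :=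
  idOp_tensorOp_graph S.isClosed_B

theorem interaction_graph (j : Fin d) : (tensorOp (momentum S.hbar j) (S.C j)).graph =
      (tensorCore (momentum S.hbar j) (S.C j)).topologicalClosure ∧
    (tensorOp (momentum S.hbar j) (S.C j)).graph ≤ fiberRelation (S.R j) :=
  tensorOp_graph (hasSymbol_momentum S.hbar j) (S.isClosed_R j) (S.eq_zero_of_mem_R j) (S.mem_R j)

theorem inner_hamiltonian {p q : L2 d F × L2 d F} (hp : p ∈ S.hamiltonian.graph)
    (hq : q ∈ S.hamiltonian.graph) : inner ℂ p.2 q.1 = (inner ℂ p.1 q.2 : ℂ) := by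
  obtain ⟨X, Y⟩ := p
  obtain ⟨X', Y'⟩ := q
  obtain ⟨u, v, w, hu, hv, hw, rfl⟩ := S.mem_graph_iff.1 hp
  obtain ⟨u', v', w', hu', hv', hw', rfl⟩ := S.mem_graph_iff.1 hq
  refine inner_combination Finset.univ _ _ ?_ ?_ fun j => ?_
  · refine inner_tensorOp hasSymbol_laplacianOp ?_
      (tensorOp_idOp_graph hasSymbol_laplacianOp).1 hu hu'
    intro p hp q hq
    rw [LinearPMap.mem_idOp_graph_iff.1 hp, LinearPMap.mem_idOp_graph_iff.1 hq]
  · exact inner_tensorOp hasSymbol_idOp S.inner_B S.energy_graph.1 hv hv'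
  · exact inner_tensorOp (hasSymbol_momentum S.hbar j) (S.inner_C j) (S.interaction_graph j).1
      (hw j) (hw' j)

theorem mem_graph_of_core {X u v : L2 d F} {w : Fin d → L2 d F}
    (hu : (X, u) ∈ (tensorCore (laplacianOp d) (idOp F)).topologicalClosure)
    (hv : (X, v) ∈ (tensorCore (idOp (L2 d ℂ)) S.B).topologicalClosure)
    (hw : ∀ j, (X, w j) ∈ (tensorCore (momentum S.hbar j) (S.C j)).topologicalClosure) :
    (X, (-(S.a : ℂ)) • u + v - (S.c : ℂ) • ∑ j, w j) ∈ S.hamiltonian.graph :=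
  S.mem_graph_iff.2 ⟨u, v, w, (tensorOp_idOp_graph (F := F) hasSymbol_laplacianOp).1 ▸ hu,
    S.energy_graph.1 ▸ hv, fun j => (S.interaction_graph j).1 ▸ hw j, rfl⟩

theorem tensor_mem_domain {ψ : L2 d ℂ} (hψ : ψ ∈ smoothDomain d S.hbar) {Φ : F}
    (hB : Φ ∈ S.B.domain) (hC : ∀ j, Φ ∈ (S.C j).domain) :
    tensor ψ Φ ∈ S.hamiltonian.domain := by
  obtain ⟨χ, hχ⟩ := LinearPMap.mem_domain_iff.1 hψ.1
  choose θ hθ using fun j => LinearPMap.mem_domain_iff.1 ((Submodule.mem_iInf _).1 hψ.2 j)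
  obtain ⟨Φ', hΦ'⟩ := LinearPMap.mem_domain_iff.1 hB
  choose Θ hΘ using fun j => LinearPMap.mem_domain_iff.1 (hC j)
  have hid : (ψ, ψ) ∈ (idOp (L2 d ℂ)).graph := LinearPMap.mem_idOp_graph_iff.2 rfl
  have hid' : (Φ, Φ) ∈ (idOp F).graph := LinearPMap.mem_idOp_graph_iff.2 rfl
  have h1 := (tensorCore (laplacianOp d) (idOp F)).le_topologicalClosure
    (tensor_pair_mem_tensorCore hχ hid')
  have h2 := (tensorCore (idOp (L2 d ℂ)) S.B).le_topologicalClosure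
    (tensor_pair_mem_tensorCore hid hΦ')
  have h3 := fun j => (tensorCore (momentum S.hbar j) (S.C j)).le_topologicalClosure
    (tensor_pair_mem_tensorCore (hθ j) (hΘ j))
  exact LinearPMap.mem_domain_iff.2 ⟨_, S.mem_graph_of_core h1 h2 h3⟩

theorem dense_domain {D : Submodule ℂ F} (hD : Dense (D : Set F)) (hB : D ≤ S.B.domain)
    (hC : ∀ j, D ≤ (S.C j).domain) : Dense (S.hamiltonian.domain : Set (L2 d F)) := by
  refine (dense_tensorSpan (dense_smoothDomain S.hbar) hD).mono ?_
  refine Submodule.span_le.2 ?_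
  rintro _ ⟨ψ, hψ, Φ, hΦ, rfl⟩
  exact S.tensor_mem_domain hψ (hB hΦ) fun j => hC j hΦ

/-- The energy of the system in the presence of an electron of frequency `ξ` is at least
`κ` times the kinetic energy. -/
def FiberBound (κ : ℝ) : Prop :=
  ∀ (ξ : Space d) (Ψ χ : F) (w : Fin d → F), (Ψ, χ) ∈ S.B.graph → (∀ j, (Ψ, w j) ∈ S.R j ξ) →
    κ * (laplaceSymbol d ξ * ‖Ψ‖ ^ 2) ≤ S.a * laplaceSymbol d ξ * ‖Ψ‖ ^ 2 +
      (inner ℂ Ψ χ : ℂ).re + -S.c * (inner ℂ Ψ (∑ j, w j) : ℂ).re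

variable {S} {κ : ℝ}

theorem FiberBound.ae_ge (h : S.FiberBound κ) {p : L2 d F × L2 d F}
    (hp : p ∈ S.hamiltonian.graph) : ∀ᵐ ξ, κ * (laplaceSymbol d ξ * ‖(𝓕 p.1 : L2 d F) ξ‖ ^ 2) ≤
        (inner ℂ ((𝓕 p.1 : L2 d F) ξ) ((𝓕 p.2 : L2 d F) ξ) : ℂ).re := by
  obtain ⟨X, Y⟩ := p
  obtain ⟨u, v, w, hu, hv, hw, rfl⟩ := S.mem_graph_iff.1 hp
  have hu' : ∀ᵐ ξ, _ := (tensorOp_idOp_graph hasSymbol_laplacianOp).2 hu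
  have hv' : ∀ᵐ ξ, _ := S.energy_graph.2 hv
  have hw' : ∀ᵐ ξ, ∀ j, _ := ae_all_iff.2 fun j => (S.interaction_graph j).2 (hw j)
  filter_upwards [hu', hv', hw', fourier_combination Finset.univ u v w (-(S.a : ℂ)) (S.c : ℂ)]
    with ξ h1 h2 h3 h4
  rw [h4, show (𝓕 u : L2 d F) ξ = _ from mem_scalarRelation.1 h1, re_inner_combination]
  exact h ξ _ _ _ h2 h3

theorem FiberBound.ge (h : S.FiberBound κ) (hκ : 0 < κ) {p : L2 d F × L2 d F}
    (hp : p ∈ S.hamiltonian.graph) : p.1 ∈ (kinForm d F).domain ∧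
      κ * ((kinForm d F).val p.1 p.1).re ≤ (inner ℂ p.1 p.2 : ℂ).re := by
  have hae := h.ae_ge hp
  have hi : Integrable (fun ξ =>
      (inner ℂ ((𝓕 p.1 : L2 d F) ξ) ((𝓕 p.2 : L2 d F) ξ) : ℂ).re) volume :=
    (L2.integrable_inner (𝕜 := ℂ) (𝓕 p.1 : L2 d F) (𝓕 p.2 : L2 d F)).re
  have hint : Integrable (fun ξ => κ * (laplaceSymbol d ξ * ‖(𝓕 p.1 : L2 d F) ξ‖ ^ 2))
      volume := by
    refine hi.mono' ?_ ?_
    · exact (measurable_laplaceSymbol.aestronglyMeasurable.mul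
        ((Lp.aestronglyMeasurable _).norm.pow 2)).const_mul κ
    · filter_upwards [hae] with ξ h
      rwa [Real.norm_of_nonneg (mul_nonneg hκ.le
        (mul_nonneg (laplaceSymbol_nonneg ξ) (sq_nonneg _)))]
  have hint' := hint.const_mul κ⁻¹
  simp only [inv_mul_cancel_left₀ hκ.ne'] at hint'
  refine ⟨mem_kinForm_domain.2 hint', ?_⟩
  rw [re_kinForm_val, ← integral_const_mul, ← inner_fourier p.1, L2.inner_def]
  refine (integral_mono_ae hint hi hae).trans_eq ?_
  exact integral_re (𝕜 := ℂ) (L2.integrable_inner _ _)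

variable (S) in
theorem inner_apply_symm (u v : S.hamiltonian.domain) :
    inner ℂ (S.hamiltonian u) (v : L2 d F) = (inner ℂ (u : L2 d F) (S.hamiltonian v) : ℂ) :=
  S.inner_hamiltonian (S.hamiltonian.mem_graph u) (S.hamiltonian.mem_graph v)

theorem re_kinForm_nonneg (X : L2 d F) : 0 ≤ ((kinForm d F).val X X).re := by
  rw [re_kinForm_val]
  exact integral_nonneg fun ξ => mul_nonneg (laplaceSymbol_nonneg ξ) (sq_nonneg _)

theorem FiberBound.isSemibounded (h : S.FiberBound κ) (hκ : 0 < κ) :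
    IsSemibounded S.hamiltonian := by
  refine ⟨0, fun ψ => ?_⟩
  rw [zero_mul]
  exact (mul_nonneg hκ.le (re_kinForm_nonneg _)).trans (h.ge hκ (S.hamiltonian.mem_graph ψ)).2

theorem FiberBound.isClosedSemibounded (h : S.FiberBound κ) (hκ : 0 < κ)
    (hd : Dense (S.hamiltonian.domain : Set (L2 d F))) :
    (formOf S.hamiltonian).IsClosedSemibounded :=
  (QForm.formOf_isClosedSemibounded S.inner_apply_symm (h.isSemibounded hκ) hd).1

theorem FiberBound.mem_kinForm_domain (h : S.FiberBound κ) (hκ : 0 < κ)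
    (hd : Dense (S.hamiltonian.domain : Set (L2 d F))) {X : L2 d F}
    (hX : X ∈ (formOf S.hamiltonian).domain) : X ∈ (kinForm d F).domain ∧
      κ * ((kinForm d F).val X X).re ≤ ((formOf S.hamiltonian).val X X).re := by
  obtain ⟨u, hu⟩ := (QForm.mem_formDomain (h.isSemibounded hκ) X).1 hX
  have hlim := (QForm.formOf_isClosedSemibounded S.inner_apply_symm (h.isSemibounded hκ) hd).2
    X X u u hu hu
  have hdom : ∀ n, (u n : L2 d F) ∈ (kinForm d F).domain := fun n =>
    (h.ge hκ (S.hamiltonian.mem_graph (u n))).1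
  have hc : Tendsto (fun p : ℕ × ℕ => ((kinForm d F).val ((u p.1 : L2 d F) - u p.2)
      ((u p.1 : L2 d F) - u p.2)).re) atTop (𝓝 0) := by
    have h2 := hu.2.const_mul κ⁻¹
    rw [mul_zero] at h2
    refine squeeze_zero (fun p => re_kinForm_nonneg _) (fun p => ?_) h2
    rw [le_inv_mul_iff₀ hκ]
    exact (h.ge hκ (S.hamiltonian.mem_graph (u p.1 - u p.2))).2
  obtain ⟨hX', hX''⟩ := kinForm_isClosedSemibounded.isClosed _ _ hdom hu.1 hc
  refine ⟨hX', ?_⟩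
  have hk : Tendsto (fun n => κ * ((kinForm d F).val (u n : L2 d F) (u n)).re) atTop
      (𝓝 (κ * ((kinForm d F).val X X).re)) :=
    (kinForm_isClosedSemibounded.tendsto_re_val hdom hX' hu.1 hX'').const_mul κ
  exact le_of_tendsto_of_tendsto' hk ((Complex.continuous_re.tendsto _).comp hlim) fun n =>
    (h.ge hκ (S.hamiltonian.mem_graph (u n))).2

end DipoleSystem
end

noncomputable section

theorem coeFn_smul_add_smul {d : ℕ} {F : Type*} [NormedAddCommGroup F] [InnerProductSpace ℂ F]
    (α β : ℂ) (X X' : L2 d F) : ⇑(α • X + β • X') =ᵐ[volume] fun ξ => α • X ξ + β • X' ξ := by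
  filter_upwards [Lp.coeFn_add (α • X) (β • X'), Lp.coeFn_smul α X, Lp.coeFn_smul β X']
    with ξ h1 h2 h3
  rw [h1, Pi.add_apply, h2, h3, Pi.smul_apply, Pi.smul_apply]

theorem smul_combination {F ι : Type*} [AddCommGroup F] [Module ℂ F] (s : Finset ι) {a l k c : ℂ}
    {η b : F} {t : ι → ℂ} {w : ι → F} (z : ℂ)
    (e : (a * l) • η + b - c • ∑ i ∈ s, t i • w i = k • η) :
    (-a) • (-l) • z • η + (1 : ℂ) • z • b - c • ∑ i ∈ s, t i • z • w i = k • z • η := by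
  have h : ∑ i ∈ s, t i • z • w i = z • ∑ i ∈ s, t i • w i := by
    rw [Finset.smul_sum]
    exact Finset.sum_congr rfl fun i _ => smul_comm _ _ _
  rw [h, smul_comm k, ← e, smul_sub, smul_add, smul_comm c, one_smul, smul_smul (-a), neg_mul_neg,
    smul_comm z (a * l)]

theorem re_inner_smul_unit {F : Type*} [NormedAddCommGroup F] [InnerProductSpace ℂ F] {η : F}
    (hη : ‖η‖ = 1) {r : ℝ} (hr : 0 ≤ r) (α β z w : ℂ) :
    (inner ℂ (α • z • η + β • w • η) (α • (r : ℂ) • z • η + β • (r : ℂ) • w • η) : ℂ).re =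
      ‖α • ((√|r| : ℝ) : ℂ) • z + β • ((√|r| : ℝ) : ℂ) • w‖ ^ 2 := by
  have e1 : α • (r : ℂ) • z • η + β • (r : ℂ) • w • η = (r : ℂ) • (α * z + β * w) • η := by module
  have e2 : α • z • η + β • w • η = (α * z + β * w) • η := by module
  have e3 : α • ((√|r| : ℝ) : ℂ) • z + β • ((√|r| : ℝ) : ℂ) • w =
    ((√|r| : ℝ) : ℂ) • (α * z + β * w) := by
    simp only [smul_eq_mul]
    ring
  rw [e1, e2, e3, norm_sqrt_smul_sq, inner_smul_right, Complex.re_ofReal_mul, inner_self_re,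
    norm_smul, hη, mul_one, abs_of_nonneg hr]

namespace DipoleSystem

variable {d : ℕ} {F : Type*} [NormedAddCommGroup F] [InnerProductSpace ℂ F] [CompleteSpace F]

/-- Vectors `η ξ` that are eigenvectors of the fibers of the Hamiltonian, with the energy
`κ |2πξ|²` of an electron without environment. -/
structure Dressing (S : DipoleSystem d F) (κ : ℝ) where
  η : Space d → F
  b : Space d → F
  c : Fin d → Space d → F
  norm_eq : ∀ ξ, ‖η ξ‖ = 1
  measurable_η : StronglyMeasurable η
  measurable_b : StronglyMeasurable b
  measurable_c : ∀ j, StronglyMeasurable (c j)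
  bounded : ∀ n : ℝ, ∃ C : ℝ, ∀ ξ, ‖ξ‖ ≤ n → ‖b ξ‖ ≤ C ∧ ∀ j, ‖c j ξ‖ ≤ C
  mem_B : ∀ ξ, (η ξ, b ξ) ∈ S.B.graph
  mem_C : ∀ j ξ, (η ξ, c j ξ) ∈ (S.C j).graph
  eigen : ∀ ξ, ((S.a * laplaceSymbol d ξ : ℝ) : ℂ) • η ξ + b ξ -
    (S.c : ℂ) • ∑ j, ((2 * Real.pi * S.hbar * ξ j : ℝ) : ℂ) • c j ξ =
      ((κ * laplaceSymbol d ξ : ℝ) : ℂ) • η ξ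

namespace Dressing

variable {S : DipoleSystem d F} {κ : ℝ} (E : Dressing S κ)

theorem memLp_smul (φ : L2 d ℂ) {θ : Space d → F} (hθ : StronglyMeasurable θ) {C : ℝ}
    (hC : ∀ᵐ ξ, φ ξ ≠ 0 → ‖θ ξ‖ ≤ C) : MemLp (fun ξ => φ ξ • θ ξ) 2 volume := by
  refine (Lp.memLp φ).of_le_mul (c := C)
    ((Lp.aestronglyMeasurable φ).smul hθ.aestronglyMeasurable) ?_
  filter_upwards [hC] with ξ h
  rw [norm_smul, mul_comm]
  by_cases h0 : φ ξ = 0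
  · simp [h0]
  · exact mul_le_mul_of_nonneg_right (h h0) (norm_nonneg _)

theorem exists_fourier_eq_smul (φ : L2 d ℂ) {θ : Space d → F} (hθ : StronglyMeasurable θ) {C : ℝ}
    (hC : ∀ᵐ ξ, φ ξ ≠ 0 → ‖θ ξ‖ ≤ C) :
    ∃ X : L2 d F, ⇑(𝓕 X : L2 d F) =ᵐ[volume] fun ξ => φ ξ • θ ξ :=
  ⟨(Lp.fourierTransformₗᵢ (Space d) F).symm ((memLp_smul φ hθ hC).toLp _), by
    rw [fourier_symm_apply]
    exact (memLp_smul φ hθ hC).coeFn_toLp⟩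

theorem exists_mem_closure_tensorCore {A : L2 d ℂ →ₗ.[ℂ] L2 d ℂ} {a : Space d → ℝ} {B : F →ₗ.[ℂ] F}
    (hA : HasSymbol A a) (ha : Continuous a) {η θ : Space d → F} (hη : StronglyMeasurable η)
    (hθ : StronglyMeasurable θ) (hηθ : ∀ ξ, (η ξ, θ ξ) ∈ B.graph) (hn : ∀ ξ, ‖η ξ‖ = 1) {n C : ℝ}
    (hC : ∀ ξ, ‖ξ‖ ≤ n → ‖θ ξ‖ ≤ C) (ψ : L2 d ℂ) {X : L2 d F}
    (hX : ⇑(𝓕 X : L2 d F) =ᵐ[volume] fun ξ => (𝓕 (lowPass n ψ) : L2 d ℂ) ξ • η ξ) :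
    ∃ Y : L2 d F, (X, Y) ∈ (tensorCore A B).topologicalClosure ∧ ⇑(𝓕 Y : L2 d F) =ᵐ[volume]
      fun ξ => (a ξ : ℂ) • (𝓕 (lowPass n ψ) : L2 d ℂ) ξ • θ ξ := by
  obtain ⟨χ, hχ⟩ := exists_lowPass_mem_graph hA ha n ψ
  have h0 : ∀ᵐ ξ, (𝓕 (lowPass n ψ) : L2 d ℂ) ξ ≠ 0 → ‖ξ‖ ≤ n := by
    filter_upwards [fourier_lowPass n ψ] with ξ h1 h2
    by_contra h3
    exact h2 (by rw [h1, cutoff, if_neg h3, zero_mul])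
  have hs := (hA _).1 hχ
  have h1 : ∀ᵐ ξ, (𝓕 χ : L2 d ℂ) ξ ≠ 0 → ‖θ ξ‖ ≤ C := by
    filter_upwards [h0, hs] with ξ h1 h2 h3
    refine hC ξ (h1 fun h4 => h3 ?_)
    rw [h2]
    exact (congrArg _ h4).trans (mul_zero _)
  obtain ⟨Y, hY⟩ := exists_fourier_eq_smul (𝓕 χ : L2 d ℂ) hθ h1
  refine ⟨Y, mem_closure_tensorCore hA hχ (hη.prodMk hθ) hηθ (C := max 1 C) ?_ hX hY, ?_⟩
  · filter_upwards [h0] with ξ h1 h2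
    rw [Prod.norm_def]
    exact max_le_max (hn ξ).le (hC ξ (h1 h2))
  · filter_upwards [hY, hs] with ξ h2 h3
    rw [h2, h3, smul_smul]

theorem exists_lowPass_mem_graph (n : ℝ) (ψ : L2 d ℂ) {X : L2 d F}
    (hX : ⇑(𝓕 X : L2 d F) =ᵐ[volume] fun ξ => (𝓕 (lowPass n ψ) : L2 d ℂ) ξ • E.η ξ) :
    ∃ Y : L2 d F, (X, Y) ∈ S.hamiltonian.graph ∧ ⇑(𝓕 Y : L2 d F) =ᵐ[volume]
      fun ξ => ((κ * laplaceSymbol d ξ : ℝ) : ℂ) • (𝓕 X : L2 d F) ξ := by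
  obtain ⟨C, hC⟩ := E.bounded n
  obtain ⟨u, hu, hu'⟩ := exists_mem_closure_tensorCore (B := idOp F) hasSymbol_laplacianOp
    (by fun_prop) E.measurable_η E.measurable_η (fun ξ => LinearPMap.mem_idOp_graph_iff.2 rfl)
    E.norm_eq (C := 1) (fun ξ _ => (E.norm_eq ξ).le) ψ hX
  obtain ⟨v, hv, hv'⟩ := exists_mem_closure_tensorCore (hasSymbol_idOp (d := d))
    continuous_const E.measurable_η E.measurable_b E.mem_B E.norm_eq
    (fun ξ hξ => (hC ξ hξ).1) ψ hX
  choose w hw hw' using fun j => exists_mem_closure_tensorCore (hasSymbol_momentum S.hbar j)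
    (continuous_coord_mul _ j) E.measurable_η (E.measurable_c j) (E.mem_C j) E.norm_eq
    (fun ξ hξ => (hC ξ hξ).2 j) ψ hX
  refine ⟨_, S.mem_graph_of_core hu hv hw, ?_⟩
  filter_upwards [fourier_combination Finset.univ u v w (-(S.a : ℂ)) (S.c : ℂ), hu', hv',
    ae_all_iff.2 hw', hX] with ξ h1 h2 h3 h4 h5
  rw [h1, h2, h3, h5, Complex.ofReal_neg, Complex.ofReal_one]
  simp only [h4]
  refine smul_combination _ _ ?_
  have h := E.eigen ξ
  rwa [Complex.ofReal_mul, laplaceSymbol] at h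

/-- The dressing map. -/
def IsDressing (J : L2 d ℂ →ₗ[ℂ] L2 d F) : Prop :=
  ∀ ψ, ⇑(𝓕 (J ψ) : L2 d F) =ᵐ[volume] fun ξ => (𝓕 ψ : L2 d ℂ) ξ • E.η ξ

variable {E} {J : L2 d ℂ →ₗ[ℂ] L2 d F}

theorem IsDressing.norm_map (hJ : E.IsDressing J) (ψ : L2 d ℂ) : ‖J ψ‖ = ‖ψ‖ := by
  have h : ‖(𝓕 (J ψ) : L2 d F)‖ = ‖(𝓕 ψ : L2 d ℂ)‖ := by
    refine le_antisymm (Lp.norm_le_norm_of_ae_le ?_) (Lp.norm_le_norm_of_ae_le ?_)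
    all_goals
      filter_upwards [hJ ψ] with ξ hξ
      rw [hξ, norm_smul, E.norm_eq, mul_one]
  exact ((Lp.fourierTransformₗᵢ (Space d) F).norm_map _).symm.trans
    (h.trans ((Lp.fourierTransformₗᵢ (Space d) ℂ).norm_map _))

theorem IsDressing.form_eq (hJ : E.IsDressing J) (hκ : 0 < κ) (hS : S.FiberBound κ)
    (hd : Dense (S.hamiltonian.domain : Set (L2 d F))) {ψ : L2 d ℂ}
    (hψ : ψ ∈ (kinForm d ℂ).domain) : J ψ ∈ (formOf S.hamiltonian).domain ∧
      ((formOf S.hamiltonian).val (J ψ) (J ψ)).re = κ * ((kinForm d ℂ).val ψ ψ).re := by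
  choose Y hY hY' using fun n : ℕ => E.exists_lowPass_mem_graph n ψ (hJ (lowPass n ψ))
  let u : ℕ → S.hamiltonian.domain := fun n =>
    ⟨J (lowPass n ψ), LinearPMap.mem_domain_iff.2 ⟨Y n, hY n⟩⟩
  have hu : ∀ n, S.hamiltonian (u n) = Y n := fun n =>
    LinearPMap.mem_graph_snd_inj _ (S.hamiltonian.mem_graph (u n)) (hY n) rfl
  have hJc : Continuous J := (⟨J, hJ.norm_map⟩ : L2 d ℂ →ₗᵢ[ℂ] L2 d F).continuous
  have hlim : Tendsto (fun n => (u n : L2 d F)) atTop (𝓝 (J ψ)) :=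
    (hJc.tendsto ψ).comp (tendsto_lowPass ψ)
  obtain ⟨Z, hZ⟩ : ∃ Z : L2 d ℂ, Z =ᵐ[volume]
      fun ξ => ((√|κ * laplaceSymbol d ξ| : ℝ) : ℂ) • (𝓕 ψ : L2 d ℂ) ξ := by
    have hm : MemLp (fun ξ => ((√|κ * laplaceSymbol d ξ| : ℝ) : ℂ) • (𝓕 ψ : L2 d ℂ) ξ) 2
        volume := by
      refine mem_mulForm_domain.1 ((mem_mulForm_domain_iff_integrable
        (measurable_laplaceSymbol.const_mul κ)).2 ?_)
      refine ((mem_kinForm_domain.1 hψ).const_mul κ).congr (Eventually.of_forall fun ξ => ?_)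
      dsimp only
      rw [abs_of_nonneg (mul_nonneg hκ.le (laplaceSymbol_nonneg ξ)), mul_assoc]
    exact ⟨hm.toLp _, hm.coeFn_toLp⟩
  have hZn : ∀ n : ℝ, mulOp (cutoff (fun ξ : Space d => ‖ξ‖) n) Z =ᵐ[volume] fun ξ =>
      ((√|κ * laplaceSymbol d ξ| : ℝ) : ℂ) • (𝓕 (lowPass n ψ) : L2 d ℂ) ξ := by
    intro n
    filter_upwards [hZ, fourier_lowPass n ψ, coeFn_mulOp_cutoff measurable_norm n Z]
      with ξ h1 h2 h3
    rw [h3, h1, h2, smul_eq_mul, smul_eq_mul, smul_eq_mul]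
    ring
  have hval : ∀ (α β : ℂ) (n m : ℕ), (inner ℂ ((α • u n + β • u m : S.hamiltonian.domain) : L2 d F)
      (S.hamiltonian (α • u n + β • u m))).re =
      ‖α • mulOp (cutoff (fun ξ : Space d => ‖ξ‖) n) Z +
        β • mulOp (cutoff (fun ξ : Space d => ‖ξ‖) m) Z‖ ^ 2 := by
    intro α β n m
    rw [LinearPMap.map_add, LinearPMap.map_smul, LinearPMap.map_smul, hu, hu, ← inner_fourier,
      L2.inner_def, L2.norm_sq_eq_integral]
    refine (integral_re (𝕜 := ℂ) (L2.integrable_inner _ _)).symm.trans ?_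
    refine integral_congr_ae ?_
    have e1 : ∀ X X' : L2 d F, (𝓕 (α • X + β • X') : L2 d F) = α • 𝓕 X + β • 𝓕 X' := fun X X' =>
      (map_add (Lp.fourierTransformₗᵢ (Space d) F) _ _).trans
        (congrArg₂ _ (map_smul (Lp.fourierTransformₗᵢ (Space d) F) α X)
          (map_smul (Lp.fourierTransformₗᵢ (Space d) F) β X'))
    have e3 : ((α • u n + β • u m : S.hamiltonian.domain) : L2 d F) =
      α • J (lowPass n ψ) + β • J (lowPass m ψ) := rfl
    rw [e3, e1, e1]
    filter_upwards [coeFn_smul_add_smul α β (𝓕 (J (lowPass n ψ)) : L2 d F) (𝓕 (J (lowPass m ψ)) : L2 d F),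
      coeFn_smul_add_smul α β (𝓕 (Y n) : L2 d F) (𝓕 (Y m) : L2 d F),
      coeFn_smul_add_smul α β (mulOp (cutoff (fun ξ : Space d => ‖ξ‖) n) Z) (mulOp (cutoff (fun ξ : Space d => ‖ξ‖) m) Z),
      hJ (lowPass n ψ), hJ (lowPass m ψ), hY' n, hY' m, hZn n, hZn m]
      with ξ h1 h2 h3 h4 h5 h6 h7 h8 h9
    rw [h1, h2, h3, h6, h7, h8, h9, h4, h5]
    exact re_inner_smul_unit (E.norm_eq ξ) (mul_nonneg hκ.le (laplaceSymbol_nonneg ξ)) _ _ _ _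
  have hZlim := tendsto_mulOp_cutoff (measurable_norm (α := Space d)) Z
  have happ : FormApprox S.hamiltonian u (J ψ) := by
    refine ⟨hlim, ?_⟩
    have h1 := cauchySeq_iff_tendsto_norm_sub_sq.1 hZlim.cauchySeq
    refine h1.congr fun p => ?_
    have h2 := hval 1 (-1) p.1 p.2
    simp only [one_smul, neg_smul, ← sub_eq_add_neg] at h2
    exact h2.symm
  refine ⟨(QForm.mem_formDomain (hS.isSemibounded hκ) _).2 ⟨u, happ⟩, ?_⟩
  have h1 := (QForm.formOf_isClosedSemibounded S.inner_apply_symm (hS.isSemibounded hκ) hd).2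
    _ _ u u happ happ
  refine tendsto_nhds_unique ((Complex.continuous_re.tendsto _).comp h1) ?_
  have h2 : κ * ((kinForm d ℂ).val ψ ψ).re = ‖Z‖ ^ 2 := by
    rw [re_kinForm_val, L2.norm_sq_eq_integral, ← integral_const_mul]
    refine integral_congr_ae ?_
    filter_upwards [hZ] with ξ h
    rw [h, norm_sqrt_smul_sq, abs_of_nonneg (mul_nonneg hκ.le (laplaceSymbol_nonneg ξ)), mul_assoc]
  rw [h2]
  refine (hZlim.norm.pow 2).congr fun n => ?_
  have h3 := hval 1 0 n n
  simp only [one_smul, zero_smul, add_zero] at h3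
  exact h3.symm

end Dressing
end DipoleSystem
end

noncomputable section

theorem eigen_combination {V F ι : Type*} [AddCommGroup V] [Module ℂ V] [AddCommGroup F]
    [Module ℂ F] (s : Finset ι) (L : V →ₗ[ℂ] F) (η : F) (t i : ι → ℂ) (g : ι → V) {a c σ k : ℂ}
    (h : a - c * σ * ∑ j ∈ s, t j * i j = k) :
    a • η + L ((c * σ) • ∑ j ∈ s, t j • g j) - c • ∑ j ∈ s, t j • ((σ * i j) • η + σ • L (g j)) =
      k • η := by
  have e1 : ∑ j ∈ s, t j • ((σ * i j) • η + σ • L (g j)) =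
      (σ * ∑ j ∈ s, t j * i j) • η + σ • ∑ j ∈ s, t j • L (g j) := by
    rw [Finset.mul_sum, Finset.sum_smul, Finset.smul_sum, ← Finset.sum_add_distrib]
    refine Finset.sum_congr rfl fun j _ => ?_
    module
  rw [e1, map_smul, map_sum, ← h]
  simp only [map_smul]
  module

namespace DipoleSystem

variable {d : ℕ} {F : Type*} [NormedAddCommGroup F] [InnerProductSpace ℂ F] [CompleteSpace F]
  {S : DipoleSystem d F} {κ : ℝ} {A : L2 d F →ₗ.[ℂ] L2 d F}

theorem FiberBound.isClosedSemibounded_of_eq (h : S.FiberBound κ) (hA : A = S.hamiltonian)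
    (hκ : 0 < κ) (hd : Dense (S.hamiltonian.domain : Set (L2 d F))) :
    (formOf A).IsClosedSemibounded := by
  subst hA
  exact h.isClosedSemibounded hκ hd

theorem FiberBound.mem_kinForm_domain_of_eq (h : S.FiberBound κ) (hA : A = S.hamiltonian)
    (hκ : 0 < κ) (hd : Dense (S.hamiltonian.domain : Set (L2 d F))) {X : L2 d F}
    (hX : X ∈ (formOf A).domain) : X ∈ (kinForm d F).domain ∧
      κ * ((kinForm d F).val X X).re ≤ ((formOf A).val X X).re := by
  subst hA
  exact h.mem_kinForm_domain hκ hd hX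

theorem Dressing.IsDressing.form_eq_of_eq {E : Dressing S κ} {J : L2 d ℂ →ₗ[ℂ] L2 d F}
    (hJ : E.IsDressing J) (hA : A = S.hamiltonian) (hκ : 0 < κ) (hS : S.FiberBound κ)
    (hd : Dense (S.hamiltonian.domain : Set (L2 d F))) {ψ : L2 d ℂ}
    (hψ : ψ ∈ (kinForm d ℂ).domain) : J ψ ∈ (formOf A).domain ∧
      ((formOf A).val (J ψ) (J ψ)).re = κ * ((kinForm d ℂ).val ψ ψ).re := by
  subst hA
  exact hJ.form_eq hκ hS hd hψ

end DipoleSystem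

namespace PauliFierzModel

variable {d : ℕ} (M : PauliFierzModel d)

theorem norm_mom_sq (ξ : Space d) : ‖M.mom ξ‖ ^ 2 = M.hbar ^ 2 * laplaceSymbol d ξ := by
  rw [mom, norm_smul, mul_pow, Real.norm_eq_abs, sq_abs, laplaceSymbol]
  ring

theorem measurable_energy : Measurable fun κ : PhotonSpace d => M.hbar * M.ω κ.1 :=
  (M.ω_measurable.comp measurable_fst).const_mul _

theorem energy_nonneg' (κ : PhotonSpace d) : 0 ≤ M.hbar * M.ω κ.1 :=
  mul_nonneg M.hbar_pos.le (M.ω_nonneg _)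

theorem ae_ω_pos : ∀ᵐ κ : PhotonSpace d ∂photonMeasure d, 0 < M.ω κ.1 :=
  (Measure.quasiMeasurePreserving_fst (μ := (volume : Measure (Space d)))
    (ν := (Measure.count : Measure (Fin (d - 1))))).ae M.ω_pos

theorem polarizedSum_amp_eq (P : Space d) : M.polarizedSum M.amp P =ᵐ[photonMeasure d]
    fun κ => ((√(M.hbar * M.ω κ.1) : ℝ) : ℂ) * M.polarizedSum M.ampSqrt P κ := by
  filter_upwards [M.coeFn_polarizedSum M.memLp_amp P, M.coeFn_polarizedSum M.memLp_ampSqrt P,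
    M.ae_ω_pos] with κ h1 h2 h3
  rw [h1, h2, ← Complex.ofReal_mul, Finset.mul_sum]
  congr 1
  refine Finset.sum_congr rfl fun j _ => ?_
  have := (Real.sqrt_pos.2 (mul_pos M.hbar_pos h3)).ne'
  rw [ampSqrt]
  field_simp

theorem fiber_constant {P x : ℝ} :
    P / (2 * M.m) * x = P / (2 * M.m0) * x - (-(M.q / M.m)) ^ 2 / 2 *
      (((d : ℝ) - 1) / d * (M.eps0⁻¹ * ∫ k, |M.ρ k| ^ 2 / M.ω k ^ 2) * P) * x := by
  have h := M.mass_relation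
  have hm := M.m_pos.ne'
  have h0 := M.m0_pos.ne'
  have he := M.eps0_pos.ne'
  have e1 : P / (2 * M.m0) * x = 1 / M.m0 * (P / 2 * x) := by field_simp
  rw [e1, h]
  field_simp
  ring

theorem fiber_bound_of_norm_sq {L N X Y G : ℝ} (hG : G ^ 2 = ((d : ℝ) - 1) / d *
    (M.eps0⁻¹ * ∫ k, |M.ρ k| ^ 2 / M.ω k ^ 2) * (M.hbar ^ 2 * L))
    (h : -((-(M.q / M.m)) ^ 2 / 2 * G ^ 2 * N ^ 2) ≤ X + -(M.q / M.m) * Y) :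
    M.hbar ^ 2 / (2 * M.m) * (L * N ^ 2) ≤
      M.hbar ^ 2 / (2 * M.m0) * L * N ^ 2 + X + -(M.q / M.m) * Y := by
  have h2 := M.fiber_constant (x := N ^ 2) (P := M.hbar ^ 2 * L)
  rw [hG] at h
  have e1 : M.hbar ^ 2 / (2 * M.m) * (L * N ^ 2) = M.hbar ^ 2 * L / (2 * M.m) * N ^ 2 := by ring
  have e2 : M.hbar ^ 2 / (2 * M.m0) * L * N ^ 2 = M.hbar ^ 2 * L / (2 * M.m0) * N ^ 2 := by ring
  rw [e1, e2]
  linarith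

theorem norm_polarizedSum_ampSqrt_sq (hd : 2 ≤ d) (ξ : Space d) :
    ‖M.polarizedSum M.ampSqrt (M.mom ξ)‖ ^ 2 = ((d : ℝ) - 1) / d *
      (M.eps0⁻¹ * ∫ k, |M.ρ k| ^ 2 / M.ω k ^ 2) * (M.hbar ^ 2 * laplaceSymbol d ξ) := by
  rw [M.norm_polarizedSum_sq hd M.memLp_ampSqrt M.ampSqrt_radial,
    M.integral_ampSqrt_mul_ampSqrt, M.norm_mom_sq]

theorem fiber_bound (hd : 2 ≤ d) {ξ : Space d} {Ψ χ Θ : Fock d}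
    (hχ : (Ψ, χ) ∈ M.photonEnergy.graph)
    (hΘ : (Ψ, Θ) ∈ (segalPair (M.polarizedSum M.amp (M.mom ξ))).relation) :
    M.hbar ^ 2 / (2 * M.m) * (laplaceSymbol d ξ * ‖Ψ‖ ^ 2) ≤
      M.hbar ^ 2 / (2 * M.m0) * laplaceSymbol d ξ * ‖Ψ‖ ^ 2 + (inner ℂ Ψ χ : ℂ).re +
        -(M.q / M.m) * (inner ℂ Ψ Θ : ℂ).re :=
  M.fiber_bound_of_norm_sq (M.norm_polarizedSum_ampSqrt_sq hd ξ)
    (energy_add_segal_ge M.measurable_energy M.energy_nonneg'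
      (M.polarizedSum_amp_eq (M.mom ξ)) hχ hΘ (-(M.q / M.m)))

/-- The model as a dipole system. -/
@[reducible] def system : DipoleSystem d (Fock d) where
  a := M.hbar ^ 2 / (2 * M.m0)
  c := M.q / M.m
  hbar := M.hbar
  B := M.photonEnergy
  C := M.vectorPotential
  R j ξ := (segalPair (M.polarized M.amp j)).smulRelation ((2 * Real.pi * M.hbar * ξ j : ℝ) : ℂ)
  a_ne_zero := (div_pos (pow_pos M.hbar_pos 2) (mul_pos two_pos M.m0_pos)).ne'
  c_ne_zero := div_ne_zero M.q_ne_zero M.m_pos.ne'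
  isClosed_B := isClosed_secondQuantization_graph
  inner_B p hp q hq := inner_secondQuantization hp hq
  inner_C j p hp q hq := inner_segalField (M.memLp_g j) hp hq
  isClosed_R j ξ := LadderPair.isClosed_smulRelation (E := fun n : ℕ => symSector d n) _ _
  eq_zero_of_mem_R j ξ u hu :=
    LadderPair.eq_zero_of_mem_smulRelation (E := fun n : ℕ => symSector d n) hu
  mem_R j ξ q hq := by
    have h := (SetLike.ext_iff.1 (segalField_graph (M.memLp_g j)) _).1 hq
    rw [toLp_g] at h
    exact LadderPair.smul_mem_smulRelation (E := fun n : ℕ => symSector d n) h _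

theorem freeHamiltonian_eq : M.freeHamiltonian = M.system.hamiltonian := by
  have h1 : (-(M.hbar ^ 2 / (2 * M.m0) : ℂ)) = -((M.hbar ^ 2 / (2 * M.m0) : ℝ) : ℂ) := by
    push_cast; rfl
  have h2 : (M.q / M.m : ℂ) = ((M.q / M.m : ℝ) : ℂ) := by push_cast; rfl
  exact congrArg₂ (fun α β : ℂ => α • tensorOp (laplacianOp d) (idOp (Fock d))
    + tensorOp (idOp (L2 d ℂ)) M.photonEnergy
    - β • ∑ j : Fin d, tensorOp (momentum M.hbar j) (M.vectorPotential j)) h1 h2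

/-- The factor `ħ² / (2m)`. -/
def kineticFactor : ℝ := M.hbar ^ 2 / (2 * M.m)

theorem kineticFactor_pos : 0 < M.kineticFactor :=
  div_pos (pow_pos M.hbar_pos 2) (mul_pos two_pos M.m_pos)

theorem system_fiberBound (hd : 2 ≤ d) : M.system.FiberBound M.kineticFactor := by
  intro ξ Ψ χ w hχ hw
  exact M.fiber_bound hd hχ (sum_mem_segal_relation Finset.univ (fun j => M.mom ξ j)
    (fun j => M.polarized M.amp j) hw)

theorem system_dense : Dense (M.system.hamiltonian.domain : Set (L2 d (Fock d))) :=
  M.system.dense_domain (dense_secondQuantizationCore M.measurable_energy) (fun _ h => h.2)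
    fun j Φ h => LinearPMap.mem_domain_iff.2
      ⟨_, (segalField_isEntireCore (M.memLp_g j)).mem_graph ⟨Φ, h.1⟩⟩

/-- `ħω` times the amplitude of the coherent state at frequency `ξ`. -/
def energyShift (ξ : Space d) : OnePhoton d :=
  (((M.q / M.m : ℝ) : ℂ) * ((√2 : ℝ) : ℂ)⁻¹) • M.polarizedSum M.amp (M.mom ξ)

theorem energyShift_eq (ξ : Space d) : M.energyShift ξ =ᵐ[photonMeasure d]
    fun κ => ((M.hbar * M.ω κ.1 : ℝ) : ℂ) * M.shift (M.mom ξ) κ := by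
  filter_upwards [M.coeFn_polarizedSum M.memLp_amp (M.mom ξ),
    M.coeFn_polarizedSum M.memLp_ampDiv (M.mom ξ), M.ae_ω_pos,
    Lp.coeFn_smul (((M.q / M.m : ℝ) : ℂ) * ((√2 : ℝ) : ℂ)⁻¹) (M.polarizedSum M.amp (M.mom ξ)),
    Lp.coeFn_smul ((M.q / (M.m * M.hbar) / √2 : ℝ) : ℂ) (M.polarizedSum M.ampDiv (M.mom ξ))]
    with κ h1 h2 h3 h4 h5
  rw [energyShift, shift, h4, h5, Pi.smul_apply, Pi.smul_apply, h1, h2, smul_eq_mul, smul_eq_mul,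
    ← Complex.ofReal_inv, ← Complex.ofReal_mul, ← Complex.ofReal_mul, ← Complex.ofReal_mul,
    ← Complex.ofReal_mul, Finset.mul_sum, Finset.mul_sum, Finset.mul_sum]
  congr 1
  refine Finset.sum_congr rfl fun j _ => ?_
  have := M.hbar_pos.ne'
  have := M.m_pos.ne'
  rw [ampDiv]
  field_simp

theorem inner_polarized_shift (hd : 2 ≤ d) (ξ : Space d) (j : Fin d) :
    inner ℂ (M.polarized M.amp j) (M.shift (M.mom ξ)) = ((M.q / (M.m * M.hbar) / √2 *
      (((d : ℝ) - 1) / d * (M.hbar / M.eps0 * ∫ k, |M.ρ k| ^ 2 / M.ω k ^ 2) * M.mom ξ j) : ℝ) :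
        ℂ) := by
  rw [shift, inner_smul_right, M.inner_polarized_polarizedSum hd M.memLp_amp M.memLp_ampDiv
    M.amp_radial M.ampDiv_radial, M.integral_amp_mul_ampDiv, ← Complex.ofReal_mul]

theorem eigenvalue_eq (hd : 2 ≤ d) (ξ : Space d) :
    ((M.hbar ^ 2 / (2 * M.m0) * laplaceSymbol d ξ : ℝ) : ℂ) -
      ((M.q / M.m : ℝ) : ℂ) * ((√2 : ℝ) : ℂ)⁻¹ * ∑ j, ((M.mom ξ j : ℝ) : ℂ) *
        inner ℂ (M.polarized M.amp j) (M.shift (M.mom ξ)) =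
      ((M.kineticFactor * laplaceSymbol d ξ : ℝ) : ℂ) := by
  simp only [M.inner_polarized_shift hd]
  rw [← Complex.ofReal_inv]
  simp only [← Complex.ofReal_mul, ← Complex.ofReal_sum, ← Complex.ofReal_sub]
  congr 1
  have h2 := M.fiber_constant (x := 1) (P := M.hbar ^ 2 * laplaceSymbol d ξ)
  have h3 : M.hbar ^ 2 * laplaceSymbol d ξ = ∑ j, M.mom ξ j ^ 2 := by
    rw [← norm_mom_sq, EuclideanSpace.real_norm_sq_eq]
  have h4 : ∀ c : ℝ, ∑ j, M.mom ξ j * (M.q / (M.m * M.hbar) / √2 * (c * M.mom ξ j)) =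
      M.q / (M.m * M.hbar) / √2 * c * (M.hbar ^ 2 * laplaceSymbol d ξ) := by
    intro c
    rw [h3, Finset.mul_sum]
    exact Finset.sum_congr rfl fun j _ => by ring
  rw [h4, kineticFactor]
  have hs : (√2)⁻¹ * (√2)⁻¹ = (1 / 2 : ℝ) := by
    rw [← mul_inv, Real.mul_self_sqrt two_pos.le, one_div]
  have := M.hbar_pos.ne'
  have e : M.q / M.m * (√2)⁻¹ * (M.q / (M.m * M.hbar) / √2 * (((d : ℝ) - 1) / d *
      (M.hbar / M.eps0 * ∫ k, |M.ρ k| ^ 2 / M.ω k ^ 2)) * (M.hbar ^ 2 * laplaceSymbol d ξ)) =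
      (M.hbar / M.hbar) * ((√2)⁻¹ * (√2)⁻¹) * (M.q / M.m) ^ 2 * (((d : ℝ) - 1) / d *
      (M.eps0⁻¹ * ∫ k, |M.ρ k| ^ 2 / M.ω k ^ 2)) * (M.hbar ^ 2 * laplaceSymbol d ξ) := by
    simp only [div_eq_mul_inv, mul_inv]
    ring
  rw [e, hs, div_self this]
  linear_combination -h2

theorem continuous_shift_mom : Continuous fun ξ : Space d => M.shift (M.mom ξ) :=
  M.continuous_shift.comp M.continuous_mom

theorem continuous_energyShift : Continuous M.energyShift :=
  Continuous.const_smul ((M.continuous_polarizedSum M.amp).comp M.continuous_mom)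
    (((M.q / M.m : ℝ) : ℂ) * ((√2 : ℝ) : ℂ)⁻¹)

theorem isBounded_norm_on_ball {E : Type*} [NormedAddCommGroup E] {f : Space d → E}
    (hf : Continuous f) (n : ℝ) : ∃ C : ℝ, ∀ ξ, ‖ξ‖ ≤ n → ‖f ξ‖ ≤ C := by
  obtain ⟨C, hC⟩ := (isCompact_closedBall (0 : Space d) n).exists_bound_of_continuousOn
    hf.continuousOn
  exact ⟨C, fun ξ hξ => hC ξ (mem_closedBall_zero_iff.2 hξ)⟩

/-- The value of `g_j`-field on the coherent state at frequency `ξ`. -/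
def fieldCloud (j : Fin d) (ξ : Space d) : Fock d :=
  (((√2 : ℝ) : ℂ)⁻¹ * inner ℂ (M.polarized M.amp j) (M.shift (M.mom ξ))) • M.cloud ξ +
    ((√2 : ℝ) : ℂ)⁻¹ • coherentCre (M.polarized M.amp j) (M.shift (M.mom ξ))

/-- The photon energy applied to the coherent state at frequency `ξ`. -/
def energyCloud (ξ : Space d) : Fock d := coherentCre (M.energyShift ξ) (M.shift (M.mom ξ))

theorem norm_smul_add_smul_le {E : Type*} [NormedAddCommGroup E] [NormedSpace ℂ E] {α β : ℂ}
    {x y : E} {A B X Y : ℝ} (hα : ‖α‖ ≤ A) (hβ : ‖β‖ ≤ B) (hx : ‖x‖ ≤ X) (hy : ‖y‖ ≤ Y) :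
    ‖α • x + β • y‖ ≤ A * X + B * Y := by
  refine (norm_add_le _ _).trans (add_le_add ?_ ?_)
  all_goals
    rw [norm_smul]
    gcongr
    exact (norm_nonneg _).trans (by assumption)

theorem fieldCloud_mem (j : Fin d) (ξ : Space d) :
    (M.cloud ξ, M.fieldCloud j ξ) ∈ (M.vectorPotential j).graph := by
  have h := coherent_mem_segalField (M.memLp_g j) (M.shift (M.mom ξ))
  rw [toLp_g] at h
  exact h

theorem energyCloud_mem (ξ : Space d) : (M.cloud ξ, M.energyCloud ξ) ∈ M.photonEnergy.graph :=
  coherent_mem_secondQuantization (M.energyShift_eq ξ)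

theorem measurable_energyCloud : StronglyMeasurable M.energyCloud :=
  stronglyMeasurable_coherentCre M.continuous_energyShift M.continuous_shift_mom

theorem measurable_fieldCloud (j : Fin d) : StronglyMeasurable (M.fieldCloud j) := by
  have h1 : StronglyMeasurable fun ξ : Space d => (((√2 : ℝ) : ℂ)⁻¹ *
      inner ℂ (M.polarized M.amp j) (M.shift (M.mom ξ)) : ℂ) :=
    (continuous_const.mul (continuous_const.inner M.continuous_shift_mom)).stronglyMeasurable
  have h2 := stronglyMeasurable_coherentCre (continuous_const (y := M.polarized M.amp j))
    M.continuous_shift_mom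
  exact (stronglyMeasurable_smul_complex h1 M.stronglyMeasurable_cloud).add
    (stronglyMeasurable_smul_complex stronglyMeasurable_const h2)

theorem exists_norm_fieldCloud_le (n : ℝ) : ∃ C : ℝ, ∀ ξ, ‖ξ‖ ≤ n →
    ‖M.energyCloud ξ‖ ≤ C ∧ ∀ j, ‖M.fieldCloud j ξ‖ ≤ C := by
  obtain ⟨R, hR⟩ := isBounded_norm_on_ball M.continuous_shift_mom n
  obtain ⟨C, hC0, hC⟩ := exists_norm_coherentCre_le (d := d) R
  obtain ⟨G, hG⟩ := isBounded_norm_on_ball M.continuous_energyShift n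
  have hA : ∀ j, ∃ A : ℝ, ∀ ξ : Space d, ‖ξ‖ ≤ n → ‖(((√2 : ℝ) : ℂ)⁻¹ *
      inner ℂ (M.polarized M.amp j) (M.shift (M.mom ξ)) : ℂ)‖ ≤ A := fun j =>
    isBounded_norm_on_ball (continuous_const.mul
      (continuous_const.inner M.continuous_shift_mom)) n
  choose A hA using hA
  let K : Fin d → ℝ := fun j => A j * 1 + ‖((√2 : ℝ) : ℂ)⁻¹‖ * (C * ‖M.polarized M.amp j‖)
  refine ⟨|C * G| + ∑ j, |K j|, fun ξ hξ => ⟨?_, fun j => ?_⟩⟩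
  · have h1 : ‖M.energyCloud ξ‖ ≤ C * G :=
      (hC _ _ (hR ξ hξ)).trans (mul_le_mul_of_nonneg_left (hG ξ hξ) hC0)
    exact (h1.trans (le_abs_self _)).trans
      (le_add_of_nonneg_right (Finset.sum_nonneg fun j _ => abs_nonneg _))
  · have h1 : ‖M.fieldCloud j ξ‖ ≤ K j := norm_smul_add_smul_le (hA j ξ hξ) le_rfl
      (M.norm_cloud ξ).le (hC _ _ (hR ξ hξ))
    refine (h1.trans (le_abs_self _)).trans ?_
    refine (Finset.single_le_sum (f := fun j => |K j|) (fun j _ => abs_nonneg _)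
      (Finset.mem_univ j)).trans (le_add_of_nonneg_left (abs_nonneg _))

theorem cloud_eigen (hd : 2 ≤ d) (ξ : Space d) :
    ((M.hbar ^ 2 / (2 * M.m0) * laplaceSymbol d ξ : ℝ) : ℂ) • M.cloud ξ + M.energyCloud ξ -
      ((M.q / M.m : ℝ) : ℂ) • ∑ j, ((2 * Real.pi * M.hbar * ξ j : ℝ) : ℂ) • M.fieldCloud j ξ =
        ((M.kineticFactor * laplaceSymbol d ξ : ℝ) : ℂ) • M.cloud ξ :=
  eigen_combination Finset.univ (coherentCreₗ (M.shift (M.mom ξ))) (M.cloud ξ)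
    (fun j => ((M.mom ξ j : ℝ) : ℂ))
    (fun j => inner ℂ (M.polarized M.amp j) (M.shift (M.mom ξ)))
    (fun j => M.polarized M.amp j) (M.eigenvalue_eq hd ξ)

/-- The coherent states dress the electron. -/
def cloudDressing (hd : 2 ≤ d) : M.system.Dressing M.kineticFactor where
  η := M.cloud
  b := M.energyCloud
  c := M.fieldCloud
  norm_eq := M.norm_cloud
  measurable_η := M.stronglyMeasurable_cloud
  measurable_b := M.measurable_energyCloud
  measurable_c := M.measurable_fieldCloud
  bounded := M.exists_norm_fieldCloud_le
  mem_B := M.energyCloud_mem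
  mem_C := M.fieldCloud_mem
  eigen := M.cloud_eigen hd

/-- The map `ψ ↦ ψ_dr`. -/
def dressedₗ : L2 d ℂ →ₗ[ℂ] L2 d (Fock d) :=
  (ContinuousLinearMap.adjoint M.dressing ∘L tensorL (vacuum d)).toLinearMap

theorem isDressing (hd : 2 ≤ d) : (M.cloudDressing hd).IsDressing M.dressedₗ := M.fourier_dressed

theorem norm_dressed (hd : 2 ≤ d) (ψ : L2 d ℂ) : ‖M.dressed ψ‖ = ‖ψ‖ :=
  (M.isDressing hd).norm_map ψ

theorem freeForm_isClosedSemibounded (hd : 2 ≤ d) :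
    (formOf M.freeHamiltonian).IsClosedSemibounded :=
  (M.system_fiberBound hd).isClosedSemibounded_of_eq M.freeHamiltonian_eq M.kineticFactor_pos
    M.system_dense

theorem freeForm_ge (hd : 2 ≤ d) {X : L2 d (Fock d)}
    (hX : X ∈ (formOf M.freeHamiltonian).domain) : X ∈ (kinForm d (Fock d)).domain ∧
      M.kineticFactor * ((kinForm d (Fock d)).val X X).re ≤
        ((formOf M.freeHamiltonian).val X X).re :=
  (M.system_fiberBound hd).mem_kinForm_domain_of_eq M.freeHamiltonian_eq M.kineticFactor_pos
    M.system_dense hX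

theorem freeForm_dressed (hd : 2 ≤ d) {ψ : L2 d ℂ} (hψ : ψ ∈ (kinForm d ℂ).domain) :
    M.dressed ψ ∈ (formOf M.freeHamiltonian).domain ∧
      ((formOf M.freeHamiltonian).val (M.dressed ψ) (M.dressed ψ)).re =
        M.kineticFactor * ((kinForm d ℂ).val ψ ψ).re :=
  (M.isDressing hd).form_eq_of_eq M.freeHamiltonian_eq M.kineticFactor_pos
    (M.system_fiberBound hd) M.system_dense hψ

end PauliFierzModel
end

noncomputable section

section RealDensity

variable {d : ℕ} {F : Type*} [NormedAddCommGroup F] [InnerProductSpace ℂ F]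

/-- The measure `ρ(x) dx`. -/
def realDensity (ρ : Space d → ℝ) : Measure (Space d) :=
  volume.withDensity fun x => ENNReal.ofReal (ρ x)

variable {ρ : Space d → ℝ}

theorem integral_realDensity {E : Type*} [NormedAddCommGroup E] [NormedSpace ℝ E]
    (hρ : AEMeasurable ρ volume) (h0 : ∀ x, 0 ≤ ρ x) (f : Space d → E) :
    ∫ x, f x ∂(realDensity ρ) = ∫ x, ρ x • f x := by
  rw [realDensity, integral_withDensity_eq_integral_toReal_smul₀ hρ.ennreal_ofReal
    (Eventually.of_forall fun _ => ENNReal.ofReal_lt_top)]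
  simp only [ENNReal.toReal_ofReal (h0 _)]

theorem integrable_realDensity_iff (hρ : AEMeasurable ρ volume) (h0 : ∀ x, 0 ≤ ρ x)
    {f : Space d → ℝ} :
    Integrable f (realDensity ρ) ↔ Integrable (fun x => ρ x * f x) volume := by
  rw [realDensity, integrable_withDensity_iff_integrable_smul₀' hρ.ennreal_ofReal
    (Eventually.of_forall fun _ => ENNReal.ofReal_lt_top)]
  simp only [ENNReal.toReal_ofReal (h0 _), smul_eq_mul]

theorem isFiniteMeasure_realDensity (hρ : Integrable ρ volume) :
    IsFiniteMeasure (realDensity ρ) :=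
  isFiniteMeasure_withDensity_ofReal hρ.2

/-- The position distribution `‖X(x)‖² dx`. -/
def positionMeasure (X : L2 d F) : Measure (Space d) := realDensity fun x => ‖X x‖ ^ 2

theorem aemeasurable_norm_sq (X : L2 d F) : AEMeasurable (fun x => ‖X x‖ ^ 2) volume :=
  (L2.integrable_norm_sq X).aestronglyMeasurable.aemeasurable

instance (X : L2 d F) : IsFiniteMeasure (positionMeasure X) :=
  isFiniteMeasure_realDensity (L2.integrable_norm_sq X)

theorem integral_positionMeasure (X : L2 d F) {E : Type*} [NormedAddCommGroup E] [NormedSpace ℝ E]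
    (f : Space d → E) : ∫ x, f x ∂(positionMeasure X) = ∫ x, ‖X x‖ ^ 2 • f x :=
  integral_realDensity (aemeasurable_norm_sq X) (fun _ => sq_nonneg _) f

theorem integrable_positionMeasure_iff (X : L2 d F) {f : Space d → ℝ} :
    Integrable f (positionMeasure X) ↔ Integrable (fun x => ‖X x‖ ^ 2 * f x) volume :=
  integrable_realDensity_iff (aemeasurable_norm_sq X) (fun _ => sq_nonneg _)

theorem charFun_positionMeasure [CompleteSpace F] (X : L2 d F) (t : Space d) :
    charFun (positionMeasure X) t =
      inner ℂ (𝓕 X : L2 d F) (translateL2 F ((2 * Real.pi)⁻¹ • t) (𝓕 X)) := by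
  have h1 := fourierInv_translateL2 ((2 * Real.pi)⁻¹ • t) (𝓕 X : L2 d F)
  have e1 : (𝓕⁻ (𝓕 X : L2 d F) : L2 d F) = X :=
    (Lp.fourierTransformₗᵢ (Space d) F).symm_apply_apply X
  have e2 : (𝓕 (𝓕⁻ (translateL2 F ((2 * Real.pi)⁻¹ • t) (𝓕 X)) : L2 d F) : L2 d F) =
      translateL2 F ((2 * Real.pi)⁻¹ • t) (𝓕 X) :=
    (Lp.fourierTransformₗᵢ (Space d) F).apply_symm_apply _
  rw [e1] at h1
  rw [← e2, h1, inner_fourier, charFun_apply, integral_positionMeasure, L2.inner_def]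
  refine integral_congr_ae ?_
  filter_upwards [coeFn_mulOp_exp (fun x : Space d =>
    2 * Real.pi * (inner ℝ ((2 * Real.pi)⁻¹ • t) x : ℝ)) (by fun_prop) X] with x hx
  rw [hx, inner_smul_right, inner_self_eq_norm_sq_to_K, real_inner_smul_left,
    mul_inv_cancel_left₀ Real.two_pi_pos.ne', real_inner_comm, Complex.real_smul, mul_comm]
  simp

end RealDensity

section Gaussian

variable {d : ℕ} {a : ℝ}

/-- The density of the centered normal distribution with characteristic function
`exp (-a ‖t‖²)`. -/
def gaussianDensity (d : ℕ) (a : ℝ) (y : Space d) : ℝ :=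
  1 / (4 * Real.pi * a) ^ ((d : ℝ) / 2) * Real.exp (-‖y‖ ^ 2 / (4 * a))

theorem continuous_gaussianDensity : Continuous (gaussianDensity d a) := by
  unfold gaussianDensity
  fun_prop

theorem gaussianDensity_nonneg (ha : 0 < a) (y : Space d) : 0 ≤ gaussianDensity d a y := by
  unfold gaussianDensity
  positivity

theorem integral_gaussianDensity_mul_cexp (ha : 0 < a) (t : Space d) :
    ∫ y, gaussianDensity d a y • Complex.exp ((inner ℝ y t : ℝ) * Complex.I) =
      ((Real.exp (-(a * ‖t‖ ^ 2)) : ℝ) : ℂ) := by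
  have hb : 0 < (((4 * a)⁻¹ : ℝ) : ℂ).re := by
    rw [Complex.ofReal_re]
    positivity
  have h := GaussianFourier.integral_cexp_neg_mul_sq_norm_add hb Complex.I t
  have e : ∀ y : Space d, gaussianDensity d a y • Complex.exp ((inner ℝ y t : ℝ) * Complex.I) =
      ((1 / (4 * Real.pi * a) ^ ((d : ℝ) / 2) : ℝ) : ℂ) *
        Complex.exp (-(((4 * a)⁻¹ : ℝ) : ℂ) * ‖y‖ ^ 2 + Complex.I * (inner ℝ t y : ℝ)) := by
    intro y
    rw [gaussianDensity, Complex.real_smul, Complex.ofReal_mul, Complex.ofReal_exp, mul_assoc,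
      ← Complex.exp_add, real_inner_comm t y]
    congr 2
    push_cast
    rw [div_eq_mul_inv, mul_comm Complex.I]
    ring
  simp only [e]
  rw [integral_const_mul, h, finrank_euclideanSpace_fin]
  have e2 : ((Real.pi : ℂ) / (((4 * a)⁻¹ : ℝ) : ℂ)) ^ ((d : ℂ) / 2) =
      (((4 * Real.pi * a) ^ ((d : ℝ) / 2) : ℝ) : ℂ) := by
    rw [Complex.ofReal_cpow (by positivity)]
    push_cast
    congr 1
    rw [div_inv_eq_mul]
    ring
  rw [e2, ← mul_assoc, ← Complex.ofReal_mul, one_div, inv_mul_cancel₀ (by positivity),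
    Complex.ofReal_one, one_mul, Complex.ofReal_exp]
  congr 1
  rw [Complex.I_sq]
  have : (a : ℂ) ≠ 0 := Complex.ofReal_ne_zero.2 ha.ne'
  push_cast
  field_simp

theorem integrable_gaussianDensity (ha : 0 < a) :
    Integrable (gaussianDensity d a) volume := by
  have h := integral_gaussianDensity_mul_cexp (d := d) ha 0
  have h1 : Integrable (fun y : Space d =>
      gaussianDensity d a y • Complex.exp ((inner ℝ y (0 : Space d) : ℝ) * Complex.I)) volume := by
    by_contra h2
    rw [integral_undef h2] at h
    simp at h
  simpa [Complex.norm_real, abs_of_nonneg (gaussianDensity_nonneg ha _)] using h1.norm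

theorem integral_gaussianDensity (ha : 0 < a) : ∫ y, gaussianDensity d a y = 1 := by
  have h := integral_gaussianDensity_mul_cexp (d := d) ha 0
  simp only [inner_zero_right, Complex.ofReal_zero, zero_mul, Complex.exp_zero,
    Complex.real_smul, mul_one, integral_complex_ofReal] at h
  simpa using h

/-- The centered normal distribution with characteristic function `exp (-a ‖t‖²)`. -/
def gaussianMeasure (d : ℕ) (a : ℝ) : Measure (Space d) := realDensity (gaussianDensity d a)

theorem integral_gaussianMeasure (ha : 0 < a) {E : Type*} [NormedAddCommGroup E] [NormedSpace ℝ E]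
    (f : Space d → E) : ∫ y, f y ∂(gaussianMeasure d a) = ∫ y, gaussianDensity d a y • f y :=
  integral_realDensity continuous_gaussianDensity.measurable.aemeasurable
    (gaussianDensity_nonneg ha) f

theorem charFun_gaussianMeasure (ha : 0 < a) (t : Space d) :
    charFun (gaussianMeasure d a) t = ((Real.exp (-(a * ‖t‖ ^ 2)) : ℝ) : ℂ) := by
  rw [charFun_apply, integral_gaussianMeasure ha, integral_gaussianDensity_mul_cexp ha]

theorem isFiniteMeasure_gaussianMeasure (ha : 0 < a) : IsFiniteMeasure (gaussianMeasure d a) :=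
  isFiniteMeasure_realDensity (integrable_gaussianDensity ha)

theorem positionMeasure_eq_conv {F : Type*} [NormedAddCommGroup F] [InnerProductSpace ℂ F]
    [CompleteSpace F] (ha : 0 < a) {η : Space d → F}
    (hη : ∀ ξ ξ', inner ℂ (η ξ) (η ξ') =
      ((Real.exp (-(a * (2 * Real.pi) ^ 2 * ‖ξ - ξ'‖ ^ 2)) : ℝ) : ℂ)) {X : L2 d F} {ψ : L2 d ℂ}
    (h : ⇑(𝓕 X : L2 d F) =ᵐ[volume] fun ξ => (𝓕 ψ : L2 d ℂ) ξ • η ξ) :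
    positionMeasure X = positionMeasure ψ ∗ gaussianMeasure d a := by
  have := isFiniteMeasure_gaussianMeasure (d := d) ha
  refine Measure.ext_of_charFun (funext fun t => ?_)
  rw [charFun_conv, charFun_gaussianMeasure ha, charFun_positionMeasure, charFun_positionMeasure,
    L2.inner_def, L2.inner_def, ← integral_mul_const]
  have hsub := (measurePreserving_sub_right (volume : Measure (Space d))
    ((2 * Real.pi)⁻¹ • t)).quasiMeasurePreserving.ae h
  refine integral_congr_ae ?_
  filter_upwards [h, hsub, coeFn_translateL2 ((2 * Real.pi)⁻¹ • t) (𝓕 X : L2 d F),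
    coeFn_translateL2 ((2 * Real.pi)⁻¹ • t) (𝓕 ψ : L2 d ℂ)] with ξ h1 h2 h3 h4
  have e : a * (2 * Real.pi) ^ 2 * ‖ξ - (ξ - (2 * Real.pi)⁻¹ • t)‖ ^ 2 = a * ‖t‖ ^ 2 := by
    rw [sub_sub_cancel, norm_smul, norm_inv, Real.norm_of_nonneg Real.two_pi_pos.le]
    field_simp
  rw [h3, h4, h1, h2, inner_smul_left, inner_smul_right, hη, e, RCLike.inner_apply]
  ring

end Gaussian
end

noncomputable section

section GaussianTail

variable {d : ℕ} {V : Space d → ℝ}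

/-- `V` is integrable against all normal distributions. -/
def GaussianIntegrable (V : Space d → ℝ) : Prop :=
  ∀ t : ℝ, 0 < t → Integrable (fun x => V x * Real.exp (-t * ‖x‖ ^ 2)) volume

theorem GaussianIntegrable.abs (h : GaussianIntegrable V) :
    GaussianIntegrable fun x => |V x| := by
  intro t ht
  refine (h t ht).abs.congr (Eventually.of_forall fun x => ?_)
  simp only [abs_mul, Real.abs_exp]

theorem exp_neg_norm_sub_sq_le {a : ℝ} (ha : 0 < a) (x y : Space d) :
    Real.exp (-‖x - y‖ ^ 2 / (4 * a)) ≤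
      Real.exp (‖x‖ ^ 2 / (4 * a)) * Real.exp (-(8 * a)⁻¹ * ‖y‖ ^ 2) := by
  rw [← Real.exp_add, Real.exp_le_exp]
  have h1 : ‖y‖ ≤ ‖x‖ + ‖x - y‖ := by
    have := norm_sub_le x (x - y)
    rwa [sub_sub_cancel] at this
  have h2 : ‖y‖ ^ 2 ≤ 2 * ‖x‖ ^ 2 + 2 * ‖x - y‖ ^ 2 := by
    have := pow_le_pow_left₀ (norm_nonneg y) h1 2
    nlinarith [sq_nonneg (‖x‖ - ‖x - y‖)]
  have e : ‖x‖ ^ 2 / (4 * a) + -(8 * a)⁻¹ * ‖y‖ ^ 2 - -‖x - y‖ ^ 2 / (4 * a) =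
      (8 * a)⁻¹ * (2 * ‖x‖ ^ 2 + 2 * ‖x - y‖ ^ 2 - ‖y‖ ^ 2) := by
    field_simp
    ring
  have : 0 ≤ (8 * a)⁻¹ * (2 * ‖x‖ ^ 2 + 2 * ‖x - y‖ ^ 2 - ‖y‖ ^ 2) :=
    mul_nonneg (by positivity) (by linarith)
  linarith

theorem norm_mul_exp_le {a : ℝ} (ha : 0 < a) (x y : Space d) :
    ‖V y * Real.exp (-‖x - y‖ ^ 2 / (4 * a))‖ ≤
      Real.exp (‖x‖ ^ 2 / (4 * a)) * ‖V y * Real.exp (-(8 * a)⁻¹ * ‖y‖ ^ 2)‖ := by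
  rw [norm_mul, norm_mul, Real.norm_of_nonneg (Real.exp_nonneg _),
    Real.norm_of_nonneg (Real.exp_nonneg _), mul_left_comm]
  exact mul_le_mul_of_nonneg_left (exp_neg_norm_sub_sq_le ha x y) (norm_nonneg _)

theorem GaussianIntegrable.integrable_sub (h : GaussianIntegrable V) (hV : Measurable V) {a : ℝ}
    (ha : 0 < a) (x : Space d) :
    Integrable (fun y => V y * Real.exp (-‖x - y‖ ^ 2 / (4 * a))) volume := by
  refine ((h (8 * a)⁻¹ (by positivity)).norm.const_mul (Real.exp (‖x‖ ^ 2 / (4 * a)))).mono' ?_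
    (Eventually.of_forall fun y => norm_mul_exp_le ha x y)
  exact (hV.mul (by fun_prop)).aestronglyMeasurable

theorem GaussianIntegrable.integrable_add (h : GaussianIntegrable V) (hV : Measurable V) {a : ℝ}
    (ha : 0 < a) (x : Space d) : Integrable (fun y => V (x + y)) (gaussianMeasure d a) := by
  rw [gaussianMeasure, integrable_realDensity_iff
    continuous_gaussianDensity.measurable.aemeasurable (gaussianDensity_nonneg ha)]
  have h1 := ((h.integrable_sub hV ha x).comp_add_left x).const_mul
    (1 / (4 * Real.pi * a) ^ ((d : ℝ) / 2))
  refine h1.congr (Eventually.of_forall fun y => ?_)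
  simp only [gaussianDensity, sub_add_cancel_left, norm_neg]
  ring

theorem GaussianIntegrable.locallyIntegrable (h : GaussianIntegrable V) :
    LocallyIntegrable V volume := by
  have h1 := (h 1 one_pos).locallyIntegrable
  have h2 : Continuous fun x : Space d => Real.exp (‖x‖ ^ 2) := by fun_prop
  rw [← locallyIntegrableOn_univ] at h1 ⊢
  have h3 := h1.continuousOn_mul h2.continuousOn isOpen_univ.isLocallyClosed
  refine h3.congr (Eventually.of_forall fun x => ?_)
  rw [mul_left_comm, ← Real.exp_add]
  simp

end GaussianTail

namespace PauliFierzModel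

variable {d : ℕ} (M : PauliFierzModel d) {V : Space d → ℝ}

theorem effectivePotential_eq (hd : 2 ≤ d) (V : Space d → ℝ) (x : Space d) :
    M.effectivePotential V x = ∫ y, V (x + y) ∂(gaussianMeasure d M.a) := by
  rw [integral_gaussianMeasure (M.a_pos hd), effectivePotential, ← integral_const_mul,
    ← integral_add_left_eq_self _ x]
  refine integral_congr_ae (Eventually.of_forall fun y => ?_)
  simp only [gaussianDensity, sub_add_cancel_left, norm_neg, smul_eq_mul]
  ring

theorem measurable_effectivePotential (hV : Measurable V) : Measurable (M.effectivePotential V) := by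
  unfold effectivePotential
  refine Measurable.const_mul ?_ _
  have h : StronglyMeasurable fun p : Space d × Space d =>
      V p.2 * Real.exp (-‖p.1 - p.2‖ ^ 2 / (4 * M.a)) :=
    ((hV.comp measurable_snd).mul (by fun_prop)).stronglyMeasurable
  exact h.integral_prod_right'.measurable

theorem abs_effectivePotential_le (hd : 2 ≤ d) (V : Space d → ℝ) (x : Space d) :
    |M.effectivePotential V x| ≤ M.effectivePotential (fun y => |V y|) x := by
  rw [effectivePotential_eq M hd, effectivePotential_eq M hd]
  exact norm_integral_le_integral_norm (μ := gaussianMeasure d M.a) fun y => V (x + y)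

theorem effectivePotential_abs_nonneg (hd : 2 ≤ d) (V : Space d → ℝ) (x : Space d) :
    0 ≤ M.effectivePotential (fun y => |V y|) x :=
  (abs_nonneg _).trans (M.abs_effectivePotential_le hd V x)

theorem integral_gaussianMeasure_const (hd : 2 ≤ d) (c : ℝ) :
    ∫ _, c ∂(gaussianMeasure d M.a) = c := by
  rw [integral_gaussianMeasure (M.a_pos hd)]
  simp only [smul_eq_mul]
  rw [integral_mul_const, integral_gaussianDensity (M.a_pos hd), one_mul]

theorem effectivePotential_le_add (hd : 2 ≤ d) {W : Space d → ℝ} (hV : Measurable V)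
    (hV2 : GaussianIntegrable V) (hW : Measurable W) (hW2 : GaussianIntegrable W) {c : ℝ}
    (h : ∀ x, V x ≤ W x + c) (x : Space d) :
    M.effectivePotential V x ≤ M.effectivePotential W x + c := by
  have := isFiniteMeasure_gaussianMeasure (d := d) (M.a_pos hd)
  rw [effectivePotential_eq M hd, effectivePotential_eq M hd,
    ← M.integral_gaussianMeasure_const hd c,
    ← integral_add (hW2.integrable_add hW (M.a_pos hd) x) (integrable_const c)]
  exact integral_mono (hV2.integrable_add hV (M.a_pos hd) x)
    ((hW2.integrable_add hW (M.a_pos hd) x).add (integrable_const c)) fun y => h _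

theorem le_effectivePotential (hd : 2 ≤ d) (hV : Measurable V) (hV2 : GaussianIntegrable V) {c : ℝ}
    (h : ∀ x, c ≤ V x) (x : Space d) : c ≤ M.effectivePotential V x := by
  have := isFiniteMeasure_gaussianMeasure (d := d) (M.a_pos hd)
  rw [effectivePotential_eq M hd, ← M.integral_gaussianMeasure_const hd c]
  exact integral_mono (integrable_const c) (hV2.integrable_add hV (M.a_pos hd) x) fun y => h _

theorem locallyIntegrable_effectivePotential (hd : 2 ≤ d) (hV : Measurable V)
    (hV2 : GaussianIntegrable V) : LocallyIntegrable (M.effectivePotential V) volume := by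
  have ha := M.a_pos hd
  let C := 1 / (4 * Real.pi * M.a) ^ ((d : ℝ) / 2) *
    ∫ y, ‖V y * Real.exp (-(8 * M.a)⁻¹ * ‖y‖ ^ 2)‖
  have hc : Continuous fun x : Space d => C * Real.exp (‖x‖ ^ 2 / (4 * M.a)) := by fun_prop
  refine hc.locallyIntegrable.mono (M.measurable_effectivePotential hV).aestronglyMeasurable
    (Eventually.of_forall fun x => le_trans ?_ (le_abs_self _))
  have h1 : ‖∫ y, V y * Real.exp (-‖x - y‖ ^ 2 / (4 * M.a))‖ ≤
      Real.exp (‖x‖ ^ 2 / (4 * M.a)) * ∫ y, ‖V y * Real.exp (-(8 * M.a)⁻¹ * ‖y‖ ^ 2)‖ := by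
    rw [← integral_const_mul]
    exact norm_integral_le_of_norm_le ((hV2 (8 * M.a)⁻¹ (by positivity)).norm.const_mul _)
      (Eventually.of_forall fun y => norm_mul_exp_le ha x y)
  rw [effectivePotential, norm_mul, Real.norm_of_nonneg (by positivity)]
  refine (mul_le_mul_of_nonneg_left h1 (by positivity)).trans_eq ?_
  simp only [C]
  ring

theorem positionMeasure_dressed (hd : 2 ≤ d) (ψ : L2 d ℂ) :
    positionMeasure (M.dressed ψ) = positionMeasure ψ ∗ gaussianMeasure d M.a := by
  refine positionMeasure_eq_conv (M.a_pos hd) (fun ξ ξ' => ?_) (M.fourier_dressed ψ)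
  refine (M.inner_coherent_shift hd (M.mom ξ) (M.mom ξ')).trans ?_
  congr 3
  have := M.hbar_pos.ne'
  rw [mom, mom, ← smul_sub, norm_smul, mul_pow, Real.norm_eq_abs, sq_abs]
  field_simp

theorem integrable_conv_iff_effectivePotential (hd : 2 ≤ d) (hV : Measurable V)
    (hV2 : GaussianIntegrable V) (ψ : L2 d ℂ) :
    Integrable V (positionMeasure ψ ∗ gaussianMeasure d M.a) ↔
      Integrable (M.effectivePotential fun x => |V x|) (positionMeasure ψ) := by
  have := isFiniteMeasure_gaussianMeasure (d := d) (M.a_pos hd)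
  rw [integrable_conv_iff hV.aestronglyMeasurable]
  simp only [hV2.integrable_add hV (M.a_pos hd), Real.norm_eq_abs,
    ← M.effectivePotential_eq hd (fun x => |V x|), eventually_true, true_and]

theorem integral_conv_eq_effectivePotential (hd : 2 ≤ d) {ψ : L2 d ℂ}
    (h : Integrable V (positionMeasure ψ ∗ gaussianMeasure d M.a)) :
    ∫ x, V x ∂(positionMeasure ψ ∗ gaussianMeasure d M.a) =
      ∫ x, M.effectivePotential V x ∂(positionMeasure ψ) := by
  have := isFiniteMeasure_gaussianMeasure (d := d) (M.a_pos hd)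
  rw [integral_conv h]
  simp only [M.effectivePotential_eq hd V]

theorem integrable_dressed_iff (hd : 2 ≤ d) (hV : Measurable V) (hV2 : GaussianIntegrable V)
    (ψ : L2 d ℂ) : Integrable (fun x => ‖M.dressed ψ x‖ ^ 2 * V x) volume ↔
      Integrable (fun x => ‖ψ x‖ ^ 2 * M.effectivePotential (fun x => |V x|) x) volume := by
  rw [← integrable_positionMeasure_iff, M.positionMeasure_dressed hd,
    M.integrable_conv_iff_effectivePotential hd hV hV2, integrable_positionMeasure_iff]

theorem integral_dressed (hd : 2 ≤ d) {ψ : L2 d ℂ}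
    (h : Integrable (fun x => ‖M.dressed ψ x‖ ^ 2 * V x) volume) :
    ∫ x, ‖M.dressed ψ x‖ ^ 2 * V x = ∫ x, ‖ψ x‖ ^ 2 * M.effectivePotential V x := by
  have h1 := (integrable_positionMeasure_iff (M.dressed ψ)).2 h
  rw [M.positionMeasure_dressed hd] at h1
  have h2 := M.integral_conv_eq_effectivePotential hd h1
  rw [← M.positionMeasure_dressed hd, integral_positionMeasure] at h2
  exact h2.trans (integral_positionMeasure ψ _)

end PauliFierzModel
end

noncomputable section

section FormDomainOfOperator

variable {H : Type*} [NormedAddCommGroup H] [InnerProductSpace ℂ H]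

theorem domain_le_formDomain {A : H →ₗ.[ℂ] H} (hA : IsSemibounded A) :
    A.domain ≤ formDomain A := by
  intro ψ hψ
  refine (QForm.mem_formDomain hA ψ).2 ⟨fun _ => ⟨ψ, hψ⟩, tendsto_const_nhds, ?_⟩
  simp

end FormDomainOfOperator

section TestFunctions

variable {d : ℕ}

theorem HasSymbol.toLp_mem_domain {A : L2 d ℂ →ₗ.[ℂ] L2 d ℂ} {a : Space d → ℝ}
    (hA : HasSymbol A a) (ha : Function.HasTemperateGrowth fun ξ => (a ξ : ℂ)) (f : 𝓢(Space d, ℂ)) :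
    (f.toLp 2 : L2 d ℂ) ∈ A.domain := by
  let g : 𝓢(Space d, ℂ) := SchwartzMap.smulLeftCLM ℂ (fun ξ => (a ξ : ℂ)) (𝓕 f)
  have hg : 𝓕 ((𝓕⁻ g : 𝓢(Space d, ℂ)).toLp 2 : L2 d ℂ) = g.toLp 2 := by
    rw [SchwartzMap.toLp_fourier_eq, FourierTransform.fourier_fourierInv_eq]
  refine LinearPMap.mem_domain_iff.2 ⟨(𝓕⁻ g : 𝓢(Space d, ℂ)).toLp 2, (hA _).2 ?_⟩
  simp only [hg, SchwartzMap.toLp_fourier_eq]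
  filter_upwards [g.coeFn_toLp 2, (𝓕 f : 𝓢(Space d, ℂ)).coeFn_toLp 2] with ξ h1 h2
  rw [h1, h2, SchwartzMap.smulLeftCLM_apply_apply ha, smul_eq_mul]

theorem toLp_mem_smoothDomain (hbar : ℝ) (f : 𝓢(Space d, ℂ)) :
    (f.toLp 2 : L2 d ℂ) ∈ smoothDomain d hbar := by
  refine ⟨hasSymbol_laplacianOp.toLp_mem_domain ?_ f, (Submodule.mem_iInf _).2 fun j =>
    (hasSymbol_momentum hbar j).toLp_mem_domain ?_ f⟩
  · fun_prop
  · have h := hasTemperateGrowth_const_smul (hasTemperateGrowth_coord (d := d) j)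
      ((2 * Real.pi * hbar : ℝ) : ℂ)
    have e : (fun ξ : Space d => ((2 * Real.pi * hbar * ξ j : ℝ) : ℂ)) =
        ((2 * Real.pi * hbar : ℝ) : ℂ) • fun ξ : Space d => ((ξ j : ℝ) : ℂ) := by
      ext ξ
      simp
    exact e ▸ h

theorem smoothDomain_le_kinForm_domain (hbar : ℝ) :
    smoothDomain d hbar ≤ (kinForm d ℂ).domain := by
  intro ψ hψ
  obtain ⟨χ, hχ⟩ := LinearPMap.mem_domain_iff.1 hψ.1
  have h := (hasSymbol_laplacianOp _).1 hχ
  rw [mem_kinForm_domain]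
  refine ((L2.integrable_norm_sq (𝓕 χ : L2 d ℂ)).add (L2.integrable_norm_sq (𝓕 ψ : L2 d ℂ))).mono'
    (measurable_laplaceSymbol.aestronglyMeasurable.mul
      (L2.integrable_norm_sq (𝓕 ψ : L2 d ℂ)).aestronglyMeasurable) ?_
  filter_upwards [h] with ξ hξ
  have e : ‖(𝓕 χ : L2 d ℂ) ξ‖ = laplaceSymbol d ξ * ‖(𝓕 ψ : L2 d ℂ) ξ‖ := by
    rw [hξ, norm_mul, Complex.norm_real, norm_neg]
    exact congrArg (· * _) (Real.norm_of_nonneg (laplaceSymbol_nonneg ξ))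
  rw [Pi.add_apply, e, Real.norm_of_nonneg (mul_nonneg (laplaceSymbol_nonneg ξ) (sq_nonneg _))]
  nlinarith [sq_nonneg (laplaceSymbol d ξ * ‖(𝓕 ψ : L2 d ℂ) ξ‖ - ‖(𝓕 ψ : L2 d ℂ) ξ‖),
    sq_nonneg (laplaceSymbol d ξ * ‖(𝓕 ψ : L2 d ℂ) ξ‖), sq_nonneg ‖(𝓕 ψ : L2 d ℂ) ξ‖]

variable {V : Space d → ℝ}

theorem dense_smoothDomain_inf_mulForm_domain (hbar : ℝ) (hV : Measurable V)
    (hloc : LocallyIntegrable V volume) :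
    Dense ((smoothDomain d hbar ⊓ (mulForm ℂ V).domain : Submodule ℂ (L2 d ℂ)) :
      Set (L2 d ℂ)) := by
  refine (Lp.dense_hasCompactSupport_contDiff (p := 2) (by simp)).mono ?_
  rintro ψ ⟨g, hg, hc, hs⟩
  have e : ψ = (hc.toSchwartzMap hs).toLp 2 :=
    Lp.ext (hg.trans ((hc.toSchwartzMap hs).coeFn_toLp 2).symm)
  refine ⟨e ▸ toLp_mem_smoothDomain hbar _, (mem_mulForm_domain_iff_integrable hV).2 ?_⟩
  have hl : LocallyIntegrable (fun x => |V x|) volume := fun x => (hloc x).norm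
  have hi := hl.integrable_smul_right_of_hasCompactSupport (g := fun x => ‖g x‖ ^ 2)
    (by have := hs.continuous; fun_prop) (hc.norm.comp_left (g := fun r : ℝ => r ^ 2) (by simp))
  refine hi.congr ?_
  filter_upwards [hg] with x hx
  rw [hx, smul_eq_mul]

theorem dense_kinForm_domain_inf_mulForm_domain (hV : Measurable V)
    (hloc : LocallyIntegrable V volume) :
    Dense (((kinForm d ℂ).domain ⊓ (mulForm ℂ V).domain : Submodule ℂ (L2 d ℂ)) :
      Set (L2 d ℂ)) :=
  (dense_smoothDomain_inf_mulForm_domain 1 hV hloc).mono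
    (inf_le_inf_right _ (smoothDomain_le_kinForm_domain 1))

variable {F : Type*} [NormedAddCommGroup F] [InnerProductSpace ℂ F]

theorem tensor_mem_mulForm_domain (hV : Measurable V) {ψ : L2 d ℂ}
    (hψ : ψ ∈ (mulForm ℂ V).domain) (Φ : F) : tensor ψ Φ ∈ (mulForm F V).domain := by
  rw [mem_mulForm_domain_iff_integrable hV] at hψ ⊢
  refine (hψ.mul_const (‖Φ‖ ^ 2)).congr ?_
  filter_upwards [coeFn_tensor ψ Φ] with x hx
  rw [hx, norm_smul]
  ring

theorem DipoleSystem.FiberBound.dense_formDomain_inf_mulForm_domain [CompleteSpace F]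
    {S : DipoleSystem d F} {κ : ℝ}
    (h : S.FiberBound κ) (hκ : 0 < κ) {A : L2 d F →ₗ.[ℂ] L2 d F} (hA : A = S.hamiltonian)
    {D : Submodule ℂ F} (hD : Dense (D : Set F)) (hB : D ≤ S.B.domain)
    (hC : ∀ j, D ≤ (S.C j).domain) (hV : Measurable V) (hloc : LocallyIntegrable V volume) :
    Dense (((formOf A).domain ⊓ (mulForm F V).domain : Submodule ℂ (L2 d F)) : Set (L2 d F)) := by
  subst hA
  refine (dense_tensorSpan (dense_smoothDomain_inf_mulForm_domain S.hbar hV hloc) hD).mono ?_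
  refine Submodule.span_le.2 ?_
  rintro _ ⟨ψ, hψ, Φ, hΦ, rfl⟩
  exact ⟨domain_le_formDomain (h.isSemibounded hκ)
    (S.tensor_mem_domain hψ.1 (hB hΦ) fun j => hC j hΦ), tensor_mem_mulForm_domain hV hψ.2 Φ⟩

end TestFunctions

theorem PauliFierzModel.dense_freeForm_inf_mulForm_domain {d : ℕ} (M : PauliFierzModel d)
    (hd : 2 ≤ d) {V : Space d → ℝ} (hV : Measurable V) (hloc : LocallyIntegrable V volume) :
    Dense (((formOf M.freeHamiltonian).domain ⊓ (mulForm (Fock d) V).domain :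
      Submodule ℂ (L2 d (Fock d))) : Set (L2 d (Fock d))) :=
  (M.system_fiberBound hd).dense_formDomain_inf_mulForm_domain M.kineticFactor_pos
    M.freeHamiltonian_eq (dense_secondQuantizationCore M.measurable_energy) (fun _ h => h.2)
    (fun j Φ h => LinearPMap.mem_domain_iff.2
      ⟨_, (segalField_isEntireCore (M.memLp_g j)).mem_graph ⟨Φ, h.1⟩⟩) hV hloc

end

noncomputable section

theorem QForm.IsClosedSemibounded.of_eq_mul {H : Type*} [NormedAddCommGroup H]
    [InnerProductSpace ℂ H] {s t : QForm H} (hs : s.IsClosedSemibounded) {c : ℝ} (hc : 0 < c)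
    (hd : t.domain = s.domain)
    (hv : ∀ φ ∈ s.domain, ∀ ψ ∈ s.domain, t.val φ ψ = c * s.val φ ψ) :
    t.IsClosedSemibounded := by
  obtain ⟨⟨h1, h2, h3⟩, h4, ⟨b, h5⟩, h6⟩ := hs
  have hre : ∀ ψ ∈ s.domain, (t.val ψ ψ).re = c * (s.val ψ ψ).re := fun ψ hψ => by
    rw [hv ψ hψ ψ hψ, Complex.re_ofReal_mul]
  refine ⟨⟨?_, ?_, ?_⟩, hd ▸ h4, ⟨c * b, ?_⟩, ?_⟩
  · rw [hd]
    intro φ hφ ψ hψ χ hχ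
    rw [hv _ hφ _ (add_mem hψ hχ), hv _ hφ _ hψ, hv _ hφ _ hχ, h1 _ hφ _ hψ _ hχ, mul_add]
  · rw [hd]
    intro a φ hφ ψ hψ
    rw [hv _ hφ _ (s.domain.smul_mem a hψ), hv _ hφ _ hψ, h2 _ _ hφ _ hψ, mul_left_comm]
  · rw [hd]
    intro φ hφ ψ hψ
    rw [hv _ hφ _ hψ, hv _ hψ _ hφ, h3 _ hφ _ hψ, map_mul, Complex.conj_ofReal]
  · rw [hd]
    intro ψ hψ
    rw [hre ψ hψ, mul_assoc]
    exact mul_le_mul_of_nonneg_left (h5 ψ hψ) hc.le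
  · intro u ψ hu hlim hcauchy
    rw [hd] at hu ⊢
    have h : Tendsto (fun p : ℕ × ℕ => (s.val (u p.1 - u p.2) (u p.1 - u p.2)).re) atTop (𝓝 0) := by
      have := hcauchy.const_mul c⁻¹
      rw [mul_zero] at this
      refine this.congr fun p => ?_
      rw [hre _ (sub_mem (hu _) (hu _)), inv_mul_cancel_left₀ hc.ne']
    obtain ⟨h7, h8⟩ := h6 u ψ hu hlim h
    refine ⟨h7, ?_⟩
    have h9 := h8.const_mul c
    rw [mul_zero] at h9
    exact h9.congr fun n => (hre _ (sub_mem (hu n) h7)).symm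

theorem formOf_smul_laplacian_isClosedSemibounded {d : ℕ} {c : ℝ} (hc : 0 < c) :
    (formOf ((-(c : ℂ)) • laplacianOp d)).IsClosedSemibounded :=
  (kinForm_isClosedSemibounded (d := d) (F := ℂ)).of_eq_mul hc (formOf_smul_laplacian hc).1
    (formOf_smul_laplacian hc).2

section Comparison

variable {d : ℕ} {V W : Space d → ℝ}

theorem mulForm_domain_mono {F : Type*} [NormedAddCommGroup F] [InnerProductSpace ℂ F]
    (hV : Measurable V) (hW : Measurable W) {c : ℝ} (h : ∀ x, |V x| ≤ |W x| + c) :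
    (mulForm F W).domain ≤ (mulForm F V).domain := by
  intro X hX
  rw [mem_mulForm_domain_iff_integrable hW] at hX
  rw [mem_mulForm_domain_iff_integrable hV]
  refine (hX.add ((L2.integrable_norm_sq X).const_mul c)).mono' (hV.abs.aestronglyMeasurable.mul
    (L2.integrable_norm_sq X).aestronglyMeasurable) (Eventually.of_forall fun x => ?_)
  rw [Real.norm_of_nonneg (by positivity), Pi.add_apply, ← add_mul]
  exact mul_le_mul_of_nonneg_right (h x) (sq_nonneg _)

theorem InfinitesimallyFormBounded.mono (h : InfinitesimallyFormBounded W) (hV : Measurable V)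
    (hW : Measurable W) (hVW : ∀ x, |V x| ≤ |W x|) : InfinitesimallyFormBounded V := by
  have hle : (mulForm ℂ W).domain ≤ (mulForm ℂ V).domain :=
    mulForm_domain_mono (c := 0) hV hW (by simpa using hVW)
  refine ⟨h.1.trans hle, fun α hα => ?_⟩
  obtain ⟨β, hβ, hb⟩ := h.2 α hα
  refine ⟨β, hβ, fun ψ hψ => le_trans ?_ (hb ψ hψ)⟩
  exact integral_mono ((mem_mulForm_domain_iff_integrable hV).1 (hle (h.1 hψ)))
    ((mem_mulForm_domain_iff_integrable hW).1 (h.1 hψ)) fun x =>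
      mul_le_mul_of_nonneg_right (hVW x) (sq_nonneg _)

theorem integrable_norm_sq_mul_iff {F : Type*} [NormedAddCommGroup F] [InnerProductSpace ℂ F]
    (hV : Measurable V) (X : L2 d F) :
    Integrable (fun x => ‖X x‖ ^ 2 * V x) volume ↔ X ∈ (mulForm F V).domain := by
  have hm : AEStronglyMeasurable (fun x => ‖X x‖ ^ 2 * V x) volume :=
    (L2.integrable_norm_sq X).aestronglyMeasurable.mul hV.aestronglyMeasurable
  rw [mem_mulForm_domain_iff_integrable hV, ← integrable_norm_iff hm]
  simp only [norm_mul, norm_pow, Real.norm_eq_abs, abs_norm, mul_comm]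

end Comparison

namespace PauliFierzModel

variable {d : ℕ} (M : PauliFierzModel d) {V : Space d → ℝ}

theorem dressed_mem_mulForm_domain_iff (hd : 2 ≤ d) (hV : Measurable V)
    (hV2 : GaussianIntegrable V) (ψ : L2 d ℂ) : M.dressed ψ ∈ (mulForm (Fock d) V).domain ↔
      ψ ∈ (mulForm ℂ (M.effectivePotential fun x => |V x|)).domain :=
  (integrable_norm_sq_mul_iff hV (M.dressed ψ)).symm.trans
    ((M.integrable_dressed_iff hd hV hV2 ψ).trans
      (integrable_norm_sq_mul_iff (M.measurable_effectivePotential hV.abs) ψ))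

theorem re_kinForm_dressed (ψ : L2 d ℂ) :
    ((kinForm d (Fock d)).val (M.dressed ψ) (M.dressed ψ)).re = ((kinForm d ℂ).val ψ ψ).re := by
  rw [re_kinForm_val, re_kinForm_val]
  refine integral_congr_ae ?_
  filter_upwards [M.fourier_dressed ψ] with ξ hξ
  rw [hξ, norm_smul, M.norm_cloud, mul_one]

theorem infinitesimallyFormBounded_effectivePotential_abs (hd : 2 ≤ d) (hV : Measurable V)
    (hV2 : GaussianIntegrable V) (h : InfinitesimallyFormBounded V) :
    InfinitesimallyFormBounded (M.effectivePotential fun x => |V x|) := by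
  have hkin : ∀ ψ ∈ (kineticForm d).domain, M.dressed ψ ∈ (kinForm d (Fock d)).domain :=
    fun ψ hψ => (M.freeForm_ge hd (M.freeForm_dressed hd (kineticForm_eq.1 ▸ hψ)).1).1
  refine ⟨fun ψ hψ => ?_, fun α hα => ?_⟩
  · obtain ⟨β, -, hb⟩ := h.vector (F := Fock d) hV one_pos
    exact (M.dressed_mem_mulForm_domain_iff hd hV hV2 ψ).1 (hb _ (hkin ψ hψ)).1
  · obtain ⟨β, hβ, hb⟩ := h.vector (F := Fock d) hV hα
    refine ⟨β, hβ, fun ψ hψ => ?_⟩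
    have hψ' : ψ ∈ (kinForm d ℂ).domain := kineticForm_eq.1 ▸ hψ
    obtain ⟨hm, hle⟩ := hb _ (hkin ψ hψ)
    have h1 := (integrable_norm_sq_mul_iff hV.abs (M.dressed ψ)).2
      (mulForm_domain_mono (c := 0) hV.abs hV (by simp) hm)
    have h2 := M.integral_dressed hd h1
    rw [M.re_kinForm_dressed, M.norm_dressed hd] at hle
    rw [kineticForm_eq.2 ψ hψ' ψ hψ']
    refine le_trans (le_of_eq ?_) hle
    simp only [abs_of_nonneg (M.effectivePotential_abs_nonneg hd V _),
      mul_comm _ (‖(_ : ℂ)‖ ^ 2), mul_comm _ (‖(_ : Fock d)‖ ^ 2)]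
    exact h2.symm

theorem infinitesimallyFormBounded_effectivePotential (hd : 2 ≤ d) (hV : Measurable V)
    (hV2 : GaussianIntegrable V) (h : InfinitesimallyFormBounded V) :
    InfinitesimallyFormBounded (M.effectivePotential V) :=
  (M.infinitesimallyFormBounded_effectivePotential_abs hd hV hV2 h).mono
    (M.measurable_effectivePotential hV) (M.measurable_effectivePotential hV.abs)
    fun x => (M.abs_effectivePotential_le hd V x).trans (le_abs_self _)

theorem kinForm_domain_inf_effectivePotential_abs (hd : 2 ≤ d) (hV : Measurable V)
    (hV1 : InfinitesimallyFormBounded V ∨ ∃ c : ℝ, ∀ x, c ≤ V x) (hV2 : GaussianIntegrable V) :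
    (kinForm d ℂ).domain ⊓ (mulForm ℂ (M.effectivePotential fun x => |V x|)).domain =
      (kinForm d ℂ).domain ⊓ (mulForm ℂ (M.effectivePotential V)).domain := by
  rcases hV1 with h | ⟨c, hc⟩
  · have h1 := (M.infinitesimallyFormBounded_effectivePotential_abs hd hV hV2 h).1
    have h2 := (M.infinitesimallyFormBounded_effectivePotential hd hV hV2 h).1
    rw [kineticForm_eq.1] at h1 h2
    exact (inf_eq_left.2 h1).trans (inf_eq_left.2 h2).symm
  · congr 1
    refine le_antisymm (mulForm_domain_mono (c := 0) (M.measurable_effectivePotential hV)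
      (M.measurable_effectivePotential hV.abs) fun x => ?_)
      (mulForm_domain_mono (c := 2 * |c|) (M.measurable_effectivePotential hV.abs)
        (M.measurable_effectivePotential hV) fun x => ?_)
    · rw [add_zero]
      exact (M.abs_effectivePotential_le hd V x).trans (le_abs_self _)
    · have h := M.effectivePotential_le_add hd hV.abs hV2.abs hV hV2 (c := 2 * |c|) (fun x => by
        have h1 := hc x
        have h2 := neg_abs_le c
        rcases abs_cases (V x) with h | h <;> linarith [abs_nonneg c]) x
      rw [abs_of_nonneg (M.effectivePotential_abs_nonneg hd V x)]
      linarith [le_abs_self (M.effectivePotential V x)]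

theorem totalFormSum_isClosedSemibounded (hd : 2 ≤ d) (hV : Measurable V)
    (hV1 : InfinitesimallyFormBounded V ∨ ∃ c : ℝ, ∀ x, c ≤ V x) (hV2 : GaussianIntegrable V) :
    (M.totalFormSum V).IsClosedSemibounded :=
  (M.freeForm_isClosedSemibounded hd).add_mulForm M.kineticFactor_pos
    (fun _ hX => (M.freeForm_ge hd hX).1) (fun _ hX => (M.freeForm_ge hd hX).2) hV
    (hV1.imp_right fun h => ⟨h, M.dense_freeForm_inf_mulForm_domain hd hV hV2.locallyIntegrable⟩)

theorem effectiveFormSum_eq (V : Space d → ℝ) : M.effectiveFormSum V =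
    (formOf ((-(M.kineticFactor : ℂ)) • laplacianOp d)).add
      (mulForm ℂ (M.effectivePotential V)) := by
  have h : (M.hbar ^ 2 / (2 * M.m) : ℂ) = (M.kineticFactor : ℂ) := by
    rw [kineticFactor]
    push_cast
    rfl
  rw [effectiveFormSum, h]

theorem effectiveFormSum_isClosedSemibounded (hd : 2 ≤ d) (hV : Measurable V)
    (hV1 : InfinitesimallyFormBounded V ∨ ∃ c : ℝ, ∀ x, c ≤ V x) (hV2 : GaussianIntegrable V) :
    (M.effectiveFormSum V).IsClosedSemibounded := by
  have hk := formOf_smul_laplacian (d := d) M.kineticFactor_pos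
  rw [effectiveFormSum_eq]
  refine (formOf_smul_laplacian_isClosedSemibounded M.kineticFactor_pos).add_mulForm
    M.kineticFactor_pos hk.1.le (fun X hX => ?_) (M.measurable_effectivePotential hV) ?_
  · rw [hk.1] at hX
    rw [hk.2 X hX X hX, Complex.re_ofReal_mul]
  · rw [hk.1]
    exact hV1.imp (M.infinitesimallyFormBounded_effectivePotential hd hV hV2) fun ⟨c, hc⟩ =>
      ⟨⟨c, M.le_effectivePotential hd hV hV2 hc⟩, dense_kinForm_domain_inf_mulForm_domain
        (M.measurable_effectivePotential hV) (M.locallyIntegrable_effectivePotential hd hV hV2)⟩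

theorem effectiveForm_domain (hd : 2 ≤ d) (hV : Measurable V)
    (hV1 : InfinitesimallyFormBounded V ∨ ∃ c : ℝ, ∀ x, c ≤ V x) (hV2 : GaussianIntegrable V) :
    (M.effectiveForm V).domain = (M.effectiveFormSum V).domain := by
  rw [effectiveFormSum_eq]
  change (kineticForm d).domain ⊓ (mulForm ℂ (M.effectivePotential fun x => |V x|)).domain =
    (formOf _).domain ⊓ _
  rw [kineticForm_eq.1, (formOf_smul_laplacian M.kineticFactor_pos).1,
    M.kinForm_domain_inf_effectivePotential_abs hd hV hV1 hV2]

theorem dressed_mem_totalFormSum (hd : 2 ≤ d) (hV : Measurable V) (hV2 : GaussianIntegrable V)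
    {ψ : L2 d ℂ} (hψ : ψ ∈ (M.effectiveForm V).domain) :
    M.dressed ψ ∈ (M.totalFormSum V).domain :=
  ⟨(M.freeForm_dressed hd (kineticForm_eq.1 ▸ hψ.1)).1,
    (M.dressed_mem_mulForm_domain_iff hd hV hV2 ψ).2 hψ.2⟩

theorem re_effectiveFormSum_val (hd : 2 ≤ d) (hV : Measurable V) (hV2 : GaussianIntegrable V)
    {ψ : L2 d ℂ} (hψ : ψ ∈ (M.effectiveForm V).domain) :
    ((M.effectiveFormSum V).val ψ ψ).re =
      ((M.totalFormSum V).val (M.dressed ψ) (M.dressed ψ)).re := by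
  have hk : ψ ∈ (kinForm d ℂ).domain := kineticForm_eq.1 ▸ hψ.1
  have h1 := (M.freeForm_dressed hd hk).2
  have h2 := M.integral_dressed hd ((integrable_norm_sq_mul_iff hV (M.dressed ψ)).2
    ((M.dressed_mem_mulForm_domain_iff hd hV hV2 ψ).2 hψ.2))
  have h3 : ((mulForm (Fock d) V).val (M.dressed ψ) (M.dressed ψ)).re =
      ((mulForm ℂ (M.effectivePotential V)).val ψ ψ).re := by
    rw [re_mulForm_val, re_mulForm_val]
    simp only [mul_comm _ (‖(_ : ℂ)‖ ^ 2), mul_comm _ (‖(_ : Fock d)‖ ^ 2)]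
    exact h2
  rw [effectiveFormSum_eq]
  refine Eq.trans (congrArg₂ (· + ·) ?_ h3.symm) (Complex.add_re _ _).symm
  refine Eq.trans ?_ h1.symm
  rw [(formOf_smul_laplacian M.kineticFactor_pos).2 ψ hk ψ hk, Complex.re_ofReal_mul]

theorem effectiveForm_val (hd : 2 ≤ d) (hV : Measurable V)
    (hV1 : InfinitesimallyFormBounded V ∨ ∃ c : ℝ, ∀ x, c ≤ V x) (hV2 : GaussianIntegrable V)
    {φ ψ : L2 d ℂ} (hφ : φ ∈ (M.effectiveForm V).domain) (hψ : ψ ∈ (M.effectiveForm V).domain) :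
    (M.effectiveForm V).val φ ψ = (M.effectiveFormSum V).val φ ψ := by
  have ht := M.totalFormSum_isClosedSemibounded hd hV hV1 hV2
  have h1 := (M.effectiveFormSum_isClosedSemibounded hd hV hV1 hV2).isHermitian.ext_of_diag
    ht.isHermitian (M.effectiveForm V).domain M.dressedₗ
    (M.effectiveForm_domain hd hV hV1 hV2).le
    (fun χ hχ => M.dressed_mem_totalFormSum hd hV hV2 hχ)
    (fun χ hχ => M.re_effectiveFormSum_val hd hV hV2 hχ) hφ hψ
  exact (ht.formOf_op.2 _ (M.dressed_mem_totalFormSum hd hV hV2 hφ) _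
    (M.dressed_mem_totalFormSum hd hV hV2 hψ)).trans h1.symm

end PauliFierzModel

end

noncomputable section

theorem mainTheorem1 {d : ℕ} (hd : 2 ≤ d) (M : PauliFierzModel d) (V : Space d → ℝ)
    (hV : Measurable V)
    (hV1 : InfinitesimallyFormBounded V ∨ ∃ c : ℝ, ∀ x, c ≤ V x)
    (hV2 : ∀ t : ℝ, 0 < t → Integrable (fun x => V x * Real.exp (-t * ‖x‖ ^ 2)) volume) :
    -- the two form sums exist, so that the Hamiltonians are well defined
    (M.totalFormSum V).IsClosedSemibounded ∧ IsSelfAdjoint (M.totalHamiltonian V) ∧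
    (M.effectiveFormSum V).IsClosedSemibounded ∧ IsSelfAdjoint (M.effectiveHamiltonian V) ∧
    -- `s_eff` is well defined
    (∀ ψ ∈ (M.effectiveForm V).domain, M.dressed ψ ∈ (M.totalForm V).domain) ∧
    -- `s_eff` is closed and bounded from below, and its operator is the effective Hamiltonian
    (M.effectiveForm V).IsClosedSemibounded ∧
    (M.effectiveForm V).op = M.effectiveHamiltonian V := by
  have ht := M.totalFormSum_isClosedSemibounded hd hV hV1 hV2
  have he := M.effectiveFormSum_isClosedSemibounded hd hV hV1 hV2
  have hdom := M.effectiveForm_domain hd hV hV1 hV2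
  have hval : ∀ φ ∈ (M.effectiveFormSum V).domain, ∀ ψ ∈ (M.effectiveFormSum V).domain,
      (M.effectiveForm V).val φ ψ = (M.effectiveFormSum V).val φ ψ := fun φ hφ ψ hψ =>
    M.effectiveForm_val hd hV hV1 hV2 (hdom.symm ▸ hφ) (hdom.symm ▸ hψ)
  exact ⟨ht, ht.isSelfAdjoint_op, he, he.isSelfAdjoint_op,
    fun ψ hψ => ht.formOf_op.1.ge (M.dressed_mem_totalFormSum hd hV hV2 hψ),
    he.congr hdom hval, QForm.op_congr hdom hval⟩

end
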